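/- Let $P$ be a finite $2$-group and let $\mathcal F$ be a saturated fusion system on $P$. A subgroup $Q\le P$ is $\mathcal F$-essential if it is $\mathcal F$-centric and $\mathrm{Out}_{\mathcal F}(Q)$ has a strongly $2$-embedded subgroup; the essential rank $\mathrm{rk}_e(\mathcal F)$ is the number of $\mathcal F$-conjugacy classes of $\mathcal F$-essential subgroups. For a finite group $G$ we write $\mathcal F\cong\mathcal F(G)$ if $\mathcal F$ is isomorphic to the fusion system of $G$ on a Sylow $2$-subgroup of $G$. Below, $q$ denotes some odd prime power, subject to the stated congruences. (a) Let $P$ be dihedral of order $2^n$ ($n\ge3$), semidihedral of order $2^n$ ($n\ge4$), generalized quaternion of order $2^n$ ($n\ge4$), or wreathed, $P\cong C_{2^n}\wr C_2$ ($n\ge2$). Then $\mathrm{rk}_e(\mathcal F)\le 2$. If $\mathrm{rk}_e(\mathcal F)=0$, then $\mathcal F\cong\mathcal F(P)$. Otherwise: - $P$ dihedral: if $\mathrm{rk}_e(\mathcal F)=1$ then $\mathcal F\cong\mathcal F(\mathrm{PGL}_2(q))$ for some $q$; if $\mathrm{rk}_e(\mathcal F)=2$ then $\mathcal F\cong\mathcal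 F(\mathrm{PSL}_2(q))$ for some $q\equiv\pm1\bmod 8$. - $P$ semidihedral: if $\mathrm{rk}_e(\mathcal F)=1$ then $\mathcal F\cong\mathcal F(\mathrm{PSL}_2(q^2).C_2)$ for some $q$, where $\mathrm{PSL}_2(q^2).C_2$ is the nonsplit extension generated by $\mathrm{PSL}_2(q^2)$ and a product of an element of $\mathrm{PGL}_2(q^2)\setminus\mathrm{PSL}_2(q^2)$ with the field automorphism $x\mapsto x^q$, or $\mathcal F\cong\mathcal F(\mathrm{GL}_2(q))$ for some $q\equiv3\bmod4$; if $\mathrm{rk}_e(\mathcal F)=2$ then $\mathcal F\cong\mathcal F(\mathrm{PSL}_3(q))$ for some $q\equiv3\bmod4$. - $P$ generalized quaternion: if $\mathrm{rk}_e(\mathcal F)=1$ then $\mathcal F\cong\mathcal F(\mathrm{SL}_2(q).C_2)$ for some $q$, where $\mathrm{SL}_2(q).C_2$ is the subgroup of $\mathrm{SL}_2(q^2)$ of all matrices that are scalar multiples of matrices over $\mathbb F_q$; if $\mathrm{rk}_e(\mathcal F)=2$ then $\mathcal F\cong\mathcal F(\mathrm{SL}_2(q))$ for some $q$. - $P\cong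 C_{2^n}\wr C_2$ wreathed: if $\mathrm{rk}_e(\mathcal F)=1$ then $\mathcal F\cong\mathcal F((C_{2^n}\times C_{2^n})\rtimes S_3)$, where $S_3$ permutes $a,b,a^{-1}b^{-1}$ for the generators $a,b$ of the two factors, or $\mathcal F\cong\mathcal F(\mathrm{GL}_2(q))$ for some $q\equiv1\bmod4$; if $\mathrm{rk}_e(\mathcal F)=2$ then $\mathcal F\cong\mathcal F(\mathrm{PSL}_3(q))$ for some $q\equiv1\bmod4$. If $P\cong Q_8$, then $\mathrm{rk}_e(\mathcal F)=0$, and $\mathcal F\cong\mathcal F(P)$ or $\mathcal F\cong\mathcal F(\mathrm{SL}_2(q))$ for some $q$. (b) If $P\cong C_{2^n}\times C_{2^n}$ ($n\ge1$), then $\mathrm{rk}_e(\mathcal F)=0$, and $\mathcal F\cong\mathcal F(P)$ or $\mathcal F\cong\mathcal F(P\rtimes C_3)$ for a faithful action of $C_3$ on $P$. There are exactly $2$ saturated fusion systems on $P$ up to isomorphism. (c) If $P$ is isomorphic to a Sylow $2$-subgroup of $\mathrm{PSU}_3(4)$, then $\mathrm{rk}_e(\mathcal F)=0$, and $\mathcal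 F\cong\mathcal F(P)$ or $\mathcal F\cong\mathcal F(P\rtimes C_m)$ for some $m\in\{3,5,15\}$ and a faithful action of $C_m$ on $P$. There are exactly $4$ saturated fusion systems on $P$ up to isomorphism. -/

import Mathlib

/-- A fusion system on a group `P`: for each subgroup `Q` of `P`, the set `Hom Q` of the morphisms
`Q → P` of the category; the morphisms `Q → R` are the elements of `Hom Q` with values in `R`.
All morphisms are injective, all maps induced by conjugation in `P` are morphisms, morphisms
compose (with `Q → P` the inclusion of `Q` in `R`, this includes restriction), and the inverse of
a morphism, seen as an isomorphism onto its image, is a morphism. -/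
@[ext]
structure FusionSystem (P : Type*) [Group P] where
  Hom : ∀ Q : Subgroup P, Set (Q →* P)
  injective : ∀ (Q : Subgroup P) (φ : Q →* P), φ ∈ Hom Q → Function.Injective φ
  conj_mem : ∀ (Q : Subgroup P) (g : P), (MulAut.conj g).toMonoidHom.comp Q.subtype ∈ Hom Q
  comp_mem : ∀ (Q R : Subgroup P) (φ : Q →* P) (ψ : R →* P) (h : ∀ x, φ x ∈ R),
    φ ∈ Hom Q → ψ ∈ Hom R → ψ.comp (φ.codRestrict R h) ∈ Hom Q
  inv_mem : ∀ (Q : Subgroup P) (φ : Q →* P) (ψ : φ.range →* P),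
    φ ∈ Hom Q → (∀ x : Q, ψ ⟨φ x, x, rfl⟩ = x) → ψ ∈ Hom φ.range

namespace FusionSystem

variable {P : Type*} [Group P] (F : FusionSystem P)

/-- `Q` and `R` are `F`-conjugate: some morphism of `F` maps `Q` isomorphically onto `R`. -/
def IsConj (Q R : Subgroup P) : Prop := ∃ φ ∈ F.Hom Q, φ.range = R

theorem inclusion_mem (Q : Subgroup P) : Q.subtype ∈ F.Hom Q := by
  have h := F.conj_mem Q 1
  have e : (MulAut.conj (1 : P)).toMonoidHom.comp Q.subtype = Q.subtype := by ext; simp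
  rwa [e] at h

/-- The automorphism group of `Q` in `F`. -/
def aut (Q : Subgroup P) : Subgroup (MulAut Q) where
  carrier := {α | Q.subtype.comp α.toMonoidHom ∈ F.Hom Q}
  one_mem' := by
    have e : Q.subtype.comp (1 : MulAut Q).toMonoidHom = Q.subtype := by ext; simp
    change Q.subtype.comp (1 : MulAut Q).toMonoidHom ∈ F.Hom Q
    rw [e]
    exact F.inclusion_mem Q
  mul_mem' := by
    intro α β hα hβ
    have h := F.comp_mem Q Q (Q.subtype.comp β.toMonoidHom) (Q.subtype.comp α.toMonoidHom)
      (fun x => (β x).2) hβ hα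
    exact h
  inv_mem' := by
    intro α hα
    have hr : (Q.subtype.comp α.toMonoidHom).range = Q := by
      ext x
      constructor
      · rintro ⟨y, rfl⟩
        exact (α y).2
      · intro hx
        exact ⟨α.symm ⟨x, hx⟩, by simp⟩
    have hl : ∀ x : Q, (x : P) ∈ (Q.subtype.comp α.toMonoidHom).range := fun x => by
      rw [hr]; exact x.2
    have hl' : ∀ x : (Q.subtype.comp α.toMonoidHom).range, (x : P) ∈ Q := fun x =>
      hr.le x.2
    have h := F.inv_mem Q (Q.subtype.comp α.toMonoidHom)
      ((Q.subtype.comp α.symm.toMonoidHom).comp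
        ((Q.subtype.comp α.toMonoidHom).range.subtype.codRestrict Q hl')) hα (by
        intro x
        change ((α.symm (α x) : Q) : P) = x
        simp)
    have h2 := F.comp_mem Q _ Q.subtype _ hl (F.inclusion_mem Q) h
    exact h2

/-- The group `Inn(Q)` of inner automorphisms. -/
def inn (Q : Type*) [Group Q] : Subgroup (MulAut Q) := (MulAut.conj : Q →* MulAut Q).range

instance (Q : Type*) [Group Q] : (inn Q).Normal where
  conj_mem := by
    rintro _ ⟨q, rfl⟩ α
    refine ⟨α q, ?_⟩
    ext x
    simp [MulAut.conj_apply]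

/-- `Out_F(Q) = Aut_F(Q) / Inn(Q)`, as a subgroup of `Out(Q) = Aut(Q) / Inn(Q)`. -/
def out (Q : Subgroup P) : Subgroup (MulAut Q ⧸ inn Q) :=
  (F.aut Q).map (QuotientGroup.mk' (inn Q))

/-- `Aut_P(Q)`: the automorphisms of `Q` induced by conjugation in the normalizer of `Q`. -/
def autP (Q : Subgroup P) : Subgroup (MulAut Q) := Q.normalizerMonoidHom.range

/-- No subgroup that is `F`-conjugate to `Q` has a larger normalizer. -/
def IsFullyNormalized (Q : Subgroup P) : Prop :=
  ∀ R, F.IsConj Q R →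
    Nat.card (Subgroup.normalizer (R : Set P)) ≤ Nat.card (Subgroup.normalizer (Q : Set P))

/-- No subgroup that is `F`-conjugate to `Q` has a larger centralizer. -/
def IsFullyCentralized (Q : Subgroup P) : Prop :=
  ∀ R, F.IsConj Q R →
    Nat.card (Subgroup.centralizer (R : Set P)) ≤ Nat.card (Subgroup.centralizer (Q : Set P))

/-- The subgroup `N_φ` of the normalizer of `Q`: those `x` whose conjugation action on `Q`
corresponds under `φ` to conjugation by some `y` that normalizes `φ(Q)`. -/
def extender {Q : Subgroup P} (φ : Q →* P) : Subgroup P where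
  carrier := {x | ∃ hx : x ∈ Subgroup.normalizer (Q : Set P),
    ∃ y ∈ Subgroup.normalizer (φ.range : Set P),
      ∀ u : Q, φ (Q.normalizerMonoidHom ⟨x, hx⟩ u) = y * φ u * y⁻¹}
  one_mem' := ⟨one_mem _, 1, one_mem _, fun u => by
    have e : (⟨1, one_mem _⟩ : Subgroup.normalizer (Q : Set P)) = 1 := rfl
    rw [e, map_one]
    simp⟩
  mul_mem' := by
    rintro a b ⟨ha, y, hy, h⟩ ⟨hb, z, hz, k⟩
    refine ⟨mul_mem ha hb, y * z, mul_mem hy hz, fun u => ?_⟩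
    have e : (⟨a * b, mul_mem ha hb⟩ : Subgroup.normalizer (Q : Set P)) = ⟨a, ha⟩ * ⟨b, hb⟩ := rfl
    rw [e, map_mul, MulAut.mul_apply, h, k]
    group
  inv_mem' := by
    rintro a ⟨ha, y, hy, h⟩
    refine ⟨InvMemClass.inv_mem ha, y⁻¹, InvMemClass.inv_mem hy, fun u => ?_⟩
    have e : (⟨a⁻¹, InvMemClass.inv_mem ha⟩ : Subgroup.normalizer (Q : Set P)) = (⟨a, ha⟩)⁻¹ := rfl
    have h' := h ((Q.normalizerMonoidHom ⟨a, ha⟩)⁻¹ u)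
    rw [MulAut.apply_inv_self] at h'
    rw [e, map_inv, h']
    group

/-- Saturation (for a finite `p`-group `P`): if `Q` is fully normalized then it is fully
centralized and `Aut_P(Q)` is a Sylow `p`-subgroup of `Aut_F(Q)`, and every morphism `φ` with
fully centralized image extends to a morphism on `N_φ`. -/
structure IsSaturated (p : ℕ) : Prop where
  sylow : ∀ Q : Subgroup P, F.IsFullyNormalized Q →
    F.IsFullyCentralized Q ∧ ∃ S : Sylow p (F.aut Q), (S : Subgroup _).map (F.aut Q).subtype = autP Q
  extension : ∀ (Q : Subgroup P) (φ : Q →* P), φ ∈ F.Hom Q → F.IsFullyCentralized φ.range →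
    ∃ ψ ∈ F.Hom (extender φ), ∀ (x : P) (hx : x ∈ Q) (hx' : x ∈ extender φ),
      ψ ⟨x, hx'⟩ = φ ⟨x, hx⟩

/-- `Q` is `F`-centric: every `F`-conjugate of `Q` contains its centralizer in `P`. -/
def IsCentric (Q : Subgroup P) : Prop :=
  ∀ R, F.IsConj Q R → Subgroup.centralizer (R : Set P) ≤ R

/-- `H` is a strongly `p`-embedded subgroup of `G`. -/
def IsStronglyEmbedded (p : ℕ) {G : Type*} [Group G] (H : Subgroup G) : Prop :=
  H ≠ ⊤ ∧ p ∣ Nat.card H ∧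
    ∀ g : G, g ∉ H → ¬ p ∣ Nat.card (H ⊓ H.map (MulAut.conj g).toMonoidHom : Subgroup G)

/-- `Q` is `F`-essential: it is `F`-centric and `Out_F(Q)` has a strongly `p`-embedded subgroup. -/
def IsEssential (p : ℕ) (Q : Subgroup P) : Prop :=
  F.IsCentric Q ∧ ∃ H : Subgroup (F.out Q), IsStronglyEmbedded p H

/-- The essential rank: the number of `F`-conjugacy classes of `F`-essential subgroups. -/
noncomputable def essentialRank (p : ℕ) : ℕ :=
  Set.ncard {C : Set (Subgroup P) | ∃ Q, F.IsEssential p Q ∧ C = {R | F.IsConj Q R}}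

/-- The fusion system `F_S(G)` of a group `G` on a subgroup `S`: the morphisms are the maps
between subgroups of `S` that are induced by conjugation in `G`. -/
def ofGroup {G : Type*} [Group G] (S : Subgroup G) : FusionSystem S where
  Hom Q := {φ | ∃ g : G, ∀ x : Q, ((φ x : S) : G) = g * ((x : S) : G) * g⁻¹}
  injective := by
    rintro Q φ ⟨g, hg⟩ x y hxy
    have h : g * ((x : S) : G) * g⁻¹ = g * ((y : S) : G) * g⁻¹ := by rw [← hg, ← hg, hxy]
    exact Subtype.ext (Subtype.ext (by simpa using h))
  conj_mem Q g := ⟨g, fun x => by simp [MulAut.conj_apply]⟩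
  comp_mem := by
    rintro Q R φ ψ h ⟨g, hg⟩ ⟨k, hk⟩
    refine ⟨k * g, fun x => ?_⟩
    have := hk (φ.codRestrict R h x)
    rw [MonoidHom.comp_apply, this]
    simp [hg, mul_assoc]
  inv_mem := by
    rintro Q φ ψ ⟨g, hg⟩ h
    refine ⟨g⁻¹, ?_⟩
    rintro ⟨_, x, rfl⟩
    rw [h x, hg x]
    group

/-- An isomorphism of groups `e : P ≃* P'` carries `F` to `F'`: the morphisms `Q → P` of `F`
correspond under `φ ↦ e ∘ φ ∘ e⁻¹` to the morphisms `e(Q) → P'` of `F'`. -/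
def IsIsoVia {P' : Type*} [Group P'] (F' : FusionSystem P') (e : P ≃* P') : Prop :=
  ∀ (Q : Subgroup P) (φ : Q →* P),
    φ ∈ F.Hom Q ↔ (e.toMonoidHom.comp φ).comp (e.subgroupMap Q).symm.toMonoidHom ∈
      F'.Hom (Q.map (e : P →* P'))

/-- Isomorphism of fusion systems. -/
def IsIso {P' : Type*} [Group P'] (F' : FusionSystem P') : Prop := ∃ e : P ≃* P', F.IsIsoVia F' e

/-- `F` is isomorphic to the fusion system of `G` on a Sylow `p`-subgroup of `G`. -/
def IsFusionSystemOf (p : ℕ) (G : Type*) [Group G] : Prop :=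
  ∃ S : Sylow p G, F.IsIso (ofGroup (S : Subgroup G))

theorem hom_congr {Q R : Subgroup P} (h : Q = R) (φ : Q →* P) (ψ : R →* P)
    (hφ : ∀ (x : P) (hx : x ∈ Q) (hx' : x ∈ R), φ ⟨x, hx⟩ = ψ ⟨x, hx'⟩) :
    φ ∈ F.Hom Q ↔ ψ ∈ F.Hom R := by
  subst h
  have e : φ = ψ := by
    ext ⟨x, hx⟩
    exact hφ x hx hx
  rw [e]

variable {F}

theorem IsIso.refl (F : FusionSystem P) : F.IsIso F := by
  refine ⟨MulEquiv.refl P, fun Q φ => F.hom_congr (by ext; simp) _ _ ?_⟩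
  intro x hx hx'
  simp
  rfl

theorem IsIso.symm {P' : Type*} [Group P'] {F' : FusionSystem P'} (h : F.IsIso F') :
    F'.IsIso F := by
  obtain ⟨e, he⟩ := h
  refine ⟨e.symm, fun Q φ => ?_⟩
  rw [he]
  refine F'.hom_congr (by ext; simp) _ _ ?_
  intro x hx hx'
  simp

theorem IsIso.trans {P' P'' : Type*} [Group P'] [Group P''] {F' : FusionSystem P'}
    {F'' : FusionSystem P''} (h : F.IsIso F') (h' : F'.IsIso F'') : F.IsIso F'' := by
  obtain ⟨e, he⟩ := h
  obtain ⟨d, hd⟩ := h'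
  refine ⟨e.trans d, fun Q φ => ?_⟩
  rw [he, hd]
  refine F''.hom_congr (by ext; simp) _ _ ?_
  intro x hx hx'
  simp
  rfl

/-- Isomorphism as an equivalence relation on the saturated fusion systems on `P`. -/
def isoSetoid (p : ℕ) (P : Type*) [Group P] :
    Setoid {F : FusionSystem P // F.IsSaturated p} where
  r F F' := F.1.IsIso F'.1
  iseqv := ⟨fun F => IsIso.refl F.1, IsIso.symm, IsIso.trans⟩

/-- The number of saturated fusion systems on `P`, up to isomorphism. -/
noncomputable def numSaturated (p : ℕ) (P : Type*) [Group P] : ℕ :=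
  Nat.card (Quotient (isoSetoid p P))

end FusionSystem

/-- `P` is a semidihedral group of order `2 ^ n`, that is
`⟨x, y | x ^ (2 ^ (n - 1)) = y ^ 2 = 1, y x y⁻¹ = x ^ (2 ^ (n - 2) - 1)⟩` with `n ≥ 4`. -/
def IsSemidihedral (n : ℕ) (P : Type*) [Group P] : Prop :=
  4 ≤ n ∧ Nat.card P = 2 ^ n ∧ ∃ x y : P, orderOf x = 2 ^ (n - 1) ∧ orderOf y = 2 ∧
    y * x * y⁻¹ = x ^ (2 ^ (n - 2) - 1) ∧ Subgroup.closure {x, y} = ⊤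

/-- The cyclic group of order `m`, written multiplicatively. -/
abbrev Cyc (m : ℕ) : Type := Multiplicative (ZMod m)

/-- The group `SL_2(q).C_2` inside `SL_2(q²)`, for a quadratic extension `K/F` of finite fields
of odd order: the matrices of determinant one over `K` that are scalar multiples of matrices over
`F`. It contains `SL_2(F)` with index two, and its Sylow 2-subgroups are generalized quaternion. -/
def slTwoExtension (F K : Type*) [Field F] [Field K] [Algebra F K] :
    Subgroup (Matrix.SpecialLinearGroup (Fin 2) K) where
  carrier := {g | ∃ (c : K) (h : Matrix (Fin 2) (Fin 2) F),
    (g : Matrix (Fin 2) (Fin 2) K) = c • h.map (algebraMap F K)}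
  one_mem' := ⟨1, 1, by simp⟩
  mul_mem' := by
    rintro a b ⟨c, h, hh⟩ ⟨d, k, hk⟩
    refine ⟨c * d, h * k, ?_⟩
    rw [Matrix.SpecialLinearGroup.coe_mul, hh, hk, Matrix.map_mul]
    simp [smul_smul, mul_comm]
  inv_mem' := by
    rintro a ⟨c, h, hh⟩
    refine ⟨c, h.adjugate, ?_⟩
    rw [Matrix.SpecialLinearGroup.coe_inv, hh, Matrix.adjugate_smul]
    have e := (algebraMap F K).map_adjugate h
    simp only [RingHom.mapMatrix_apply] at e
    rw [e]
    simp

/-- The action of the Galois group of `K/F` on `GL_2(K)`, entry by entry. -/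
def galAction (F K : Type*) [Field F] [Field K] [Algebra F K] :
    (K ≃ₐ[F] K) →* MulAut (Matrix.GeneralLinearGroup (Fin 2) K) where
  toFun τ :=
    { Matrix.GeneralLinearGroup.map (n := Fin 2) (τ : K →+* K) with
      invFun := Matrix.GeneralLinearGroup.map (n := Fin 2) (τ.symm : K →+* K)
      left_inv := fun g => by ext i j; simp
      right_inv := fun g => by ext i j; simp }
  map_one' := by ext g i j; simp
  map_mul' τ τ' := by ext g i j; simp

/-- The group of semilinear automorphisms `ΓL` of `K²` for the field extension `K/F`. -/
abbrev SemilinearGroup (F K : Type*) [Field F] [Field K] [Algebra F K] : Type _ :=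
  SemidirectProduct (Matrix.GeneralLinearGroup (Fin 2) K) (K ≃ₐ[F] K) (galAction F K)

/-- In a finite field, the product of two nonzero elements is a square exactly when both or none
of them is a square (in odd characteristic). -/
theorem isSquare_mul_iff_of_finite {K : Type*} [Field K] [Finite K] (hK : Odd (Nat.card K))
    {a b : K} (ha : a ≠ 0) (hb : b ≠ 0) : IsSquare (a * b) ↔ (IsSquare a ↔ IsSquare b) := by
  classical
  have := Fintype.ofFinite K
  have hc : ringChar K ≠ 2 := by
    intro h
    have h2 := FiniteField.even_card_of_char_two h
    rw [← Nat.card_eq_fintype_card] at h2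
    rcases hK with ⟨k, hk⟩
    omega
  rw [← quadraticChar_one_iff_isSquare (mul_ne_zero ha hb), ← quadraticChar_one_iff_isSquare ha,
    ← quadraticChar_one_iff_isSquare hb, map_mul]
  rcases quadraticChar_dichotomy ha with h | h <;>
    rcases quadraticChar_dichotomy hb with h' | h' <;> simp [h, h']

theorem det_galAction {F K : Type*} [Field F] [Field K] [Algebra F K] (τ : K ≃ₐ[F] K)
    (g : Matrix.GeneralLinearGroup (Fin 2) K) :
    ((galAction F K τ g).det : K) = τ (g.det : K) := by
  change ((Matrix.GeneralLinearGroup.map (n := Fin 2) (τ : K →+* K) g).det : K) = _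
  rw [Matrix.GeneralLinearGroup.map_det]
  rfl

theorem isSquare_algEquiv_iff {F K : Type*} [Field F] [Field K] [Algebra F K] (τ : K ≃ₐ[F] K)
    (a : K) : IsSquare (τ a) ↔ IsSquare a :=
  ⟨fun h => by simpa using h.map τ.symm, fun h => h.map τ⟩

theorem gal_mul_eq_one_iff {F K : Type*} [Field F] [Field K] [Algebra F K] [Finite K]
    (hd : Module.finrank F K = 2) (σ τ : K ≃ₐ[F] K) : σ * τ = 1 ↔ (σ = 1 ↔ τ = 1) := by
  have : Finite F := Finite.of_injective _ (algebraMap F K).injective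
  have hc : Nat.card (K ≃ₐ[F] K) = 2 := by rw [IsGalois.card_aut_eq_finrank, hd]
  have hs : ∀ σ : K ≃ₐ[F] K, σ * σ = 1 := fun σ => by
    rw [← pow_two, ← hc, pow_card_eq_one']
  obtain ⟨x, y, hxy, hu⟩ := Nat.card_eq_two_iff.1 hc
  have key : ∀ σ : K ≃ₐ[F] K, σ = x ∨ σ = y := fun σ => by
    have : σ ∈ ({x, y} : Set _) := hu ▸ Set.mem_univ σ
    simpa using this
  constructor
  · intro h
    constructor
    · rintro rfl; simpa using h
    · rintro rfl; simpa using h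
  · intro h
    by_cases h1 : σ = 1
    · rw [h1, h.1 h1, one_mul]
    · have h2 : τ ≠ 1 := fun e => h1 (h.2 e)
      have : σ = τ := by
        rcases key σ with a | a <;> rcases key τ with b | b <;> rcases key 1 with c | c <;> simp_all
      rw [this, hs]

/-- For a quadratic extension `K/F` of finite fields of odd order, the subgroup of the semilinear
group of those `(g, τ)` with `τ = 1` if `det g` is a square and `τ` the field automorphism of
order two otherwise. -/
def twistedSubgroup (F K : Type*) [Field F] [Field K] [Algebra F K] [Finite K]
    (hK : Odd (Nat.card K)) (hd : Module.finrank F K = 2) : Subgroup (SemilinearGroup F K) where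
  carrier := {x | IsSquare (x.left.det : K) ↔ x.right = 1}
  one_mem' := by simp
  mul_mem' := by
    intro x y hx hy
    simp only [Set.mem_ofPred_eq] at hx hy ⊢
    have hdet : ((x * y).left.det : K) = (x.left.det : K) * x.right (y.left.det : K) := by
      rw [SemidirectProduct.mul_left, map_mul, Units.val_mul, det_galAction]
    rw [hdet, isSquare_mul_iff_of_finite hK (Units.ne_zero _)
      ((map_ne_zero _).2 (Units.ne_zero _)), isSquare_algEquiv_iff, hx, hy, SemidirectProduct.mul_right,
      gal_mul_eq_one_iff hd]
  inv_mem' := by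
    intro x hx
    simp only [Set.mem_ofPred_eq] at hx ⊢
    have hdet : ((x⁻¹).left.det : K) = x.right⁻¹ (x.left.det : K)⁻¹ := by
      rw [SemidirectProduct.inv_left, det_galAction, map_inv, Units.val_inv_eq_inv_val]
    rw [hdet, isSquare_algEquiv_iff, isSquare_inv, hx, SemidirectProduct.inv_right, inv_eq_one]

/-- The scalar matrices as a normal subgroup of the semilinear group. -/
def scalarSubgroup (F K : Type*) [Field F] [Field K] [Algebra F K] :
    Subgroup (SemilinearGroup F K) :=
  (Subgroup.center (Matrix.GeneralLinearGroup (Fin 2) K)).map SemidirectProduct.inl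

instance (F K : Type*) [Field F] [Field K] [Algebra F K] : (scalarSubgroup F K).Normal where
  conj_mem := by
    rintro _ ⟨z, hz, rfl⟩ x
    have hz' : galAction F K x.right z ∈ Subgroup.center _ := by
      rw [Subgroup.mem_center_iff]
      intro g
      have := Subgroup.mem_center_iff.1 hz ((galAction F K x.right).symm g)
      have := congrArg (galAction F K x.right) this
      simpa using this
    refine ⟨galAction F K x.right z, hz', ?_⟩
    have h := Subgroup.mem_center_iff.1 hz' x.left
    ext1
    · simp [h]
    · simp

/-- The nonsplit extension of `PSL_2(q²)` by a cyclic group of order two whose elements outside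
`PSL_2(q²)` are the products of elements of `PGL_2(q²)` outside `PSL_2(q²)` with the field
automorphism of order two (`F` has order `q` and `K` has order `q²`, `q` odd). -/
abbrev TwistedPSL (F K : Type*) [Field F] [Field K] [Algebra F K] [Finite K]
    (hK : Odd (Nat.card K)) (hd : Module.finrank F K = 2) : Type _ :=
  twistedSubgroup F K hK hd ⧸ (scalarSubgroup F K).subgroupOf (twistedSubgroup F K hK hd)

/-- The elements `a`, `b`, `a⁻¹b⁻¹` of `C_m × C_m = ⟨a⟩ × ⟨b⟩`, written additively. -/
def triple (m : ℕ) : Fin 3 → ZMod m × ZMod m := ![(1, 0), (0, 1), (-1, -1)]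

theorem triple_sum (m : ℕ) (σ : Equiv.Perm (Fin 3)) :
    triple m (σ 0) + triple m (σ 1) + triple m (σ 2) = 0 := by
  have h := Equiv.sum_comp σ (triple m)
  rw [Fin.sum_univ_three, Fin.sum_univ_three] at h
  rw [h]
  simp [triple]

/-- The endomorphism of `C_m × C_m` that permutes `a`, `b`, `a⁻¹b⁻¹` by `σ`. -/
def tripleLin (m : ℕ) (σ : Equiv.Perm (Fin 3)) : ZMod m × ZMod m →ₗ[ZMod m] ZMod m × ZMod m :=
  (LinearMap.fst _ _ _).smulRight (triple m (σ 0)) + (LinearMap.snd _ _ _).smulRight (triple m (σ 1))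

theorem tripleLin_triple (m : ℕ) (σ : Equiv.Perm (Fin 3)) (i : Fin 3) :
    tripleLin m σ (triple m i) = triple m (σ i) := by
  have h := triple_sum m σ
  fin_cases i
  · simp [tripleLin, triple]
  · simp [tripleLin, triple]
  · have h2 : triple m (σ 2) = -triple m (σ 0) - triple m (σ 1) := by
      rw [eq_sub_iff_add_eq, eq_neg_iff_add_eq_zero, ← h]; abel
    change tripleLin m σ (-1, -1) = triple m (σ 2)
    rw [h2]
    simp [tripleLin, sub_eq_add_neg]

theorem tripleLin_mul (m : ℕ) (σ τ : Equiv.Perm (Fin 3)) (v : ZMod m × ZMod m) :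
    tripleLin m (σ * τ) v = tripleLin m σ (tripleLin m τ v) := by
  have e : tripleLin m τ v = v.1 • triple m (τ 0) + v.2 • triple m (τ 1) := rfl
  rw [e, map_add, map_smul, map_smul, tripleLin_triple, tripleLin_triple]
  rfl

theorem tripleLin_one (m : ℕ) (v : ZMod m × ZMod m) : tripleLin m 1 v = v := by
  ext <;> simp [tripleLin, triple]

/-- The action of `S_3` on `C_m × C_m = ⟨a⟩ × ⟨b⟩` that permutes `a`, `b`, `a⁻¹b⁻¹`. -/
def symmThreeAction (m : ℕ) :
    Equiv.Perm (Fin 3) →* MulAut (Multiplicative (ZMod m × ZMod m)) where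
  toFun σ := AddEquiv.toMultiplicative
    { toFun := tripleLin m σ
      invFun := tripleLin m σ⁻¹
      left_inv := fun v => by rw [← tripleLin_mul, inv_mul_cancel, tripleLin_one]
      right_inv := fun v => by rw [← tripleLin_mul, mul_inv_cancel, tripleLin_one]
      map_add' := map_add _ }
  map_one' := by ext v : 1; exact congrArg Multiplicative.ofAdd (tripleLin_one m v.toAdd)
  map_mul' σ τ := by
    ext v : 1; exact congrArg Multiplicative.ofAdd (tripleLin_mul m σ τ v.toAdd)

/-- `(C_m × C_m) ⋊ S_3`, with `S_3` permuting `a`, `b`, `a⁻¹b⁻¹`. -/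
abbrev SqSymmThree (m : ℕ) : Type :=
  SemidirectProduct (Multiplicative (ZMod m × ZMod m)) (Equiv.Perm (Fin 3)) (symmThreeAction m)

/-- The special unitary group `SU_3` over `K`, with respect to `σ` (an automorphism of order
two), of the Hermitian form with Gram matrix `antidiag(1, 1, 1)`. -/
def specialUnitary {K : Type*} [Field K] (σ : K →+* K) :
    Subgroup (Matrix.SpecialLinearGroup (Fin 3) K) where
  carrier := {g | (g : Matrix (Fin 3) (Fin 3) K) * !![0, 0, 1; 0, 1, 0; 1, 0, 0] *
    ((g : Matrix (Fin 3) (Fin 3) K).map σ).transpose = !![0, 0, 1; 0, 1, 0; 1, 0, 0]}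
  one_mem' := by simp
  mul_mem' := by
    intro a b ha hb
    have e : ((a * b : Matrix (Fin 3) (Fin 3) K).map σ).transpose =
      ((b : Matrix (Fin 3) (Fin 3) K).map σ).transpose *
        ((a : Matrix (Fin 3) (Fin 3) K).map σ).transpose := by
      rw [Matrix.map_mul, Matrix.transpose_mul]
    simp only [Set.mem_ofPred_eq] at ha hb ⊢
    rw [Matrix.SpecialLinearGroup.coe_mul, e]
    calc _ = (a : Matrix (Fin 3) (Fin 3) K) * ((b : Matrix (Fin 3) (Fin 3) K) *
          !![0, 0, 1; 0, 1, 0; 1, 0, 0] * ((b : Matrix (Fin 3) (Fin 3) K).map σ).transpose) *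
          ((a : Matrix (Fin 3) (Fin 3) K).map σ).transpose := by
            simp only [Matrix.mul_assoc]
      _ = _ := by rw [hb, ha]
  inv_mem' := by
    intro a ha
    have h1 : ((a⁻¹ : Matrix.SpecialLinearGroup (Fin 3) K) : Matrix (Fin 3) (Fin 3) K) * a = 1 := by
      rw [← Matrix.SpecialLinearGroup.coe_mul, inv_mul_cancel, Matrix.SpecialLinearGroup.coe_one]
    have e : ((a : Matrix (Fin 3) (Fin 3) K).map σ).transpose *
        (((a⁻¹ : Matrix.SpecialLinearGroup (Fin 3) K) : Matrix (Fin 3) (Fin 3) K).map σ).transpose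
          = 1 := by
      rw [← Matrix.transpose_mul, ← Matrix.map_mul, h1]
      simp
    simp only [Set.mem_ofPred_eq] at ha ⊢
    generalize (!![0, 0, 1; 0, 1, 0; 1, 0, 0] : Matrix (Fin 3) (Fin 3) K) = J at *
    generalize (((a⁻¹ : Matrix.SpecialLinearGroup (Fin 3) K) :
      Matrix (Fin 3) (Fin 3) K).map σ).transpose = B at *
    conv_lhs => rw [← ha]
    simp only [Matrix.mul_assoc, e]
    rw [← Matrix.mul_assoc, h1]
    simp

/-- The group `PSU_3(4)`: over the field of order 16, with the automorphism `x ↦ x ^ 4`. -/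
abbrev PSUThreeFour : Type :=
  specialUnitary (iterateFrobenius (GaloisField 2 4) 2 2) ⧸
    Subgroup.center (specialUnitary (iterateFrobenius (GaloisField 2 4) 2 2))

/-!
A saturated fusion system `F` on `P` is determined by `F.aut ⊤` and by the groups `F.aut Q` for the
essential subgroups `Q`: this is Alperin's fusion theorem (`IsSaturated.mor_of_aut_le`), where a
morphism of `F` is encoded as a function `P → P` that agrees with it on its domain (`Mor`). To
identify `F` with the system of a finite group `G`, one embeds `P` in `G` with odd index, pulls the
fusion back to a system `ofEmb` on `P`, which is saturated by `isSaturated_ofEmb`, and compares the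
few automorphism groups that matter.

On homocyclic groups, on the Sylow subgroup of `PSU_3(4)` and on the quaternion group of order eight
there are no essential subgroups (`IsSaturated.not_isEssential_of_central`), since the involutions
are central and all commutators have a trivial square. Hence `F` is given by `F.aut ⊤`, which has
the form `Inn(P) ⋊ K` with `K` of odd order by the theorem of Schur and Zassenhaus. It remains to
count the conjugacy classes of subgroups `K` of odd order in `MulAut P`
(`classification_of_odd_automorphisms`). On a homocyclic group such a `K` acts faithfully on the
four-group of involutions, so its order divides `3`. For the Sylow subgroup of `PSU_3(4)`, which is
the group `Herm` of pairs over the field of order `16`, its order divides `15`, and `K` is conjugate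
to a subgroup of a cyclic group of order `15` that comes from the multiplicative group of the field.

For the groups of maximal class the presentation `MaxClass` has a cyclic subgroup `⟨x⟩` of index
two. A subgroup with a nontrivial automorphism of odd order that contains the center is a four-group
or a quaternion group `core x k u` with `u` outside `⟨x⟩` (`MaxClass.exists_eq_core`). There are two
classes in `P`, those of `y` and `xy`, and if one of them is essential, its automorphism group is as
large as possible (`mem_of_fixes_ker`). So `F` is determined by the set of classes that are
essential (`MaxClass.eq_of_has_iff`), and each case occurs in a linear group over a field of order
`p` or `p ^ 2`: an element that permutes `w`, `u` and `wu` cyclically (`Rotates`) makes a class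
essential, and a normal subgroup that contains `w` and not `u` (`Separated`) prevents this. The
primes, with `p - 1` or `p + 1` exactly divisible by a given power of two, come from Dirichlet's
theorem on primes in arithmetic progressions.

For wreathed groups (`WreathedTop`) the candidates are the abelian subgroup `base` of index two and
the central products `core` of the center with a dihedral group of order eight, which are all
conjugate (`WreathedTop.eq_base_or`). If `base` is essential, its automorphism group is a symmetric
group of degree three, and the generators can be chosen so that it permutes `a`, `b` and `(ab)⁻¹`
(`WreathedTop.exists_adapted`). If the nonabelian candidate is essential, its automorphisms are
determined because they act trivially on the center of `P` (`WreathedTop.aut_core_z`). The four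
cases are those of `P` itself, of the extension by the symmetric group, of `GL_2(p)` and of
`PSL_3(p)`.
-/

set_option linter.unusedSectionVars false

open Subgroup (zpowers closure mem_zpowers card_map_of_injective mem_centralizer_iff le_normalizer
  closure_le mem_normalizer_iff topEquiv centralizer zpowers_le subset_closure mem_top mem_bot)
open scoped MatrixGroups

local notation "N(" Q ")" => Subgroup.normalizer (SetLike.coe Q)
local notation "𝕄" => Matrix (Fin 2) (Fin 2)
local notation "glScalar" => Matrix.GeneralLinearGroup.scalar (Fin 2)
local notation "𝕃(" K "," a ")" => QuadraticAlgebra K a 0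

/-! ### Conjugation of `p`-subgroups -/

theorem mem_normalizer_of_conj_mem {G : Type*} [Group G] {H : Subgroup G} [Finite H] {n : G}
    (h : ∀ y ∈ H, n * y * n⁻¹ ∈ H) : n ∈ N(H) := by
  rw [Subgroup.mem_normalizer_iff_map_conj_eq]
  refine Subgroup.eq_of_le_of_card_ge ?_ ?_
  · rintro _ ⟨y, hy, rfl⟩
    exact h y hy
  · exact (Nat.card_congr
      (H.equivMapOfInjective _ (MulAut.conj n).injective).toEquiv).le

open Pointwise in
/-- Sylow's second theorem for a `p`-subgroup of index prime to `p` in an intermediate subgroup. -/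
theorem exists_conj_le {G : Type*} [Group G] [Finite G] {p : ℕ} [Fact p.Prime]
    {H X M : Subgroup G} (hH : IsPGroup p H) (hi : ¬ p ∣ H.relIndex M)
    (hX : IsPGroup p X) (hXM : X ≤ M) : ∃ m ∈ M, ∀ x ∈ X, m * x * m⁻¹ ∈ H := by
  let S : Sylow p M := (hH.comap_subtype (K := M)).toSylow hi
  obtain ⟨T, hT⟩ := (hX.comap_subtype (K := M)).exists_le_sylow
  obtain ⟨m, hm⟩ := MulAction.exists_smul_eq M T S
  refine ⟨m, m.2, fun x hx => ?_⟩
  have h1 : (⟨x, hXM hx⟩ : M) ∈ (T : Subgroup M) := hT hx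
  have h2 : MulAut.conj m • (⟨x, hXM hx⟩ : M) ∈ MulAut.conj m • (T : Subgroup M) :=
    Subgroup.smul_mem_pointwise_smul _ _ _ h1
  rw [← Sylow.coe_subgroup_smul, hm] at h2
  exact h2

/-- A `p`-subgroup of maximal order has index prime to `p`. -/
theorem not_dvd_relIndex_of_card_le {G : Type*} [Group G] [Finite G] {p : ℕ} [Fact p.Prime]
    {H M : Subgroup G} (hH : IsPGroup p H) (hHM : H ≤ M)
    (hmax : ∀ Y ≤ M, IsPGroup p Y → Nat.card Y ≤ Nat.card H) : ¬ p ∣ H.relIndex M := by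
  obtain ⟨T, hT⟩ := (hH.comap_subtype (K := M)).exists_le_sylow
  have h1 : Nat.card ((T : Subgroup M).map M.subtype) ≤ Nat.card H :=
    hmax _ (Subgroup.map_subtype_le _) (T.2.map _)
  have h2 : H.subgroupOf M = T := by
    refine Subgroup.eq_of_le_of_card_ge hT ?_
    rw [card_map_of_injective M.subtype_injective] at h1
    rwa [Nat.card_congr (Subgroup.subgroupOfEquivOfLe hHM).toEquiv]
  rw [Subgroup.relIndex, h2]
  exact T.not_dvd_index

/-- If the `p`-subgroup `D` has the same image under `c` as a subgroup containing the `p`-group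
`X`, and `D` meets the kernel of `c` in a Sylow subgroup of the kernel, then an element of the
kernel conjugates `X` into `D`. -/
theorem exists_ker_conj_le {N H : Type*} [Group N] [Finite N] [Group H] {p : ℕ} [Fact p.Prime]
    (c : N →* H) {D X : Subgroup N} (hD : IsPGroup p D) (hX : IsPGroup p X)
    (hXD : X.map c ≤ D.map c)
    (hmax : ∀ Y ≤ c.ker, IsPGroup p Y → Nat.card Y ≤ Nat.card (c.ker ⊓ D : Subgroup N)) :
    ∃ m ∈ c.ker, ∀ x ∈ X, m * x * m⁻¹ ∈ D := by
  have hmap : (D ⊔ c.ker).map c = D.map c := by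
    rw [Subgroup.map_sup, (Subgroup.map_eq_bot_iff _).2 le_rfl, sup_bot_eq]
  have hc : ∀ Y : Subgroup N, Nat.card Y = Nat.card (c.ker ⊓ Y : Subgroup N) *
      Nat.card (Y.map c) := fun Y => by
    rw [← Subgroup.relIndex_ker, ← Subgroup.inf_relIndex_right,
      ← Subgroup.relIndex_bot_left, ← Subgroup.relIndex_bot_left,
      Subgroup.relIndex_mul_relIndex _ _ _ bot_le inf_le_right]
  have hidx : ¬ p ∣ D.relIndex (D ⊔ c.ker) := by
    refine not_dvd_relIndex_of_card_le hD le_sup_left fun Y hY hYp => ?_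
    rw [hc Y, hc D]
    refine Nat.mul_le_mul (hmax _ inf_le_left hYp.to_inf_right) ?_
    exact Nat.card_mono ((Set.toFinite (D : Set N)).image c) ((Subgroup.map_mono hY).trans hmap.le)
  have hXM : X ≤ D ⊔ c.ker := by
    intro x hx
    obtain ⟨d, hd, hdx⟩ := hXD ⟨x, hx, rfl⟩
    have : x = d * (d⁻¹ * x) := by group
    rw [this]
    refine Subgroup.mul_mem_sup hd ?_
    rw [MonoidHom.mem_ker, map_mul, map_inv, hdx, inv_mul_cancel]
  obtain ⟨m, hm, h⟩ := exists_conj_le hD hidx hX hXM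
  obtain ⟨d, hd, k, hk, rfl⟩ := Subgroup.mem_sup_of_normal_right.1 hm
  refine ⟨k, hk, fun x hx => ?_⟩
  have := D.mul_mem (D.mul_mem (D.inv_mem hd) (h x hx)) hd
  convert this using 1
  group

namespace FusionSystem

/-! ### Morphisms given by functions on the whole group -/

section Mor

variable {P : Type*} [Group P] {F : FusionSystem P} {Q R : Subgroup P} {f g : P → P}

/-- The restriction of the function `f : P → P` to the subgroup `Q` is a morphism of `F`. Only the
values of `f` on `Q` matter. -/
def Mor (F : FusionSystem P) (Q : Subgroup P) (f : P → P) : Prop :=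
  ∃ φ ∈ F.Hom Q, ∀ x : Q, φ x = f x

open Classical in
/-- The extension by `1` of a function on a subgroup. -/
noncomputable def extendFun {Q : Subgroup P} (φ : Q → P) : P → P :=
  fun x => if h : x ∈ Q then φ ⟨x, h⟩ else 1

theorem extendFun_apply (φ : Q → P) (x : Q) : extendFun φ x = φ x := by
  simp [extendFun]

theorem mor_extendFun {φ : Q →* P} (h : φ ∈ F.Hom Q) : F.Mor Q (extendFun φ) :=
  ⟨φ, h, fun x => (extendFun_apply φ x).symm⟩

theorem mem_hom_iff {φ : Q →* P} (h : ∀ x : Q, f x = φ x) : φ ∈ F.Hom Q ↔ F.Mor Q f := by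
  constructor
  · exact fun hφ => ⟨φ, hφ, fun x => (h x).symm⟩
  · rintro ⟨ψ, hψ, hx⟩
    have : φ = ψ := by ext x; rw [hx, h]
    rwa [this]

theorem Mor.congr (hf : F.Mor Q f) (h : ∀ x ∈ Q, f x = g x) : F.Mor Q g := by
  obtain ⟨φ, hφ, e⟩ := hf
  exact ⟨φ, hφ, fun x => (e x).trans (h x x.2)⟩

theorem Mor.map_mul (hf : F.Mor Q f) {x y : P} (hx : x ∈ Q) (hy : y ∈ Q) :
    f (x * y) = f x * f y := by
  obtain ⟨φ, -, e⟩ := hf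
  have := φ.map_mul ⟨x, hx⟩ ⟨y, hy⟩
  rwa [e, e, e] at this

theorem Mor.injOn (hf : F.Mor Q f) : Set.InjOn f Q := by
  obtain ⟨φ, hφ, e⟩ := hf
  intro x hx y hy hxy
  have := F.injective Q φ hφ (a₁ := ⟨x, hx⟩) (a₂ := ⟨y, hy⟩) (by rw [e, e]; exact hxy)
  exact congrArg Subtype.val this

theorem Mor.comp (hg : F.Mor R g) (hf : F.Mor Q f) (h : ∀ x ∈ Q, f x ∈ R) :
    F.Mor Q (g ∘ f) := by
  obtain ⟨φ, hφ, e⟩ := hf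
  obtain ⟨ψ, hψ, e'⟩ := hg
  refine ⟨_, F.comp_mem Q R φ ψ (fun x => by rw [e x]; exact h x x.2) hφ hψ, fun x => ?_⟩
  rw [MonoidHom.comp_apply, e']
  exact congrArg g (e x)

theorem mor_conj (F : FusionSystem P) (Q : Subgroup P) (g : P) :
    F.Mor Q (fun x => g * x * g⁻¹) :=
  ⟨_, F.conj_mem Q g, fun x => by simp [MulAut.conj_apply]⟩

theorem mor_id (F : FusionSystem P) (Q : Subgroup P) : F.Mor Q id :=
  (F.mor_conj Q 1).congr fun x _ => by simp

theorem Mor.mono (hf : F.Mor R f) (h : Q ≤ R) : F.Mor Q f :=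
  hf.comp (F.mor_id Q) fun _ hx => h hx

theorem Mor.inv (hf : F.Mor Q f) (hg : ∀ x ∈ Q, g (f x) = x) (hR : ∀ y ∈ R, ∃ x ∈ Q, f x = y) :
    F.Mor R g := by
  obtain ⟨φ, hφ, e⟩ := hf
  let ε := MonoidHom.ofInjective (F.injective Q φ hφ)
  have hψ := F.inv_mem Q φ (Q.subtype.comp ε.symm.toMonoidHom) hφ (fun x => by
    have : (⟨φ x, x, rfl⟩ : φ.range) = ε x := rfl
    rw [this]
    simp)
  have h1 : F.Mor φ.range g := ⟨_, hψ, by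
    rintro ⟨_, x, rfl⟩
    have : (⟨φ x, x, rfl⟩ : φ.range) = ε x := rfl
    rw [this]
    change ((ε.symm (ε x) : Q) : P) = g (φ x)
    rw [ε.symm_apply_apply, e, hg x x.2]⟩
  refine h1.mono fun y hy => ?_
  obtain ⟨x, hx, rfl⟩ := hR y hy
  exact ⟨⟨x, hx⟩, e _⟩

theorem isConj_iff : F.IsConj Q R ↔ ∃ f, F.Mor Q f ∧ ∀ y, y ∈ R ↔ ∃ x ∈ Q, f x = y := by
  constructor
  · rintro ⟨φ, hφ, rfl⟩
    refine ⟨extendFun φ, mor_extendFun hφ, fun y => ?_⟩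
    constructor
    · rintro ⟨x, rfl⟩
      exact ⟨x, x.2, extendFun_apply _ x⟩
    · rintro ⟨x, hx, rfl⟩
      exact ⟨⟨x, hx⟩, (extendFun_apply φ ⟨x, hx⟩).symm⟩
  · rintro ⟨f, ⟨φ, hφ, e⟩, h⟩
    refine ⟨φ, hφ, ?_⟩
    ext y
    rw [h]
    constructor
    · rintro ⟨x, rfl⟩
      exact ⟨x, x.2, (e x).symm⟩
    · rintro ⟨x, hx, rfl⟩
      exact ⟨⟨x, hx⟩, e _⟩

theorem IsConj.refl (F : FusionSystem P) (Q : Subgroup P) : F.IsConj Q Q :=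
  isConj_iff.2 ⟨id, F.mor_id Q, fun y => by simp⟩

theorem Mor.exists_inv (hf : F.Mor Q f) (h : ∀ y, y ∈ R ↔ ∃ x ∈ Q, f x = y) :
    ∃ g, F.Mor R g ∧ ∀ x ∈ Q, g (f x) = x := by
  have hg : ∀ x ∈ Q, Function.invFunOn f Q (f x) = x := fun x hx =>
    hf.injOn (Function.invFunOn_mem ⟨x, hx, rfl⟩) hx (Function.invFunOn_eq ⟨x, hx, rfl⟩)
  exact ⟨_, hf.inv hg fun y hy => (h y).1 hy, hg⟩

theorem IsConj.symm (h : F.IsConj Q R) : F.IsConj R Q := by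
  obtain ⟨f, hf, h⟩ := isConj_iff.1 h
  obtain ⟨g, hg', hg⟩ := hf.exists_inv h
  refine isConj_iff.2 ⟨g, hg', fun x => ?_⟩
  constructor
  · exact fun hx => ⟨f x, (h _).2 ⟨x, hx, rfl⟩, hg x hx⟩
  · rintro ⟨y, hy, rfl⟩
    obtain ⟨x, hx, rfl⟩ := (h y).1 hy
    rwa [hg x hx]

theorem IsConj.trans {S : Subgroup P} (h : F.IsConj Q R) (h' : F.IsConj R S) :
    F.IsConj Q S := by
  obtain ⟨f, hf, h⟩ := isConj_iff.1 h
  obtain ⟨g, hg, h'⟩ := isConj_iff.1 h'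
  refine isConj_iff.2 ⟨_, hg.comp hf fun x hx => (h _).2 ⟨x, hx, rfl⟩, fun y => ?_⟩
  constructor
  · intro hy
    obtain ⟨z, hz, rfl⟩ := (h' y).1 hy
    obtain ⟨x, hx, rfl⟩ := (h z).1 hz
    exact ⟨x, hx, rfl⟩
  · rintro ⟨x, hx, rfl⟩
    exact (h' _).2 ⟨f x, (h _).2 ⟨x, hx, rfl⟩, rfl⟩

theorem IsConj.card_eq (h : F.IsConj Q R) : Nat.card Q = Nat.card R := by
  obtain ⟨φ, hφ, rfl⟩ := h
  exact Nat.card_congr (MonoidHom.ofInjective (F.injective Q φ hφ)).toEquiv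

theorem isConj_conj (F : FusionSystem P) (Q : Subgroup P) (g : P) :
    F.IsConj Q (Q.map (MulAut.conj g).toMonoidHom) :=
  isConj_iff.2 ⟨_, F.mor_conj Q g, fun y => by simp [Subgroup.mem_map]⟩

theorem mem_aut_iff {α : MulAut Q} (h : ∀ x : Q, f x = α x) : α ∈ F.aut Q ↔ F.Mor Q f :=
  mem_hom_iff (φ := Q.subtype.comp α.toMonoidHom) h

/-- The extension by `1` of an automorphism of a subgroup. -/
noncomputable def autFun (α : MulAut Q) : P → P := extendFun fun x => (α x : P)

theorem autFun_apply (α : MulAut Q) (x : Q) : autFun α x = α x :=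
  extendFun_apply (fun x => (α x : P)) x

theorem autFun_mem {α : MulAut Q} {x : P} (hx : x ∈ Q) : autFun α x ∈ Q := by
  rw [autFun_apply α ⟨x, hx⟩]
  exact (α _).2

theorem mor_of_mem_aut {α : MulAut Q} (h : α ∈ F.aut Q) : F.Mor Q (autFun α) :=
  (mem_aut_iff (autFun_apply α)).1 h

theorem Mor.exists_aut [Finite P] (hf : F.Mor Q f) (hQ : ∀ x ∈ Q, f x ∈ Q) :
    ∃ α ∈ F.aut Q, ∀ x : Q, (α x : P) = f x := by
  obtain ⟨φ, hφ, e⟩ := hf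
  let β : Q →* Q := φ.codRestrict Q (fun x => by rw [e]; exact hQ x x.2)
  have hβ : Function.Injective β := fun x y hxy => F.injective Q φ hφ (congrArg Subtype.val hxy)
  let α : MulAut Q := MulEquiv.ofBijective β ⟨hβ, Finite.surjective_of_injective hβ⟩
  refine ⟨α, ?_, e⟩
  exact (mem_aut_iff fun x => (e x).symm).2 ⟨φ, hφ, e⟩

theorem exists_aut_conj (F : FusionSystem P) [Finite P] {s : Set P} {d : P}
    (h : ∀ x ∈ s, d * x * d⁻¹ ∈ closure s) :
    ∃ α ∈ F.aut (closure s), ∀ x : closure s, (α x : P) = d * x * d⁻¹ :=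
  (F.mor_conj _ d).exists_aut fun _ hx =>
    (closure_le ((closure s).comap (MulAut.conj d).toMonoidHom)).2 h hx

theorem ext_of_mor {F' : FusionSystem P} (h : ∀ Q f, F.Mor Q f ↔ F'.Mor Q f) : F = F' := by
  ext Q φ
  have e : ∀ x : Q, extendFun φ x = φ x := extendFun_apply φ
  rw [mem_hom_iff e, mem_hom_iff e, h]

end Mor

/-! ### The fusion system of a group, transported along an embedding -/

section OfEmb

variable {P G : Type*} [Group P] [Group G]

/-- The fusion system on `P` of a group `G` into which `P` is embedded: the morphisms are the maps
between subgroups of `P` that become conjugation by an element of `G`. -/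
def ofEmb (i : P →* G) (hi : Function.Injective i) : FusionSystem P where
  Hom Q := {φ | ∃ g : G, ∀ x : Q, i (φ x) = g * i x * g⁻¹}
  injective := by
    rintro Q φ ⟨g, hg⟩ x y hxy
    have h : g * i x * g⁻¹ = g * i y * g⁻¹ := by rw [← hg, ← hg, hxy]
    exact Subtype.ext (hi (by simpa using h))
  conj_mem Q g := ⟨i g, fun x => by simp [MulAut.conj_apply]⟩
  comp_mem := by
    rintro Q R φ ψ h ⟨g, hg⟩ ⟨k, hk⟩
    refine ⟨k * g, fun x => ?_⟩
    have := hk (φ.codRestrict R h x)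
    rw [MonoidHom.comp_apply, this]
    simp [hg, mul_assoc]
  inv_mem := by
    rintro Q φ ψ ⟨g, hg⟩ h
    refine ⟨g⁻¹, ?_⟩
    rintro ⟨_, x, rfl⟩
    rw [h x, hg x]
    group

variable {i : P →* G} {hi : Function.Injective i} {Q : Subgroup P} {f : P → P}

theorem mor_ofEmb : (ofEmb i hi).Mor Q f ↔ ∃ g : G, ∀ x ∈ Q, i (f x) = g * i x * g⁻¹ := by
  constructor
  · rintro ⟨φ, ⟨g, hg⟩, e⟩
    exact ⟨g, fun x hx => by rw [← hg ⟨x, hx⟩, e]⟩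
  · rintro ⟨g, hg⟩
    refine ⟨MonoidHom.mk' (fun x : Q => f x) fun a b => hi ?_, ⟨g, fun x => hg x x.2⟩,
      fun x => rfl⟩
    rw [map_mul, hg _ a.2, hg _ b.2]
    have : i (f ((a * b : Q) : P)) = g * i ((a : P) * b) * g⁻¹ := hg _ (Q.mul_mem a.2 b.2)
    rw [this, map_mul]
    group

theorem mem_aut_ofEmb {α : MulAut Q} :
    α ∈ (ofEmb i hi).aut Q ↔ ∃ g : G, ∀ x : Q, i (α x) = g * i x * g⁻¹ := by
  rw [mem_aut_iff (autFun_apply α), mor_ofEmb]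
  refine exists_congr fun g => ⟨fun h x => ?_, fun h x hx => ?_⟩
  · rw [← h x x.2, autFun_apply]
  · rw [← h ⟨x, hx⟩, ← autFun_apply α]

/-- An element of `G` that maps the generators of a subgroup into this subgroup induces an
automorphism. -/
theorem exists_aut_ofEmb [Finite P] {Q : Subgroup P} {s : Set P} (hs : Q = closure s) {g : G}
    (hg : ∀ x ∈ s, ∃ y ∈ Q, i y = g * i x * g⁻¹) :
    ∃ α ∈ (ofEmb i hi).aut Q, ∀ x : Q, i (α x) = g * i x * g⁻¹ := by
  have h1 : Q ≤ (Q.map i).comap ((MulAut.conj g).toMonoidHom.comp i) :=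
    hs.le.trans ((closure_le _).2 hg)
  have h2 : ∀ x ∈ Q, i (Function.invFun i (g * i x * g⁻¹)) = g * i x * g⁻¹ := fun x hx => by
    obtain ⟨y, -, hy⟩ := h1 hx
    exact Function.invFun_eq ⟨y, hy⟩
  obtain ⟨α, hα, hα'⟩ := (mor_ofEmb.2 ⟨g, h2⟩ : (ofEmb i hi).Mor Q
    (fun x => Function.invFun i (g * i x * g⁻¹))).exists_aut fun x hx => by
      obtain ⟨y, hy, e⟩ := h1 hx
      change i y = g * i x * g⁻¹ at e
      rw [← e, Function.leftInverse_invFun hi y]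
      exact hy
  exact ⟨α, hα, fun x => by rw [hα', h2 x x.2]⟩

theorem ofEmb_isIso : (ofEmb i hi).IsIso (ofGroup i.range) := by
  refine ⟨MonoidHom.ofInjective hi, fun Q φ => ?_⟩
  constructor
  · rintro ⟨g, hg⟩
    refine ⟨g, fun y => ?_⟩
    obtain ⟨x, rfl⟩ := ((MonoidHom.ofInjective hi).subgroupMap Q).surjective y
    simp only [MonoidHom.comp_apply, MulEquiv.coe_toMonoidHom, MulEquiv.symm_apply_apply]
    exact hg x
  · rintro ⟨g, hg⟩
    refine ⟨g, fun x => ?_⟩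
    have := hg ((MonoidHom.ofInjective hi).subgroupMap Q x)
    simp only [MonoidHom.comp_apply, MulEquiv.coe_toMonoidHom, MulEquiv.symm_apply_apply] at this
    exact this

theorem isFusionSystemOf_ofEmb {p : ℕ} [Fact p.Prime] (hP : IsPGroup p P)
    (hidx : ¬ p ∣ i.range.index) [Finite G] : (ofEmb i hi).IsFusionSystemOf p G :=
  ⟨(hP.of_surjective i.rangeRestrict i.rangeRestrict_surjective).toSylow hidx, ofEmb_isIso⟩

section Saturation

/-- A conjugate in `G` of a subgroup `Q` of `P` that lies in `P` again, as a subgroup of `P`. -/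
theorem exists_isConj_ofEmb {g : G} (h : ∀ x ∈ Q, g * i x * g⁻¹ ∈ i.range) :
    ∃ R : Subgroup P, (ofEmb i hi).IsConj Q R ∧
      ∀ y, y ∈ R ↔ ∃ x ∈ Q, i y = g * i x * g⁻¹ := by
  let R : Subgroup P := ((Q.map i).map (MulAut.conj g).toMonoidHom).comap i
  have hR : ∀ y, y ∈ R ↔ ∃ x ∈ Q, i y = g * i x * g⁻¹ := fun y => by
    simp [R, Subgroup.mem_map, MulAut.conj_apply, eq_comm]
  refine ⟨R, isConj_iff.2 ⟨fun x => Function.invFun i (g * i x * g⁻¹), mor_ofEmb.2 ⟨g, fun x hx =>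
    Function.invFun_eq (h x hx)⟩, fun y => ?_⟩, hR⟩
  rw [hR]
  constructor
  · rintro ⟨x, hx, e⟩
    exact ⟨x, hx, hi (by rw [e]; exact Function.invFun_eq (h x hx))⟩
  · rintro ⟨x, hx, rfl⟩
    exact ⟨x, hx, Function.invFun_eq (h x hx)⟩

theorem card_le_card_of_conj [Finite P] {T : Subgroup G} {H : Subgroup P} {g : G}
    (h : ∀ t ∈ T, ∃ y ∈ H, i y = g * t * g⁻¹) : Nat.card T ≤ Nat.card H := by
  choose! f hf hfe using h
  refine Nat.card_le_card_of_injective (fun t : T => (⟨f t, hf t t.2⟩ : H)) fun s t hst => ?_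
  have h1 : f s = f t := congrArg Subtype.val hst
  have h2 := hfe s s.2
  rw [h1, hfe t t.2] at h2
  exact Subtype.ext (by simpa using h2.symm)

/-- The action of the normalizer in `G` of a subgroup `Q` of `P` on `Q`. -/
noncomputable def normalizerAction (i : P →* G) (hi : Function.Injective i) (Q : Subgroup P) :
    N(Q.map i) →* MulAut Q :=
  (MulAut.congr (Q.equivMapOfInjective i hi).symm).toMonoidHom.comp
    (Q.map i).normalizerMonoidHom

theorem normalizerAction_apply (g : N(Q.map i)) (x : Q) :
    i (normalizerAction i hi Q g x : Q) = g * i x * (g : G)⁻¹ := by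
  have h : ∀ y : Q, i y = Q.equivMapOfInjective i hi y := fun y => rfl
  rw [h]
  simp only [normalizerAction, MonoidHom.comp_apply, MulEquiv.coe_toMonoidHom, MulAut.congr_apply,
    MulEquiv.trans_apply, MulEquiv.symm_symm, MulEquiv.apply_symm_apply]
  rfl

theorem mem_normalizer_map [Finite P] (hi : Function.Injective i) {n : P} :
    i n ∈ N(Q.map i) ↔ n ∈ N(Q) := by
  have : Finite (Q.map i) := (Set.toFinite (Q : Set P)).image i
  constructor
  · intro h
    refine mem_normalizer_of_conj_mem fun y hy => ?_
    obtain ⟨x, hx, e⟩ := (mem_normalizer_iff.1 h (i y)).1 ⟨y, hy, rfl⟩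
    have : x = n * y * n⁻¹ := hi (by rw [e]; simp)
    rwa [← this]
  · intro h
    refine mem_normalizer_of_conj_mem ?_
    rintro _ ⟨y, hy, rfl⟩
    exact ⟨n * y * n⁻¹, (mem_normalizer_iff.1 h y).1 hy, by simp⟩

variable [Finite G] {p : ℕ} [Fact p.Prime]

theorem exists_conj_mem_range (hP : IsPGroup p P) (hidx : ¬ p ∣ i.range.index) {T : Subgroup G}
    (hT : IsPGroup p T) : ∃ g : G, ∀ x ∈ T, g * x * g⁻¹ ∈ i.range := by
  have hr : IsPGroup p i.range := hP.of_surjective i.rangeRestrict i.rangeRestrict_surjective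
  obtain ⟨g, -, h⟩ := exists_conj_le hr (M := ⊤) (by rwa [Subgroup.relIndex_top_right]) hT le_top
  exact ⟨g, h⟩

theorem card_le_card_normalizer [Finite P] (hP : IsPGroup p P) (hidx : ¬ p ∣ i.range.index)
    (hQ : (ofEmb i hi).IsFullyNormalized Q) {T : Subgroup G}
    (hT : IsPGroup p T) (hTQ : T ≤ N(Q.map i)) :
    Nat.card T ≤ Nat.card (N(Q)) := by
  have hT' : IsPGroup p (T ⊔ Q.map i : Subgroup G) :=
    hT.to_sup_of_normal_right' ((hP.to_subgroup Q).map i) hTQ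
  obtain ⟨g, hg⟩ := exists_conj_mem_range hP hidx hT'
  obtain ⟨R, hR, hmem⟩ := exists_isConj_ofEmb (hi := hi) (Q := Q) (g := g) fun x hx =>
    hg _ (Subgroup.mem_sup_right ⟨x, hx, rfl⟩)
  refine le_trans (card_le_card_of_conj (i := i) (g := g) fun t ht => ?_) (hQ R hR)
  obtain ⟨n, hn⟩ := hg t (Subgroup.mem_sup_left ht)
  refine ⟨n, mem_normalizer_of_conj_mem fun y hy => ?_, hn⟩
  obtain ⟨x, hx, e⟩ := (hmem y).1 hy
  obtain ⟨x', hx', e'⟩ := (mem_normalizer_iff.1 (hTQ ht) (i x)).1 ⟨x, hx, rfl⟩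
  refine (hmem _).2 ⟨x', hx', ?_⟩
  rw [e', map_mul, map_mul, map_inv, hn, e]
  group

theorem card_le_card_centralizer [Finite P] (hP : IsPGroup p P) (hidx : ¬ p ∣ i.range.index)
    (hQ : (ofEmb i hi).IsFullyCentralized Q) {T : Subgroup G}
    (hT : IsPGroup p T) (hTQ : ∀ t ∈ T, ∀ x ∈ Q, t * i x * t⁻¹ = i x) :
    Nat.card T ≤ Nat.card (centralizer (Q : Set P)) := by
  have hT' : IsPGroup p (T ⊔ Q.map i : Subgroup G) := by
    refine hT.to_sup_of_normal_right' ((hP.to_subgroup Q).map i) fun t ht => ?_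
    refine mem_normalizer_of_conj_mem ?_
    rintro _ ⟨x, hx, rfl⟩
    rw [hTQ t ht x hx]
    exact ⟨x, hx, rfl⟩
  obtain ⟨g, hg⟩ := exists_conj_mem_range hP hidx hT'
  obtain ⟨R, hR, hmem⟩ := exists_isConj_ofEmb (hi := hi) (Q := Q) (g := g) fun x hx =>
    hg _ (Subgroup.mem_sup_right ⟨x, hx, rfl⟩)
  refine le_trans (card_le_card_of_conj (i := i) (g := g) fun t ht => ?_) (hQ R hR)
  obtain ⟨n, hn⟩ := hg t (Subgroup.mem_sup_left ht)
  refine ⟨n, mem_centralizer_iff.2 fun y hy => ?_, hn⟩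
  obtain ⟨x, hx, e⟩ := (hmem y).1 hy
  apply hi
  have h1 := hTQ t ht x hx
  have h2 : t * i x = i x * t := by rwa [mul_inv_eq_iff_eq_mul] at h1
  rw [map_mul, map_mul, hn, e]
  have h3 : g * i x * g⁻¹ * (g * t * g⁻¹) = g * (i x * t) * g⁻¹ := by group
  rw [h3, ← h2]
  group

/-- The fusion system of a finite group on a Sylow subgroup is saturated. -/
theorem isSaturated_ofEmb [Finite P] (hP : IsPGroup p P) (hidx : ¬ p ∣ i.range.index) :
    (ofEmb i hi).IsSaturated p := by
  constructor
  · intro Q hQ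
    let N := N(Q.map i)
    let D : Subgroup N := ((N(Q)).map i).subgroupOf N
    have hDN : (N(Q)).map i ≤ N := by
      rintro _ ⟨n, hn, rfl⟩
      exact (mem_normalizer_map hi).2 hn
    have hDp : IsPGroup p ((N(Q)).map i) :=
      (hP.to_subgroup _).map i
    have hDc : Nat.card ((N(Q)).map i) =
        Nat.card (N(Q)) := card_map_of_injective hi
    have hDi : ¬ p ∣ ((N(Q)).map i).relIndex N := by
      refine not_dvd_relIndex_of_card_le hDp hDN fun Y hY hYp => ?_
      rw [hDc]
      exact card_le_card_normalizer hP hidx hQ hYp hY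
    constructor
    · intro R hR
      obtain ⟨φ, ⟨g, hg⟩, rfl⟩ := hR
      -- conjugate the centralizer of the image back into the centralizer of `Q`
      let T : Subgroup G := ((centralizer (φ.range : Set P)).map i).map
        (MulAut.conj g⁻¹).toMonoidHom
      have hTp : IsPGroup p T := ((hP.to_subgroup _).map i).map _
      have hTc : Nat.card T = Nat.card (centralizer (φ.range : Set P)) := by
        rw [card_map_of_injective (MulAut.conj g⁻¹).injective,
          card_map_of_injective hi]
      have hT : ∀ t ∈ T, ∀ x ∈ Q, t * i x = i x * t := by
        rintro _ ⟨_, ⟨c, hc, rfl⟩, rfl⟩ x hx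
        have h1 := congrArg i (mem_centralizer_iff.1 hc (φ ⟨x, hx⟩) ⟨_, rfl⟩)
        rw [map_mul, map_mul, hg] at h1
        simp only [MulEquiv.coe_toMonoidHom, MulAut.conj_apply]
        calc g⁻¹ * i c * (g⁻¹)⁻¹ * i x = g⁻¹ * (i c * (g * i x * g⁻¹)) * g := by group
          _ = g⁻¹ * ((g * i x * g⁻¹) * i c) * g := by rw [← h1]
          _ = _ := by group
      have hTN : T ≤ N := fun t ht => mem_normalizer_of_conj_mem (by
        rintro _ ⟨x, hx, rfl⟩
        rw [hT t ht x hx]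
        exact ⟨x, hx, by simp⟩)
      obtain ⟨m, hm, h⟩ := exists_conj_le hDp hDi hTp hTN
      rw [← hTc]
      refine card_le_card_of_conj (i := i) (g := m) fun t ht => ?_
      obtain ⟨n, hn, e⟩ := h t ht
      refine ⟨n, mem_centralizer_iff.2 fun x hx => hi ?_, e⟩
      obtain ⟨x', hx', e'⟩ := (Subgroup.mem_normalizer_iff''.1 hm (i x)).1 ⟨x, hx, rfl⟩
      have h2 := hT t ht x' hx'
      have h3 : i x = m * i x' * m⁻¹ := by rw [e']; group
      rw [map_mul, map_mul, e, h3]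
      calc m * i x' * m⁻¹ * (m * t * m⁻¹) = m * (i x' * t) * m⁻¹ := by group
        _ = m * (t * i x') * m⁻¹ := by rw [h2]
        _ = _ := by group
    · have hr : ∀ g : N, normalizerAction i hi Q g ∈ (ofEmb i hi).aut Q := fun g =>
        mem_aut_ofEmb.2 ⟨g, normalizerAction_apply g⟩
      let c : N →* (ofEmb i hi).aut Q := (normalizerAction i hi Q).codRestrict _ hr
      have hcs : Function.Surjective c := by
        rintro ⟨α, hα⟩
        obtain ⟨g, hg⟩ := mem_aut_ofEmb.1 hα
        have hgN : g ∈ N := mem_normalizer_of_conj_mem (by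
          rintro _ ⟨x, hx, rfl⟩
          rw [← hg ⟨x, hx⟩]
          exact ⟨_, (α ⟨x, hx⟩).2, rfl⟩)
        refine ⟨⟨g, hgN⟩, Subtype.ext (MulEquiv.ext fun x => Subtype.ext (hi ?_))⟩
        rw [hg]
        exact normalizerAction_apply (hi := hi) ⟨g, hgN⟩ x
      let S : Sylow p N := (hDp.comap_subtype (K := N)).toSylow hDi
      refine ⟨S.mapSurjective hcs, ?_⟩
      have key : ∀ (n : P) (hn : n ∈ N(Q)),
          normalizerAction i hi Q ⟨i n, (mem_normalizer_map hi).2 hn⟩ =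
            Q.normalizerMonoidHom ⟨n, hn⟩ := fun n hn => by
        refine MulEquiv.ext fun x => Subtype.ext (hi ?_)
        rw [normalizerAction_apply]
        simp
      ext α
      constructor
      · rintro ⟨_, ⟨⟨_, hn'⟩, ⟨n, hn, rfl⟩, rfl⟩, rfl⟩
        exact ⟨⟨n, hn⟩, (key n hn).symm⟩
      · rintro ⟨⟨n, hn⟩, rfl⟩
        exact ⟨_, ⟨⟨i n, (mem_normalizer_map hi).2 hn⟩, ⟨n, hn, rfl⟩, rfl⟩, key n hn⟩
  · rintro Q φ ⟨g, hg⟩ hR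
    let R := φ.range
    let N := N(R.map i)
    let c : N →* MulAut (R.map i) := (R.map i).normalizerMonoidHom
    let D : Subgroup N := ((N(R)).map i).subgroupOf N
    let X' : Subgroup G := ((extender φ).map i).map (MulAut.conj g).toMonoidHom
    let X : Subgroup N := X'.subgroupOf N
    have hact : ∀ (x : P) (hx : x ∈ N(Q)) (y : P)
        (hxy : ∀ u : Q, φ (Q.normalizerMonoidHom ⟨x, hx⟩ u) = y * φ u * y⁻¹) (u : Q),
        (g * i x * g⁻¹) * i (φ u) * (g * i x * g⁻¹)⁻¹ = i y * i (φ u) * (i y)⁻¹ := by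
      intro x hx y hxy u
      have h1 := congrArg i (hxy u)
      rw [hg] at h1
      simp only [map_mul, map_inv] at h1
      rw [← h1, hg]
      simp only [Subgroup.normalizerMonoidHom_apply_apply_coe, map_mul, map_inv]
      group
    have hX'N : X' ≤ N := by
      rintro _ ⟨_, ⟨x, ⟨hx, y, hy, hxy⟩, rfl⟩, rfl⟩
      refine mem_normalizer_of_conj_mem ?_
      rintro _ ⟨_, ⟨u, rfl⟩, rfl⟩
      have := hact x hx y hxy u
      simp only [MulEquiv.coe_toMonoidHom, MulAut.conj_apply]
      rw [this]
      exact ⟨y * φ u * y⁻¹, (mem_normalizer_iff.1 hy _).1 ⟨u, rfl⟩, by simp⟩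
    have hDp : IsPGroup p D := ((hP.to_subgroup _).map i).comap_subtype
    have hXp : IsPGroup p X := (((hP.to_subgroup _).map i).map _).comap_subtype
    have hcker : ∀ n : N, n ∈ c.ker ↔ ∀ u : Q, (n : G) * i (φ u) * (n : G)⁻¹ = i (φ u) := by
      intro n
      rw [MonoidHom.mem_ker]
      constructor
      · intro h u
        have := congrArg (fun α : MulAut (R.map i) => (α ⟨i (φ u), φ u, ⟨u, rfl⟩, rfl⟩ : G)) h
        exact this
      · intro h
        refine MulEquiv.ext ?_
        rintro ⟨_, _, ⟨u, rfl⟩, rfl⟩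
        exact Subtype.ext (h u)
    have hXD : X.map c ≤ D.map c := by
      rintro _ ⟨⟨_, hn⟩, ⟨_, ⟨x, ⟨hx, y, hy, hxy⟩, rfl⟩, e⟩, rfl⟩
      refine ⟨⟨i y, (mem_normalizer_map hi).2 hy⟩, ⟨y, hy, rfl⟩, ?_⟩
      refine MulEquiv.ext ?_
      rintro ⟨_, _, ⟨u, rfl⟩, rfl⟩
      have := hact x hx y hxy u
      refine Subtype.ext (this.symm.trans ?_)
      simp only [MulEquiv.coe_toMonoidHom, MulAut.conj_apply, Subgroup.subtype_apply] at e
      rw [e]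
      rfl
    have hmax : ∀ Y ≤ c.ker, IsPGroup p Y → Nat.card Y ≤ Nat.card (c.ker ⊓ D : Subgroup N) := by
      intro Y hY hYp
      have h1 := card_le_card_centralizer hP hidx hR (T := Y.map N.subtype) (hYp.map _) (by
        rintro _ ⟨n, hn, rfl⟩ _ ⟨u, rfl⟩
        exact (hcker n).1 (hY hn) u)
      rw [card_map_of_injective N.subtype_injective] at h1
      refine h1.trans ?_
      have hcen : ∀ z : centralizer (R : Set P),
          (z : P) ∈ N(R) := fun z =>
        Subgroup.centralizer_le_normalizer _ z.2
      refine Nat.card_le_card_of_injective (fun z => ⟨⟨i (z : P), (mem_normalizer_map hi).2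
        (hcen z)⟩, (hcker _).2 fun u => ?_, ⟨z, hcen z, rfl⟩⟩) fun z w hzw => ?_
      · have := congrArg i (mem_centralizer_iff.1 z.2 (φ u) ⟨u, rfl⟩)
        rw [map_mul, map_mul] at this
        change i z * i (φ u) * (i z)⁻¹ = i (φ u)
        rw [← this]
        group
      · have h2 : i (z : P) = i (w : P) := congrArg (fun a => ((a : N) : G)) (congrArg Subtype.val hzw)
        exact Subtype.ext (hi h2)
    obtain ⟨m, hm, h⟩ := exists_ker_conj_le c hDp hXp hXD hmax
    have hmem : ∀ x ∈ extender φ, (m : G) * (g * i x * g⁻¹) * (m : G)⁻¹ ∈ i.range := by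
      intro x hx
      have h1 : g * i x * g⁻¹ ∈ X' := ⟨i x, ⟨x, hx, rfl⟩, rfl⟩
      obtain ⟨n, -, hn⟩ := h ⟨_, hX'N h1⟩ h1
      exact ⟨n, hn⟩
    let f : P → P := fun x => Function.invFun i ((m : G) * (g * i x * g⁻¹) * (m : G)⁻¹)
    have hf : ∀ x ∈ extender φ, i (f x) = (m : G) * (g * i x * g⁻¹) * (m : G)⁻¹ := fun x hx =>
      Function.invFun_eq (hmem x hx)
    obtain ⟨ψ, hψ, e⟩ := (mor_ofEmb (hi := hi) (Q := extender φ) (f := f)).2 ⟨m * g, fun x hx => by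
      rw [hf x hx]; group⟩
    refine ⟨ψ, hψ, fun x hx hx' => hi ?_⟩
    rw [e, hf x hx', ← hg ⟨x, hx⟩]
    exact (hcker m).1 hm ⟨x, hx⟩

end Saturation

end OfEmb

end FusionSystem

/-! ### Strongly embedded subgroups -/

theorem IsPGroup.exists_mem_normalizer {G : Type*} [Group G] [Finite G] {p : ℕ} [Fact p.Prime]
    {T N : Subgroup G} (hN : IsPGroup p N) (h : T < N) :
    ∃ g ∈ N, g ∉ T ∧ g ∈ N(T) := by
  have : Group.IsNilpotent N := hN.isNilpotent
  have h1 : T.subgroupOf N < ⊤ := by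
    rw [lt_top_iff_ne_top, Ne, Subgroup.subgroupOf_eq_top]
    exact h.not_ge
  obtain ⟨x, hx, hxT⟩ := SetLike.exists_of_lt (Group.normalizerCondition_of_isNilpotent _ h1)
  refine ⟨x, x.2, hxT, mem_normalizer_of_conj_mem fun y hy => ?_⟩
  exact (mem_normalizer_iff.1 hx ⟨y, h.le hy⟩).1 hy

namespace FusionSystem

section StronglyEmbedded

variable {G : Type*} [Group G] {p : ℕ} [Fact p.Prime] {H : Subgroup G}

theorem IsStronglyEmbedded.mem_of_le (hH : IsStronglyEmbedded p H) {T : Subgroup G}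
    (hT : IsPGroup p T) (hT1 : T ≠ ⊥) (hTH : T ≤ H) {g : G}
    (hTg : T ≤ H.map (MulAut.conj g).toMonoidHom) : g ∈ H := by
  by_contra hg
  refine hH.2.2 g hg ?_
  refine dvd_trans ?_ (Subgroup.card_dvd_of_le (le_inf hTH hTg))
  rcases hT.card_eq_or_dvd with h | h
  · exact absurd (Subgroup.card_eq_one.1 h) hT1
  · exact h

/-- A group with a strongly `p`-embedded subgroup has no nontrivial normal `p`-subgroup. -/
theorem IsStronglyEmbedded.eq_bot_of_normal [Finite G] (hH : IsStronglyEmbedded p H) {M : Subgroup G}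
    (hMn : M.Normal) (hM : IsPGroup p M) : M = ⊥ := by
  by_contra hM1
  obtain ⟨T₀⟩ : Nonempty (Sylow p H) := inferInstance
  let T : Subgroup G := (T₀ : Subgroup H).map H.subtype
  have hTp : IsPGroup p T := T₀.2.map _
  have hTH : T ≤ H := Subgroup.map_subtype_le _
  have hT1 : T ≠ ⊥ := by
    intro h
    rw [Subgroup.map_eq_bot_iff_of_injective _ H.subtype_injective] at h
    exact T₀.ne_bot_of_dvd_card hH.2.1 h
  have hNp : IsPGroup p (T ⊔ M : Subgroup G) := hTp.to_sup_of_normal_right hM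
  have hMT : M ≤ T := by
    by_contra hMT
    have hlt : T < T ⊔ M := lt_of_le_not_ge le_sup_left fun h => hMT (le_sup_right.trans h)
    obtain ⟨g, hgN, hgT, hg⟩ := hNp.exists_mem_normalizer hlt
    have hgH : g ∈ H := by
      refine hH.mem_of_le hTp hT1 hTH ?_
      rw [Subgroup.mem_normalizer_iff_map_conj_eq] at hg
      exact hg.ge.trans (Subgroup.map_mono hTH)
    -- `T` and `g` generate a `p`-subgroup of `H`
    have h1 : IsPGroup p (T ⊔ zpowers g : Subgroup G) :=
      hNp.to_le (sup_le le_sup_left (by simpa using hgN))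
    have h2 := T₀.3 (h1.comap_subtype (K := H)) (fun x hx =>
      Subgroup.mem_sup_left ⟨x, hx, rfl⟩)
    have h3 : (⟨g, hgH⟩ : H) ∈ (T ⊔ zpowers g).comap H.subtype :=
      Subgroup.mem_sup_right (mem_zpowers g)
    rw [h2] at h3
    exact hgT ⟨_, h3, rfl⟩
  refine hH.1 (eq_top_iff.2 fun g _ => hH.mem_of_le hM hM1 (hMT.trans hTH) ?_)
  intro m hm
  refine ⟨g⁻¹ * m * g, hTH (hMT ?_), by simp [MulAut.conj_apply, mul_assoc]⟩
  simpa using hMn.conj_mem m hm g⁻¹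

end StronglyEmbedded

/-! ### Automorphisms of essential subgroups -/

section Aut

variable {P : Type*} [Group P] {F F' : FusionSystem P} {Q R : Subgroup P} {p : ℕ}

theorem autP_le_aut (F : FusionSystem P) (Q : Subgroup P) : autP Q ≤ F.aut Q := by
  rintro _ ⟨⟨n, hn⟩, rfl⟩
  exact (mem_aut_iff (f := fun x => n * x * n⁻¹) fun x => rfl).2 (F.mor_conj Q n)

theorem inn_le_autP (Q : Subgroup P) : inn Q ≤ autP Q := by
  rintro _ ⟨q, rfl⟩
  exact ⟨⟨q, le_normalizer q.2⟩, MulEquiv.ext fun x => Subtype.ext rfl⟩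

theorem inn_le_aut (F : FusionSystem P) (Q : Subgroup P) : inn Q ≤ F.aut Q :=
  (inn_le_autP Q).trans (F.autP_le_aut Q)

theorem isPGroup_autP (hP : IsPGroup p P) (Q : Subgroup P) : IsPGroup p (autP Q) :=
  (hP.to_subgroup _).of_surjective _ Q.normalizerMonoidHom.rangeRestrict_surjective

theorem aut_le_aut_iff [Finite P] : F.aut Q ≤ F'.aut Q ↔
    ∀ f : P → P, (∀ x ∈ Q, f x ∈ Q) → F.Mor Q f → F'.Mor Q f := by
  constructor
  · intro h f hQ hf
    obtain ⟨α, hα, e⟩ := hf.exists_aut hQ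
    exact (mem_aut_iff fun x => (e x).symm).1 (h hα)
  · intro h α hα
    exact (mem_aut_iff (autFun_apply α)).2 (h _ (fun _ => autFun_mem) (mor_of_mem_aut hα))

theorem congr_mem_aut {φ : Q →* P} (hφ : φ ∈ F.Hom Q) {α : MulAut Q} (hα : α ∈ F.aut Q) :
    MulAut.congr (MonoidHom.ofInjective (F.injective Q φ hφ)) α ∈ F.aut φ.range := by
  let ε := MonoidHom.ofInjective (F.injective Q φ hφ)
  have h1 := mor_extendFun hφ
  have h2 := mor_of_mem_aut hα
  let g : P → P := extendFun fun y : φ.range => ((ε.symm y : Q) : P)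
  have hg : ∀ x : Q, g (φ x) = x := fun x => by
    have := extendFun_apply (fun y : φ.range => ((ε.symm y : Q) : P)) (ε x)
    rw [ε.symm_apply_apply] at this
    exact this
  have h3 : F.Mor φ.range g := h1.inv (fun x hx => by
    rw [extendFun_apply φ ⟨x, hx⟩, hg]) (by
    rintro _ ⟨x, rfl⟩
    exact ⟨x, x.2, extendFun_apply φ x⟩)
  refine (mem_aut_iff (f := extendFun φ ∘ autFun α ∘ g) ?_).2
    ((h1.comp h2 fun _ => autFun_mem).comp h3 ?_)
  · rintro ⟨_, x, rfl⟩
    simp only [Function.comp_apply]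
    rw [hg, autFun_apply, extendFun_apply φ]
    have : (⟨φ x, x, rfl⟩ : φ.range) = ε x := rfl
    rw [this]
    change φ (α x) = ((ε (α (ε.symm (ε x))) : φ.range) : P)
    rw [ε.symm_apply_apply]
    rfl
  · rintro _ ⟨x, rfl⟩
    rw [hg]
    exact x.2

theorem autP_top : autP (⊤ : Subgroup P) = inn (⊤ : Subgroup P) := by
  refine le_antisymm ?_ (inn_le_autP _)
  rintro _ ⟨⟨n, hn⟩, rfl⟩
  exact ⟨⟨n, mem_top n⟩, MulEquiv.ext fun x => Subtype.ext rfl⟩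

/-- The automorphism group of `Q` in `F` contains a nontrivial automorphism of order prime to
`p`. -/
def HasCoprimeAut (F : FusionSystem P) (p : ℕ) (Q : Subgroup P) : Prop :=
  ∃ α ∈ F.aut Q, α ≠ 1 ∧ ¬ p ∣ orderOf α

theorem HasCoprimeAut.of_isConj (h : F.HasCoprimeAut p Q) (hQR : F.IsConj Q R) :
    F.HasCoprimeAut p R := by
  obtain ⟨φ, hφ, rfl⟩ := hQR
  obtain ⟨α, hα, h1, h2⟩ := h
  refine ⟨_, congr_mem_aut hφ hα, ?_, ?_⟩
  · rwa [Ne, EmbeddingLike.map_eq_one_iff]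
  · rwa [MulEquiv.orderOf_eq]

theorem exists_coprime_of_not_isPGroup {G : Type*} [Group G] [Finite G] [Fact p.Prime]
    (h : ¬ IsPGroup p G) : ∃ g : G, g ≠ 1 ∧ ¬ p ∣ orderOf g := by
  rw [isPGroup_iff_pow_pow_eq_one] at h
  push Not at h
  obtain ⟨g, hg⟩ := h
  obtain ⟨a, m, hm, e⟩ := Nat.exists_eq_pow_mul_and_not_dvd (orderOf_pos g).ne' p
    (Fact.out : p.Prime).ne_one
  refine ⟨g ^ p ^ a, hg a, ?_⟩
  rwa [orderOf_pow_of_dvd (pow_ne_zero _ (Fact.out : p.Prime).ne_zero) ⟨m, e⟩, e,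
    Nat.mul_div_cancel_left _ (pow_pos (Fact.out : p.Prime).pos _)]

variable [Finite P] [Fact p.Prime]

theorem IsEssential.le_inn (hQ : F.IsEssential p Q) {M : Subgroup (MulAut Q)}
    (hMn : ∀ α ∈ F.aut Q, ∀ β ∈ M, α * β * α⁻¹ ∈ M) (hM : IsPGroup p M)
    (hMF : M ≤ F.aut Q) : M ≤ inn Q := by
  obtain ⟨-, H, hH⟩ := hQ
  let M' : Subgroup (F.out Q) := (M.map (QuotientGroup.mk' (inn Q))).subgroupOf (F.out Q)
  have hM'n : M'.Normal := by
    constructor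
    rintro ⟨_, _⟩ ⟨β, hβ, rfl⟩ ⟨_, α, hα, rfl⟩
    exact ⟨α * β * α⁻¹, hMn α hα β hβ, by simp⟩
  have h := hH.eq_bot_of_normal hM'n ((hM.map _).comap_subtype)
  intro α hα
  have h1 : (⟨QuotientGroup.mk' (inn Q) α, α, hMF hα, rfl⟩ : F.out Q) ∈ M' := ⟨α, hα, rfl⟩
  rw [h, mem_bot] at h1
  exact (QuotientGroup.eq_one_iff α).1 (congrArg Subtype.val h1)

theorem IsEssential.not_isPGroup (hQ : F.IsEssential p Q) : ¬ IsPGroup p (F.aut Q) := by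
  intro h
  have h1 := hQ.le_inn (M := F.aut Q)
    (fun α hα β hβ => mul_mem (mul_mem hα hβ) (InvMemClass.inv_mem hα)) h le_rfl
  obtain ⟨-, H, hH⟩ := hQ
  refine hH.1 (eq_top_iff.2 ?_)
  rintro ⟨_, α, hα, rfl⟩ -
  have : (⟨QuotientGroup.mk' (inn Q) α, α, hα, rfl⟩ : F.out Q) = 1 :=
    Subtype.ext ((QuotientGroup.eq_one_iff α).2 (h1 hα))
  rw [this]
  exact one_mem _

theorem IsEssential.hasCoprimeAut (hQ : F.IsEssential p Q) : F.HasCoprimeAut p Q := by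
  obtain ⟨g, h1, h2⟩ := exists_coprime_of_not_isPGroup hQ.not_isPGroup
  exact ⟨g, g.2, by simpa using h1, by simpa using h2⟩

theorem IsSaturated.not_dvd_relIndex (hF : F.IsSaturated p) (hQ : F.IsFullyNormalized Q) :
    ¬ p ∣ (autP Q).relIndex (F.aut Q) := by
  obtain ⟨-, S, hS⟩ := hF.sylow Q hQ
  have : (autP Q).subgroupOf (F.aut Q) = S := by
    rw [← hS]
    exact Subgroup.comap_map_eq_self_of_injective (F.aut Q).subtype_injective _
  rw [Subgroup.relIndex, this]
  exact S.not_dvd_index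

theorem isFullyNormalized_top (F : FusionSystem P) : F.IsFullyNormalized ⊤ := fun R _ => by
  rw [Subgroup.normalizer_eq_top (H := (⊤ : Subgroup P))]
  exact Nat.card_mono (Set.toFinite _) (le_top (a := N(R)))

theorem IsSaturated.not_isEssential_top (hF : F.IsSaturated p) : ¬ F.IsEssential p ⊤ := by
  rintro ⟨-, H, hH⟩
  have h := hF.not_dvd_relIndex F.isFullyNormalized_top
  rw [autP_top, ← QuotientGroup.ker_mk' (inn _), Subgroup.relIndex_ker] at h
  exact h (hH.2.1.trans (Subgroup.card_subgroup_dvd_card H))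

theorem IsSaturated.aut_top_le_of_isPGroup (hF : F.IsSaturated p) (h : IsPGroup p (F.aut ⊤)) :
    F.aut ⊤ ≤ autP ⊤ := by
  have h1 := hF.not_dvd_relIndex F.isFullyNormalized_top
  obtain ⟨n, hn⟩ := h.index ((autP ⊤).subgroupOf (F.aut ⊤))
  rw [Subgroup.relIndex, hn] at h1
  rw [← Subgroup.relIndex_eq_one, Subgroup.relIndex, hn]
  rcases n with - | n
  · simp
  · exact absurd (dvd_pow_self p n.succ_ne_zero) h1

theorem card_lt_card_of_lt {H K : Subgroup P} (h : H < K) : Nat.card H < Nat.card K := by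
  refine lt_of_le_of_ne (Nat.card_mono (Set.toFinite _) h.le) fun e => ?_
  exact h.ne (Subgroup.eq_of_le_of_card_ge h.le e.ge)

end Aut

/-! ### Alperin's fusion theorem -/

section Alperin

variable {P : Type*} [Group P] {F F' : FusionSystem P} {Q R : Subgroup P} {p : ℕ}
  {f : P → P}

theorem IsSaturated.exists_extension (hF : F.IsSaturated p) (hf : F.Mor Q f)
    (hR : ∀ y, y ∈ R ↔ ∃ x ∈ Q, f x = y) (hRc : F.IsFullyCentralized R) :
    ∃ (N : Subgroup P) (f' : P → P), F.Mor N f' ∧ (∀ x ∈ Q, f' x = f x) ∧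
      (∀ x, x ∈ N ↔ x ∈ N(Q) ∧
        ∃ y ∈ N(R), ∀ u ∈ Q, f (x * u * x⁻¹) = y * f u * y⁻¹) := by
  obtain ⟨φ, hφ, e⟩ := hf
  have hRφ : R = φ.range := by
    ext y
    rw [hR]
    constructor
    · rintro ⟨x, hx, rfl⟩
      exact ⟨⟨x, hx⟩, e _⟩
    · rintro ⟨x, rfl⟩
      exact ⟨x, x.2, (e x).symm⟩
  subst hRφ
  obtain ⟨ψ, hψ, h⟩ := hF.extension Q φ hφ hRc
  have hN : ∀ x, x ∈ extender φ ↔ x ∈ N(Q) ∧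
      ∃ y ∈ N(φ.range), ∀ u ∈ Q,
        f (x * u * x⁻¹) = y * f u * y⁻¹ := fun x => by
    constructor
    · rintro ⟨hx, y, hy, h⟩
      refine ⟨hx, y, hy, fun u hu => ?_⟩
      have := h ⟨u, hu⟩
      rw [e, e] at this
      exact this
    · rintro ⟨hx, y, hy, h⟩
      refine ⟨hx, y, hy, fun u => ?_⟩
      rw [e, e]
      exact h u u.2
  refine ⟨extender φ, extendFun ψ, mor_extendFun hψ, ?_, hN⟩
  intro x hx
  have hx' : x ∈ extender φ := by
    refine (hN x).2 ⟨le_normalizer hx, f x, le_normalizer ⟨⟨x, hx⟩, e _⟩, ?_⟩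
    intro u hu
    have hf : F.Mor Q f := ⟨φ, hφ, e⟩
    have h1 := hf.map_mul (mul_mem hx hu) (InvMemClass.inv_mem hx)
    have h2 := hf.map_mul (InvMemClass.inv_mem hx) hx
    have h3 := hf.map_mul (one_mem Q) (one_mem Q)
    rw [inv_mul_cancel] at h2
    rw [mul_one] at h3
    rw [h1, hf.map_mul hx hu]
    congr 1
    rw [eq_inv_iff_mul_eq_one, ← h2]
    simpa using h3
  rw [extendFun_apply ψ ⟨x, hx'⟩, h x hx hx', e]

variable [Finite P]

theorem exists_isFullyNormalized (F : FusionSystem P) (Q : Subgroup P) :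
    ∃ R, F.IsConj Q R ∧ F.IsFullyNormalized R := by
  obtain ⟨R, hR, hmax⟩ := Set.exists_max_image {R | F.IsConj Q R}
    (fun R => Nat.card (N(R))) (Set.toFinite _)
    ⟨Q, IsConj.refl F Q⟩
  exact ⟨R, hR, fun S hS => hmax S (hR.trans hS)⟩

variable [Fact p.Prime]

theorem lt_normalizer (hP : IsPGroup p P) (hQ : Q ≠ ⊤) :
    Q < N(Q) := by
  obtain ⟨g, -, hg, h⟩ := (hP.to_subgroup ⊤).exists_mem_normalizer (lt_top_iff_ne_top.2 hQ)
  exact lt_of_le_of_ne le_normalizer fun e => hg (by rw [e]; exact h)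

/-- A conjugation onto a fully normalized subgroup can be chosen so as to extend to the
normalizer. -/
theorem IsSaturated.exists_mor_normalizer (hF : F.IsSaturated p) (hP : IsPGroup p P)
    (hR : F.IsFullyNormalized R) (hQR : F.IsConj Q R) :
    ∃ f, F.Mor (N(Q)) f ∧ ∀ y, y ∈ R ↔ ∃ x ∈ Q, f x = y := by
  obtain ⟨φ, hφ, rfl⟩ := hQR
  let ε := MonoidHom.ofInjective (F.injective Q φ hφ)
  let X : Subgroup (MulAut φ.range) := (autP Q).map (MulAut.congr ε).toMonoidHom
  have hX : X ≤ F.aut φ.range := by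
    rintro _ ⟨α, hα, rfl⟩
    exact congr_mem_aut hφ (F.autP_le_aut Q hα)
  obtain ⟨χ, hχ, h⟩ := exists_conj_le (isPGroup_autP hP φ.range) (hF.not_dvd_relIndex hR)
    ((isPGroup_autP hP Q).map _) hX
  have h3 := (mor_of_mem_aut hχ).comp (mor_extendFun hφ) (fun x hx => by
    rw [extendFun_apply φ ⟨x, hx⟩]
    exact ⟨_, rfl⟩)
  have e : ∀ x : Q, (autFun χ ∘ extendFun φ) x = χ (ε x) := fun x => by
    rw [Function.comp_apply, extendFun_apply φ]
    exact autFun_apply χ (ε x)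
  have hr : ∀ y, y ∈ φ.range ↔ ∃ x ∈ Q, (autFun χ ∘ extendFun φ) x = y := fun y => by
    constructor
    · intro hy
      obtain ⟨z, hz⟩ := χ.surjective ⟨y, hy⟩
      obtain ⟨x, rfl⟩ := ε.surjective z
      exact ⟨x, x.2, by rw [e, hz]⟩
    · rintro ⟨x, hx, rfl⟩
      rw [e ⟨x, hx⟩]
      exact (χ _).2
  obtain ⟨N, f', hf', hff', hN⟩ := hF.exists_extension h3 hr (hF.sylow _ hR).1
  have hnN : N(Q) ≤ N := fun n hn => by
    refine (hN n).2 ⟨hn, ?_⟩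
    obtain ⟨⟨y, hy⟩, hc⟩ := h _ ⟨_, ⟨⟨n, hn⟩, rfl⟩, rfl⟩
    refine ⟨y, hy, fun u hu => ?_⟩
    have h4 := congrArg (fun α : MulAut φ.range => ((α (χ (ε ⟨u, hu⟩)) : φ.range) : P)) hc
    have h5 := e (Q.normalizerMonoidHom ⟨n, hn⟩ ⟨u, hu⟩)
    have h6 := e ⟨u, hu⟩
    have h7 : (autFun χ ∘ extendFun φ) (n * u * n⁻¹) =
        χ (ε (Q.normalizerMonoidHom ⟨n, hn⟩ ⟨u, hu⟩)) := h5
    simp only [] at h6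
    rw [h7, h6]
    refine Eq.trans ?_ h4.symm
    simp [MulAut.mul_apply]
  refine ⟨f', hf'.mono hnN, fun y => (hr y).trans ?_⟩
  constructor
  · rintro ⟨x, hx, rfl⟩
    exact ⟨x, hx, hff' x hx⟩
  · rintro ⟨x, hx, rfl⟩
    exact ⟨x, hx, (hff' x hx).symm⟩

theorem IsSaturated.isCentric (hR : F.IsFullyCentralized R)
    (hc : centralizer (R : Set P) ≤ R) : F.IsCentric R := by
  intro S hS
  obtain ⟨f, hf, h⟩ := isConj_iff.1 hS
  have h1 : Nat.card (centralizer (R : Set P)) ≤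
      Nat.card (centralizer (S : Set P) ⊓ S : Subgroup P) := by
    refine Nat.card_le_card_of_injective (fun c => ⟨f c, ?_, (h _).2 ⟨c, hc c.2, rfl⟩⟩)
      fun c d hcd => Subtype.ext (hf.injOn (hc c.2) (hc d.2) (congrArg Subtype.val hcd))
    refine mem_centralizer_iff.2 fun s hs => ?_
    obtain ⟨x, hx, rfl⟩ := (h s).1 hs
    rw [← hf.map_mul hx (hc c.2), ← hf.map_mul (hc c.2) hx,
      mem_centralizer_iff.1 c.2 x hx]
  have h2 : centralizer (S : Set P) ⊓ S = centralizer (S : Set P) :=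
    Subgroup.eq_of_le_of_card_ge inf_le_left ((hR S hS).trans h1)
  rw [← h2]
  exact inf_le_right

/-- The heart of Alperin's fusion theorem: the automorphisms of a fully normalized proper subgroup
`R` lie in every fusion system `F'` that contains the morphisms of `F` between larger subgroups,
and the automorphisms of `R` if `R` is essential. If the automorphisms that lie in `F'` form a
proper subgroup, then it becomes strongly embedded modulo inner automorphisms. -/
theorem IsSaturated.aut_le_of_isFullyNormalized (hF : F.IsSaturated p) (hP : IsPGroup p P)
    (hR : F.IsFullyNormalized R) (hRt : R ≠ ⊤)
    (ih : ∀ (Q : Subgroup P) (f : P → P), Nat.card R < Nat.card Q → F.Mor Q f → F'.Mor Q f)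
    (hess : F.IsEssential p R → F.aut R ≤ F'.aut R) : F.aut R ≤ F'.aut R := by
  have hRc := (hF.sylow R hR).1
  -- an automorphism that extends to a larger subgroup lies in `F'`
  have key : ∀ α ∈ F.aut R, ∀ n ∉ R, ∀ hn : n ∈ N(R),
      α * R.normalizerMonoidHom ⟨n, hn⟩ * α⁻¹ ∈ autP R → α ∈ F'.aut R := by
    intro α hα n hnR hn hαn
    have e := autFun_apply α
    obtain ⟨N, f', hf', hff', hN⟩ := hF.exists_extension (R := R) (mor_of_mem_aut hα) (fun y => by
      constructor
      · intro hy
        obtain ⟨x, hx⟩ := α.surjective ⟨y, hy⟩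
        exact ⟨x, x.2, by rw [e, hx]⟩
      · rintro ⟨x, hx, rfl⟩
        exact autFun_mem hx) hRc
    have hconj : ∀ (x : P) (hx : x ∈ N(R)),
        α * R.normalizerMonoidHom ⟨x, hx⟩ * α⁻¹ ∈ autP R → x ∈ N := by
      rintro x hx ⟨⟨y, hy⟩, hxy⟩
      refine (hN x).2 ⟨hx, y, hy, fun u hu => ?_⟩
      have h4 := congrArg (fun β : MulAut R => ((β (α ⟨u, hu⟩) : R) : P)) hxy
      have h5 : autFun α (x * u * x⁻¹) =
          α (R.normalizerMonoidHom ⟨x, hx⟩ ⟨u, hu⟩) := e (R.normalizerMonoidHom ⟨x, hx⟩ ⟨u, hu⟩)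
      rw [h5, e ⟨u, hu⟩]
      refine Eq.trans ?_ h4.symm
      simp [MulAut.mul_apply]
    have hRN : R ≤ N := fun x hx => by
      refine hconj x (le_normalizer hx) (inn_le_autP R ?_)
      have : R.normalizerMonoidHom ⟨x, le_normalizer hx⟩ =
        MulAut.conj (⟨x, hx⟩ : R) := MulEquiv.ext fun x => Subtype.ext rfl
      rw [this]
      exact (inferInstance : (inn R).Normal).conj_mem _ ⟨_, rfl⟩ α
    have hlt : R < N := SetLike.lt_iff_le_and_exists.2 ⟨hRN, n, hconj n hn hαn, hnR⟩
    refine (mem_aut_iff e).2 (((ih N f' (card_lt_card_of_lt hlt) hf').mono hRN).congr hff')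
  by_cases hc : centralizer (R : Set P) ≤ R
  swap
  · intro α hα
    obtain ⟨c, hc, hcR⟩ := SetLike.not_le_iff_exists.1 hc
    refine key α hα c hcR (Subgroup.centralizer_le_normalizer _ hc) ?_
    have : R.normalizerMonoidHom ⟨c, Subgroup.centralizer_le_normalizer _ hc⟩ = 1 := by
      rw [← MonoidHom.mem_ker, Subgroup.normalizerMonoidHom_ker]
      exact hc
    rw [this]
    simp
  by_cases he : F.IsEssential p R
  · exact hess he
  by_contra hle
  refine he ⟨IsSaturated.isCentric hRc hc, ?_⟩
  let π := QuotientGroup.mk' (inn R)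
  let H : Subgroup (F.out R) := ((F.aut R ⊓ F'.aut R).map π).subgroupOf (F.out R)
  let T : Subgroup (F.out R) := ((autP R).map π).subgroupOf (F.out R)
  have hTp : IsPGroup p T := ((isPGroup_autP hP R).map _).comap_subtype
  have hTH : T ≤ H := by
    rintro ⟨_, hx⟩ ⟨τ, hτ, rfl⟩
    exact ⟨τ, ⟨F.autP_le_aut R hτ, F'.autP_le_aut R hτ⟩, rfl⟩
  have hker : ∀ α β : MulAut R, π α = π β → ∃ ι ∈ inn R, β = α * ι := fun α β h =>
    ⟨α⁻¹ * β, QuotientGroup.eq.1 h, by group⟩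
  have hTi : ¬ p ∣ T.relIndex H := by
    intro hd
    refine hF.not_dvd_relIndex hR (hd.trans ((Subgroup.relIndex_dvd_index_of_le hTH).trans ?_))
    have hi1 : autP R ⊔ π.ker = autP R := by
      rw [QuotientGroup.ker_mk', sup_eq_left]; exact inn_le_autP R
    have hi2 : F.aut R ⊔ π.ker = F.aut R := by
      rw [QuotientGroup.ker_mk', sup_eq_left]; exact F.inn_le_aut R
    have : T.index = (autP R).relIndex (F.aut R) := by
      change ((autP R).map π).relIndex ((F.aut R).map π) = _
      rw [Subgroup.relIndex_map_map, hi1, hi2]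
    rw [this]
  obtain ⟨n, hn, hnR⟩ := SetLike.exists_of_lt (lt_normalizer hP hRt)
  refine ⟨H, fun htop => hle fun α hα => ?_, ?_, fun g hg hd => hg ?_⟩
  · have h1 : (⟨π α, α, hα, rfl⟩ : F.out R) ∈ H := by rw [htop]; trivial
    obtain ⟨β, ⟨-, hβ⟩, hαβ⟩ := h1
    obtain ⟨ι, hι, rfl⟩ := hker β α hαβ
    exact mul_mem hβ (F'.inn_le_aut R hι)
  · refine dvd_trans (hTp.card_eq_or_dvd.resolve_left fun h1 => hnR ?_)
      (Subgroup.card_dvd_of_le hTH)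
    rw [Subgroup.card_eq_one] at h1
    have hτ : R.normalizerMonoidHom ⟨n, hn⟩ ∈ autP R := ⟨_, rfl⟩
    have h2 : (⟨π (R.normalizerMonoidHom ⟨n, hn⟩), _, F.autP_le_aut R hτ, rfl⟩ : F.out R) ∈ T :=
      ⟨_, hτ, rfl⟩
    rw [h1, mem_bot] at h2
    obtain ⟨r, hr⟩ := (QuotientGroup.eq_one_iff _).1 (congrArg Subtype.val h2)
    have h3 : (r : P)⁻¹ * n ∈ R := hc (mem_centralizer_iff.2 fun x hx => by
      have h4 := congrArg (fun β : MulAut R => ((β ⟨x, hx⟩ : R) : P)) hr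
      simp only [MulAut.conj_apply, Subgroup.normalizerMonoidHom_apply_apply_coe,
        Subgroup.coe_mul, Subgroup.coe_inv] at h4
      calc x * ((r : P)⁻¹ * n) = (r : P)⁻¹ * (r * x * (r : P)⁻¹) * n := by group
        _ = (r : P)⁻¹ * (n * x * n⁻¹) * n := by rw [h4]
        _ = _ := by group)
    have h4 := mul_mem r.2 h3
    rwa [mul_inv_cancel_left] at h4
  · obtain ⟨⟨x, hxH, hxg⟩, hx⟩ := exists_prime_orderOf_dvd_card' p hd
    replace hx : orderOf x = p := by rw [← hx]; exact (Subgroup.orderOf_mk x _).symm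
    obtain ⟨x', hx', e⟩ := hxg
    simp only [MulEquiv.coe_toMonoidHom, MulAut.conj_apply] at e
    have hxx' : orderOf x' = p := by
      have h5 := MulEquiv.orderOf_eq (MulAut.conj g) x'
      rw [MulAut.conj_apply, e, hx] at h5
      exact h5.symm
    have hpz : ∀ y : F.out R, orderOf y = p → IsPGroup p (zpowers y) := fun y hy =>
      IsPGroup.of_card (n := 1) (by rw [Nat.card_zpowers, hy, pow_one])
    obtain ⟨h₁, hh₁, hc₁⟩ := exists_conj_le hTp hTi (hpz x hx)
      (by rwa [zpowers_le])
    obtain ⟨h₂, hh₂, hc₂⟩ := exists_conj_le hTp hTi (hpz x' hxx')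
      (by rwa [zpowers_le])
    have hv := hc₁ x (mem_zpowers x)
    have hw := hc₂ x' (mem_zpowers x')
    set k := h₂ * g⁻¹ * h₁⁻¹ with hk
    have hkv : k * (h₁ * x * h₁⁻¹) * k⁻¹ ∈ T := by
      have : k * (h₁ * x * h₁⁻¹) * k⁻¹ = h₂ * x' * h₂⁻¹ := by
        rw [← e, hk]; group
      rwa [this]
    have hv1 : h₁ * x * h₁⁻¹ ≠ 1 := by
      intro h5
      have h6 : x = 1 := by simpa using h5
      rw [h6, orderOf_one] at hx
      exact (Fact.out : p.Prime).ne_one hx.symm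
    generalize h₁ * x * h₁⁻¹ = v at hv hkv hv1
    have hkH : k ∈ H := by
      obtain ⟨_, κ, hκ, rfl⟩ := k
      obtain ⟨_, hv0⟩ := v
      obtain ⟨τ, ⟨⟨m, hm⟩, rfl⟩, rfl⟩ := hv
      obtain ⟨τ', hτ', e'⟩ := hkv
      refine ⟨κ, ⟨hκ, key κ hκ m (fun hmR => hv1 (Subtype.ext ?_)) hm ?_⟩, rfl⟩
      · exact (QuotientGroup.eq_one_iff _).2 ⟨⟨m, hmR⟩, MulEquiv.ext fun x => Subtype.ext rfl⟩
      · have e2 : π τ' = π (κ * R.normalizerMonoidHom ⟨m, hm⟩ * κ⁻¹) := by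
          rw [map_mul, map_mul, map_inv]
          exact e'
        obtain ⟨ι, hι, e3⟩ := hker _ _ e2
        rw [e3]
        exact mul_mem hτ' (inn_le_autP R hι)
    have hgk : g = h₁⁻¹ * k⁻¹ * h₂ := by rw [hk]; group
    rw [hgk]
    exact mul_mem (mul_mem (InvMemClass.inv_mem hh₁) (InvMemClass.inv_mem hkH)) hh₂

/-- **Alperin's fusion theorem**: a saturated fusion system is contained in every fusion system
that contains its automorphisms of `P` and of the essential subgroups. -/
theorem IsSaturated.mor_of_aut_le (hF : F.IsSaturated p) (hP : IsPGroup p P)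
    (htop : F.aut ⊤ ≤ F'.aut ⊤) (hess : ∀ Q, F.IsEssential p Q → F.aut Q ≤ F'.aut Q)
    (hf : F.Mor Q f) : F'.Mor Q f := by
  induction hn : Nat.card P - Nat.card Q using Nat.strong_induction_on generalizing Q f with
  | _ n ih =>
  subst hn
  by_cases hQ : Q = ⊤
  · subst hQ
    exact aut_le_aut_iff.1 htop f (fun _ _ => mem_top _) hf
  have hlt : ∀ {S : Subgroup P}, S ≠ ⊤ → Nat.card S < Nat.card P := fun {S} hS => by
    have := card_lt_card_of_lt (lt_top_iff_ne_top.2 hS)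
    rwa [Subgroup.card_top] at this
  have ih' : ∀ (S : Subgroup P) (g : P → P), Nat.card Q < Nat.card S → F.Mor S g → F'.Mor S g :=
    fun S g hS hg => ih _ (by have := hlt hQ; omega) hg rfl
  obtain ⟨R, hQR, hR⟩ := F.exists_isFullyNormalized Q
  have hcR := hQR.card_eq
  have hne : ∀ {S : Subgroup P}, Nat.card S = Nat.card Q → S ≠ ⊤ := fun {S} h1 h2 => by
    have := hlt hQ
    rw [← h1, h2, Subgroup.card_top] at this
    exact this.false
  -- `S` is the image of `f`
  obtain ⟨S, hS⟩ : ∃ S : Subgroup P, ∀ y, y ∈ S ↔ ∃ x ∈ Q, f x = y := by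
    obtain ⟨φ, hφ, e⟩ := hf
    exact ⟨φ.range, fun y => ⟨fun ⟨x, hx⟩ => ⟨x, x.2, by rw [← e, hx]⟩,
      fun ⟨x, hx, hxy⟩ => ⟨⟨x, hx⟩, by rw [e, hxy]⟩⟩⟩
  have hQS : F.IsConj Q S := isConj_iff.2 ⟨f, hf, hS⟩
  have hcS := hQS.card_eq
  obtain ⟨a, ha, haR⟩ := hF.exists_mor_normalizer hP hR hQR
  obtain ⟨b, hb, hbR⟩ := hF.exists_mor_normalizer hP hR (hQS.symm.trans hQR)
  have ha' := ih' _ a (card_lt_card_of_lt (lt_normalizer hP hQ)) ha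
  have hb' := ih' _ b (hcS ▸ card_lt_card_of_lt (lt_normalizer hP (hne hcS.symm))) hb
  replace ha := ha.mono le_normalizer
  replace hb' := hb'.mono le_normalizer
  obtain ⟨a', h1, haa'⟩ := ha.exists_inv haR
  obtain ⟨b', h2, hbb'⟩ := hb'.exists_inv hbR
  have ha'Q : ∀ y ∈ R, a' y ∈ Q := fun y hy => by
    obtain ⟨x, hx, rfl⟩ := (haR y).1 hy
    rwa [haa' x hx]
  have hfS : ∀ x ∈ Q, f x ∈ S := fun x hx => (hS _).2 ⟨x, hx, rfl⟩
  have hbS : ∀ x ∈ S, b x ∈ R := fun x hx => (hbR _).2 ⟨x, hx, rfl⟩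
  have haQ : ∀ x ∈ Q, a x ∈ R := fun x hx => (haR _).2 ⟨x, hx, rfl⟩
  have h3 : F.Mor R (b ∘ f ∘ a') := (hb.mono le_normalizer).comp (hf.comp h1 ha'Q) fun y hy => hfS _ (ha'Q y hy)
  have h4 : F'.Mor R (b ∘ f ∘ a') :=
    aut_le_aut_iff.1 (hF.aut_le_of_isFullyNormalized hP hR (hne hcR.symm)
      (fun S g hS => ih' S g (hcR ▸ hS)) (hess R)) _
      (fun y hy => hbS _ (hfS _ (ha'Q y hy))) h3
  have h5 : F'.Mor Q (b' ∘ (b ∘ f ∘ a') ∘ a) :=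
    h2.comp (h4.comp (ha'.mono le_normalizer) haQ) fun x hx => hbS _ (hfS _ (ha'Q _ (haQ x hx)))
  refine h5.congr fun x hx => ?_
  simp only [Function.comp_apply]
  rw [haa' x hx, hbb' _ (hfS x hx)]

end Alperin

end FusionSystem

/-! ### Automorphisms of odd order -/

section OddAut

variable {E : Type*} [Group E]

theorem mem_of_pow_two_pow_mem {S : Subgroup E} {g : E} (hg : Odd (orderOf g)) {j : ℕ}
    (h : g ^ 2 ^ j ∈ S) : g ∈ S := by
  obtain ⟨m, hm⟩ := exists_pow_eq_self_of_coprime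
    (Nat.Coprime.pow_left j (Nat.coprime_two_left.2 hg))
  rw [← hm]
  exact pow_mem h m

variable {α : MulAut E}

theorem MulAut.apply_eq_of_pow_two_pow (hα : Odd (orderOf α)) {j : ℕ} {x : E}
    (h : (α ^ 2 ^ j) x = x) : α x = x :=
  mem_of_pow_two_pow_mem hα (S := MulAction.stabilizer (MulAut E) x) h

theorem MulAut.apply_eq_of_apply_apply (hα : Odd (orderOf α)) {x : E} (h : α (α x) = x) :
    α x = x :=
  MulAut.apply_eq_of_pow_two_pow hα (j := 1) (by rwa [pow_one, pow_two])

theorem MulAut.apply_eq_of_mul (hα : Odd (orderOf α)) {c u : E} (hc : α c = c) {j : ℕ}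
    (hj : c ^ 2 ^ j = 1) (hu : α u = c * u) : α u = u := by
  have h : ∀ k : ℕ, (α ^ k) u = c ^ k * u := fun k => by
    induction k with
    | zero => simp
    | succ k ih => rw [pow_succ', MulAut.mul_apply, ih, map_mul, map_pow, hc, hu, pow_succ, mul_assoc]
  exact MulAut.apply_eq_of_pow_two_pow hα (j := j) (by rw [h, hj, one_mul])

/-- An automorphism of odd order fixes the elements of a cyclic `2`-subgroup that it
normalizes. -/
theorem MulAut.apply_eq_of_mem_zpowers (hα : Odd (orderOf α)) {g : E} {l : ℕ}
    (hg : g ^ 2 ^ l = 1) (h : α g ∈ zpowers g) : α g = g := by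
  obtain ⟨m, -, hm⟩ := (Nat.dvd_prime_pow Nat.prime_two).1 (orderOf_dvd_of_pow_eq_one hg)
  have hfin : IsOfFinOrder g := isOfFinOrder_iff_pow_eq_one.2 ⟨_, by positivity, hg⟩
  obtain ⟨a, ha⟩ := hfin.mem_powers_iff_mem_zpowers.2 h
  simp only at ha
  have h1 : ∀ k : ℕ, (α ^ k) g = g ^ a ^ k := fun k => by
    induction k with
    | zero => simp
    | succ k ih => rw [pow_succ', MulAut.mul_apply, ih, map_pow, ← ha, ← pow_mul, pow_succ']
  have hco : a.Coprime (2 ^ m) := by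
    have h2 : orderOf (g ^ a) = orderOf g := by rw [ha]; exact MulEquiv.orderOf_eq α g
    rw [hfin.orderOf_pow, hm] at h2
    have h3 : (2 ^ m).gcd a = 1 := by
      have h4 := Nat.gcd_dvd_left (2 ^ m) a
      obtain ⟨c, hc⟩ := h4
      have h5 : 0 < (2 ^ m).gcd a := Nat.gcd_pos_of_pos_left _ (by positivity)
      rw [Nat.div_eq_of_eq_mul_right h5 hc] at h2
      rw [h2] at hc
      have h6 : 0 < 2 ^ m := by positivity
      nlinarith
    exact Nat.Coprime.symm h3
  have h2 := Nat.ModEq.pow_totient hco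
  refine MulAut.apply_eq_of_pow_two_pow hα (j := m - 1) ?_
  rw [h1]
  rcases m with - | m
  · rw [pow_zero, orderOf_eq_one_iff] at hm
    rw [hm, one_pow]
  · rw [Nat.totient_prime_pow_succ Nat.prime_two] at h2
    simp only [Nat.add_one_sub_one, mul_one] at h2 ⊢
    conv_rhs => rw [← pow_one g]
    rwa [pow_eq_pow_iff_modEq, hm]

/-- An automorphism of odd order of an abelian `2`-group that fixes the involutions is trivial. -/
theorem MulAut.eq_one_of_fixes_involutions (hα : Odd (orderOf α)) (hE : IsPGroup 2 E)
    (hcomm : ∀ x y : E, x * y = y * x) (h : ∀ x : E, x ^ 2 = 1 → α x = x) : α = 1 := by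
  have key : ∀ (l : ℕ) (x : E), x ^ 2 ^ l = 1 → α x = x := fun l => by
    induction l with
    | zero => intro x hx; rw [pow_zero, pow_one] at hx; rw [hx, map_one]
    | succ l ih =>
      intro x hx
      have h1 : α (x ^ 2) = x ^ 2 := ih _ (by rw [← pow_mul, ← pow_succ']; exact hx)
      have hc : Commute (α x) x⁻¹ := hcomm _ _
      have h2 : (α x * x⁻¹) ^ 2 = 1 := by
        rw [hc.mul_pow, ← map_pow, h1, inv_pow, mul_inv_cancel]
      exact MulAut.apply_eq_of_mul hα (h _ h2) (j := 1) (by rwa [pow_one]) (by group)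
  refine MulEquiv.ext fun x => ?_
  obtain ⟨l, hl⟩ := (isPGroup_iff_pow_pow_eq_one.1 hE) x
  exact key l x hl

/-- The order of a group of automorphisms that acts freely on a set divides the cardinality of the
set. -/
theorem card_dvd_of_free {K : Subgroup (MulAut E)} {Y : Set E}
    (hK : ∀ α ∈ K, ∀ y ∈ Y, α y ∈ Y) (hfree : ∀ α ∈ K, ∀ y ∈ Y, α y = y → α = 1) :
    Nat.card K ∣ Nat.card Y := by
  let act : MulAction K Y :=
    { smul := fun α y => ⟨(α : MulAut E) y, hK α α.2 y y.2⟩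
      one_smul := fun y => rfl
      mul_smul := fun α β y => rfl }
  have hs : ∀ y : Y, MulAction.stabilizer K y = ⊥ := fun y => by
    refine (Subgroup.eq_bot_iff_forall _).2 fun α hα => Subtype.ext ?_
    exact hfree α α.2 y y.2 (congrArg Subtype.val hα)
  rw [Nat.card_congr (MulAction.selfEquivOrbitsQuotientProd hs), Nat.card_prod]
  exact dvd_mul_left _ _

end OddAut

theorem Nat.odd_of_not_two_dvd {n : ℕ} (h : ¬ 2 ∣ n) : Odd n := by
  rwa [← Nat.not_even_iff_odd, even_iff_two_dvd]

namespace FusionSystem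

/-! ### Groups without essential subgroups -/

section Resistant

variable {P : Type*} [Group P] [Finite P] {F F' : FusionSystem P} {Q : Subgroup P}

/-- If the involutions of the `2`-group `P` are central and all commutators are trivial or
involutions, then no subgroup is essential: the normalizer of a centric subgroup `Q` acts trivially
on the involutions of `Q` and modulo the involutions, so it acts on `Q` through a normal
`2`-subgroup of the automorphism group of `Q`. -/
theorem IsSaturated.not_isEssential_of_central (hF : F.IsSaturated 2) (hP : IsPGroup 2 P)
    (h1 : ∀ x y : P, x ^ 2 = 1 → x * y = y * x) (h2 : ∀ x y : P, (x * y * x⁻¹ * y⁻¹) ^ 2 = 1) :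
    ¬ F.IsEssential 2 Q := by
  intro hQ
  have hQt : Q ≠ ⊤ := by
    rintro rfl
    exact hF.not_isEssential_top hQ
  obtain ⟨g, hg, hgQ⟩ := SetLike.exists_of_lt (lt_normalizer hP hQt)
  have hcomm : ∀ x y : Q, x ^ 2 = 1 → x * y = y * x := fun x y hx =>
    Subtype.ext (h1 x y (congrArg Subtype.val hx))
  let M : Subgroup (MulAut Q) := F.aut Q ⊓
    { carrier := {α | (∀ x : Q, x ^ 2 = 1 → α x = x) ∧ ∀ x : Q, (α x * x⁻¹) ^ 2 = 1}
      one_mem' := ⟨fun x _ => rfl, fun x => by simp⟩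
      mul_mem' := by
        rintro α β ⟨hα, hα'⟩ ⟨hβ, hβ'⟩
        refine ⟨fun x hx => by rw [MulAut.mul_apply, hβ x hx, hα x hx], fun x => ?_⟩
        have h3 : (α * β) x * x⁻¹ = (α (β x) * (β x)⁻¹) * (β x * x⁻¹) := by
          rw [MulAut.mul_apply]; group
        have h4 : Commute (α (β x) * (β x)⁻¹) (β x * x⁻¹) := hcomm _ _ (hα' _)
        rw [h3, h4.mul_pow, hα', hβ', one_mul]
      inv_mem' := by
        rintro α ⟨hα, hα'⟩
        refine ⟨fun x hx => ?_, fun x => ?_⟩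
        · rw [MulAut.inv_apply, MulEquiv.symm_apply_eq, hα x hx]
        · have h3 := hα' (α⁻¹ x)
          rw [MulAut.apply_inv_self] at h3
          rw [← inv_inj, inv_one, ← inv_pow, mul_inv_rev, inv_inv]
          exact h3 }
  have hMn : ∀ α ∈ F.aut Q, ∀ β ∈ M, α * β * α⁻¹ ∈ M := by
    rintro α hα β ⟨hβF, hβ, hβ'⟩
    refine ⟨(F.aut Q).mul_mem ((F.aut Q).mul_mem hα hβF) ((F.aut Q).inv_mem hα), fun x hx => ?_, fun x => ?_⟩
    · rw [MulAut.mul_apply, MulAut.mul_apply, hβ _ (by rw [← map_pow, hx, map_one]),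
        MulAut.apply_inv_self]
    · have h3 : (α * β * α⁻¹) x * x⁻¹ = α (β (α⁻¹ x) * (α⁻¹ x)⁻¹) := by
        rw [map_mul, map_inv, MulAut.apply_inv_self]; rfl
      rw [h3, ← map_pow, hβ', map_one]
  have hMp : IsPGroup 2 M := isPGroup_iff_pow_pow_eq_one.2 (by
    rintro ⟨α, -, hα, hα'⟩
    refine ⟨1, Subtype.ext (MulEquiv.ext fun x => ?_)⟩
    have h3 : α (α x * x⁻¹) = α x * x⁻¹ := hα _ (hα' x)
    have h4 : α x * x⁻¹ * (α x * x⁻¹) = 1 := by rw [← pow_two]; exact hα' x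
    rw [map_mul, map_inv, mul_inv_eq_iff_eq_mul] at h3
    change (α ^ 2 ^ 1) x = x
    rw [pow_one, pow_two, MulAut.mul_apply, h3]
    calc α x * x⁻¹ * α x = α x * x⁻¹ * (α x * x⁻¹) * x := by group
      _ = x := by rw [h4, one_mul])
  have hgM : Q.normalizerMonoidHom ⟨g, hg⟩ ∈ M := by
    refine ⟨F.autP_le_aut Q ⟨_, rfl⟩, fun x hx => Subtype.ext ?_, fun x => Subtype.ext ?_⟩
    · simp [← h1 x g (congrArg Subtype.val hx)]
    · exact h2 g x
  obtain ⟨q, hq⟩ := hQ.le_inn hMn hMp inf_le_left hgM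
  refine hgQ ?_
  have h3 : (q : P)⁻¹ * g ∈ Q := by
    refine hQ.1 Q (IsConj.refl F Q) (mem_centralizer_iff.2 fun x hx => ?_)
    have h4 := congrArg (fun β : MulAut Q => ((β ⟨x, hx⟩ : Q) : P)) hq
    simp only [MulAut.conj_apply, Subgroup.normalizerMonoidHom_apply_apply_coe,
      Subgroup.coe_mul, Subgroup.coe_inv] at h4
    calc x * ((q : P)⁻¹ * g) = (q : P)⁻¹ * (q * x * (q : P)⁻¹) * g := by group
      _ = (q : P)⁻¹ * (g * x * g⁻¹) * g := by rw [h4]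
      _ = _ := by group
  simpa using mul_mem q.2 h3

theorem essentialRank_eq_zero {p : ℕ} (h : ∀ Q, ¬ F.IsEssential p Q) : F.essentialRank p = 0 := by
  rw [essentialRank, Set.ncard_eq_zero]
  ext C
  simp [h]

/-- The automorphisms of the whole group `P` in a fusion system on `P`. -/
def autTop (F : FusionSystem P) : Subgroup (MulAut P) :=
  (F.aut ⊤).comap (MulAut.congr (topEquiv (G := P)).symm).toMonoidHom

theorem mem_autTop {α : MulAut P} : α ∈ F.autTop ↔ F.Mor ⊤ α :=
  mem_aut_iff fun _ => rfl

theorem inn_le_autTop (F : FusionSystem P) : inn P ≤ F.autTop := by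
  rintro _ ⟨g, rfl⟩
  exact mem_autTop.2 (F.mor_conj ⊤ g)

theorem aut_top_le_of_autTop_le (h : F.autTop ≤ F'.autTop) : F.aut ⊤ ≤ F'.aut ⊤ := by
  rwa [autTop, autTop, Subgroup.comap_le_comap_of_surjective
    (MulAut.congr (topEquiv (G := P)).symm).surjective] at h

theorem inn_eq_comap_autP : inn P = (autP (⊤ : Subgroup P)).comap
    (MulAut.congr (topEquiv (G := P)).symm).toMonoidHom := by
  ext α
  rw [autP_top]
  constructor
  · rintro ⟨g, rfl⟩
    exact ⟨⟨g, trivial⟩, MulEquiv.ext fun x => Subtype.ext rfl⟩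
  · rintro ⟨g, hg⟩
    exact ⟨g, MulEquiv.ext fun x => congrArg (fun β : MulAut (⊤ : Subgroup P) => (β ⟨x, trivial⟩ : P)) hg⟩

theorem aut_top_le_autP_iff : F.aut ⊤ ≤ autP ⊤ ↔ F.autTop ≤ inn P := by
  rw [inn_eq_comap_autP, autTop, Subgroup.comap_le_comap_of_surjective
    (MulAut.congr (topEquiv (G := P)).symm).surjective]

theorem IsSaturated.not_dvd_relIndex_autTop {p : ℕ} [Fact p.Prime] (hF : F.IsSaturated p) :
    ¬ p ∣ (inn P).relIndex F.autTop := by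
  have h := hF.not_dvd_relIndex F.isFullyNormalized_top
  rwa [inn_eq_comap_autP, Subgroup.relIndex_comap, autTop, Subgroup.map_comap_eq_self_of_surjective
    (MulAut.congr (topEquiv (G := P)).symm).surjective]

theorem eq_of_autTop_eq {p : ℕ} [Fact p.Prime] (hP : IsPGroup p P) (hF : F.IsSaturated p)
    (hF' : F'.IsSaturated p) (hn : ∀ Q, ¬ F.IsEssential p Q) (hn' : ∀ Q, ¬ F'.IsEssential p Q)
    (h : F.autTop = F'.autTop) : F = F' :=
  ext_of_mor fun _ _ =>
    ⟨hF.mor_of_aut_le hP (aut_top_le_of_autTop_le h.le) fun Q hQ => absurd hQ (hn Q),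
      hF'.mor_of_aut_le hP (aut_top_le_of_autTop_le h.ge) fun Q hQ => absurd hQ (hn' Q)⟩

theorem autTop_ofEmb_id (α : MulAut P) :
    α ∈ (ofEmb (MonoidHom.id P) Function.injective_id).autTop ↔ α ∈ inn P := by
  rw [mem_autTop, mor_ofEmb]
  constructor
  · rintro ⟨g, hg⟩
    exact ⟨g, MulEquiv.ext fun x => (hg x trivial).symm⟩
  · rintro ⟨g, rfl⟩
    exact ⟨g, fun x _ => rfl⟩

theorem not_dvd_index_range_id {p : ℕ} [Fact p.Prime] : ¬ p ∣ (MonoidHom.id P).range.index := by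
  rw [MonoidHom.range_eq_top.2 Function.surjective_id, Subgroup.index_top, Nat.dvd_one]
  exact (Fact.out : p.Prime).ne_one

/-- A saturated fusion system without essential subgroups on `P`, all of whose automorphisms of `P`
are inner, is the fusion system of the group `P`. -/
theorem IsSaturated.isFusionSystemOf_self {p : ℕ} [Fact p.Prime] (hF : F.IsSaturated p)
    (hP : IsPGroup p P) (hn : ∀ Q, ¬ F.IsEssential p Q) (h : F.aut ⊤ ≤ autP ⊤) :
    F.IsFusionSystemOf p P := by
  have e : F = ofEmb (MonoidHom.id P) Function.injective_id := ext_of_mor fun Q f => by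
    constructor
    · exact hF.mor_of_aut_le hP (h.trans (autP_le_aut _ _)) fun Q hQ => absurd hQ (hn Q)
    · intro hf
      obtain ⟨g, hg⟩ := mor_ofEmb.1 hf
      exact (F.mor_conj Q g).congr fun x hx => (hg x hx).symm
  exact e ▸ isFusionSystemOf_ofEmb hP not_dvd_index_range_id

/-- By the Schur–Zassenhaus theorem, the automorphisms of `P` in a saturated fusion system are the
products of the inner automorphisms with a group of automorphisms of order prime to `p`. -/
theorem IsSaturated.exists_complement {p : ℕ} [Fact p.Prime] (hF : F.IsSaturated p)
    (hP : IsPGroup p P) : ∃ K : Subgroup (MulAut P), ¬ p ∣ Nat.card K ∧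
      ∀ α, α ∈ F.autTop ↔ ∃ g : P, ∃ κ ∈ K, α = MulAut.conj g * κ := by
  have hi := hF.not_dvd_relIndex_autTop
  have hp : IsPGroup p ((inn P).subgroupOf F.autTop) :=
    (hP.of_surjective (MulAut.conj : P →* MulAut P).rangeRestrict
      (MulAut.conj : P →* MulAut P).rangeRestrict_surjective).comap_subtype
  obtain ⟨n, hn⟩ := IsPGroup.iff_card.1 hp
  have hco : (Nat.card ((inn P).subgroupOf F.autTop)).Coprime
      ((inn P).subgroupOf F.autTop).index := by
    rw [hn]
    exact Nat.Coprime.pow_left _ (((Fact.out : p.Prime).coprime_iff_not_dvd).2 hi)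
  obtain ⟨K, hK⟩ := Subgroup.exists_right_complement'_of_coprime hco
  refine ⟨K.map F.autTop.subtype, ?_, fun α => ?_⟩
  · rw [card_map_of_injective F.autTop.subtype_injective, ← hK.symm.index_eq_card]
    exact hi
  · constructor
    · intro hα
      have h1 : (⟨α, hα⟩ : F.autTop) ∈ (inn P).subgroupOf F.autTop ⊔ K := by
        rw [hK.sup_eq_top]; trivial
      obtain ⟨⟨_, _⟩, ⟨g, rfl⟩, κ, hκ, e⟩ := Subgroup.mem_sup_of_normal_left.1 h1
      exact ⟨g, κ, ⟨κ, hκ, rfl⟩, congrArg Subtype.val e.symm⟩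
    · rintro ⟨g, _, ⟨κ, -, rfl⟩, rfl⟩
      exact mul_mem (F.inn_le_autTop ⟨g, rfl⟩) κ.2

theorem card_autTop {p : ℕ} [Fact p.Prime] (hP : IsPGroup p P) {K : Subgroup (MulAut P)}
    (hK : ¬ p ∣ Nat.card K)
    (h : ∀ α, α ∈ F.autTop ↔ ∃ g : P, ∃ κ ∈ K, α = MulAut.conj g * κ) :
    Nat.card F.autTop = Nat.card (inn P) * Nat.card K := by
  have hp : IsPGroup p (inn P) := hP.of_surjective (MulAut.conj : P →* MulAut P).rangeRestrict
      (MulAut.conj : P →* MulAut P).rangeRestrict_surjective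
  obtain ⟨n, hn⟩ := IsPGroup.iff_card.1 hp
  have hd : Disjoint (inn P) K := Subgroup.disjoint_of_coprime_natCard (by
    rw [hn]; exact Nat.Coprime.pow_left _ (((Fact.out : p.Prime).coprime_iff_not_dvd).2 hK))
  rw [← Nat.card_prod]
  refine (Nat.card_congr (Equiv.ofBijective (fun x : inn P × K =>
    (⟨x.1 * x.2, ?_⟩ : F.autTop)) ⟨fun x y hxy => ?_, ?_⟩)).symm
  · obtain ⟨⟨_, g, rfl⟩, κ⟩ := x
    exact (h _).2 ⟨g, κ, κ.2, rfl⟩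
  · exact Subgroup.mul_injective_of_disjoint hd (congrArg Subtype.val hxy)
  · rintro ⟨α, hα⟩
    obtain ⟨g, κ, hκ, rfl⟩ := (h α).1 hα
    exact ⟨(⟨_, g, rfl⟩, ⟨κ, hκ⟩), rfl⟩

variable {C : Type*} [Group C] [Finite C]

theorem range_inl_comp (φ : C →* MulAut P) (β : MulAut P) :
    ((SemidirectProduct.inl : P →* SemidirectProduct P C φ).comp β.toMonoidHom).range =
      SemidirectProduct.inl.range := by
  rw [MonoidHom.range_comp, MonoidHom.range_eq_top.2 β.surjective, ← MonoidHom.range_eq_map]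

theorem index_range_inl (φ : C →* MulAut P) (β : MulAut P) :
    ((SemidirectProduct.inl : P →* SemidirectProduct P C φ).comp β.toMonoidHom).range.index =
      Nat.card C := by
  rw [range_inl_comp, SemidirectProduct.range_inl_eq_ker_rightHom, Subgroup.index_ker,
    MonoidHom.range_eq_top.2 SemidirectProduct.rightHom_surjective, Subgroup.card_top]

theorem injective_inl_comp (φ : C →* MulAut P) (β : MulAut P) : Function.Injective
    ((SemidirectProduct.inl : P →* SemidirectProduct P C φ).comp β.toMonoidHom) :=
  SemidirectProduct.inl_injective.comp β.injective

theorem mem_autTop_inl (φ : C →* MulAut P) (β α : MulAut P) :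
    α ∈ (ofEmb _ (injective_inl_comp φ β)).autTop ↔
      ∃ g : P, ∃ κ, β * κ * β⁻¹ ∈ φ.range ∧ α = MulAut.conj g * κ := by
  have key : ∀ (g : P) (c : C) (x : P),
      (⟨g, c⟩ : SemidirectProduct P C φ) * SemidirectProduct.inl x * (⟨g, c⟩)⁻¹ =
        SemidirectProduct.inl (g * φ c x * g⁻¹) := fun g c x => by
    have : (⟨g, c⟩ : SemidirectProduct P C φ) =
        SemidirectProduct.inl g * SemidirectProduct.inr c := by ext <;> simp
    rw [this, map_mul, map_mul, SemidirectProduct.inl_aut, map_inv]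
    simp only [mul_inv_rev, mul_assoc, map_inv]
  rw [mem_autTop, mor_ofEmb]
  constructor
  · rintro ⟨⟨g, c⟩, h⟩
    refine ⟨β⁻¹ g, β⁻¹ * φ c * β, ⟨c, by group⟩, MulEquiv.ext fun x => β.injective ?_⟩
    have h1 := h x trivial
    simp only [MonoidHom.comp_apply, MulEquiv.coe_toMonoidHom] at h1
    rw [key] at h1
    rw [SemidirectProduct.inl_injective h1]
    simp [MulAut.conj_apply]
  · rintro ⟨g, κ, ⟨c, hc⟩, rfl⟩
    refine ⟨⟨β g, c⟩, fun x _ => ?_⟩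
    simp only [MonoidHom.comp_apply, MulEquiv.coe_toMonoidHom]
    rw [key, hc]
    simp [MulAut.conj_apply]

theorem isSaturated_inl {p : ℕ} [Fact p.Prime] (hP : IsPGroup p P) (hC : ¬ p ∣ Nat.card C)
    (φ : C →* MulAut P) (β : MulAut P) : (ofEmb _ (injective_inl_comp φ β)).IsSaturated p := by
  have : Finite (SemidirectProduct P C φ) := Finite.of_equiv _ SemidirectProduct.equivProd.symm
  exact isSaturated_ofEmb hP (by rwa [index_range_inl])

/-- A saturated fusion system without essential subgroups is the fusion system of the semidirect
product of `P` with a complement of the inner automorphisms. -/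
theorem IsSaturated.isFusionSystemOf_semidirect {p : ℕ} [Fact p.Prime] (hF : F.IsSaturated p)
    (hP : IsPGroup p P)
    (hn : ∀ F : FusionSystem P, F.IsSaturated p → ∀ Q, ¬ F.IsEssential p Q)
    (hC : ¬ p ∣ Nat.card C) (φ : C →* MulAut P) (β : MulAut P) {K : Subgroup (MulAut P)}
    (hK : ∀ α, α ∈ F.autTop ↔ ∃ g : P, ∃ κ ∈ K, α = MulAut.conj g * κ)
    (hβ : ∀ κ, κ ∈ K ↔ β * κ * β⁻¹ ∈ φ.range) :
    F.IsFusionSystemOf p (SemidirectProduct P C φ) := by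
  have : Finite (SemidirectProduct P C φ) := Finite.of_equiv _ SemidirectProduct.equivProd.symm
  have hS := isSaturated_inl hP hC φ β
  have e : F = ofEmb _ (injective_inl_comp φ β) :=
    eq_of_autTop_eq hP hF hS (hn F hF) (hn _ hS) (by
      ext α
      rw [hK, mem_autTop_inl]
      simp_rw [hβ])
  rw [e]
  exact isFusionSystemOf_ofEmb hP (by rwa [index_range_inl])

theorem IsIsoVia.mor {P' : Type*} [Group P'] {F' : FusionSystem P'} {e : P ≃* P'}
    (h : F.IsIsoVia F' e) {f : P → P} (hf : F.Mor Q f) :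
    F'.Mor (Q.map (e : P →* P')) (e ∘ f ∘ e.symm) := by
  obtain ⟨φ, hφ, hfx⟩ := hf
  refine ⟨_, (h Q φ).1 hφ, fun y => ?_⟩
  obtain ⟨x, rfl⟩ := (e.subgroupMap Q).surjective y
  simp only [MonoidHom.comp_apply, MulEquiv.coe_toMonoidHom, MulEquiv.symm_apply_apply,
    Function.comp_apply, MulEquiv.coe_subgroupMap_apply]
  rw [hfx]

theorem IsIso.card_autTop_le {P' : Type*} [Group P'] [Finite P'] {F' : FusionSystem P'}
    (h : F.IsIso F') : Nat.card F.autTop ≤ Nat.card F'.autTop := by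
  obtain ⟨e, he⟩ := h
  refine Nat.card_le_card_of_injective (fun α : F.autTop => (⟨MulAut.congr e α, ?_⟩ : F'.autTop))
    fun α β hαβ => Subtype.ext ((MulAut.congr e).injective (congrArg Subtype.val hαβ))
  have h1 := he.mor (mem_autTop.1 α.2)
  rw [Subgroup.map_top_of_surjective (e : P →* P') e.surjective] at h1
  exact mem_autTop.2 h1

theorem IsIso.card_autTop_eq {P' : Type*} [Group P'] [Finite P'] {F' : FusionSystem P'}
    (h : F.IsIso F') : Nat.card F.autTop = Nat.card F'.autTop :=
  h.card_autTop_le.antisymm h.symm.card_autTop_le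

theorem exists_cyc_hom {G : Type*} [Group G] (g : G) : ∃ φ : Cyc (orderOf g) →* G,
    Function.Injective φ ∧ φ.range = zpowers g := by
  rw [← Nat.card_zpowers]
  let e := zmodCyclicMulEquiv (G := zpowers g) inferInstance
  refine ⟨(zpowers g).subtype.comp e.toMonoidHom,
    Subtype.coe_injective.comp e.injective, ?_⟩
  have he : e.toMonoidHom.range = ⊤ := MonoidHom.range_eq_top.2 e.surjective
  rw [MonoidHom.range_comp, he, ← MonoidHom.range_eq_map, Subgroup.range_subtype]

/-- The classification of the saturated fusion systems on a `2`-group without essential subgroups,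
all of whose groups of automorphisms of odd order are conjugate to `⟨γ m⟩` for some `m ∈ D`. -/
theorem classification_of_odd_automorphisms (hP : IsPGroup 2 P)
    (hn : ∀ F : FusionSystem P, F.IsSaturated 2 → ∀ Q, ¬ F.IsEssential 2 Q) (D : Finset ℕ)
    (γ : ℕ → MulAut P) (hγ : ∀ m ∈ D, orderOf (γ m) = m ∧ Odd m)
    (hconj : ∀ K : Subgroup (MulAut P), Odd (Nat.card K) →
      ∃ m ∈ D, ∃ β, ∀ κ, κ ∈ K ↔ β * κ * β⁻¹ ∈ zpowers (γ m)) :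
    (∀ F : FusionSystem P, F.IsSaturated 2 → F.essentialRank 2 = 0 ∧
        (F.IsFusionSystemOf 2 P ∨
        ∃ m ∈ D, m ≠ 1 ∧ ∃ φ : Cyc m →* MulAut P, Function.Injective φ ∧
          F.IsFusionSystemOf 2 (SemidirectProduct P (Cyc m) φ))) ∧
      numSaturated 2 P = D.card := by
  have hγ' : ∀ m ∈ D, ∃ φ : Cyc m →* MulAut P, Function.Injective φ ∧
      φ.range = zpowers (γ m) := fun m hm => by
    obtain ⟨φ, h⟩ := exists_cyc_hom (γ m)
    have e := (hγ m hm).1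
    revert φ
    rw [e]
    exact fun φ h => ⟨φ, h⟩
  have hfin : ∀ m ∈ D, Finite (Cyc m) ∧ ¬ 2 ∣ Nat.card (Cyc m) := fun m hm => by
    have ho := (hγ m hm).2
    have : NeZero m := ⟨by rintro rfl; simp at ho⟩
    refine ⟨inferInstanceAs (Finite (ZMod m)), ?_⟩
    have hc : Nat.card (Cyc m) = m := by
      rw [Cyc, Nat.card_congr Multiplicative.toAdd, Nat.card_zmod]
    rw [hc, ← even_iff_two_dvd, Nat.not_even_iff_odd]
    exact ho
  -- every saturated fusion system is given by some `m ∈ D`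
  have main : ∀ F : FusionSystem P, F.IsSaturated 2 → ∃ m ∈ D, ∃ K : Subgroup (MulAut P),
      Nat.card K = m ∧
      (∀ α, α ∈ F.autTop ↔ ∃ g : P, ∃ κ ∈ K, α = MulAut.conj g * κ) ∧
      ∃ β, ∀ κ, κ ∈ K ↔ β * κ * β⁻¹ ∈ zpowers (γ m) := by
    intro F hF
    obtain ⟨K, hK, h⟩ := hF.exists_complement hP
    obtain ⟨m, hm, β, hβ⟩ := hconj K (Nat.odd_of_not_two_dvd hK)
    refine ⟨m, hm, K, ?_, h, β, hβ⟩
    rw [← (hγ m hm).1, ← Nat.card_zpowers]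
    have hKm : K = (zpowers (γ m)).comap (MulAut.conj β).toMonoidHom := by
      ext κ; exact hβ κ
    have hbij : (zpowers (γ m)) = K.map (MulAut.conj β).toMonoidHom := by
      rw [hKm, Subgroup.map_comap_eq_self_of_surjective (MulAut.conj β).surjective]
    rw [hbij, card_map_of_injective (MulAut.conj β).injective]
  have hcard : ∀ F : FusionSystem P, F.IsSaturated 2 → ∀ m ∈ D, ∀ K : Subgroup (MulAut P),
      Nat.card K = m → (∀ α, α ∈ F.autTop ↔ ∃ g : P, ∃ κ ∈ K, α = MulAut.conj g * κ) →
      Nat.card F.autTop = Nat.card (inn P) * m := by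
    intro F hF m hm K hKm h
    rw [card_autTop hP (p := 2) _ h, hKm]
    rw [hKm, ← even_iff_two_dvd, Nat.not_even_iff_odd]
    exact (hγ m hm).2
  constructor
  · intro F hF
    refine ⟨essentialRank_eq_zero (hn F hF), ?_⟩
    obtain ⟨m, hm, K, hKm, h, β, hβ⟩ := main F hF
    by_cases h1 : m = 1
    · refine Or.inl (hF.isFusionSystemOf_self hP (hn F hF) ?_)
      have hK1 : K = ⊥ := by rw [← Subgroup.card_eq_one, hKm, h1]
      refine aut_top_le_autP_iff.2 fun α hα => ?_
      obtain ⟨g, κ, hκ, rfl⟩ := (h α).1 hα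
      rw [hK1, mem_bot] at hκ
      rw [hκ, mul_one]
      exact ⟨g, rfl⟩
    · obtain ⟨φ, hφ, hr⟩ := hγ' m hm
      have := (hfin m hm).1
      exact Or.inr ⟨m, hm, h1, φ, hφ, hF.isFusionSystemOf_semidirect hP hn (hfin m hm).2 φ β h
        (fun κ => by rw [hβ, hr])⟩
  · -- the order of the automorphism group of `P` distinguishes the isomorphism classes
    let v : Quotient (isoSetoid 2 P) → ℕ :=
      Quotient.lift (fun F => Nat.card F.1.autTop) fun F F' h => IsIso.card_autTop_eq h
    have hc0 : 0 < Nat.card (inn P) := Nat.card_pos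
    have hv : Function.Injective v := by
      intro a b
      induction a using Quotient.inductionOn with | _ F =>
      induction b using Quotient.inductionOn with | _ F' =>
      intro hab
      replace hab : Nat.card F.1.autTop = Nat.card F'.1.autTop := hab
      obtain ⟨m, hm, K, hKm, h, β, hβ⟩ := main F.1 F.2
      obtain ⟨m', hm', K', hKm', h', β', hβ'⟩ := main F'.1 F'.2
      rw [hcard F.1 F.2 m hm K hKm h, hcard F'.1 F'.2 m' hm' K' hKm' h'] at hab
      have hmm : m = m' := Nat.eq_of_mul_eq_mul_left hc0 hab
      subst hmm
      refine Quotient.sound ?_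
      obtain ⟨φ, hφ, hr⟩ := hγ' m hm
      have := (hfin m hm).1
      have hA := isSaturated_inl hP (hfin m hm).2 φ β
      have hA' := isSaturated_inl hP (hfin m hm).2 φ β'
      have e : F.1 = ofEmb _ (injective_inl_comp φ β) :=
        eq_of_autTop_eq hP F.2 hA (hn _ F.2) (hn _ hA) (by
          ext α; rw [h, mem_autTop_inl]; simp_rw [hβ, hr])
      have e' : F'.1 = ofEmb _ (injective_inl_comp φ β') :=
        eq_of_autTop_eq hP F'.2 hA' (hn _ F'.2) (hn _ hA') (by
          ext α; rw [h', mem_autTop_inl]; simp_rw [hβ', hr])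
      have i1 : F.1.IsIso (ofGroup (SemidirectProduct.inl (φ := φ)).range) := by
        rw [e, ← range_inl_comp φ β]; exact ofEmb_isIso
      have i2 : F'.1.IsIso (ofGroup (SemidirectProduct.inl (φ := φ)).range) := by
        rw [e', ← range_inl_comp φ β']; exact ofEmb_isIso
      exact i1.trans i2.symm
    have hrange : Set.range v = ((D.image fun m => Nat.card (inn P) * m : Finset ℕ) : Set ℕ) := by
      ext k
      simp only [Set.mem_range, Finset.coe_image, Set.mem_image, Finset.mem_coe]
      constructor
      · rintro ⟨a, rfl⟩
        induction a using Quotient.inductionOn with | _ F =>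
        obtain ⟨m, hm, K, hKm, h, -⟩ := main F.1 F.2
        exact ⟨m, hm, (hcard F.1 F.2 m hm K hKm h).symm⟩
      · rintro ⟨m, hm, rfl⟩
        obtain ⟨φ, hφ, hr⟩ := hγ' m hm
        have := (hfin m hm).1
        have hA := isSaturated_inl hP (hfin m hm).2 φ 1
        refine ⟨Quotient.mk _ ⟨_, hA⟩, ?_⟩
        refine hcard _ hA m hm (zpowers (γ m)) ?_ fun α => ?_
        · rw [Nat.card_zpowers, (hγ m hm).1]
        · rw [mem_autTop_inl]; simp [hr]
    have hinj : Function.Injective fun m => Nat.card (inn P) * m := fun a b hab =>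
      Nat.eq_of_mul_eq_mul_left hc0 hab
    rw [numSaturated, ← Finset.card_image_of_injective D hinj, ← Set.ncard_coe_finset, ← hrange,
      ← Set.image_univ, Set.ncard_image_of_injective _ hv, Set.ncard_univ]

end Resistant

end FusionSystem

/-! ### Homocyclic groups of rank two -/

/-- By Sylow's theorem, subgroups of the largest possible `p`-power order are conjugate. -/
theorem exists_conj_mem_iff {G : Type*} [Group G] [Finite G] {p : ℕ} [Fact p.Prime]
    {K C M : Subgroup G} (hK : IsPGroup p K) (hC : IsPGroup p C) (hKM : K ≤ M) (hCM : C ≤ M)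
    (hcard : Nat.card K = Nat.card C)
    (hmax : ∀ Y ≤ M, IsPGroup p Y → Nat.card Y ≤ Nat.card C) :
    ∃ m ∈ M, ∀ k, k ∈ K ↔ m * k * m⁻¹ ∈ C := by
  obtain ⟨m, hm, h⟩ := exists_conj_le hC (not_dvd_relIndex_of_card_le hC hCM hmax) hK hKM
  refine ⟨m, hm, fun k => ⟨h k, fun hk => ?_⟩⟩
  have h1 : K.map (MulAut.conj m).toMonoidHom = C := by
    refine Subgroup.eq_of_le_of_card_ge ?_ ?_
    · rintro _ ⟨y, hy, rfl⟩
      exact h y hy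
    · rw [card_map_of_injective (MulAut.conj m).injective, hcard]
  rw [← h1] at hk
  obtain ⟨y, hy, e⟩ := hk
  rwa [← (MulAut.conj m).injective e]

section Involutions

variable {E : Type*} [Group E]

/-- An automorphism of odd order that fixes one of at most three commuting involutions fixes all
of them. -/
theorem MulAut.apply_eq_of_fixes_involution [Finite E] {α : MulAut E} (hα : Odd (orderOf α))
    (hcomm : ∀ x y : E, x ^ 2 = 1 → y ^ 2 = 1 → x * y = y * x)
    (hcard : Nat.card {x : E | x ^ 2 = 1} ≤ 4) {y : E} (hy : y ^ 2 = 1) (hy1 : y ≠ 1)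
    (hαy : α y = y) {x : E} (hx : x ^ 2 = 1) : α x = x := by
  classical
  by_cases h1 : x = 1
  · rw [h1, map_one]
  by_cases h2 : x = y
  · rw [h2, hαy]
  have hyy : y * y = 1 := by rw [← pow_two, hy]
  have h3 : y * x ≠ 1 := fun h => h2 (mul_left_cancel (h.trans hyy.symm))
  have hset : ({1, y, x, y * x} : Set E) = {x : E | x ^ 2 = 1} := by
    refine Set.eq_of_subset_of_ncard_le ?_ ?_
    · have hc : Commute y x := hcomm y x hy hx
      rintro z (rfl | rfl | rfl | rfl)
      · exact one_pow 2
      · exact hy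
      · exact hx
      · change (y * x) ^ 2 = 1
        rw [hc.mul_pow, hy, hx, one_mul]
    · refine hcard.trans ?_
      have : ({1, y, x, y * x} : Set E) = (({1, y, x, y * x} : Finset E) : Set E) := by simp
      rw [this, Set.ncard_coe_finset, Finset.card_insert_of_notMem, Finset.card_insert_of_notMem,
        Finset.card_insert_of_notMem, Finset.card_singleton]
      · simpa using hy1
      · simpa using ⟨fun h => h2 h.symm, h1⟩
      · simpa using ⟨fun h => hy1 h.symm, fun h => h1 h.symm, fun h => h3 h.symm⟩
  have hmem : α x ∈ ({1, y, x, y * x} : Set E) := by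
    rw [hset]
    change α x ^ 2 = 1
    rw [← map_pow, hx, map_one]
  rcases hmem with h | h | h | h
  · exact absurd ((map_eq_one_iff α α.injective).1 h) h1
  · exact absurd (α.injective (h.trans hαy.symm)) h2
  · exact h
  · exact MulAut.apply_eq_of_mul hα hαy (j := 1) (by rw [pow_one, hy]) h

theorem MulAut.eq_one_of_fixes_involution [Finite E] {α : MulAut E} (hα : Odd (orderOf α))
    (hE : IsPGroup 2 E) (hcomm : ∀ x y : E, x * y = y * x)
    (hcard : Nat.card {x : E | x ^ 2 = 1} ≤ 4) {y : E} (hy : y ^ 2 = 1) (hy1 : y ≠ 1)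
    (hαy : α y = y) : α = 1 :=
  MulAut.eq_one_of_fixes_involutions hα hE hcomm fun _ hx =>
    MulAut.apply_eq_of_fixes_involution hα (fun x y _ _ => hcomm x y) hcard hy hy1 hαy hx

theorem exists_involution [Finite E] [Nontrivial E] (hE : IsPGroup 2 E) :
    ∃ y : E, y ^ 2 = 1 ∧ y ≠ 1 := by
  obtain ⟨y, hy⟩ := exists_prime_orderOf_dvd_card' 2
    (hE.card_eq_or_dvd.resolve_left Finite.one_lt_card.ne')
  refine ⟨y, by rw [← hy, pow_orderOf_eq_one], ?_⟩
  rintro rfl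
  simp at hy

/-- The groups of automorphisms of odd order of an abelian `2`-group with at most three involutions
have order one or three. -/
theorem card_dvd_three_of_odd [Finite E] [Nontrivial E] (hE : IsPGroup 2 E)
    (hcomm : ∀ x y : E, x * y = y * x) (hcard : Nat.card {x : E | x ^ 2 = 1} ≤ 4)
    {K : Subgroup (MulAut E)} (hK : Odd (Nat.card K)) : Nat.card K ∣ 3 := by
  have hY : Nat.card K ∣ Nat.card ({x : E | x ^ 2 = 1} \ {1} : Set E) := by
    refine card_dvd_of_free (fun α _ y hy => ⟨?_, fun h => hy.2 ?_⟩) fun α hα y hy h => ?_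
    · change α y ^ 2 = 1
      rw [← map_pow, hy.1, map_one]
    · exact (map_eq_one_iff α α.injective).1 h
    · refine MulAut.eq_one_of_fixes_involution ?_ hE hcomm hcard hy.1 hy.2 h
      exact Odd.of_dvd_nat hK (Subgroup.orderOf_dvd_natCard K hα)
  obtain ⟨y, hy, hy1⟩ := exists_involution hE
  have h1 : Nat.card ({x : E | x ^ 2 = 1} \ {1} : Set E) + 1 = Nat.card {x : E | x ^ 2 = 1} :=
    Set.ncard_sdiff_singleton_add_one (s := {x : E | x ^ 2 = 1}) (one_pow 2)
  have h2 : 0 < Nat.card ({x : E | x ^ 2 = 1} \ {1} : Set E) :=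
    (Set.ncard_pos (Set.toFinite _)).2 ⟨y, hy, hy1⟩
  have h3 := Nat.le_of_dvd h2 hY
  have h4 : Nat.card K ≤ 3 := by omega
  have h5 := Nat.card_pos (α := K)
  generalize Nat.card K = k at *
  interval_cases k
  · exact one_dvd 3
  · exact absurd hK (by decide)
  · exact dvd_rfl

end Involutions

namespace FusionSystem

section

variable {P : Type*} [Group P] [Finite P]

theorem classification_of_card_dvd_three (hP : IsPGroup 2 P)
    (hn : ∀ F : FusionSystem P, F.IsSaturated 2 → ∀ Q, ¬ F.IsEssential 2 Q)
    (hK : ∀ K : Subgroup (MulAut P), Odd (Nat.card K) → Nat.card K ∣ 3)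
    {γ : MulAut P} (hγ : orderOf γ = 3) :
    (∀ F : FusionSystem P, F.IsSaturated 2 → F.essentialRank 2 = 0 ∧
        (F.IsFusionSystemOf 2 P ∨
        ∃ φ : Cyc 3 →* MulAut P, Function.Injective φ ∧
          F.IsFusionSystemOf 2 (SemidirectProduct P (Cyc 3) φ))) ∧
      numSaturated 2 P = 2 := by
  have h := classification_of_odd_automorphisms hP hn {1, 3} (fun m => if m = 3 then γ else 1)
    (by simp [hγ]; decide) fun K hK1 => ?_
  · refine ⟨fun F hF => ⟨(h.1 F hF).1, (h.1 F hF).2.imp_right ?_⟩, h.2⟩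
    rintro ⟨m, hm, hm1, φ, hφ⟩
    have hm3 : m = 3 := by simpa [hm1] using hm
    subst hm3
    exact ⟨φ, hφ⟩
  · rcases (Nat.dvd_prime Nat.prime_three).1 (hK K hK1) with h1 | h3
    · refine ⟨1, by simp, 1, fun κ => ?_⟩
      rw [Subgroup.card_eq_one.1 h1]
      simp
    · refine ⟨3, by simp, ?_⟩
      have : Fact (Nat.Prime 3) := ⟨Nat.prime_three⟩
      have hC : Nat.card (zpowers γ) = 3 := by rw [Nat.card_zpowers, hγ]
      obtain ⟨m, -, hm⟩ := exists_conj_mem_iff (p := 3) (K := K) (C := zpowers γ) (M := ⊤)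
        (IsPGroup.of_card (n := 1) (by simpa using h3))
        (IsPGroup.of_card (n := 1) (by simpa using hC)) le_top le_top (by rw [h3, hC])
        fun Y _ hY => by
          obtain ⟨n, hn⟩ := IsPGroup.iff_card.1 hY
          rw [hC]
          refine Nat.le_of_dvd (by norm_num) (hK Y ?_)
          rw [hn]
          exact Odd.pow (by decide)
      exact ⟨m, by simpa using hm⟩

theorem card_sq_eq_one_le {C : Type*} [Group C] [Finite C] [IsCyclic C] :
    Nat.card {x : C × C | x ^ 2 = 1} ≤ 4 := by
  classical
  have := Fintype.ofFinite C
  have h1 : Nat.card {x : C | x ^ 2 = 1} ≤ 2 := by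
    have h := IsCyclic.card_pow_eq_one_le (α := C) two_pos
    rwa [← Set.ncard_coe_finset, Finset.coe_filter_univ] at h
  have h2 : {x : C × C | x ^ 2 = 1} = {x : C | x ^ 2 = 1} ×ˢ {x : C | x ^ 2 = 1} := by
    ext ⟨a, b⟩
    simp [Prod.ext_iff]
  rw [h2, Nat.card_congr (Equiv.Set.prod _ _), Nat.card_prod]
  exact Nat.mul_le_mul h1 h1

/-- The automorphism `(u, v) ↦ (v⁻¹, u v⁻¹)` of `C × C`. -/
def rotation (C : Type*) [CommGroup C] : MulAut (C × C) where
  toFun x := (x.2⁻¹, x.1 * x.2⁻¹)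
  invFun x := (x.1⁻¹ * x.2, x.1⁻¹)
  left_inv x := by ext <;> simp
  right_inv x := by ext <;> simp
  map_mul' x y := by
    refine Prod.ext (mul_inv x.2 y.2) ?_
    simp only [Prod.fst_mul, Prod.snd_mul, mul_inv]
    exact mul_mul_mul_comm _ _ _ _

theorem orderOf_rotation (C : Type*) [CommGroup C] [Nontrivial C] : orderOf (rotation C) = 3 := by
  have : Fact (Nat.Prime 3) := ⟨Nat.prime_three⟩
  refine orderOf_eq_prime (MulEquiv.ext fun x => ?_) fun h => ?_
  · simp only [pow_succ, pow_zero, one_mul, MulAut.mul_apply, MulAut.one_apply]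
    simp [rotation]
  · obtain ⟨u, hu⟩ := exists_ne (1 : C)
    have h1 := congrArg (fun f : MulAut (C × C) => (f (u, 1)).1) h
    simp only [MulAut.one_apply] at h1
    simp only [rotation, MulEquiv.coe_mk, Equiv.coe_fn_mk, inv_one] at h1
    exact hu h1.symm

/-- The classification of the saturated fusion systems on a homocyclic `2`-group of rank two. -/
theorem classification_homocyclic {n : ℕ} (hn : 1 ≤ n) (e : P ≃* Cyc (2 ^ n) × Cyc (2 ^ n)) :
    (∀ F : FusionSystem P, F.IsSaturated 2 → F.essentialRank 2 = 0 ∧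
        (F.IsFusionSystemOf 2 P ∨
        ∃ φ : Cyc 3 →* MulAut P, Function.Injective φ ∧
          F.IsFusionSystemOf 2 (SemidirectProduct P (Cyc 3) φ))) ∧
      numSaturated 2 P = 2 := by
  have hone : 1 < 2 ^ n := Nat.one_lt_two_pow (by omega)
  have : Fact (1 < 2 ^ n) := ⟨hone⟩
  have : NeZero (2 ^ n) := ⟨by positivity⟩
  have : Finite (Cyc (2 ^ n)) := inferInstanceAs (Finite (ZMod (2 ^ n)))
  have : Nontrivial (Cyc (2 ^ n)) := inferInstanceAs (Nontrivial (ZMod (2 ^ n)))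
  have : Nontrivial P := e.toEquiv.nontrivial
  have hcomm : ∀ x y : P, x * y = y * x := fun x y => e.injective (by
    rw [map_mul, map_mul, mul_comm])
  have hP : IsPGroup 2 P := IsPGroup.of_card (n := n + n) (by
    rw [Nat.card_congr e.toEquiv, Nat.card_prod, Cyc, Nat.card_congr Multiplicative.toAdd,
      Nat.card_zmod, pow_add])
  have hcard : Nat.card {x : P | x ^ 2 = 1} ≤ 4 := by
    refine le_trans (le_of_eq ?_) (card_sq_eq_one_le (C := Cyc (2 ^ n)))
    refine Nat.card_congr (e.toEquiv.subtypeEquiv fun x => ?_)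
    change x ^ 2 = 1 ↔ e x ^ 2 = 1
    rw [← map_pow, map_eq_one_iff e e.injective]
  refine classification_of_card_dvd_three hP (fun F hF Q => ?_)
    (fun K hK => card_dvd_three_of_odd hP hcomm hcard hK)
    (γ := MulAut.congr e.symm (rotation (Cyc (2 ^ n)))) ?_
  · refine hF.not_isEssential_of_central hP (fun x y _ => hcomm x y) fun x y => ?_
    rw [hcomm x y, mul_inv_cancel_right, mul_inv_cancel, one_pow]
  · rw [MulEquiv.orderOf_eq, orderOf_rotation]

end

end FusionSystem

/-! ### The Sylow 2-subgroup of the unitary group -/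

section Herm

variable (K : Type*) [Field K]

/-- The group of the pairs `(a, b)` over the field `K` of order `16` with `b + b⁴ = a⁵`, which stand
for the upper unitriangular matrices with rows `(1, a, b)`, `(0, 1, a⁴)`, `(0, 0, 1)`. -/
@[ext]
structure Herm where
  a : K
  b : K
  eq : b + b ^ 4 = a ^ 5

variable {K} [CharP K 2] [hK : Fact (Nat.card K = 16)]

namespace Herm

omit hK in
theorem add_pow_four (x y : K) : (x + y) ^ 4 = x ^ 4 + y ^ 4 := by
  have := add_pow_char_pow (p := 2) (n := 2) x y
  simpa using this

omit hK in
theorem add_self (x : K) : x + x = 0 := CharTwo.add_self_eq_zero x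

omit [CharP K 2] in
theorem finite_field : Finite K := Nat.finite_of_card_ne_zero (by rw [hK.out]; norm_num)

omit [CharP K 2] in
theorem pow_sixteen (x : K) : x ^ 16 = x := by
  have := finite_field (K := K)
  have := Fintype.ofFinite K
  rw [← hK.out, Nat.card_eq_fintype_card]
  exact FiniteField.pow_card x

instance : Finite (Herm K) :=
  have := finite_field (K := K)
  Finite.of_injective (fun h : Herm K => (h.a, h.b)) fun _ _ h =>
    Herm.ext (congrArg Prod.fst h) (congrArg Prod.snd h)

instance : Mul (Herm K) where
  mul x y := ⟨x.a + y.a, y.b + x.a * y.a ^ 4 + x.b, by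
    rw [add_pow_four, add_pow_four, mul_pow, ← pow_mul, pow_sixteen]
    have h : (x.a + y.a) ^ 5 = (x.a + y.a) * (x.a ^ 4 + y.a ^ 4) := by
      rw [← add_pow_four, ← pow_succ']
    rw [h]
    linear_combination x.eq + y.eq⟩

instance : One (Herm K) where
  one := ⟨0, 0, by simp⟩

instance : Inv (Herm K) where
  inv x := ⟨x.a, x.b ^ 4, by rw [← pow_mul, pow_sixteen, add_comm, x.eq]⟩

@[simp] theorem mul_a (x y : Herm K) : (x * y).a = x.a + y.a := rfl
@[simp] theorem mul_b (x y : Herm K) : (x * y).b = y.b + x.a * y.a ^ 4 + x.b := rfl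
@[simp] theorem one_a : (1 : Herm K).a = 0 := rfl
@[simp] theorem one_b : (1 : Herm K).b = 0 := rfl
@[simp] theorem inv_a (x : Herm K) : (x⁻¹).a = x.a := rfl
@[simp] theorem inv_b (x : Herm K) : (x⁻¹).b = x.b ^ 4 := rfl

instance : Group (Herm K) := Group.ofLeftAxioms
  (fun _ _ _ => by
    ext
    · simp [add_assoc]
    · simp only [mul_b, mul_a, add_pow_four]; ring)
  (fun x => by ext <;> simp)
  (fun x => by
    ext
    · simp [add_self]
    · simp only [mul_b, inv_a, inv_b, one_b]
      linear_combination x.eq + add_self (x.a ^ 5))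

theorem sq_a (x : Herm K) : (x ^ 2).a = 0 := by rw [pow_two, mul_a, add_self]

theorem sq_b (x : Herm K) : (x ^ 2).b = x.a ^ 5 := by
  rw [pow_two, mul_b]
  linear_combination add_self x.b

theorem sq_eq_one_iff {x : Herm K} : x ^ 2 = 1 ↔ x.a = 0 := by
  rw [Herm.ext_iff, sq_a, sq_b]
  simp

theorem mul_comm_of_a_eq_zero {x : Herm K} (y : Herm K) (hx : x.a = 0) : x * y = y * x := by
  ext
  · simp [hx]
  · simp [hx, add_comm]

theorem commutator_b (x y : Herm K) :
    (x * y * (y * x)⁻¹).b = x.a * y.a ^ 4 + y.a * x.a ^ 4 := by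
  have h1 : (y * x).b + (y * x).b ^ 4 = (y * x).a ^ 5 := (y * x).eq
  have h2 : (x.a + y.a) ^ 5 = (x.a + y.a) * (y.a + x.a) ^ 4 := by ring
  simp only [mul_b, inv_a, inv_b, mul_a] at h1 ⊢
  linear_combination h1 + h2 - add_self (y.a * x.a ^ 4)  + add_self ((y.a + x.a) ^ 5)

theorem isPGroup : IsPGroup 2 (Herm K) := isPGroup_iff_pow_pow_eq_one.2 fun x =>
  ⟨2, by rw [show (2 : ℕ) ^ 2 = 2 * 2 from rfl, pow_mul, sq_eq_one_iff, sq_a]⟩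

theorem card_sq_eq_one_le : Nat.card {x : Herm K | x ^ 2 = 1} ≤ 4 := by
  classical
  have := finite_field (K := K)
  have h1 : Nat.card {x : Herm K | x ^ 2 = 1} ≤
      Nat.card ((Polynomial.X ^ 4 - Polynomial.X : Polynomial K).roots.toFinset : Set K) := by
    refine Nat.card_le_card_of_injective (fun x => ⟨x.1.b, ?_⟩) fun x y h => Subtype.ext ?_
    · rw [Finset.mem_coe, Multiset.mem_toFinset, Polynomial.mem_roots
        (FiniteField.X_pow_card_sub_X_ne_zero K (by norm_num))]
      have h := x.1.eq
      rw [sq_eq_one_iff.1 x.2] at h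
      simp only [Polynomial.IsRoot, Polynomial.eval_sub, Polynomial.eval_pow, Polynomial.eval_X]
      linear_combination h - add_self x.1.b
    · exact Herm.ext ((sq_eq_one_iff.1 x.2).trans (sq_eq_one_iff.1 y.2).symm)
        (congrArg Subtype.val h)
  refine h1.trans ?_
  rw [Nat.card_coe_set_eq, Set.ncard_coe_finset]
  refine (Multiset.toFinset_card_le _).trans ((Polynomial.card_roots' _).trans ?_)
  rw [FiniteField.X_pow_card_sub_X_natDegree_eq K (by norm_num)]

theorem exists_mul_of_a_eq {x y : Herm K} (h : x.a = y.a) : ∃ z : Herm K, z.a = 0 ∧ x = z * y :=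
  ⟨x * y⁻¹, by rw [mul_a, inv_a, h, add_self], by group⟩

variable {α : MulAut (Herm K)}

/-- If an automorphism of odd order fixes an element `(a, b)` with `a ≠ 0`, it fixes the centre,
hence the commutators with that element and all squares. So for each `(c, d)` that it maps to
`(c', d')`, the element `c' / a` is a root of the polynomial over the field of order `4` with roots
`c / a` and its conjugate; thus the square of the automorphism is trivial modulo the centre. -/
theorem eq_one_of_apply_eq (hα : Odd (orderOf α)) {u : Herm K} (hu : u.a ≠ 0) (hαu : α u = u) :
    α = 1 := by
  have hz : ∀ z : Herm K, z.a = 0 → α z = z := fun z hz => by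
    refine MulAut.apply_eq_of_fixes_involution hα
      (fun x y hx _ => mul_comm_of_a_eq_zero y (sq_eq_one_iff.1 hx)) card_sq_eq_one_le
      (y := u ^ 2) ?_ ?_ ?_ (sq_eq_one_iff.2 hz)
    · rw [sq_eq_one_iff, sq_a]
    · rwa [Ne, sq_eq_one_iff]
    · rw [map_pow, hαu]
  have hfix : ∀ h : Herm K, (α h).a = h.a → α h = h := fun h hh => by
    obtain ⟨z, hz0, hz1⟩ := exists_mul_of_a_eq hh
    exact MulAut.apply_eq_of_mul hα (hz z hz0) (j := 1)
      (by rw [pow_one, sq_eq_one_iff, hz0]) hz1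
  have key : ∀ h : Herm K, (α h).a = h.a ∨ (α h).a * u.a ^ 3 = h.a ^ 4 := fun h => by
    have h1 : (α h).a ^ 5 = h.a ^ 5 := by
      rw [← sq_b, ← sq_b, ← map_pow, hz _ (sq_a h)]
    have h2 : (α h).a * u.a ^ 4 + u.a * (α h).a ^ 4 = h.a * u.a ^ 4 + u.a * h.a ^ 4 := by
      rw [← commutator_b, ← commutator_b]
      nth_rewrite 1 2 [← hαu]
      rw [← map_mul, ← map_mul, ← map_inv, ← map_mul, hz _ _]
      simp only [mul_a, inv_a]
      rw [add_comm u.a, add_self]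
    have h3 : ((α h).a - h.a) * ((α h).a * u.a ^ 3 - h.a ^ 4) * u.a = 0 := by
      linear_combination (-u.a) * h1 + (α h).a * h2
    rcases mul_eq_zero.1 ((mul_eq_zero.1 h3).resolve_right hu) with h | h
    · exact Or.inl (sub_eq_zero.1 h)
    · exact Or.inr (sub_eq_zero.1 h)
  refine MulEquiv.ext fun h => ?_
  rcases key h with h1 | h1
  · exact hfix h h1
  rcases key (α h) with h2 | h2
  · exact α.injective (hfix _ h2)
  · have h15 : u.a ^ 15 = 1 := mul_right_cancel₀ hu (by rw [one_mul, ← pow_succ, pow_sixteen])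
    have h3 : (α (α h)).a = h.a := by
      have h4 : ((α h).a * u.a ^ 3) ^ 4 = h.a := by rw [h1, ← pow_mul, pow_sixteen]
      rw [mul_pow, ← h2] at h4
      linear_combination h4 - (α (α h)).a * h15
    obtain ⟨z, hz0, hz1⟩ := exists_mul_of_a_eq h3
    refine MulAut.apply_eq_of_pow_two_pow hα (j := 2) ?_
    change α (α (α (α h))) = h
    rw [hz1, map_mul, map_mul, hz _ hz0, hz _ hz0, hz1, ← mul_assoc, ← pow_two,
      sq_eq_one_iff.2 hz0, one_mul]

variable (K) in
theorem exists_add_pow_four_eq_one : ∃ ω : K, ω + ω ^ 4 = 1 := by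
  have := finite_field (K := K)
  obtain ⟨t, ht⟩ : ∃ t : K, t + t ^ 4 ≠ 0 := by
    by_contra! h
    classical
    have := Fintype.ofFinite K
    have h1 : (Finset.univ : Finset K) ⊆
        (Polynomial.X ^ 4 - Polynomial.X : Polynomial K).roots.toFinset := fun x _ => by
      rw [Multiset.mem_toFinset, Polynomial.mem_roots
        (FiniteField.X_pow_card_sub_X_ne_zero K (by norm_num))]
      simp only [Polynomial.IsRoot, Polynomial.eval_sub, Polynomial.eval_pow, Polynomial.eval_X]
      linear_combination h x - add_self x
    have h2 := (Finset.card_le_card h1).trans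
      ((Multiset.toFinset_card_le _).trans (Polynomial.card_roots' _))
    rw [FiniteField.X_pow_card_sub_X_natDegree_eq K (by norm_num), Finset.card_univ,
      ← Nat.card_eq_fintype_card, hK.out] at h2
    omega
  refine ⟨t / (t + t ^ 4), ?_⟩
  have h4 : (t + t ^ 4) ^ 4 = t + t ^ 4 := by
    rw [add_pow_four, ← pow_mul, pow_sixteen, add_comm]
  rw [div_pow, h4, ← add_div, div_self ht]

theorem card_dvd_fifteen {L : Subgroup (MulAut (Herm K))} (hL : Odd (Nat.card L)) :
    Nat.card L ∣ 15 := by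
  have := finite_field (K := K)
  have h1 : Nat.card L ∣ Nat.card {x : Herm K | x.a ≠ 0} := by
    refine card_dvd_of_free (fun α _ x hx => ?_) fun α hα x hx h =>
      eq_one_of_apply_eq (Odd.of_dvd_nat hL (Subgroup.orderOf_dvd_natCard L hα)) hx h
    change (α x).a ≠ 0
    rw [Ne, ← sq_eq_one_iff, ← map_pow, map_eq_one_iff α α.injective, sq_eq_one_iff]
    exact hx
  obtain ⟨ω, hω⟩ := exists_add_pow_four_eq_one K
  let T : AddSubgroup K :=
    { carrier := {b | b + b ^ 4 = 0}
      zero_mem' := by simp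
      add_mem' := fun {a b} ha hb => by
        simp only [Set.mem_ofPred_eq] at ha hb ⊢
        rw [add_pow_four]
        linear_combination ha + hb
      neg_mem' := fun {a} ha => by
        simp only [Set.mem_ofPred_eq] at ha ⊢
        rw [CharTwo.neg_eq, ha] }
  have h20 : ∀ a : K, (a ^ 5) ^ 4 = a ^ 5 := fun a => by
    linear_combination a ^ 4 * pow_sixteen a
  let e : {x : Herm K | x.a ≠ 0} ≃ {a : K // a ≠ 0} × T :=
    { toFun := fun x => (⟨x.1.a, x.2⟩, ⟨x.1.b + x.1.a ^ 5 * ω, by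
        change _ + _ ^ 4 = (0 : K)
        rw [add_pow_four, mul_pow, h20]
        linear_combination x.1.eq + x.1.a ^ 5 * hω + add_self (x.1.a ^ 5)⟩)
      invFun := fun y => ⟨⟨y.1, y.2 + y.1.1 ^ 5 * ω, by
        have h := y.2.2
        change y.2.1 + y.2.1 ^ 4 = 0 at h
        rw [add_pow_four, mul_pow, h20]
        linear_combination h + y.1.1 ^ 5 * hω⟩, y.1.2⟩
      left_inv := fun x => Subtype.ext (Herm.ext rfl (by
        change x.1.b + x.1.a ^ 5 * ω + x.1.a ^ 5 * ω = x.1.b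
        linear_combination add_self (x.1.a ^ 5 * ω)))
      right_inv := fun y => Prod.ext rfl (Subtype.ext (by
        change y.2.1 + y.1.1 ^ 5 * ω + y.1.1 ^ 5 * ω = y.2.1
        linear_combination add_self (y.1.1 ^ 5 * ω))) }
  have hu : Nat.card {a : K // a ≠ 0} = 15 := by
    rw [← Nat.card_congr unitsEquivNeZero, Nat.card_units, hK.out]
  rw [Nat.card_congr e, Nat.card_prod, hu] at h1
  refine Nat.Coprime.dvd_of_dvd_mul_right ?_ h1
  have h2 : Nat.card T ∣ 2 ^ 4 := by
    have := T.card_addSubgroup_dvd_card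
    rwa [hK.out] at this
  exact Nat.Coprime.coprime_dvd_right h2 (Nat.Coprime.pow_right 4 (Nat.coprime_two_right.2 hL))

/-- The automorphism `(a, b) ↦ (c a, c⁵ b)` for a nonzero `c`. -/
def scale : Kˣ →* MulAut (Herm K) where
  toFun c :=
    { toFun := fun x => ⟨c * x.a, c ^ 5 * x.b, by
        linear_combination (c : K) ^ 5 * x.eq + (c : K) ^ 4 * x.b ^ 4 * pow_sixteen (c : K)⟩
      invFun := fun x => ⟨(c⁻¹ : Kˣ) * x.a, (c⁻¹ : Kˣ) ^ 5 * x.b, by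
        linear_combination ((c⁻¹ : Kˣ) : K) ^ 5 * x.eq +
          ((c⁻¹ : Kˣ) : K) ^ 4 * x.b ^ 4 * pow_sixteen ((c⁻¹ : Kˣ) : K)⟩
      left_inv := fun x => by ext <;> simp
      right_inv := fun x => by ext <;> simp
      map_mul' := fun x y => by
        ext
        · simp [mul_add]
        · simp only [mul_b]; ring }
  map_one' := by
    ext x : 1
    ext <;> simp
  map_mul' c d := by
    ext x : 1
    ext <;> simp [mul_assoc, mul_pow]

theorem scale_injective : Function.Injective (scale : Kˣ →* MulAut (Herm K)) := by
  intro c d h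
  obtain ⟨ω, hω⟩ := exists_add_pow_four_eq_one K
  have h1 := congrArg (fun f : MulAut (Herm K) => (f ⟨1, ω, by simpa using hω⟩).a) h
  exact Units.ext (by simpa [scale] using h1)

variable (K) in
theorem exists_orderOf_eq_fifteen : ∃ γ : MulAut (Herm K), orderOf γ = 15 := by
  have := finite_field (K := K)
  obtain ⟨g, hg⟩ := IsCyclic.exists_generator (α := Kˣ)
  refine ⟨scale g, ?_⟩
  rw [orderOf_injective _ scale_injective, orderOf_eq_card_of_forall_mem_zpowers hg, Nat.card_units,
    hK.out]

end Herm

end Herm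

theorem card_le_of_dvd_fifteen {G : Type*} [Group G] [Finite G]
    (h : ∀ K : Subgroup G, Odd (Nat.card K) → Nat.card K ∣ 15) {p : ℕ} (hp : p = 3 ∨ p = 5)
    {Y : Subgroup G} (hY : IsPGroup p Y) : Nat.card Y ≤ p := by
  have hpp : Fact p.Prime := ⟨by rcases hp with rfl | rfl <;> norm_num⟩
  obtain ⟨n, hn⟩ := IsPGroup.iff_card.1 hY
  have h1 : p ^ n ∣ 15 := hn ▸ h Y (by
    rw [hn]; exact Odd.pow (by rcases hp with rfl | rfl <;> decide))
  have h2 : n ≤ 1 := by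
    by_contra! h2
    have h3 : p ^ 2 ∣ 15 := (pow_dvd_pow p h2).trans h1
    rcases hp with rfl | rfl <;> revert h3 <;> decide
  rw [hn]
  exact (Nat.pow_le_pow_right hpp.out.pos h2).trans (pow_one p).le

/-- If the order of each subgroup of odd order divides `15`, then each of these subgroups is
conjugate to a subgroup of a given cyclic group of order `15`. -/
theorem exists_conj_zpowers {G : Type*} [Group G] [Finite G]
    (h : ∀ K : Subgroup G, Odd (Nat.card K) → Nat.card K ∣ 15) {γ : G} (hγ : orderOf γ = 15)
    {K : Subgroup G} (hK : Odd (Nat.card K)) : ∃ m ∈ ({1, 3, 5, 15} : Finset ℕ), ∃ g : G,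
      ∀ k, k ∈ K ↔ g * k * g⁻¹ ∈ zpowers (γ ^ (15 / m)) := by
  have : Fact (Nat.Prime 3) := ⟨Nat.prime_three⟩
  have : Fact (Nat.Prime 5) := ⟨Nat.prime_five⟩
  have h3 : Nat.card (zpowers (γ ^ 5)) = 3 := by
    rw [Nat.card_zpowers, orderOf_pow_of_dvd (by norm_num) (by rw [hγ]; norm_num), hγ]
  have h5 : Nat.card (zpowers (γ ^ 3)) = 5 := by
    rw [Nat.card_zpowers, orderOf_pow_of_dvd (by norm_num) (by rw [hγ]; norm_num), hγ]
  have key : ∀ {p : ℕ} [Fact p.Prime] {L C M : Subgroup G}, p = 3 ∨ p = 5 → Nat.card L = p →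
      Nat.card C = p → L ≤ M → C ≤ M → ∃ m ∈ M, ∀ k, k ∈ L ↔ m * k * m⁻¹ ∈ C :=
    fun {p _ L C M} hp hL hC hLM hCM => exists_conj_mem_iff (p := p)
      (IsPGroup.of_card (n := 1) (by simpa using hL)) (IsPGroup.of_card (n := 1) (by simpa using hC))
      hLM hCM (hL.trans hC.symm) fun Y _ hY => hC.symm ▸ card_le_of_dvd_fifteen h hp hY
  have hcases : Nat.card K ∈ Nat.divisors 15 := Nat.mem_divisors.2 ⟨h K hK, by norm_num⟩
  rw [show Nat.divisors 15 = {1, 3, 5, 15} by decide] at hcases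
  simp only [Finset.mem_insert, Finset.mem_singleton] at hcases
  rcases hcases with c | c | c | c
  · refine ⟨1, by simp, 1, fun k => ?_⟩
    rw [Subgroup.card_eq_one.1 c, Nat.div_one, ← hγ, pow_orderOf_eq_one]
    simp
  · obtain ⟨g, -, hg⟩ := key (Or.inl rfl) c h3 le_top le_top
    exact ⟨3, by simp, g, hg⟩
  · obtain ⟨g, -, hg⟩ := key (Or.inr rfl) c h5 le_top le_top
    exact ⟨5, by simp, g, hg⟩
  · -- the subgroup `⟨b⟩` of order `5` is normal in `K`
    obtain ⟨b, hb⟩ := exists_prime_orderOf_dvd_card' (G := K) 5 (by rw [c]; norm_num)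
    obtain ⟨a, ha⟩ := exists_prime_orderOf_dvd_card' (G := K) 3 (by rw [c]; norm_num)
    have hn : (zpowers b).Normal := by
      refine Subgroup.normal_of_index_eq_minFac_card ?_
      have := (zpowers b).card_mul_index
      rw [Nat.card_zpowers, hb, c] at this
      rw [c]
      norm_num
      omega
    have hb' : Nat.card (zpowers (b : G)) = 5 := by
      rw [Nat.card_zpowers, Subgroup.orderOf_coe, hb]
    have ha' : Nat.card (zpowers (a : G)) = 3 := by
      rw [Nat.card_zpowers, Subgroup.orderOf_coe, ha]
    obtain ⟨g, -, hg⟩ := key (Or.inr rfl) hb' h5 le_top le_top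
    let M := N(zpowers (γ ^ 3))
    have hKM : ∀ k ∈ K, g * k * g⁻¹ ∈ M := fun k hk => mem_normalizer_of_conj_mem fun y hy => by
      have h1 : g⁻¹ * y * g ∈ zpowers (b : G) := by
        rw [hg]
        convert hy using 1
        group
      obtain ⟨i, hi⟩ := h1
      simp only at hi
      obtain ⟨j, hj⟩ := hn.conj_mem (b ^ i) ⟨i, rfl⟩ ⟨k, hk⟩
      have h2 : k * (g⁻¹ * y * g) * k⁻¹ ∈ zpowers (b : G) := by
        refine ⟨j, ?_⟩
        rw [← hi]
        exact congrArg Subtype.val hj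
      rw [hg] at h2
      convert h2 using 1
      group
    have ha2 : zpowers (g * a * g⁻¹) ≤ M := by
      rw [zpowers_le]
      exact hKM _ a.2
    have ha3 : Nat.card (zpowers (g * a * g⁻¹)) = 3 := by
      rw [← ha', Nat.card_zpowers, Nat.card_zpowers]
      exact MulEquiv.orderOf_eq (MulAut.conj g) (a : G)
    have hγM : zpowers (γ ^ 5) ≤ M := by
      rw [zpowers_le]
      refine mem_normalizer_of_conj_mem ?_
      rintro _ ⟨i, rfl⟩
      refine ⟨i, ?_⟩
      group
    obtain ⟨l, hl, hl'⟩ := key (Or.inl rfl) ha3 h3 ha2 hγM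
    -- the conjugate of `K` contains `γ ^ 3` and `γ ^ 5`, hence `γ`
    have hle : zpowers γ ≤ K.map (MulAut.conj (l * g)).toMonoidHom := by
      have m3 : γ ^ 3 ∈ K.map (MulAut.conj (l * g)).toMonoidHom := by
        have e : γ ^ 3 = l * (l⁻¹ * γ ^ 3 * l) * l⁻¹ := by group
        have h1 : l⁻¹ * γ ^ 3 * l ∈ zpowers (γ ^ 3) := by
          rw [← Subgroup.mem_normalizer_iff''.1 hl]
          exact mem_zpowers _
        have h2 : g⁻¹ * (l⁻¹ * γ ^ 3 * l) * g ∈ zpowers (b : G) := by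
          rw [hg]
          convert h1 using 1
          group
        refine ⟨_, (zpowers_le.2 b.2) h2, ?_⟩
        simp only [MulEquiv.coe_toMonoidHom, MulAut.conj_apply]
        group
      have m5 : γ ^ 5 ∈ K.map (MulAut.conj (l * g)).toMonoidHom := by
        have h1 : l⁻¹ * γ ^ 5 * l ∈ zpowers (g * a * g⁻¹) := by
          rw [hl']
          convert mem_zpowers (γ ^ 5) using 1
          group
        obtain ⟨i, hi⟩ := h1
        simp only [conj_zpow] at hi
        refine ⟨a ^ i, zpow_mem a.2 i, ?_⟩
        simp only [MulEquiv.coe_toMonoidHom, MulAut.conj_apply]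
        calc l * g * (a : G) ^ i * (l * g)⁻¹ = l * (g * (a : G) ^ i * g⁻¹) * l⁻¹ := by group
          _ = _ := by rw [hi]; group
      rw [zpowers_le]
      have h1 : γ = (γ ^ 5) ^ 2 * ((γ ^ 3) ^ 3)⁻¹ := by group
      rw [h1]
      exact mul_mem (pow_mem m5 2) (inv_mem (pow_mem m3 3))
    have heq := Subgroup.eq_of_le_of_card_ge hle (by
      rw [card_map_of_injective (MulAut.conj (l * g)).injective, c, Nat.card_zpowers, hγ])
    refine ⟨15, by simp, l * g, fun k => ?_⟩
    rw [show 15 / 15 = 1 from rfl, pow_one, heq]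
    exact (Subgroup.mem_map_iff_mem (MulAut.conj (l * g)).injective).symm

namespace FusionSystem

variable {K : Type*} [Field K] [CharP K 2] [hK : Fact (Nat.card K = 16)]

/-- The classification of the saturated fusion systems on the Sylow `2`-subgroup of the unitary
group. -/
theorem classification_herm {P : Type*} [Group P] [Finite P] (e : P ≃* Herm K) :
    (∀ F : FusionSystem P, F.IsSaturated 2 → F.essentialRank 2 = 0 ∧
        (F.IsFusionSystemOf 2 P ∨
        ∃ m ∈ ({3, 5, 15} : Set ℕ), ∃ φ : Cyc m →* MulAut P, Function.Injective φ ∧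
          F.IsFusionSystemOf 2 (SemidirectProduct P (Cyc m) φ))) ∧
      numSaturated 2 P = 4 := by
  obtain ⟨γ, hγ⟩ := Herm.exists_orderOf_eq_fifteen K
  have hc : ∀ x y : P, e x * e y = e y * e x → x * y = y * x := fun x y h =>
    e.injective (by rw [map_mul, map_mul, h])
  have h := classification_of_odd_automorphisms (P := P)
    (Herm.isPGroup.of_injective e.toMonoidHom e.injective) (fun F hF Q => ?_) {1, 3, 5, 15}
    (fun m => MulAut.congr e.symm γ ^ (15 / m)) ?_ fun L hL => ?_
  · refine ⟨fun F hF => ⟨(h.1 F hF).1, (h.1 F hF).2.imp_right ?_⟩, h.2⟩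
    rintro ⟨m, hm, hm1, φ, hφ⟩
    refine ⟨m, ?_, φ, hφ⟩
    simpa [hm1] using hm
  · refine hF.not_isEssential_of_central
      (Herm.isPGroup.of_injective e.toMonoidHom e.injective) (fun x y hx => hc x y ?_) fun x y => ?_
    · exact Herm.mul_comm_of_a_eq_zero _ (Herm.sq_eq_one_iff.1 (by rw [← map_pow, hx, map_one]))
    · refine e.injective ?_
      rw [map_pow, map_one, Herm.sq_eq_one_iff]
      simp only [map_mul, map_inv, Herm.mul_a, Herm.inv_a]
      linear_combination Herm.add_self (e x).a + Herm.add_self (e y).a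
  · intro m hm
    have hγ' : orderOf (MulAut.congr e.symm γ) = 15 := by rw [MulEquiv.orderOf_eq, hγ]
    simp only [Finset.mem_insert, Finset.mem_singleton] at hm
    rcases hm with rfl | rfl | rfl | rfl
    · rw [Nat.div_one, ← hγ', pow_orderOf_eq_one, orderOf_one]
      decide
    all_goals
      rw [orderOf_pow_of_dvd (by norm_num) (by rw [hγ']; norm_num), hγ']
      decide
  · refine exists_conj_zpowers (fun L hL => ?_) (by rw [MulEquiv.orderOf_eq, hγ]) hL
    have h1 : Nat.card (L.map (MulAut.congr e).toMonoidHom) = Nat.card L :=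
      card_map_of_injective (MulAut.congr e).injective
    rw [← h1] at hL ⊢
    exact Herm.card_dvd_fifteen hL

end FusionSystem

namespace Herm

variable {K : Type*} [Field K] [CharP K 2] [hK : Fact (Nat.card K = 16)]
  {σ : K →+* K} (hσ : ∀ x, σ x = x ^ 4)

/-- The upper unitriangular matrices in `SU_3`. -/
def toUnitary : Herm K →* specialUnitary σ where
  toFun x := ⟨⟨!![1, x.a, x.b; 0, 1, x.a ^ 4; 0, 0, 1], by simp [Matrix.det_fin_three]⟩, by
    change (_ * _ * _ : Matrix (Fin 3) (Fin 3) K) = _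
    have h16 := pow_sixteen x.a
    have h1 := x.eq
    ext i j
    fin_cases i <;> fin_cases j <;>
      simp [Matrix.mul_apply, Fin.sum_univ_three, hσ, ← pow_mul]
    · linear_combination h1 + add_self (x.a ^ 5)
    · linear_combination h16 + add_self x.a
    · exact add_self _⟩
  map_one' := by
    refine Subtype.ext (Subtype.ext ?_)
    ext i j
    fin_cases i <;> fin_cases j <;> simp
  map_mul' x y := by
    refine Subtype.ext (Subtype.ext ?_)
    change _ = (_ * _ : Matrix (Fin 3) (Fin 3) K)
    ext i j
    fin_cases i <;> fin_cases j <;>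
      simp [Matrix.mul_apply, Fin.sum_univ_three, add_pow_four] <;> ring

theorem toUnitary_apply (x : Herm K) : ((toUnitary hσ x).1 : Matrix (Fin 3) (Fin 3) K) =
    !![1, x.a, x.b; 0, 1, x.a ^ 4; 0, 0, 1] := rfl

/-- The matrix `antidiag(1, 1, 1)` in `SU_3`. -/
def flip : specialUnitary σ :=
  ⟨⟨!![0, 0, 1; 0, 1, 0; 1, 0, 0], by simp [Matrix.det_fin_three, CharTwo.neg_eq]⟩, by
    change (_ * _ * _ : Matrix (Fin 3) (Fin 3) K) = _
    ext i j
    fin_cases i <;> fin_cases j <;> simp [Matrix.mul_apply, Fin.sum_univ_three]⟩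

theorem toUnitary_mk_injective : Function.Injective
    ((QuotientGroup.mk' (Subgroup.center (specialUnitary σ))).comp (toUnitary hσ)) := by
  rw [injective_iff_map_eq_one]
  intro x hx
  have h1 := Subgroup.mem_center_iff.1 ((QuotientGroup.eq_one_iff _).1 hx) flip
  have h2 : (!![0, 0, 1; 0, 1, 0; 1, 0, 0] : Matrix (Fin 3) (Fin 3) K) *
      !![1, x.a, x.b; 0, 1, x.a ^ 4; 0, 0, 1] =
        !![1, x.a, x.b; 0, 1, x.a ^ 4; 0, 0, 1] * !![0, 0, 1; 0, 1, 0; 1, 0, 0] :=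
    congrArg (fun g : specialUnitary σ => (g.1 : Matrix (Fin 3) (Fin 3) K)) h1
  have ha := congrFun (congrFun h2 0) 1
  have hb := congrFun (congrFun h2 0) 0
  simp [Matrix.mul_apply, Fin.sum_univ_three] at ha hb
  ext
  · exact ha.symm
  · exact hb.symm

/-- A `2`-subgroup of `SU_3` that contains the upper unitriangular matrices fixes a vector, which is
a multiple of the first standard basis vector, and consists of upper unitriangular matrices. -/
theorem mem_range_toUnitary {T : Subgroup (specialUnitary σ)} (hT : IsPGroup 2 T)
    (hle : (toUnitary hσ).range ≤ T) {g : specialUnitary σ} (hg : g ∈ T) :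
    g ∈ (toUnitary hσ).range := by
  have := finite_field (K := K)
  let act : MulAction T (Fin 3 → K) :=
    { smul := fun t v => (t.1.1 : Matrix (Fin 3) (Fin 3) K).mulVec v
      one_smul := fun v => Matrix.one_mulVec v
      mul_smul := fun s t v => by
        change (s.1.1.1 * t.1.1.1 : Matrix (Fin 3) (Fin 3) K).mulVec v =
          (s.1.1.1 : Matrix (Fin 3) (Fin 3) K).mulVec ((t.1.1.1).mulVec v)
        rw [Matrix.mulVec_mulVec] }
  obtain ⟨v, hv, hv0⟩ := hT.exists_fixed_point_of_prime_dvd_card_of_fixed_point (Fin 3 → K)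
    (by rw [Nat.card_fun, hK.out, Nat.card_fin]; norm_num) (a := 0)
    (fun t => Matrix.mulVec_zero (t.1.1 : Matrix (Fin 3) (Fin 3) K))
  replace hv : ∀ t ∈ T, (t.1 : Matrix (Fin 3) (Fin 3) K).mulVec v = v := fun t ht => hv ⟨t, ht⟩
  obtain ⟨ω, hω⟩ := exists_add_pow_four_eq_one K
  have h1 := hv _ (hle ⟨⟨1, ω, by simpa using hω⟩, rfl⟩)
  rw [toUnitary_apply] at h1
  have h10 := congrFun h1 0
  have h11 := congrFun h1 1
  simp [Matrix.mulVec, dotProduct, Fin.sum_univ_three] at h10 h11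
  have hv2 : v 2 = 0 := h11
  have hv1 : v 1 = 0 := by
    rw [hv2] at h10
    linear_combination h10
  have hv3 : v 0 ≠ 0 := fun h => hv0 (by
    ext i
    fin_cases i
    · exact h.symm
    · exact hv1.symm
    · exact hv2.symm)
  have h2 := hv g hg
  have hU : (g.1 : Matrix (Fin 3) (Fin 3) K) * !![0, 0, 1; 0, 1, 0; 1, 0, 0] *
    ((g.1 : Matrix (Fin 3) (Fin 3) K).map σ).transpose = !![0, 0, 1; 0, 1, 0; 1, 0, 0] := g.2
  have hdet : (g.1 : Matrix (Fin 3) (Fin 3) K).det = 1 := g.1.2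
  obtain ⟨A, hA⟩ : ∃ A, A = (g.1 : Matrix (Fin 3) (Fin 3) K) := ⟨_, rfl⟩
  rw [← hA] at h2 hU hdet
  have h20 := congrFun h2 0
  have h21 := congrFun h2 1
  have h22 := congrFun h2 2
  simp [Matrix.mulVec, dotProduct, Fin.sum_univ_three, hv1, hv2] at h20 h21 h22
  have e0 : A 0 0 = 1 := mul_right_cancel₀ hv3 (by rw [h20, one_mul])
  have e1 : A 1 0 = 0 := h21.resolve_right hv3
  have e2 : A 2 0 = 0 := h22.resolve_right hv3
  have ent : ∀ i j, A i 2 * A j 0 ^ 4 + A i 1 * A j 1 ^ 4 + A i 0 * A j 2 ^ 4 =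
      (!![0, 0, 1; 0, 1, 0; 1, 0, 0] : Matrix (Fin 3) (Fin 3) K) i j := fun i j => by
    rw [← hU]
    simp [Matrix.mul_apply, Fin.sum_univ_three, hσ]
  have u22 := ent 2 2
  have u02 := ent 0 2
  have u01 := ent 0 1
  have u00 := ent 0 0
  simp [e0, e1, e2] at u22 u02 u01 u00
  have e3 : A 2 1 = 0 := u22
  rw [Matrix.det_fin_three] at hdet
  simp [e0, e1, e2, e3] at hdet u02
  have e4 : A 2 2 = 1 := by
    have h16 := pow_sixteen (A 2 2)
    have h5 : (A 2 2 ^ 4) ^ 4 = 1 := by rw [u02, one_pow]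
    rw [← h16]
    linear_combination h5
  have e5 : A 1 1 = 1 := by simpa [e4] using hdet
  have e6 : A 1 2 = A 0 1 ^ 4 := by
    rw [e5] at u01
    have h16 := pow_sixteen (A 1 2)
    have h7 : A 0 1 = A 1 2 ^ 4 := by linear_combination u01 - add_self (A 1 2 ^ 4)
    rw [h7, ← pow_mul, h16]
  refine ⟨⟨A 0 1, A 0 2, by linear_combination u00 - add_self (A 0 1 ^ 5)⟩,
    Subtype.ext (Subtype.ext ?_)⟩
  rw [toUnitary_apply, ← hA]
  ext i j
  fin_cases i <;> fin_cases j <;> simp [e0, e1, e2, e3, e4, e5, e6]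

include hσ in
theorem nonempty_mulEquiv_sylow
    (S : Sylow 2 (specialUnitary σ ⧸ Subgroup.center (specialUnitary σ))) :
    Nonempty (S ≃* Herm K) := by
  have := finite_field (K := K)
  have h1 : IsPGroup 2 (toUnitary hσ).range := isPGroup.of_surjective _
    (toUnitary hσ).rangeRestrict_surjective
  let T : Sylow 2 (specialUnitary σ) :=
    { (toUnitary hσ).range with
      isPGroup' := h1
      is_maximal' := fun hQ hle => le_antisymm (fun g hg => mem_range_toUnitary hσ hQ hle hg) hle }
  let mk := QuotientGroup.mk' (Subgroup.center (specialUnitary σ))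
  have hT : ¬ 2 ∣ (mk.comp (toUnitary hσ)).range.index := fun h => by
    rw [MonoidHom.range_comp] at h
    exact T.not_dvd_index (h.trans (Subgroup.index_map_dvd _ (QuotientGroup.mk'_surjective _)))
  let T' : Sylow 2 (specialUnitary σ ⧸ Subgroup.center (specialUnitary σ)) :=
    IsPGroup.toSylow (isPGroup.of_surjective _
      (mk.comp (toUnitary hσ)).rangeRestrict_surjective) hT
  exact ⟨(S.equiv T').trans (MonoidHom.ofInjective (toUnitary_mk_injective hσ)).symm⟩

end Herm

instance : Fact (Nat.card (GaloisField 2 4) = 16) :=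
  ⟨by rw [GaloisField.card 2 4 (by norm_num)]; rfl⟩

theorem nonempty_mulEquiv_herm (S : Sylow 2 PSUThreeFour) :
    Nonempty (S ≃* Herm (GaloisField 2 4)) :=
  Herm.nonempty_mulEquiv_sylow (fun x => iterateFrobenius_def 2 2 x) S

/-! ### Groups of automorphisms that are as large as possible -/

section Full

variable {E V : Type*} [Group E] [Group V] {q : E →* V} {H : Subgroup (MulAut E)}

theorem map_apply_eq_of_fixes_ker {α : MulAut E} (hα : ∀ n, q n = 1 → α n = n) {e f : E}
    (h : q e = q f) : q (α e) = q (α f) := by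
  have h1 : α (e * f⁻¹) = e * f⁻¹ := hα _ (by rw [map_mul, map_inv, h, mul_inv_cancel])
  have h2 : α e = e * f⁻¹ * α f := by rw [← h1, map_mul, map_inv]; group
  rw [h2, map_mul, map_mul, map_inv, h, mul_inv_cancel, one_mul]

/-- An automorphism of odd order that is trivial on a `2`-subgroup with quotient of exponent two
and order at most four permutes the three nontrivial cosets cyclically if it is not trivial. -/
theorem eq_one_of_fixes_coset (h2 : ∀ v : V, v * v = 1)
    (hV : ∀ e f g : V, e ≠ 1 → f ≠ 1 → e ≠ f → g = 1 ∨ g = e ∨ g = f ∨ g = e * f)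
    (hker : ∀ n, q n = 1 → ∃ j : ℕ, n ^ 2 ^ j = 1) {ρ : MulAut E} (hρ : Odd (orderOf ρ))
    (hfix : ∀ n, q n = 1 → ρ n = n) {e : E} (he : q e ≠ 1) (hρe : q (ρ e) = q e) : ρ = 1 := by
  have hfixes : ∀ f, q (ρ f) = q f → ρ f = f := fun f hf => by
    have h1 : q (ρ f * f⁻¹) = 1 := by rw [map_mul, map_inv, hf, mul_inv_cancel]
    obtain ⟨j, hj⟩ := hker _ h1
    exact MulAut.apply_eq_of_mul hρ (hfix _ h1) hj (by group)
  refine MulEquiv.ext fun f => ?_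
  have hq1 : ∀ f, q (ρ f) = 1 → q f = 1 := fun f hf => by
    have h1 : ρ f = f := ρ.injective (hfix _ hf)
    rwa [h1] at hf
  by_cases hf1 : q f = 1
  · exact hfix f hf1
  by_cases hf2 : q f = q e
  · exact hfixes f ((map_apply_eq_of_fixes_ker hfix hf2).trans (hρe.trans hf2.symm))
  rcases hV (q e) (q f) (q (ρ f)) he hf1 (Ne.symm hf2) with h | h | h | h
  · exact absurd (hq1 f h) hf1
  · refine absurd ?_ hf2
    have h3 : q (ρ (f * e⁻¹)) = 1 := by
      rw [map_mul, map_inv, map_mul, map_inv, h, hρe, mul_inv_cancel]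
    have := hq1 _ h3
    rwa [map_mul, map_inv, mul_inv_eq_one] at this
  · exact hfixes f h
  · refine MulAut.apply_eq_of_apply_apply hρ ?_
    have h4 : q (ρ (ρ f)) = q f := by
      rw [map_apply_eq_of_fixes_ker hfix (f := e * f) (by rw [h, map_mul]), map_mul, map_mul, hρe,
        h, ← mul_assoc, h2, one_mul]
    have h1 : q (ρ (ρ f) * f⁻¹) = 1 := by rw [map_mul, map_inv, h4, mul_inv_cancel]
    obtain ⟨j, hj⟩ := hker _ h1
    have hρ2 : Odd (orderOf (ρ * ρ)) := by
      rw [← pow_two]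
      exact Odd.of_dvd_nat hρ (orderOf_pow_dvd 2)
    exact MulAut.apply_eq_of_mul (α := ρ * ρ) hρ2
      (by rw [MulAut.mul_apply, hfix _ h1, hfix _ h1]) hj (by rw [MulAut.mul_apply]; group)

/-- An automorphism that multiplies `w` and `u` by central elements is inner if these are
commutators of `w` and `u`. -/
theorem mem_of_apply_eq_or {w u s : E} (hs : w * s = s * w) (hwu : w * u * w⁻¹ = s * u)
    (huw : u * w * u⁻¹ = s * w) (hinn : ∀ g, MulAut.conj g ∈ H) {α : MulAut E}
    (ext : ∀ g, α w = MulAut.conj g w → α u = MulAut.conj g u → α = MulAut.conj g)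
    (hw : α w = w ∨ α w = s * w) (hu : α u = u ∨ α u = s * u) : α ∈ H := by
  have key : ∀ g, α w = MulAut.conj g w → α u = MulAut.conj g u → α ∈ H := fun g h1 h2 =>
    ext g h1 h2 ▸ hinn g
  rcases hw with h1 | h1 <;> rcases hu with h2 | h2
  · exact key 1 (by simp [h1]) (by simp [h2])
  · exact key w (by simp [h1]) (by simp [h2, hwu])
  · exact key u (by simp [h1, huw]) (by simp [h2])
  · refine key (w * u) ?_ ?_
    · rw [map_mul, MulAut.mul_apply, MulAut.conj_apply u, huw, MulAut.conj_apply, h1, ← mul_assoc, hs,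
        mul_inv_cancel_right]
    · rw [map_mul, MulAut.mul_apply, MulAut.conj_apply u, mul_inv_cancel_right, MulAut.conj_apply, h2,
        hwu]

/-- Let `N` be the kernel of `q : E → V`, where `V` has exponent two and order at most four. A group
of automorphisms of `E` that contains those that are trivial on `N` and on `E / N`, one that
exchanges two nontrivial cosets of `N` and one of odd order contains every automorphism that is
trivial on `N`: it induces the symmetric group on the three nontrivial cosets. -/
theorem mem_of_fixes_ker (h2 : ∀ v : V, v * v = 1)
    (hV : ∀ e f g : V, e ≠ 1 → f ≠ 1 → e ≠ f → g = 1 ∨ g = e ∨ g = f ∨ g = e * f)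
    (hker : ∀ n, q n = 1 → ∃ j : ℕ, n ^ 2 ^ j = 1)
    (hH : ∀ α : MulAut E, (∀ n, q n = 1 → α n = n) → (∀ e, q (α e) = q e) → α ∈ H)
    {τ ρ : MulAut E} (hτ : τ ∈ H) (hρ : ρ ∈ H) (hτN : ∀ n, q n = 1 → τ n = n)
    (hρN : ∀ n, q n = 1 → ρ n = n) {w u : E} (hw : q w ≠ 1) (hu : q u ≠ 1) (hwu : q w ≠ q u)
    (hτw : q (τ w) = q w) (hτu : q (τ u) = q w * q u) (hρodd : Odd (orderOf ρ)) (hρ1 : ρ ≠ 1)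
    {β : MulAut E} (hβ : ∀ n, q n = 1 → β n = n) : β ∈ H := by
  have hq1 : ∀ α : MulAut E, (∀ n, q n = 1 → α n = n) → ∀ f, q (α f) = 1 → q f = 1 :=
    fun α hα f hf => by
      have h1 : α f = f := α.injective (hα _ hf)
      rwa [h1] at hf
  have hmul : ∀ α β : MulAut E, (∀ n, q n = 1 → α n = n) → (∀ n, q n = 1 → β n = n) →
      ∀ n, q n = 1 → (α * β) n = n := fun α β hα hβ n hn => by
    rw [MulAut.mul_apply, hβ n hn, hα n hn]
  -- two automorphisms that agree on the cosets of `w` and `u` differ by an element of `H`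
  have step : ∀ α : MulAut E, (∀ n, q n = 1 → α n = n) → q (α w) = q w → q (α u) = q u → α ∈ H :=
    fun α hα h3 h4 => hH α hα fun e => by
      rcases hV (q w) (q u) (q e) hw hu hwu with h | h | h | h
      · rw [hα e h]
      · rw [map_apply_eq_of_fixes_ker hα h, h3, h]
      · rw [map_apply_eq_of_fixes_ker hα h, h4, h]
      · rw [map_apply_eq_of_fixes_ker hα (f := w * u) (by rw [h, map_mul]), map_mul, map_mul, h3,
          h4, h]
  have step2 : ∀ α : MulAut E, (∀ n, q n = 1 → α n = n) → q (α w) = q w → α ∈ H := by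
    intro α hα h3
    rcases hV (q w) (q u) (q (α u)) hw hu hwu with h | h | h | h
    · exact absurd (hq1 α hα u h) hu
    · refine absurd ?_ hwu
      have h4 : q (α (w * u⁻¹)) = 1 := by
        rw [map_mul, map_inv, map_mul, map_inv, h, h3, mul_inv_cancel]
      have := hq1 α hα _ h4
      rwa [map_mul, map_inv, mul_inv_eq_one] at this
    · exact step α hα h3 h
    · have h5 : τ * α ∈ H := by
        refine step _ (hmul _ _ hτN hα) ?_ ?_
        · rw [MulAut.mul_apply, map_apply_eq_of_fixes_ker hτN h3, hτw]
        · rw [MulAut.mul_apply, map_apply_eq_of_fixes_ker hτN (f := w * u) (by rw [h, map_mul]),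
            map_mul, map_mul, hτw, hτu, ← mul_assoc, h2, one_mul]
      exact (mul_mem_cancel_left hτ).1 h5
  have hnf : ∀ e, q e ≠ 1 → q (ρ e) ≠ q e := fun e he h =>
    hρ1 (eq_one_of_fixes_coset h2 hV hker hρodd hρN he h)
  have hnf2 : ∀ e, q e ≠ 1 → q (ρ (ρ e)) ≠ q e := fun e he h => by
    have h3 : ρ ^ 2 = 1 := eq_one_of_fixes_coset h2 hV hker
      (Odd.of_dvd_nat hρodd (orderOf_pow_dvd 2)) (by rw [pow_two]; exact hmul _ _ hρN hρN) he
      (by rw [pow_two]; exact h)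
    refine hρ1 ?_
    have := Nat.Coprime.eq_one_of_dvd (Nat.coprime_two_right.2 hρodd) (orderOf_dvd_of_pow_eq_one h3)
    rwa [orderOf_eq_one_iff] at this
  have hρw : q (ρ w) ≠ 1 := fun h => hw (hq1 ρ hρN w h)
  by_cases c1 : q (β w) = q w
  · exact step2 β hβ c1
  have hβw : q (β w) ≠ 1 := fun h => hw (hq1 β hβ w h)
  by_cases c2 : q (ρ (β w)) = q w
  · have h5 := step2 (ρ * β) (hmul _ _ hρN hβ) c2
    exact (mul_mem_cancel_left hρ).1 h5
  · have h5 := step2 (ρ * ρ * β) (hmul _ _ (hmul _ _ hρN hρN) hβ) (by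
      change q (ρ (ρ (β w))) = q w
      have h7 : q (ρ (β w)) ≠ 1 := fun h => hβw (hq1 ρ hρN _ h)
      have h8 : q (ρ (ρ (β w))) ≠ 1 := fun h => h7 (hq1 ρ hρN _ h)
      -- `β w`, `ρ (β w)` and `ρ (ρ (β w))` represent the three nontrivial cosets
      have h9 := hnf _ hβw
      have h10 := hnf _ h7
      have h11 := hnf2 _ hβw
      rcases hV (q (β w)) (q (ρ (β w))) (q w) hβw h7 h9.symm with h | h | h | h
      · exact absurd h hw
      · exact absurd h.symm c1
      · exact absurd h.symm c2
      · rcases hV (q (β w)) (q (ρ (β w))) (q (ρ (ρ (β w)))) hβw h7 h9.symm with g | g | g | g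
        · exact absurd g h8
        · exact absurd g h11
        · exact absurd g h10
        · rw [g, h])
    have h6 := mul_mem (inv_mem (mul_mem hρ hρ)) h5
    rwa [inv_mul_cancel_left] at h6

/-- A group of exponent two that is covered by four elements `1`, `w`, `u`, `wu`. -/
theorem eq_of_exponent_two {w u : V} (hcov : ∀ v : V, v = 1 ∨ v = w ∨ v = u ∨ v = w * u)
    (h2 : ∀ v : V, v * v = 1) (e f g : V) (he : e ≠ 1) (hf : f ≠ 1) (hef : e ≠ f) :
    g = 1 ∨ g = e ∨ g = f ∨ g = e * f := by
  classical
  have h1 : (({w * u, u, w, 1} : Finset V) : Set V) = Set.univ := by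
    ext v
    have := hcov v
    simp only [Finset.coe_insert, Finset.coe_singleton, Set.mem_insert_iff, Set.mem_singleton_iff,
      Set.mem_univ, iff_true]
    tauto
  have h3 : ({1, e, f, e * f} : Finset V).card = 4 := by
    have h4 : e * f ≠ 1 := fun h => hef (mul_right_cancel (b := f) (h.trans (h2 f).symm))
    rw [Finset.card_insert_of_notMem, Finset.card_insert_of_notMem, Finset.card_insert_of_notMem,
      Finset.card_singleton]
    · simpa using he
    · simpa using ⟨hef, hf⟩
    · simpa using ⟨he.symm, hf.symm, h4.symm⟩
  have h4 : ({1, e, f, e * f} : Finset V) = {w * u, u, w, 1} := by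
    refine Finset.eq_of_subset_of_card_le (fun v _ => ?_) (by rw [h3]; exact Finset.card_le_four)
    rw [← Finset.mem_coe, h1]
    trivial
  have h5 : g ∈ ({1, e, f, e * f} : Finset V) := by
    rw [h4, ← Finset.mem_coe, h1]
    trivial
  simpa using h5

end Full

/-! ### Extensions of a cyclic group by one element -/

section Metacyclic

variable {G : Type*} [Group G] {x y : G} {r s : ℤ}

theorem mul_zpow_of_conj (h : y * x * y⁻¹ = x ^ r) (a : ℤ) : y * x ^ a = x ^ (r * a) * y := by
  rw [zpow_mul, ← h, conj_zpow]
  group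

/-- The subgroup of the elements `x ^ a` and `x ^ a * y`, if `y` normalizes `⟨x⟩` and its square is
in `⟨x⟩`. -/
def metacyclic (h : y * x * y⁻¹ = x ^ r) (h' : y * y = x ^ s) : Subgroup G where
  carrier := {g | ∃ a : ℤ, g = x ^ a ∨ g = x ^ a * y}
  one_mem' := ⟨0, Or.inl (by simp)⟩
  mul_mem' := by
    rintro _ _ ⟨a, rfl | rfl⟩ ⟨b, rfl | rfl⟩
    · exact ⟨a + b, Or.inl (zpow_add x a b).symm⟩
    · exact ⟨a + b, Or.inr (by rw [zpow_add, mul_assoc])⟩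
    · exact ⟨a + r * b, Or.inr (by rw [mul_assoc, mul_zpow_of_conj h, zpow_add, mul_assoc])⟩
    · refine ⟨a + r * b + s, Or.inl ?_⟩
      rw [mul_assoc, ← mul_assoc y, mul_zpow_of_conj h, mul_assoc, h', zpow_add, zpow_add,
        mul_assoc]
  inv_mem' := by
    rintro _ ⟨a, rfl | rfl⟩
    · exact ⟨-a, Or.inl (zpow_neg x a).symm⟩
    · refine ⟨-s + r * -a, Or.inr ?_⟩
      rw [zpow_add, mul_assoc, ← mul_zpow_of_conj h, zpow_neg, ← h']
      group

variable {h : y * x * y⁻¹ = x ^ r} {h' : y * y = x ^ s}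

theorem mem_metacyclic {g : G} : g ∈ metacyclic h h' ↔ ∃ a : ℤ, g = x ^ a ∨ g = x ^ a * y := Iff.rfl

theorem left_mem_metacyclic : x ∈ metacyclic h h' := ⟨1, Or.inl (zpow_one x).symm⟩

theorem right_mem_metacyclic : y ∈ metacyclic h h' := ⟨0, Or.inr (by simp)⟩

theorem metacyclic_le {S : Subgroup G} (hx : x ∈ S) (hy : y ∈ S) : metacyclic h h' ≤ S := by
  rintro _ ⟨a, rfl | rfl⟩
  · exact zpow_mem hx a
  · exact mul_mem (zpow_mem hx a) hy

/-- A subgroup of `P × G` that projects onto `P` and meets both factors trivially is the graph of an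
injective homomorphism. -/
theorem exists_monoidHom_of_graph {P : Type*} [Group P] (Γ : Subgroup (P × G))
    (key : ∀ p ∈ Γ, p.1 = 1 ↔ p.2 = 1) (hsurj : ∀ g, ∃ p ∈ Γ, p.1 = g) :
    ∃ i : P →* G, Function.Injective i ∧ ∀ p ∈ Γ, i p.1 = p.2 := by
  have hbij : Function.Bijective ((MonoidHom.fst P G).comp Γ.subtype) := by
    constructor
    · rw [injective_iff_map_eq_one]
      rintro ⟨p, hp⟩ h1
      exact Subtype.ext (Prod.ext h1 ((key p hp).1 h1))
    · intro g
      obtain ⟨p, hp, rfl⟩ := hsurj g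
      exact ⟨⟨p, hp⟩, rfl⟩
  let e : Γ ≃* P := MulEquiv.ofBijective _ hbij
  refine ⟨((MonoidHom.snd P G).comp Γ.subtype).comp e.symm.toMonoidHom, ?_, fun p hp => ?_⟩
  · rw [injective_iff_map_eq_one]
    intro g hg
    have h1 : e.symm g = 1 :=
      Subtype.ext (Prod.ext ((key _ (e.symm g).2).2 hg) hg)
    rwa [EmbeddingLike.map_eq_one_iff] at h1
  · have h1 : e.symm p.1 = ⟨p, hp⟩ := by rw [MulEquiv.symm_apply_eq]; rfl
    change (e.symm p.1).1.2 = p.2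
    rw [h1]

/-- An extension of a cyclic group by one element embeds in every group with elements that satisfy
the same relations: the homomorphism is given by its graph. -/
theorem exists_monoidHom_of_metacyclic {P : Type*} [Group P] {x y : P} {X Y : G}
    (h : y * x * y⁻¹ = x ^ r) (h' : y * y = x ^ s) (hX : Y * X * Y⁻¹ = X ^ r)
    (hX' : Y * Y = X ^ s) (ho : orderOf x = orderOf X) (hy : y ∉ zpowers x)
    (hY : Y ∉ zpowers X) (hcov : metacyclic h h' = ⊤) :
    ∃ i : P →* G, Function.Injective i ∧ i x = X ∧ i y = Y := by
  let Γ : Subgroup (P × G) := metacyclic (x := (x, X)) (y := (y, Y)) (r := r) (s := s)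
    (Prod.ext h hX) (Prod.ext h' hX')
  have ho' : ∀ a : ℤ, x ^ a = 1 ↔ X ^ a = 1 := fun a => by
    rw [← orderOf_dvd_iff_zpow_eq_one, ← orderOf_dvd_iff_zpow_eq_one, ho]
  have hinv : ∀ (a : ℤ) {x y : P}, x ^ a * y = 1 → y = x ^ (-a) := fun a x y h => by
    rw [zpow_neg]; exact eq_inv_of_mul_eq_one_right h
  have hinv' : ∀ (a : ℤ) {x y : G}, x ^ a * y = 1 → y = x ^ (-a) := fun a x y h => by
    rw [zpow_neg]; exact eq_inv_of_mul_eq_one_right h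
  obtain ⟨i, hi, h1⟩ := exists_monoidHom_of_graph Γ (by
    rintro _ ⟨a, rfl | rfl⟩
    · exact ho' a
    · constructor
      · exact fun e => absurd ⟨-a, (hinv a e).symm⟩ hy
      · exact fun e => absurd ⟨-a, (hinv' a e).symm⟩ hY) fun g => by
    have hg : g ∈ metacyclic h h' := hcov ▸ mem_top g
    obtain ⟨a, rfl | rfl⟩ := hg
    · exact ⟨(x, X) ^ a, ⟨a, Or.inl rfl⟩, rfl⟩
    · exact ⟨(x, X) ^ a * (y, Y), ⟨a, Or.inr rfl⟩, rfl⟩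
  exact ⟨i, hi, h1 (x, X) left_mem_metacyclic, h1 (y, Y) right_mem_metacyclic⟩

end Metacyclic

/-! ### Four-groups and quaternion groups of order eight -/

/-- The elements `w`, `u` generate a four-group with `w` an involution, or a quaternion group of
order eight. -/
structure QuatPair {P : Type*} [Group P] (w u : P) : Prop where
  conj : u * w * u⁻¹ = w⁻¹
  sq : u * u = w * w
  four : w ^ 4 = 1
  ne : w ≠ 1
  notMem : u ∉ zpowers w

namespace QuatPair

variable {P : Type*} [Group P] {w u : P} (h : QuatPair w u)

include h

theorem conj' : u * w * u⁻¹ = w ^ (-1 : ℤ) := by rw [h.conj, zpow_neg_one]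

theorem sq' : u * u = w ^ (2 : ℤ) := by rw [h.sq, zpow_two]

theorem mem_closure {g : P} :
    g ∈ closure {w, u} ↔ ∃ a : ℤ, g = w ^ a ∨ g = w ^ a * u := by
  rw [← mem_metacyclic (h := h.conj') (h' := h.sq')]
  constructor
  · intro hg
    refine (closure_le _).2 ?_ hg
    rintro _ (rfl | rfl)
    exacts [left_mem_metacyclic, right_mem_metacyclic]
  · intro hg
    exact metacyclic_le (subset_closure (by simp)) (subset_closure (by simp)) hg

theorem u_mul_zpow (a : ℤ) : u * w ^ a = w ^ (-a) * u := by
  rw [mul_zpow_of_conj h.conj', neg_one_mul]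

theorem four' : w * w * (w * w) = 1 := by
  rw [← h.four]; simp only [pow_succ, pow_zero, one_mul, mul_assoc]

theorem zpow_sq (a : ℤ) : w ^ a * w ^ a = 1 ∨ w ^ a * w ^ a = w * w := by
  obtain ⟨b, rfl | rfl⟩ := Int.even_or_odd' a
  · left
    have e : w ^ (2 * b) * w ^ (2 * b) = (w ^ 4) ^ b := by group
    rw [e, h.four, one_zpow]
  · right
    have e : w ^ (2 * b + 1) * w ^ (2 * b + 1) = (w ^ 4) ^ b * (w * w) := by group
    rw [e, h.four, one_zpow, one_mul]

theorem outer_sq (a : ℤ) : w ^ a * u * (w ^ a * u) = w * w := by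
  rw [mul_assoc, ← mul_assoc u, h.u_mul_zpow, zpow_neg, mul_assoc, mul_inv_cancel_left, h.sq]

theorem w_u_w : w * u * w⁻¹ = w * w * u := by
  have := h.u_mul_zpow (-1)
  rw [neg_neg, zpow_one, zpow_neg_one] at this
  rw [mul_assoc, this, mul_assoc]

theorem inv_eq : w⁻¹ = w * (w * w) := by
  rw [inv_eq_iff_mul_eq_one, ← h.four']; group

theorem u_comm : u * (w * w) = w * w * u := by
  have h1 := h.u_mul_zpow 2
  have h2 : w ^ (-2 : ℤ) = w ^ (2 : ℤ) := by
    rw [zpow_neg, inv_eq_iff_mul_eq_one, zpow_two, h.four']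
  rwa [h2, zpow_two] at h1

section Aut

variable (hcov : ∀ e : P, ∃ a : ℤ, e = w ^ a ∨ e = w ^ a * u)

include hcov

theorem aut_ext {α β : MulAut P} (hw : α w = β w) (hu : α u = β u) : α = β := by
  refine MulEquiv.ext fun e => ?_
  obtain ⟨a, rfl | rfl⟩ := hcov e
  · rw [map_zpow, map_zpow, hw]
  · rw [map_mul, map_mul, map_zpow, map_zpow, hw, hu]

theorem sq_mem (e : P) : e * e = 1 ∨ e * e = w * w := by
  obtain ⟨a, rfl | rfl⟩ := hcov e
  · exact h.zpow_sq a
  · exact Or.inr (h.outer_sq a)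

theorem aut_sq (α : MulAut P) : α (w * w) = w * w := by
  rw [map_mul]
  rcases h.sq_mem hcov (α w) with h1 | h1
  · rw [← map_mul, map_eq_one_iff α α.injective] at h1
    rw [← map_mul, h1, map_one]
  · exact h1

theorem exists_apply_eq {α : MulAut P} (hα : Odd (orderOf α)) (hα1 : α ≠ 1) :
    ∃ j : ℤ, α w = w ^ j * u := by
  obtain ⟨a, ha | ha⟩ := hcov (α w)
  · refine absurd ?_ hα1
    have hw : α w = w := MulAut.apply_eq_of_mem_zpowers hα (l := 2) h.four ⟨a, ha.symm⟩
    refine aut_ext h hcov hw ?_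
    obtain ⟨b, hb | hb⟩ := hcov (α u)
    · refine absurd ⟨b, ?_⟩ h.notMem
      refine α.injective ?_
      simp only
      rw [map_zpow, hw, hb]
    · exact MulAut.apply_eq_of_mul hα (c := w ^ b) (by rw [map_zpow, hw]) (j := 2)
        (by rw [← zpow_natCast, ← zpow_mul, mul_comm, zpow_mul, zpow_natCast]
            change (w ^ 4) ^ b = 1
            rw [h.four, one_zpow]) hb
  · exact ⟨a, ha⟩

/-- A group of automorphisms of a four-group or a quaternion group of order eight that contains the
inner automorphisms, one that fixes `w` and maps `u` to `w ^ j * u` with `j` odd, and a nontrivial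
one of odd order is the full automorphism group. -/
theorem eq_top_of_mem {H : Subgroup (MulAut P)} (hinn : ∀ g : P, MulAut.conj g ∈ H)
    {τ ρ : MulAut P} (hτ : τ ∈ H) {j : ℤ} (hj : Odd j) (hτw : τ w = w) (hτu : τ u = w ^ j * u)
    (hρ : ρ ∈ H) (hρodd : Odd (orderOf ρ)) (hρ1 : ρ ≠ 1) : H = ⊤ := by
  let N : Subgroup P := zpowers (w * w)
  have hcent : ∀ e : P, e * (w * w) = w * w * e := fun e => by
    have h1 : Commute (w * w) w := by
      change w * w * w = w * (w * w); group
    obtain ⟨a, rfl | rfl⟩ := hcov e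
    · exact (h1.zpow_right a).eq.symm
    · exact ((h1.zpow_right a).mul_right (h.u_comm.symm)).eq.symm
  have hN : ∀ n, n ∈ N ↔ n = 1 ∨ n = w * w := fun n => by
    constructor
    · rintro ⟨a, rfl⟩
      have := h.zpow_sq a
      simp only
      rwa [Commute.mul_zpow rfl]
    · rintro (rfl | rfl)
      · exact one_mem N
      · exact mem_zpowers _
  have : N.Normal := ⟨fun n hn g => by
    rcases (hN n).1 hn with rfl | rfl
    · simp
    · rw [hcent, mul_inv_cancel_right]; exact hn⟩
  let q := QuotientGroup.mk' N
  have hq : ∀ n, q n = 1 ↔ n = 1 ∨ n = w * w := fun n => by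
    rw [← hN]; exact QuotientGroup.eq_one_iff n
  have hfix : ∀ α : MulAut P, ∀ n, q n = 1 → α n = n := fun α n hn => by
    rcases (hq n).1 hn with rfl | rfl
    · exact map_one α
    · exact h.aut_sq hcov α
  have h2 : ∀ v, v * v = (1 : P ⧸ N) := fun v => by
    obtain ⟨e, rfl⟩ := QuotientGroup.mk'_surjective N v
    exact (map_mul q e e).symm.trans ((hq _).2 (h.sq_mem hcov e))
  have hqw : ∀ a : ℤ, q (w ^ a) = 1 ∨ q (w ^ a) = q w := fun a => by
    obtain ⟨b, rfl | rfl⟩ := Int.even_or_odd' a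
    · left
      rw [map_zpow, zpow_mul, zpow_two, h2, one_zpow]
    · right
      rw [map_zpow, zpow_add, zpow_mul, zpow_two, h2, one_zpow, one_mul, zpow_one]
  have hV := eq_of_exponent_two (w := q w) (u := q u) (fun v => by
    obtain ⟨e, rfl⟩ := QuotientGroup.mk'_surjective N v
    change q e = _ ∨ q e = _ ∨ q e = _ ∨ q e = _
    obtain ⟨a, rfl | rfl⟩ := hcov e
    · rcases hqw a with h1 | h1 <;> simp [h1]
    · rcases hqw a with h1 | h1 <;> simp [map_mul, h1]) h2
  have hw1 : q w ≠ 1 := fun h1 => h.ne (by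
    rcases (hq _).1 h1 with h3 | h3
    · exact h3
    · exact (mul_eq_left.1 h3.symm))
  have hu : ∀ a : ℤ, q (w ^ a * u) ≠ 1 := fun a h1 => h.notMem (by
    rcases (hq _).1 h1 with h3 | h3
    · exact ⟨-a, (zpow_neg w a).trans (eq_inv_of_mul_eq_one_right h3).symm⟩
    · refine ⟨-a + 2, ?_⟩
      simp only
      rw [zpow_add, zpow_two, ← h3, zpow_neg, inv_mul_cancel_left])
  refine (Subgroup.eq_top_iff' H).2 fun β => mem_of_fixes_ker (q := q) (w := w) (u := u) h2 hV
    (fun n hn => ⟨1, ?_⟩) (fun α hα hα' => ?_) hτ hρ (hfix τ) (hfix ρ) hw1 ?_ ?_ ?_ ?_ hρodd hρ1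
    (hfix β)
  · rcases (hq n).1 hn with rfl | rfl
    · simp
    · rw [pow_one, pow_two, h.four']
  · -- automorphisms that are trivial on `N` and modulo `N` are inner
    have h3 : ∀ e, α e = e ∨ α e = w * w * e := fun e => by
      have h4 : q (α e * e⁻¹) = 1 := by rw [map_mul, hα', map_inv, mul_inv_cancel]
      rcases (hq _).1 h4 with h5 | h5
      · exact Or.inl (mul_inv_eq_one.1 h5)
      · exact Or.inr (mul_inv_eq_iff_eq_mul.1 h5)
    exact mem_of_apply_eq_or (hcent w) h.w_u_w (by rw [h.conj, h.inv_eq, mul_assoc]) hinn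
      (fun _ => aut_ext h hcov) (h3 w) (h3 u)
  · simpa using hu 0
  · intro h1
    refine hu (-1) ?_
    rw [map_mul, map_zpow, h1, zpow_neg_one, inv_mul_cancel]
  · rw [hτw]
  · rw [hτu, map_mul]
    congr 1
    obtain ⟨b, rfl⟩ := hj
    rw [map_zpow, zpow_add, zpow_mul, zpow_two, h2, one_zpow, one_mul, zpow_one]

end Aut

theorem closure_cov (e : closure {w, u}) :
    ∃ a : ℤ, e = (⟨w, subset_closure (by simp)⟩ : closure {w, u}) ^ a ∨
      e = (⟨w, subset_closure (by simp)⟩ : closure {w, u}) ^ a *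
        ⟨u, subset_closure (by simp)⟩ := by
  obtain ⟨a, ha⟩ := h.mem_closure.1 e.2
  exact ⟨a, ha.imp (fun h => Subtype.ext h) fun h => Subtype.ext h⟩

theorem closure_pair : QuatPair
    (⟨w, subset_closure (by simp)⟩ : closure {w, u})
    ⟨u, subset_closure (by simp)⟩ where
  conj := Subtype.ext h.conj
  sq := Subtype.ext h.sq
  four := Subtype.ext h.four
  ne h1 := h.ne (congrArg Subtype.val h1)
  notMem := by
    rintro ⟨a, ha⟩
    exact h.notMem ⟨a, congrArg Subtype.val ha⟩

open FusionSystem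

variable {F : FusionSystem P}

theorem isConj_closure (F : FusionSystem P) {d u' : P} (hw : d * w = w * d)
    (hu : d * u * d⁻¹ = u') :
    F.IsConj (closure {w, u}) (closure {w, u'}) := by
  have h1 := F.isConj_conj (closure {w, u}) d
  rw [MonoidHom.map_closure, Set.image_pair] at h1
  have h2 : d * w * d⁻¹ = w := by rw [hw, mul_inv_cancel_right]
  simpa only [MulEquiv.coe_toMonoidHom, MulAut.conj_apply, h2, hu] using h1

theorem aut_eq_top [Finite P] (hF : F.HasCoprimeAut 2 (closure {w, u})) {d : P} {j : ℤ}
    (hj : Odd j) (hw : d * w = w * d) (hu : d * u * d⁻¹ = w ^ j * u) :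
    F.aut (closure {w, u}) = ⊤ := by
  have hwE : w ∈ closure {w, u} := subset_closure (by simp)
  have huE : u ∈ closure {w, u} := subset_closure (by simp)
  obtain ⟨ρ, hρ, hρ1, hρ2⟩ := hF
  have hw' : d * w * d⁻¹ = w := by rw [hw, mul_inv_cancel_right]
  obtain ⟨τ, hτ, hτ'⟩ := F.exists_aut_conj (s := {w, u}) (d := d) (by
    rintro _ (rfl | rfl)
    exacts [by rwa [hw'], hu ▸ mul_mem (zpow_mem hwE j) huE])
  refine h.closure_pair.eq_top_of_mem h.closure_cov (fun g => F.inn_le_aut _ ⟨g, rfl⟩) hτ hj ?_ ?_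
    hρ (Nat.odd_of_not_two_dvd hρ2) hρ1
  · exact Subtype.ext ((hτ' _).trans hw')
  · exact Subtype.ext ((hτ' _).trans hu)

variable {G : Type*} [Group G] {i : P →* G} {hi : Function.Injective i}

/-- If `G` has an automorphism of odd order on `⟨w, u⟩`, then normal subgroups of `G` that contain
`w` also contain `u`. -/
theorem mem_of_hasCoprimeAut (hF : (ofEmb i hi).HasCoprimeAut 2 (closure {w, u}))
    {M : Subgroup G} (hM : M.Normal) (hw : i w ∈ M) : i u ∈ M := by
  obtain ⟨α, hα, hα1, hα2⟩ := hF
  obtain ⟨j, hj⟩ := h.closure_pair.exists_apply_eq h.closure_cov (Nat.odd_of_not_two_dvd hα2) hα1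
  obtain ⟨g, hg⟩ := mem_aut_ofEmb.1 hα
  have h1 := hg ⟨w, subset_closure (by simp)⟩
  rw [hj] at h1
  have h2 : i (w ^ j * u) ∈ M := by
    have h3 := hM.conj_mem _ hw g
    rw [← h1] at h3
    exact h3
  rw [map_mul] at h2
  exact (Subgroup.mul_mem_cancel_left M (by rw [map_zpow]; exact zpow_mem hw j)).1 h2

/-- If an element of `G` maps `w`, `u` to `u`, `wu`, it induces an automorphism of order three. -/
theorem hasCoprimeAut [Finite P] {g : G} (hw : g * i w * g⁻¹ = i u)
    (hu : g * i u * g⁻¹ = i (w * u)) :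
    (ofEmb i hi).HasCoprimeAut 2 (closure {w, u}) := by
  have hwE : w ∈ closure {w, u} := subset_closure (by simp)
  have huE : u ∈ closure {w, u} := subset_closure (by simp)
  obtain ⟨α, hα, hα'⟩ := exists_aut_ofEmb (hi := hi) (Q := closure {w, u}) (g := g) rfl (by
    rintro v (rfl | rfl)
    exacts [⟨u, huE, hw.symm⟩, ⟨_, mul_mem hwE huE, hu.symm⟩])
  have aw : α ⟨w, hwE⟩ = ⟨u, huE⟩ := Subtype.ext (hi (by rw [hα', hw]))
  have au : α ⟨u, huE⟩ = ⟨w, hwE⟩ * ⟨u, huE⟩ := Subtype.ext (hi (by rw [hα', hu]; rfl))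
  have hne : α ≠ 1 := fun h3 => h.notMem ⟨1, by
    rw [h3, MulAut.one_apply] at aw
    simpa using congrArg Subtype.val aw⟩
  have : Fact (Nat.Prime 3) := ⟨Nat.prime_three⟩
  have h3 : α ^ 3 = 1 := by
    have key : (⟨u, huE⟩ * (⟨w, hwE⟩ * ⟨u, huE⟩) : closure {w, u}) = ⟨w, hwE⟩ := by
      refine Subtype.ext ?_
      change u * (w * u) = w
      have h4 := h.u_mul_zpow 1
      rw [zpow_one, zpow_neg_one] at h4
      rw [← mul_assoc, h4, mul_assoc, h.sq, inv_mul_cancel_left]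
    refine h.closure_pair.aut_ext h.closure_cov ?_ ?_
    · change α (α (α ⟨w, hwE⟩)) = ⟨w, hwE⟩
      rw [aw, au, map_mul, aw, au, key]
    · change α (α (α ⟨u, huE⟩)) = ⟨u, huE⟩
      rw [au, map_mul, aw, au, key, aw]
  exact ⟨α, hα, hne, by rw [orderOf_eq_prime h3 hne]; norm_num⟩

end QuatPair

namespace FusionSystem

variable {P : Type*} [Group P]

/-- The fusion system of all injective homomorphisms that map the subgroups of order `c` to
conjugate subgroups. -/
def conjSystem (P : Type*) [Group P] (c : ℕ) : FusionSystem P where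
  Hom Q := {φ | Function.Injective φ ∧ ∀ R : Subgroup Q, Nat.card R = c →
    ∃ g : P, R.map φ = (R.map Q.subtype).map (MulAut.conj g).toMonoidHom}
  injective _ _ h := h.1
  conj_mem Q g := ⟨(MulAut.conj g).injective.comp Q.subtype_injective,
    fun R _ => ⟨g, (Subgroup.map_map _ _ _).symm⟩⟩
  comp_mem := by
    rintro Q R φ ψ h ⟨hφ, hφ'⟩ ⟨hψ, hψ'⟩
    have hc : Function.Injective (φ.codRestrict R h) := fun x y hxy =>
      hφ (congrArg Subtype.val hxy)
    refine ⟨hψ.comp hc, fun S hS => ?_⟩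
    obtain ⟨g, hg⟩ := hφ' S hS
    obtain ⟨k, hk⟩ := hψ' (S.map (φ.codRestrict R h)) (by rw [card_map_of_injective hc, hS])
    refine ⟨k * g, ?_⟩
    have h1 : (S.map (φ.codRestrict R h)).map R.subtype = S.map φ := by
      rw [Subgroup.map_map]; rfl
    rw [← Subgroup.map_map, hk, h1, hg, Subgroup.map_map, map_mul]
    rfl
  inv_mem := by
    rintro Q φ ψ ⟨hφ, hφ'⟩ h
    have hψ : Function.Injective ψ := by
      rintro ⟨_, x, rfl⟩ ⟨_, y, rfl⟩ hxy
      rw [h, h] at hxy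
      rw [Subtype.ext hxy]
    refine ⟨hψ, fun R hR => ?_⟩
    let S : Subgroup Q := R.comap φ.rangeRestrict
    have hS : S.map φ.rangeRestrict = R :=
      Subgroup.map_comap_eq_self_of_surjective φ.rangeRestrict_surjective R
    have hr : Function.Injective φ.rangeRestrict := fun x y hxy => hφ (congrArg Subtype.val hxy)
    obtain ⟨g, hg⟩ := hφ' S (by rw [← hR, ← hS, card_map_of_injective hr])
    refine ⟨g⁻¹, ?_⟩
    have h1 : R.map φ.range.subtype = S.map φ := by
      rw [← hS, Subgroup.map_map]; rfl
    have h2 : R.map ψ = S.map Q.subtype := by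
      rw [← hS, Subgroup.map_map]
      congr 1
      ext x
      exact h x
    rw [h1, hg, Subgroup.map_map, h2]
    have h3 : (MulAut.conj g⁻¹).toMonoidHom.comp (MulAut.conj g).toMonoidHom = MonoidHom.id P := by
      ext x
      simp [mul_assoc]
    rw [h3, Subgroup.map_id]

/-- If the essential subgroups all have order `c`, then subgroups of order `c` that are conjugate in
`F` are conjugate in `P`. -/
theorem IsSaturated.exists_map_conj_eq {F : FusionSystem P} [Finite P] {p c : ℕ} [Fact p.Prime]
    (hF : F.IsSaturated p) (hP : IsPGroup p P) (htop : F.aut ⊤ ≤ autP ⊤)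
    (hess : ∀ Q, F.IsEssential p Q → Nat.card Q = c) {Q R : Subgroup P} (hQR : F.IsConj Q R)
    (hQ : Nat.card Q = c) : ∃ g : P, R = Q.map (MulAut.conj g).toMonoidHom := by
  obtain ⟨f, hf, h⟩ := isConj_iff.1 hQR
  have h1 : (conjSystem P c).Mor Q f := by
    refine hF.mor_of_aut_le hP (htop.trans (autP_le_aut _ ⊤)) (fun S hS α _ => ?_) hf
    refine ⟨S.subtype_injective.comp α.injective, fun T hT => ⟨1, ?_⟩⟩
    have hT1 : T = ⊤ := Subgroup.eq_top_of_card_eq T (by rw [hT, hess S hS])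
    rw [hT1, ← MonoidHom.range_eq_map, ← MonoidHom.range_eq_map, Subgroup.range_subtype]
    have h3 : (MulAut.conj (1 : P)).toMonoidHom = MonoidHom.id P := by ext x; simp
    have h4 : α.toMonoidHom.range = ⊤ := MonoidHom.range_eq_top.2 α.surjective
    rw [MonoidHom.range_comp, h4, ← MonoidHom.range_eq_map, Subgroup.range_subtype, h3,
      Subgroup.map_id]
  obtain ⟨φ, ⟨-, hφ⟩, hφf⟩ := h1
  obtain ⟨g, hg⟩ := hφ ⊤ (by rw [Subgroup.card_top, hQ])
  refine ⟨g, ?_⟩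
  rw [← MonoidHom.range_eq_map, ← MonoidHom.range_eq_map, Subgroup.range_subtype] at hg
  rw [← hg]
  ext y
  rw [h]
  constructor
  · rintro ⟨x, hx, rfl⟩
    exact ⟨⟨x, hx⟩, hφf _⟩
  · rintro ⟨x, rfl⟩
    exact ⟨x, x.2, (hφf x).symm⟩

end FusionSystem

/-! ### The essential rank -/

namespace FusionSystem

variable {P : Type*} [Group P] {F : FusionSystem P} {p : ℕ} {R S : Subgroup P}

/-- Some essential subgroup is conjugate to `R`. -/
def HasEssentialConj (F : FusionSystem P) (p : ℕ) (R : Subgroup P) : Prop :=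
  ∃ Q, F.IsEssential p Q ∧ F.IsConj Q R

theorem setOf_isConj_eq (h : F.IsConj R S) : {Q | F.IsConj R Q} = {Q | F.IsConj S Q} :=
  Set.ext fun _ => ⟨h.symm.trans, h.trans⟩

theorem essentialRank_eq_one (h : ∀ Q, F.IsEssential p Q → F.IsConj Q R ∨ F.IsConj Q S)
    (hR : F.HasEssentialConj p R) (hS : ¬ F.HasEssentialConj p S) : F.essentialRank p = 1 := by
  obtain ⟨Q, hQ, hQR⟩ := hR
  refine Set.ncard_eq_one.2 ⟨{T | F.IsConj R T}, Set.eq_singleton_iff_unique_mem.2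
    ⟨⟨Q, hQ, (setOf_isConj_eq hQR).symm⟩, ?_⟩⟩
  rintro _ ⟨Q', hQ', rfl⟩
  exact setOf_isConj_eq ((h Q' hQ').resolve_right fun h1 => hS ⟨Q', hQ', h1⟩)

theorem essentialRank_eq_two (h : ∀ Q, F.IsEssential p Q → F.IsConj Q R ∨ F.IsConj Q S)
    (hR : F.HasEssentialConj p R) (hS : F.HasEssentialConj p S) (hRS : ¬ F.IsConj R S) :
    F.essentialRank p = 2 := by
  obtain ⟨Q, hQ, hQR⟩ := hR
  obtain ⟨Q', hQ', hQS⟩ := hS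
  refine Set.ncard_eq_two.2 ⟨{T | F.IsConj R T}, {T | F.IsConj S T}, fun h1 => hRS ?_, ?_⟩
  · exact h1.symm.le (IsConj.refl F S)
  · refine Set.Subset.antisymm ?_ ?_
    · rintro _ ⟨Q₁, hQ₁, rfl⟩
      exact (h Q₁ hQ₁).imp setOf_isConj_eq setOf_isConj_eq
    · rintro _ (rfl | rfl)
      exacts [⟨Q, hQ, (setOf_isConj_eq hQR).symm⟩, ⟨Q', hQ', (setOf_isConj_eq hQS).symm⟩]

end FusionSystem

/-! ### Dihedral, semidihedral and generalized quaternion groups -/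

/-- A presentation of a dihedral, semidihedral or generalized quaternion group `P` of order
`2 ^ (k + 1)` (the quaternion group of order eight is excluded): `x` has order `2 ^ k`, the element
`y` acts on `⟨x⟩` as the exponent `r` and `y ^ 2 = x ^ s`, where `r` is congruent to `-1` and `s` to
`0` modulo `2 ^ (k - 1)`, and even modulo `2 ^ k` if `k = 2`. -/
structure MaxClass {P : Type*} [Group P] (x y : P) (k : ℕ) (r s : ℤ) : Prop where
  two_le : 2 ≤ k
  orderOf_x : orderOf x = 2 ^ k
  conj : y * x * y⁻¹ = x ^ r
  sq : y * y = x ^ s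
  notMem : y ∉ zpowers x
  cover : ∀ g : P, ∃ a : ℤ, g = x ^ a ∨ g = x ^ a * y
  card : Nat.card P = 2 ^ (k + 1)
  dvd_r : (2 : ℤ) ^ (k - 1) ∣ r + 1
  dvd_s : (2 : ℤ) ^ (k - 1) ∣ s
  small : 3 ≤ k ∨ (2 : ℤ) ^ k ∣ r + 1 ∧ (2 : ℤ) ^ k ∣ s

namespace MaxClass

open FusionSystem

variable {P : Type*} [Group P] {x y u : P} {k : ℕ} {r s : ℤ}

open Classical in
/-- The element of `⟨x⟩` that generates together with the element `u` outside `⟨x⟩` a four-group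
(if `u` is an involution) or a quaternion group of order eight. -/
noncomputable def w (x : P) (k : ℕ) (u : P) : P :=
  if u * u = 1 then x ^ (2 : ℤ) ^ (k - 1) else x ^ (2 : ℤ) ^ (k - 2)

/-- The four-group or quaternion group of order eight attached to the element `u` outside `⟨x⟩`. -/
noncomputable def core (x : P) (k : ℕ) (u : P) : Subgroup P := closure {w x k u, u}

theorem w_congr {v : P} (h : u * u = v * v) : w x k u = w x k v := by
  rw [w, w, h]

theorem w_mem : w x k u ∈ zpowers x := by
  rw [w]
  split_ifs
  · exact ⟨_, rfl⟩
  · exact ⟨_, rfl⟩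

variable (D : MaxClass x y k r s)

include D

theorem isPGroup : IsPGroup 2 P := IsPGroup.of_card D.card

theorem zpow_eq_one {a : ℤ} : x ^ a = 1 ↔ (2 : ℤ) ^ k ∣ a := by
  rw [← orderOf_dvd_iff_zpow_eq_one, D.orderOf_x]
  push_cast
  rfl

theorem pow_k : (2 : ℤ) ^ k = 2 ^ (k - 1) * 2 := by
  rw [← pow_succ, Nat.sub_add_cancel (by have := D.two_le; omega)]

theorem pow_k' : (2 : ℤ) ^ (k - 1) = 2 ^ (k - 2) * 2 := by
  have := D.two_le
  rw [← pow_succ, show k - 2 + 1 = k - 1 by omega]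

theorem four_dvd : (4 : ℤ) ∣ r + 1 := by
  rcases D.small with h | h
  · exact (show (4 : ℤ) ∣ 2 ^ (k - 1) from by
      rw [show (4 : ℤ) = 2 ^ 2 by norm_num]; exact pow_dvd_pow 2 (by omega)).trans D.dvd_r
  · exact (show (4 : ℤ) ∣ 2 ^ k from by
      rw [show (4 : ℤ) = 2 ^ 2 by norm_num]; exact pow_dvd_pow 2 D.two_le).trans h.1

theorem exists_odd : ∃ m : ℤ, Odd m ∧ 1 - r = 2 * m := by
  obtain ⟨t, ht⟩ := D.four_dvd
  exact ⟨1 - 2 * t, ⟨-t, by ring⟩, by linarith⟩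

theorem exists_eq (hu : u ∉ zpowers x) : ∃ a : ℤ, u = x ^ a * y := by
  obtain ⟨a, h | h⟩ := D.cover u
  · exact absurd ⟨a, h.symm⟩ hu
  · exact ⟨a, h⟩

theorem mul_inv_mem {v : P} (hu : u ∉ zpowers x) (hv : v ∉ zpowers x) :
    u * v⁻¹ ∈ zpowers x := by
  obtain ⟨a, rfl⟩ := D.exists_eq hu
  obtain ⟨b, rfl⟩ := D.exists_eq hv
  exact ⟨a - b, by simp only; rw [zpow_sub]; group⟩

theorem outer_mul (hu : u ∉ zpowers x) (j : ℤ) : u * x ^ j = x ^ (r * j) * u := by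
  obtain ⟨a, rfl⟩ := D.exists_eq hu
  rw [mul_assoc, mul_zpow_of_conj D.conj, ← mul_assoc, ← mul_assoc, ← zpow_add, ← zpow_add,
    add_comm]

theorem outer_sq (a : ℤ) : x ^ a * y * (x ^ a * y) = x ^ (a * (1 + r) + s) := by
  rw [mul_assoc, ← mul_assoc y, mul_zpow_of_conj D.conj, mul_assoc, D.sq, ← zpow_add, ← zpow_add]
  congr 1
  ring

theorem z_sq : x ^ (2 : ℤ) ^ (k - 1) * x ^ (2 : ℤ) ^ (k - 1) = 1 := by
  rw [← zpow_add, D.zpow_eq_one, D.pow_k, mul_two]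

theorem z_ne_one : x ^ (2 : ℤ) ^ (k - 1) ≠ 1 := by
  rw [Ne, D.zpow_eq_one, D.pow_k]
  intro h
  have := Int.le_of_dvd (by positivity) h
  have : (0 : ℤ) < 2 ^ (k - 1) := by positivity
  linarith

theorem sq_cases (hu : u ∉ zpowers x) :
    u * u = 1 ∨ (3 ≤ k ∧ u * u = x ^ (2 : ℤ) ^ (k - 1)) := by
  obtain ⟨a, rfl⟩ := D.exists_eq hu
  rw [D.outer_sq]
  rcases D.small with h | ⟨h1, h2⟩
  · obtain ⟨b, hb⟩ : (2 : ℤ) ^ (k - 1) ∣ a * (1 + r) + s :=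
      dvd_add ((add_comm r 1 ▸ D.dvd_r).mul_left a) D.dvd_s
    rw [hb, zpow_mul]
    obtain ⟨c, rfl | rfl⟩ := Int.even_or_odd' b
    · left
      rw [zpow_mul, zpow_two, D.z_sq, one_zpow]
    · right
      rw [zpow_add, zpow_mul, zpow_two, D.z_sq, one_zpow, one_mul, zpow_one]
      exact ⟨h, rfl⟩
  · left
    rw [D.zpow_eq_one]
    exact dvd_add ((add_comm r 1 ▸ h1).mul_left a) h2

theorem z_comm (g : P) : x ^ (2 : ℤ) ^ (k - 1) * g = g * x ^ (2 : ℤ) ^ (k - 1) := by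
  by_cases hg : g ∈ zpowers x
  · obtain ⟨a, rfl⟩ := hg
    exact zpow_mul_comm x _ _
  · rw [D.outer_mul hg]
    congr 1
    rw [← mul_inv_eq_one, ← zpow_neg, ← zpow_add, D.zpow_eq_one, D.pow_k]
    obtain ⟨t, ht⟩ := D.four_dvd
    exact ⟨1 - 2 * t, by rw [show r = 4 * t - 1 by linarith]; ring⟩

theorem w_of_sq_eq (h : u * u = 1) : w x k u = x ^ (2 : ℤ) ^ (k - 1) := if_pos h

theorem w_of_sq_ne (h : u * u = x ^ (2 : ℤ) ^ (k - 1)) : w x k u = x ^ (2 : ℤ) ^ (k - 2) :=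
  if_neg (by rw [h]; exact D.z_ne_one)

theorem pair (hu : u ∉ zpowers x) : QuatPair (w x k u) u where
  conj := by
    rcases D.sq_cases hu with h | ⟨hk, h⟩
    · rw [D.w_of_sq_eq h, ← D.z_comm, mul_inv_cancel_right]
      exact eq_inv_of_mul_eq_one_right D.z_sq
    · rw [D.w_of_sq_ne h, D.outer_mul hu, mul_inv_cancel_right, ← zpow_neg, ← mul_inv_eq_one,
        ← zpow_neg, ← zpow_add, D.zpow_eq_one]
      obtain ⟨t, ht⟩ := D.four_dvd
      refine ⟨t, ?_⟩
      rw [D.pow_k, D.pow_k', show r = 4 * t - 1 by linarith]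
      ring
  sq := by
    rcases D.sq_cases hu with h | ⟨hk, h⟩
    · rw [D.w_of_sq_eq h, h, D.z_sq]
    · rw [D.w_of_sq_ne h, h, ← zpow_add, D.pow_k', mul_two]
  four := by
    rcases D.sq_cases hu with h | ⟨hk, h⟩
    · rw [D.w_of_sq_eq h, show 4 = 2 * 2 from rfl, pow_mul, pow_two (x ^ _), D.z_sq, one_pow]
    · rw [D.w_of_sq_ne h, ← zpow_natCast, ← zpow_mul, D.zpow_eq_one, D.pow_k, D.pow_k']
      exact ⟨1, by push_cast; ring⟩
  ne := by
    rcases D.sq_cases hu with h | ⟨hk, h⟩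
    · rw [D.w_of_sq_eq h]
      exact D.z_ne_one
    · rw [D.w_of_sq_ne h]
      intro h1
      refine D.z_ne_one ?_
      rw [D.pow_k', zpow_mul, h1, one_zpow]
  notMem h := hu ((zpowers_le.2 w_mem) h)

omit D in
theorem mem_core_self : u ∈ core x k u := subset_closure (by simp)

omit D in
theorem w_mem_core : w x k u ∈ core x k u := subset_closure (by simp)

/-- A subgroup that contains the central involution and has a nontrivial automorphism of odd order
is a four-group or a quaternion group of order eight: otherwise the automorphism would fix the
generators of the intersection with `⟨x⟩`, which are characterized by their orders. -/
theorem exists_eq_core {Q : Subgroup P} (hz : x ^ (2 : ℤ) ^ (k - 1) ∈ Q) {α : MulAut Q}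
    (hα : Odd (orderOf α)) (hα1 : α ≠ 1) : ∃ u, u ∉ zpowers x ∧ Q = core x k u := by
  obtain ⟨v, hvQ, ⟨b, hb⟩, hv⟩ : ∃ v ∈ Q, v ∈ zpowers x ∧
      ∀ g ∈ Q, g ∈ zpowers x → g ∈ zpowers v := by
    have : IsCyclic (Q ⊓ zpowers x : Subgroup P) :=
      Subgroup.isCyclic_of_le (H := Q ⊓ zpowers x) (H' := zpowers x) inf_le_right
    obtain ⟨v, hv⟩ := IsCyclic.exists_generator (α := (Q ⊓ zpowers x : Subgroup P))
    refine ⟨v, v.2.1, v.2.2, fun g hg hg' => ?_⟩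
    obtain ⟨i, hi⟩ := hv ⟨g, hg, hg'⟩
    exact ⟨i, congrArg Subtype.val hi⟩
  simp only at hb
  have hvk : (⟨v, hvQ⟩ : Q) ^ 2 ^ k = 1 := Subtype.ext (by
    change v ^ 2 ^ k = 1
    rw [← hb, ← zpow_natCast, ← zpow_mul, D.zpow_eq_one]
    exact ⟨b, by push_cast; ring⟩)
  have hcyc : ∀ e : Q, (e : P) ∈ zpowers x → ∃ i : ℤ, e = (⟨v, hvQ⟩ : Q) ^ i :=
    fun e he => by
      obtain ⟨i, hi⟩ := hv e e.2 he
      exact ⟨i, Subtype.ext hi.symm⟩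
  have hfix : α ⟨v, hvQ⟩ ≠ ⟨v, hvQ⟩ := fun h => hα1 (MulEquiv.ext fun e => by
    by_cases he : (e : P) ∈ zpowers x
    · obtain ⟨i, rfl⟩ := hcyc e he
      rw [map_zpow, h, MulAut.one_apply]
    · have he' : (α e : P) ∉ zpowers x := fun h1 => by
        obtain ⟨i, hi⟩ := hcyc _ h1
        refine he ?_
        have : e = (⟨v, hvQ⟩ : Q) ^ i := α.injective (by rw [hi, map_zpow, h])
        rw [this]
        exact (zpowers x).zpow_mem ⟨b, hb⟩ i
      obtain ⟨i, hi⟩ := hcyc (α e * e⁻¹) (D.mul_inv_mem he' he)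
      refine MulAut.apply_eq_of_mul hα (c := (⟨v, hvQ⟩ : Q) ^ i) (by rw [map_zpow, h]) (j := k) ?_ ?_
      · rw [← zpow_natCast, ← zpow_mul, mul_comm, zpow_mul, zpow_natCast, hvk, one_zpow]
      · rw [← hi, inv_mul_cancel_right])
  obtain ⟨u, hu⟩ : ∃ u : P, u = α ⟨v, hvQ⟩ := ⟨_, rfl⟩
  have hux : u ∉ zpowers x := fun h => hfix (by
    obtain ⟨i, hi⟩ := hcyc (α ⟨v, hvQ⟩) (hu ▸ h)
    exact MulAut.apply_eq_of_mem_zpowers hα hvk ⟨i, hi.symm⟩)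
  have huQ : u ∈ Q := hu ▸ (α ⟨v, hvQ⟩).2
  have hsq : u * u = α (⟨v, hvQ⟩ * ⟨v, hvQ⟩) := by rw [map_mul, hu]; rfl
  have key : v ∈ zpowers (w x k u) ∧ w x k u ∈ Q := by
    rcases D.sq_cases hux with h | ⟨hk, h⟩
    · rw [D.w_of_sq_eq h]
      refine ⟨?_, hz⟩
      have h1 : v * v = 1 := by
        rw [hsq] at h
        exact congrArg Subtype.val ((map_eq_one_iff α α.injective).1 (Subtype.ext h))
      rw [← hb, ← zpow_add, D.zpow_eq_one, D.pow_k, ← mul_two] at h1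
      obtain ⟨c, rfl⟩ := Int.dvd_of_mul_dvd_mul_right two_ne_zero h1
      exact ⟨c, by rw [← hb, zpow_mul]⟩
    · rw [D.w_of_sq_ne h]
      have h1 : v * v ≠ 1 := fun h1 => by
        rw [hsq] at h
        refine D.z_ne_one (h.symm.trans ?_)
        rw [show (⟨v, hvQ⟩ * ⟨v, hvQ⟩ : Q) = 1 from Subtype.ext h1, map_one]
        rfl
      have h2 : v * v * (v * v) = 1 := by
        have h3 : α ((⟨v, hvQ⟩ * ⟨v, hvQ⟩) * (⟨v, hvQ⟩ * ⟨v, hvQ⟩)) = 1 := Subtype.ext (by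
          rw [map_mul]
          change (α _ : P) * (α _ : P) = 1
          rw [← hsq, h, D.z_sq])
        exact congrArg Subtype.val ((map_eq_one_iff α α.injective).1 h3)
      rw [← hb, ← zpow_add, ← zpow_add, D.zpow_eq_one, D.pow_k, D.pow_k',
        show b + b + (b + b) = b * 2 * 2 by ring] at h2
      obtain ⟨c, hc⟩ := Int.dvd_of_mul_dvd_mul_right two_ne_zero
        (Int.dvd_of_mul_dvd_mul_right two_ne_zero h2)
      have hvc : v = (x ^ (2 : ℤ) ^ (k - 2)) ^ c := by rw [← hb, hc, zpow_mul]
      refine ⟨⟨c, hvc.symm⟩, ?_⟩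
      -- the exponent `c` is odd, so `c ^ 2` is congruent to `1` modulo `4`
      obtain ⟨d, rfl | rfl⟩ := Int.even_or_odd' c
      · refine absurd ?_ h1
        rw [← hb, ← zpow_add, D.zpow_eq_one, hc, D.pow_k, D.pow_k']
        exact ⟨d, by ring⟩
      · have h3 : x ^ (2 : ℤ) ^ (k - 2) = v ^ (2 * d + 1) := by
          rw [hvc, ← zpow_mul, ← zpow_mul, ← mul_inv_eq_one, ← zpow_neg, ← zpow_add, D.zpow_eq_one,
            D.pow_k, D.pow_k']
          exact ⟨-d * d - d, by ring⟩
        rw [h3]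
        exact zpow_mem hvQ _
  refine ⟨u, hux, le_antisymm (fun g hg => ?_) ?_⟩
  · have h1 : ∀ g ∈ Q, g ∈ zpowers x → g ∈ core x k u := fun g hg hg' =>
      (zpowers_le.2 w_mem_core) ((zpowers_le.2 key.1) (hv g hg hg'))
    by_cases hgx : g ∈ zpowers x
    · exact h1 g hg hgx
    · have h2 := h1 (g * u⁻¹) (mul_mem hg (inv_mem huQ)) (D.mul_inv_mem hgx hux)
      simpa using mul_mem h2 (mem_core_self (x := x) (k := k) (u := u))
  · refine (closure_le _).2 ?_
    rintro g (hg | hg)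
    · rw [hg]; exact key.2
    · rw [Set.mem_singleton_iff.1 hg]; exact huQ

theorem isPGroup_aut_top [Finite P] (F : FusionSystem P) : IsPGroup 2 (F.aut ⊤) := by
  by_contra h
  obtain ⟨α, hα1, hα⟩ := exists_coprime_of_not_isPGroup h
  obtain ⟨u, hu, h1⟩ := D.exists_eq_core (Q := ⊤) (mem_top _) (α := (α : MulAut _))
    (by rw [Subgroup.orderOf_coe]; exact Nat.odd_of_not_two_dvd hα)
    (fun h => hα1 (Subtype.ext h))
  have hx : x ∈ core x k u := h1 ▸ mem_top x
  obtain ⟨a, ha | ha⟩ := (D.pair hu).mem_closure.1 hx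
  · have h4 : x ^ (2 : ℤ) ^ 2 = 1 := by
      nth_rewrite 1 [ha]
      rw [← zpow_mul, mul_comm, zpow_mul, show (2 : ℤ) ^ 2 = ((4 : ℕ) : ℤ) by norm_num,
        zpow_natCast, (D.pair hu).four, one_zpow]
    rw [D.zpow_eq_one] at h4
    have hk : k = 2 := le_antisymm
      ((pow_dvd_pow_iff (a := (2 : ℤ)) (by norm_num) (by simp [Int.isUnit_iff])).1 h4) D.two_le
    rcases D.sq_cases hu with h5 | ⟨h5, -⟩
    · rw [D.w_of_sq_eq h5] at ha
      have h6 : x ^ (2 : ℤ) = 1 := by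
        nth_rewrite 1 [ha]
        rw [← zpow_mul, mul_comm, zpow_mul, zpow_two, D.z_sq, one_zpow]
      rw [D.zpow_eq_one, hk] at h6
      norm_num at h6
    · omega
  · refine hu ?_
    have h2 : u = (w x k u) ^ (-a) * x := by
      rw [zpow_neg]; exact eq_inv_mul_of_mul_eq ha.symm
    rw [h2]
    exact mul_mem (zpow_mem w_mem _) (mem_zpowers x)

theorem conj_outer (hu : u ∉ zpowers x) {m : ℤ} (hm : 1 - r = 2 * m) (c : ℤ) :
    x ^ c * u * (x ^ c)⁻¹ = x ^ (2 * m * c) * u := by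
  rw [mul_assoc, ← zpow_neg, D.outer_mul hu, ← mul_assoc, ← zpow_add]
  congr 2
  rw [← hm]
  ring

/-- Each element outside `⟨x⟩` is conjugate to `y` or `xy`. -/
theorem exists_conj (hu : u ∉ zpowers x) :
    ∃ c : ℤ, x ^ c * u * (x ^ c)⁻¹ = y ∨ x ^ c * u * (x ^ c)⁻¹ = x * y := by
  obtain ⟨m, hm, hmr⟩ := D.exists_odd
  obtain ⟨a, rfl⟩ := D.exists_eq hu
  obtain ⟨p, q, hpq⟩ : IsCoprime m ((2 : ℤ) ^ k) :=
    IsCoprime.pow_right (by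
      obtain ⟨t, ht⟩ := hm
      exact ⟨1, -t, by rw [ht]; ring⟩)
  obtain ⟨b, rfl | rfl⟩ := Int.even_or_odd' a
  · refine ⟨-(p * b), Or.inl ?_⟩
    rw [D.conj_outer hu hmr, ← mul_assoc, ← zpow_add]
    refine (mul_eq_right).2 (D.zpow_eq_one.2 ⟨2 * b * q, ?_⟩)
    linear_combination (-2 * b) * hpq
  · refine ⟨-(p * b), Or.inr ?_⟩
    rw [D.conj_outer hu hmr, ← mul_assoc, ← zpow_add, ← add_assoc, zpow_add_one, mul_assoc]
    refine (mul_eq_right).2 (D.zpow_eq_one.2 ⟨2 * b * q, ?_⟩)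
    linear_combination (-2 * b) * hpq

theorem mul_notMem : x * y ∉ zpowers x := fun h =>
  D.notMem ((mul_mem_cancel_left (mem_zpowers x)).1 h)

theorem isConj_core (F : FusionSystem P) (hu : u ∉ zpowers x) {c : ℤ} {v : P}
    (h : x ^ c * u * (x ^ c)⁻¹ = v) : F.IsConj (core x k u) (core x k v) := by
  have h1 : u * u = v * v := by
    have h2 : v * v = x ^ c * (u * u) * (x ^ c)⁻¹ := by rw [← h]; group
    rw [h2]
    rcases D.sq_cases hu with h3 | ⟨-, h3⟩
    · rw [h3]; group
    · rw [h3, ← D.z_comm, mul_inv_cancel_right]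
  rw [core, core, ← w_congr h1]
  refine (D.pair hu).isConj_closure F ?_ h
  obtain ⟨a, ha⟩ := w_mem (x := x) (k := k) (u := u)
  rw [← ha]
  exact zpow_mul_comm x _ _

theorem notMem_of_eq {v : P} (h : v = y ∨ v = x * y) : v ∉ zpowers x := by
  rcases h with rfl | rfl
  exacts [D.notMem, D.mul_notMem]

theorem exists_w_eq (hu : u ∉ zpowers x) : ∃ c : ℤ, w x k u = x ^ (2 * c) := by
  rcases D.sq_cases hu with h | ⟨hk, h⟩
  · exact ⟨2 ^ (k - 2), by rw [D.w_of_sq_eq h, D.pow_k', mul_comm]⟩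
  · refine ⟨2 ^ (k - 3), ?_⟩
    rw [D.w_of_sq_ne h, ← pow_succ', show k - 3 + 1 = k - 2 by omega]

theorem aut_eq_top [Finite P] {F : FusionSystem P} (hu : u ∉ zpowers x)
    (hF : F.HasCoprimeAut 2 (core x k u)) : F.aut (core x k u) = ⊤ := by
  obtain ⟨m, hm, hmr⟩ := D.exists_odd
  obtain ⟨c, hc⟩ := D.exists_w_eq hu
  refine (D.pair hu).aut_eq_top hF hm (d := x ^ c) ?_ ?_
  · rw [hc]
    exact zpow_mul_comm x _ _
  · rw [D.conj_outer hu hmr, hc, ← zpow_mul]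
    congr 2
    ring

/-- Some essential subgroup is conjugate to the four-group or quaternion group attached to `u`. -/
def Has (F : FusionSystem P) (x : P) (k : ℕ) (u : P) : Prop :=
  F.HasEssentialConj 2 (core x k u)

variable [Finite P] {F F' : FusionSystem P}

theorem exists_of_isEssential {Q : Subgroup P} (hQ : F.IsEssential 2 Q) :
    ∃ u, u ∉ zpowers x ∧ Q = core x k u := by
  obtain ⟨α, -, hα1, hα⟩ := hQ.hasCoprimeAut
  refine D.exists_eq_core (hQ.1 Q (FusionSystem.IsConj.refl F Q) ?_) (Nat.odd_of_not_two_dvd hα) hα1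
  exact mem_centralizer_iff.2 fun g _ => (D.z_comm g).symm

theorem isConj_or (Q : Subgroup P) (hQ : F.IsEssential 2 Q) :
    F.IsConj Q (core x k y) ∨ F.IsConj Q (core x k (x * y)) := by
  obtain ⟨u, hu, rfl⟩ := D.exists_of_isEssential hQ
  obtain ⟨c, h⟩ := D.exists_conj hu
  exact h.imp (D.isConj_core F hu) (D.isConj_core F hu)

theorem aut_top_le (hF : F.IsSaturated 2) : F.aut ⊤ ≤ autP ⊤ :=
  hF.aut_top_le_of_isPGroup (D.isPGroup_aut_top F)

/-- A saturated fusion system is determined by the question which of the two four-groups or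
quaternion groups have nontrivial automorphisms of odd order. -/
theorem eq_of_has_iff (hF : F.IsSaturated 2) (hF' : F'.IsSaturated 2)
    (h : ∀ v, v = y ∨ v = x * y → (Has F x k v ↔ F'.HasCoprimeAut 2 (core x k v))) : F = F' := by
  have key : ∀ {F F' : FusionSystem P}, F.IsSaturated 2 → (∀ v, v = y ∨ v = x * y → Has F x k v →
      F'.HasCoprimeAut 2 (core x k v)) → ∀ Q f, F.Mor Q f → F'.Mor Q f := fun {F F'} hF h Q f =>
    hF.mor_of_aut_le D.isPGroup ((D.aut_top_le hF).trans (autP_le_aut F' ⊤)) fun Q hQ => by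
      obtain ⟨u, hu, rfl⟩ := D.exists_of_isEssential hQ
      obtain ⟨c, hc⟩ := D.exists_conj hu
      have h1 := h _ hc ⟨_, hQ, D.isConj_core F hu rfl⟩
      rw [D.aut_eq_top hu (h1.of_isConj (D.isConj_core F' hu rfl).symm)]
      exact le_top
  exact ext_of_mor fun Q f => ⟨key hF (fun v hv => (h v hv).1) Q f, key hF' (fun v hv hv' => by
    obtain ⟨R, hR, hRv⟩ := hv'
    obtain ⟨S, hS, hSv⟩ := (h v hv).2 (hR.hasCoprimeAut.of_isConj hRv)
    exact hS.hasCoprimeAut.of_isConj hSv) Q f⟩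

/-- The two four-groups or quaternion groups are not conjugate in a saturated fusion system: they
are not conjugate in `P`, since only one of them is contained in `⟨x ^ 2, y⟩`. -/
theorem not_isConj (hF : F.IsSaturated 2) : ¬ F.IsConj (core x k y) (core x k (x * y)) := by
  intro hc
  obtain ⟨g, hg⟩ := hF.exists_map_conj_eq D.isPGroup
    (D.aut_top_le hF) (fun Q hQ => (D.isConj_or Q hQ).elim (·.card_eq)
      (·.card_eq.trans hc.card_eq.symm)) hc rfl
  obtain ⟨e, he, heg⟩ := hg ▸ (mem_core_self : x * y ∈ core x k (x * y))
  replace heg : g * e * g⁻¹ = x * y := heg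
  obtain ⟨m, -, hm⟩ := D.exists_odd
  obtain ⟨c, hc⟩ := D.exists_w_eq D.notMem
  have h2 : ∀ b : ℤ, x ^ (2 * b) * y ≠ x * y := fun b hb => by
    have h3 : x ^ (2 * b - 1) = 1 := by
      rw [zpow_sub, zpow_one, mul_right_cancel hb, mul_inv_cancel]
    rw [D.zpow_eq_one] at h3
    have h4 : (2 : ℤ) ∣ 2 * b - 1 := (dvd_pow_self 2 (by have := D.two_le; omega)).trans h3
    omega
  have h3 : ∀ b : ℤ, x ^ b ≠ x * y := fun b hb => D.mul_notMem ⟨b, hb⟩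
  -- conjugation by `x` preserves the form `x ^ (2 * b) * y`, and so does conjugation by `y`
  have h4 : ∀ a b : ℤ, x ^ a * (x ^ (2 * b) * y) * (x ^ a)⁻¹ = x ^ (2 * (b + m * a)) * y :=
    fun a b => by
      have h5 : x ^ (2 * b) * y ∉ zpowers x := fun h => D.notMem
        ((mul_mem_cancel_left (zpow_mem (mem_zpowers x) _)).1 h)
      rw [D.conj_outer h5 hm, ← mul_assoc, ← zpow_add]
      congr 2
      ring
  obtain ⟨i, rfl | rfl⟩ := (D.pair D.notMem).mem_closure.1 he
  · rw [hc, ← zpow_mul] at heg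
    obtain ⟨a, rfl | rfl⟩ := D.cover g
    · rw [zpow_mul_comm, mul_inv_cancel_right] at heg
      exact h3 _ heg
    · rw [mul_assoc (x ^ a), mul_zpow_of_conj D.conj, mul_inv_rev, mul_assoc, mul_assoc _ y,
        mul_inv_cancel_left, ← mul_assoc, zpow_mul_comm, mul_inv_cancel_right] at heg
      exact h3 _ heg
  · rw [hc, ← zpow_mul] at heg
    obtain ⟨a, rfl | rfl⟩ := D.cover g
    · rw [mul_assoc 2 c i, h4] at heg
      exact h2 _ heg
    · refine h2 (c * i * r + m * a) ?_
      rw [← h4, ← heg]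
      have h5 : y * (x ^ (2 * c * i) * y) * y⁻¹ = x ^ (2 * (c * i * r)) * y := by
        rw [← mul_assoc, mul_inv_cancel_right, mul_zpow_of_conj D.conj]
        congr 2
        ring
      rw [← h5]
      group

theorem rank_zero (hF : F.IsSaturated 2) (h1 : ¬ Has F x k y) (h2 : ¬ Has F x k (x * y)) :
    F.essentialRank 2 = 0 ∧ F.IsFusionSystemOf 2 P := by
  have h : ∀ Q, ¬ F.IsEssential 2 Q := fun Q hQ => by
    rcases D.isConj_or Q hQ with hv | hv
    exacts [h1 ⟨Q, hQ, hv⟩, h2 ⟨Q, hQ, hv⟩]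
  exact ⟨essentialRank_eq_zero h, hF.isFusionSystemOf_self D.isPGroup h (D.aut_top_le hF)⟩

theorem rank_one_left (h1 : Has F x k y) (h2 : ¬ Has F x k (x * y)) : F.essentialRank 2 = 1 :=
  essentialRank_eq_one D.isConj_or h1 h2

theorem rank_one_right (h1 : ¬ Has F x k y) (h2 : Has F x k (x * y)) : F.essentialRank 2 = 1 :=
  essentialRank_eq_one (fun Q hQ => (D.isConj_or Q hQ).symm) h2 h1

theorem rank_two (hF : F.IsSaturated 2) (h1 : Has F x k y) (h2 : Has F x k (x * y)) :
    F.essentialRank 2 = 2 :=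
  essentialRank_eq_two D.isConj_or h1 h2 (D.not_isConj hF)

/-- Exchange of the roles of `y` and `xy`. -/
theorem swap : MaxClass x (x * y) k r (1 + r + s) where
  two_le := D.two_le
  orderOf_x := D.orderOf_x
  conj := by
    have := D.outer_mul D.mul_notMem 1
    rw [zpow_one, mul_one] at this
    rw [this, mul_inv_cancel_right]
  sq := by simpa using D.outer_sq 1
  notMem := D.mul_notMem
  cover g := by
    obtain ⟨a, h | h⟩ := D.cover g
    · exact ⟨a, Or.inl h⟩
    · exact ⟨a - 1, Or.inr (by rw [← mul_assoc, zpow_sub_one, inv_mul_cancel_right, h])⟩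
  card := D.card
  dvd_r := D.dvd_r
  dvd_s := dvd_add (add_comm r 1 ▸ D.dvd_r) D.dvd_s
  small := D.small.imp_right fun h => ⟨h.1, dvd_add (add_comm r 1 ▸ h.1) h.2⟩

/-- The data exchanged twice: `x ^ 2 * y` is conjugate to `y`. -/
theorem has_swap_iff : Has F x k (x * (x * y)) ↔ Has F x k y := by
  obtain ⟨m, hm, hmr⟩ := D.exists_odd
  have hu : x * (x * y) ∉ zpowers x := D.swap.mul_notMem
  obtain ⟨c, h | h⟩ := D.exists_conj hu
  · have h1 := D.isConj_core F hu h
    exact ⟨fun ⟨Q, hQ, hQ'⟩ => ⟨Q, hQ, hQ'.trans h1⟩, fun ⟨Q, hQ, hQ'⟩ => ⟨Q, hQ, hQ'.trans h1.symm⟩⟩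
  · rw [D.conj_outer hu hmr, ← mul_assoc, ← mul_assoc] at h
    have h1 := mul_right_cancel h
    rw [← zpow_add_one, mul_eq_right, D.zpow_eq_one] at h1
    have h4 : (2 : ℤ) ∣ 2 * m * c + 1 := (dvd_pow_self 2 (by have := D.two_le; omega)).trans h1
    rw [mul_assoc] at h4
    omega

end MaxClass

/-! ### Realization by finite groups -/

section Rotates

variable {G : Type*} [Group G]

/-- Some element of `G` permutes `w`, `u` and `wu` cyclically (up to sign in quaternion groups). -/
def Rotates (w u : G) : Prop := ∃ g : G, g * w * g⁻¹ = u ∧ g * u * g⁻¹ = w * u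

/-- Some normal subgroup of `G` contains `w` and not `u`. -/
def Separated (w u : G) : Prop := ∃ M : Subgroup G, M.Normal ∧ w ∈ M ∧ u ∉ M

theorem Rotates.map {H : Type*} [Group H] {w u : G} (h : Rotates w u) (f : G →* H) :
    Rotates (f w) (f u) := by
  obtain ⟨g, h1, h2⟩ := h
  exact ⟨f g, by rw [← h1]; simp, by rw [← map_inv, ← map_mul, ← map_mul, h2, map_mul]⟩

theorem separated_of_hom {H : Type*} [Group H] {w u : G} (f : G →* H) (hw : f w = 1)
    (hu : f u ≠ 1) : Separated w u :=
  ⟨f.ker, f.normal_ker, hw, hu⟩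

theorem not_dvd_index_range {P : Type*} [Group P] [Finite G] {i : P →* G}
    (hi : Function.Injective i) {m : ℕ} (hP : Nat.card P = 2 ^ m)
    (hG : ¬ 2 ^ (m + 1) ∣ Nat.card G) : ¬ 2 ∣ i.range.index := fun h => hG (by
  rw [← i.range.card_mul_index, Nat.card_congr (MonoidHom.ofInjective hi).toEquiv.symm, hP, pow_succ]
  exact mul_dvd_mul_left _ h)

theorem not_dvd_of_eq_mul_odd {n m c : ℕ} (hc : Odd c) (h : n = 2 ^ m * c) : ¬ 2 ^ (m + 1) ∣ n := by
  rw [h, pow_succ, Nat.mul_dvd_mul_iff_left (by positivity)]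
  exact hc.not_two_dvd_nat

end Rotates

namespace MaxClass

open FusionSystem

variable {P : Type*} [Group P] {x y : P} {k : ℕ} {r s : ℤ} (D : MaxClass x y k r s)

include D

theorem metacyclic_eq_top : metacyclic D.conj D.sq = ⊤ :=
  (Subgroup.eq_top_iff' _).2 D.cover

/-- A saturated fusion system on `P` is the fusion system of a group `G` with a subgroup of odd
index that is isomorphic to `P` if `G` has elements of order three on the right four-groups or
quaternion groups. -/
theorem isFusionSystemOf [Finite P] {F : FusionSystem P} (hF : F.IsSaturated 2)
    {G : Type*} [Group G] [Finite G] {X Y : G} (ho : orderOf X = 2 ^ k)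
    (hc : Y * X * Y⁻¹ = X ^ r) (hs : Y * Y = X ^ s)
    (hcard : ¬ 2 ^ (k + 2) ∣ Nat.card G)
    (h1 : Has F x k y ∧ Rotates (w X k Y) Y ∨ ¬ Has F x k y ∧ Separated (w X k Y) Y)
    (h2 : Has F x k (x * y) ∧ Rotates (w X k (X * Y)) (X * Y) ∨
      ¬ Has F x k (x * y) ∧ Separated (w X k (X * Y)) (X * Y)) :
    F.IsFusionSystemOf 2 G := by
  have hY : Y ∉ zpowers X := by
    rintro ⟨a, rfl⟩
    simp only at hc
    obtain ⟨t, ht⟩ := D.four_dvd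
    have h3 : X ^ (1 - r) = 1 := by
      rw [zpow_sub, zpow_one, ← hc, ← zpow_add_one, add_comm a 1, zpow_one_add,
        mul_inv_cancel_right, mul_inv_cancel]
    rw [← orderOf_dvd_iff_zpow_eq_one, ho] at h3
    have h4 : ((2 ^ 2 : ℕ) : ℤ) ∣ 1 - r :=
      (Int.natCast_dvd_natCast.2 (pow_dvd_pow 2 D.two_le)).trans h3
    push_cast at h4
    omega
  obtain ⟨i, hi, hx, hy⟩ := exists_monoidHom_of_metacyclic D.conj D.sq hc hs
    (by rw [D.orderOf_x, ho]) D.notMem hY D.metacyclic_eq_top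
  have hidx := not_dvd_index_range hi D.card hcard
  have hw : ∀ v, i (w x k v) = w (i x) k (i v) := fun v => by
    rw [w, w, ← map_mul, map_eq_one_iff i hi]
    split_ifs <;> rw [map_zpow]
  have key : ∀ v, v ∉ zpowers x →
      (Has F x k v ∧ Rotates (w (i x) k (i v)) (i v) ∨
        ¬ Has F x k v ∧ Separated (w (i x) k (i v)) (i v)) →
      (Has F x k v ↔ (ofEmb i hi).HasCoprimeAut 2 (core x k v)) := by
    intro v hv h
    rw [← hw] at h
    rcases h with ⟨h, g, h3, h4⟩ | ⟨h, M, hM, hwM, huM⟩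
    · exact iff_of_true h ((D.pair hv).hasCoprimeAut h3 (by rw [h4, map_mul]))
    · exact iff_of_false h fun h3 => huM ((D.pair hv).mem_of_hasCoprimeAut h3 hM hwM)
  have e : F = ofEmb i hi := by
    refine D.eq_of_has_iff hF (isSaturated_ofEmb D.isPGroup hidx) fun v hv => ?_
    refine key v (D.notMem_of_eq hv) ?_
    rcases hv with rfl | rfl
    · rwa [hx, hy]
    · rwa [map_mul, hx, hy]
  rw [e]
  exact isFusionSystemOf_ofEmb D.isPGroup hidx

end MaxClass

section Matrix

open Matrix

/-- In a quaternion group generated by `I` and `J` in `SL_2` over a field of characteristic different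
from two, the matrix `(1 + I + J + IJ) / 2` permutes `I`, `J` and `IJ` cyclically. -/
theorem rotates_of_sl_two {K : Type*} [Field K] (h2 : (2 : K) ≠ 0) {I J : SL(2, K)}
    (hI : (I : 𝕄 K) * I = -1) (hJ : (J : 𝕄 K) * J = -1)
    (hJI : (J : 𝕄 K) * I = -(I * J)) : Rotates I J := by
  have hadj : ∀ A : SL(2, K), (A : 𝕄 K) * A = -1 →
      adjugate (A : 𝕄 K) = -A := fun A hA => by
    have h3 : (A : 𝕄 K) * adjugate (A : 𝕄 K) = 1 := by
      rw [mul_adjugate, A.2, one_smul]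
    calc adjugate (A : 𝕄 K)
        = -((A : 𝕄 K) * A) * adjugate (A : 𝕄 K) := by
          rw [hA, neg_neg, one_mul]
      _ = -A := by rw [neg_mul, mul_assoc, h3, mul_one]
  have hIJ : ((I * J : SL(2, K)) : 𝕄 K) *
      (I * J : SL(2, K)) = -1 := by
    rw [Matrix.SpecialLinearGroup.coe_mul, mul_assoc, ← mul_assoc (J : 𝕄 K), hJI,
      neg_mul, mul_neg, mul_assoc, hJ, mul_neg, mul_neg, neg_neg, mul_one, hI]
  have aI := hadj I hI
  have aJ := hadj J hJ
  have aIJ := hadj _ hIJ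
  rw [Matrix.SpecialLinearGroup.coe_mul] at aIJ
  obtain ⟨A, hA⟩ : ∃ A, A = (I : 𝕄 K) := ⟨_, rfl⟩
  obtain ⟨B, hB⟩ : ∃ B, B = (J : 𝕄 K) := ⟨_, rfl⟩
  rw [← hA] at hI hJI aI aIJ
  rw [← hB] at hJ hJI aJ aIJ
  have hA' : ∀ C, A * (A * C) = -C := fun C => by rw [← mul_assoc, hI, neg_one_mul]
  have hB' : ∀ C, B * (B * C) = -C := fun C => by rw [← mul_assoc, hJ, neg_one_mul]
  have hBA' : ∀ C, B * (A * C) = -(A * (B * C)) := fun C => by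
    rw [← mul_assoc, hJI, neg_mul, mul_assoc]
  have hadd : ∀ M N : 𝕄 K, adjugate (M + N) = adjugate M + adjugate N :=
    fun M N => by
      rw [adjugate_fin_two, adjugate_fin_two, adjugate_fin_two]
      ext i j
      fin_cases i <;> fin_cases j <;> simp <;> ring
  have h4 : (1 + A + B + A * B) * (1 - A - B - A * B) = (4 : K) • 1 := by
    simp only [add_mul, mul_sub, mul_assoc, hI, hJ, hJI, hA', hBA', mul_neg,
      one_mul, mul_one, neg_neg]
    rw [show (4 : K) = 1 + 1 + 1 + 1 by norm_num]
    simp only [add_smul, one_smul]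
    abel
  have hω : ((2 : K)⁻¹ • (1 + A + B + A * B)).det = 1 := by
    have h5 := mul_adjugate ((2 : K)⁻¹ • (1 + A + B + A * B))
    have h6 : adjugate ((2 : K)⁻¹ • (1 + A + B + A * B)) = (2 : K)⁻¹ • (1 - A - B - A * B) := by
      rw [adjugate_smul, hadd, hadd, hadd, adjugate_one, aI, aJ, aIJ]
      simp [sub_eq_add_neg]
    rw [h6, smul_mul_smul_comm, h4, smul_smul] at h5
    have h7 := congrFun (congrFun h5 0) 0
    simp only [Matrix.smul_apply, one_apply_eq, smul_eq_mul, mul_one] at h7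
    rw [← h7]
    field_simp
    norm_num
  obtain ⟨g, hg⟩ : ∃ g : SL(2, K), (g : 𝕄 K) =
    (2 : K)⁻¹ • (1 + A + B + A * B) := ⟨⟨_, hω⟩, rfl⟩
  refine ⟨g, ?_, ?_⟩
  · rw [mul_inv_eq_iff_eq_mul]
    refine Subtype.ext ?_
    change (g : 𝕄 K) * (I : 𝕄 K) =
      (J : 𝕄 K) * g
    rw [hg, ← hA, ← hB, smul_mul_assoc, mul_smul_comm]
    congr 1
    simp only [mul_add, add_mul, mul_assoc, hI, hJ, hJI, hBA', mul_neg, one_mul, mul_one, neg_neg]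
    simp only [hA']
    abel
  · rw [mul_inv_eq_iff_eq_mul]
    refine Subtype.ext ?_
    change (g : 𝕄 K) * (J : 𝕄 K) =
      (I : 𝕄 K) * (J : 𝕄 K) * g
    rw [hg, ← hA, ← hB, smul_mul_assoc, mul_smul_comm]
    congr 1
    simp only [mul_add, add_mul, mul_assoc, hI, hJ, hJI, hBA', mul_neg, one_mul, mul_one, neg_neg]
    simp only [hA', neg_neg]
    abel

variable {K : Type*} [Field K] [Finite K]

theorem card_gl (n : ℕ) : Nat.card (GL (Fin n) K) =
    ∏ i : Fin n, (Nat.card K ^ n - Nat.card K ^ (i : ℕ)) := by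
  have := Fintype.ofFinite K
  rw [card_GL_field, Nat.card_eq_fintype_card]

theorem card_sl_mul (n : ℕ) [NeZero n] : Nat.card (Matrix.SpecialLinearGroup (Fin n) K) * (Nat.card K - 1) =
    Nat.card (GL (Fin n) K) := by
  have h1 : (Matrix.SpecialLinearGroup.toGL : Matrix.SpecialLinearGroup (Fin n) K →* GL (Fin n) K).range =
      (GeneralLinearGroup.det : GL (Fin n) K →* Kˣ).ker := by
    ext g
    constructor
    · rintro ⟨A, rfl⟩
      exact Units.ext A.2
    · intro hg
      exact ⟨⟨g, congrArg Units.val hg⟩, Units.ext rfl⟩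
  rw [Nat.card_congr (MonoidHom.ofInjective Matrix.SpecialLinearGroup.toGL_injective).toEquiv, h1,
    ← Nat.card_units, ← Subgroup.card_mul_index (GeneralLinearGroup.det : GL (Fin n) K →* Kˣ).ker,
    Subgroup.index_ker, MonoidHom.range_eq_top.2 GeneralLinearGroup.det_surjective,
    Subgroup.card_top]

/-- The order of `SL_2(q)` and `PGL_2(q)`. -/
def cardSL (q : ℕ) : ℕ := (q - 1) * ((q + 1) * q)

theorem card_gl_two : Nat.card (GL (Fin 2) K) = (Nat.card K - 1) * cardSL (Nat.card K) := by
  rw [card_gl, Fin.prod_univ_two, cardSL]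
  have h1 : 1 < Nat.card K := Finite.one_lt_card
  obtain ⟨q, hq⟩ := Nat.exists_eq_add_of_lt h1
  rw [hq]
  have e1 : (1 + q + 1) ^ 2 - (1 + q + 1) ^ ((0 : Fin 2) : ℕ) = (1 + q) * (1 + q + 1 + 1) := by
    refine Nat.sub_eq_of_eq_add ?_
    simp only [Fin.val_zero, pow_zero]
    ring
  have e2 : (1 + q + 1) ^ 2 - (1 + q + 1) ^ ((1 : Fin 2) : ℕ) = (1 + q) * (1 + q + 1) := by
    refine Nat.sub_eq_of_eq_add ?_
    simp only [Fin.val_one, pow_one]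
    ring
  rw [e1, e2, show 1 + q + 1 - 1 = 1 + q by omega]
  ring

theorem card_sl_two : Nat.card SL(2, K) = cardSL (Nat.card K) := by
  have h1 : 0 < Nat.card K - 1 := by have : 1 < Nat.card K := Finite.one_lt_card; omega
  refine Nat.eq_of_mul_eq_mul_right h1 ?_
  rw [card_sl_mul, card_gl_two, mul_comm]

theorem card_sl_three : Nat.card SL(3, K) = (Nat.card K - 1) *
    ((Nat.card K - 1) * ((Nat.card K + 1) *
      (Nat.card K ^ 3 * (Nat.card K * (Nat.card K + 1) + 1)))) := by
  have h1 : 1 < Nat.card K := Finite.one_lt_card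
  have h2 := card_sl_mul (K := K) 3
  rw [card_gl, Fin.prod_univ_three] at h2
  obtain ⟨q, hq⟩ := Nat.exists_eq_add_of_lt h1
  rw [hq] at h2 ⊢
  have e1 : (1 + q + 1) ^ 3 - (1 + q + 1) ^ ((0 : Fin 3) : ℕ) =
      (1 + q) * ((1 + q + 1) * (1 + q + 1 + 1) + 1) := by
    refine Nat.sub_eq_of_eq_add ?_
    simp only [Fin.val_zero, pow_zero]
    ring
  have e2 : (1 + q + 1) ^ 3 - (1 + q + 1) ^ ((1 : Fin 3) : ℕ) =
      (1 + q) * (1 + q + 1 + 1) * (1 + q + 1) := by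
    refine Nat.sub_eq_of_eq_add ?_
    simp only [Fin.val_one, pow_one]
    ring
  have e3 : (1 + q + 1) ^ 3 - (1 + q + 1) ^ ((2 : Fin 3) : ℕ) = (1 + q) * (1 + q + 1) ^ 2 := by
    refine Nat.sub_eq_of_eq_add ?_
    simp only [Fin.val_two]
    ring
  rw [e1, e2, e3, show 1 + q + 1 - 1 = 1 + q by omega] at h2
  rw [show 1 + q + 1 - 1 = 1 + q by omega]
  refine Nat.eq_of_mul_eq_mul_right (show 0 < 1 + q by omega) ?_
  rw [h2]
  ring

theorem card_pgl_two_dvd : Nat.card (ProjGenLinGroup (Fin 2) K) ∣ cardSL (Nat.card K) := by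
  have h1 : 0 < Nat.card K - 1 := by have : 1 < Nat.card K := Finite.one_lt_card; omega
  have h2 := Subgroup.card_eq_card_quotient_mul_card_subgroup (Subgroup.center (GL (Fin 2) K))
  have h3 : Nat.card K - 1 ∣ Nat.card (Subgroup.center (GL (Fin 2) K)) := by
    have h4 : (glScalar : Kˣ →* GL (Fin 2) K).range ≤
        Subgroup.center (GL (Fin 2) K) := by
      rw [GeneralLinearGroup.center_eq_range_scalar]
    have h5 := Subgroup.card_dvd_of_le h4
    have h6 : Function.Injective (glScalar : Kˣ →* GL (Fin 2) K) :=
      fun a b hab => by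
        have := congrArg (fun g : GL (Fin 2) K => (g : 𝕄 K) 0 0) hab
        exact Units.ext (by simpa using this)
    rwa [Nat.card_congr (MonoidHom.ofInjective h6).toEquiv.symm, Nat.card_units] at h5
  rw [card_gl_two] at h2
  refine Nat.dvd_of_mul_dvd_mul_right h1 ?_
  rw [mul_comm (cardSL _), h2]
  exact mul_dvd_mul_left _ h3

theorem two_mul_card_psl_two_dvd (h2 : (2 : K) ≠ 0) :
    2 * Nat.card PSL(2, K) ∣ cardSL (Nat.card K) := by
  have h3 := Subgroup.card_eq_card_quotient_mul_card_subgroup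
    (Subgroup.center SL(2, K))
  rw [card_sl_two] at h3
  rw [h3, mul_comm 2]
  refine mul_dvd_mul_left _ ?_
  let c : Subgroup.center SL(2, K) := ⟨-1, by
    rw [Matrix.SpecialLinearGroup.mem_center_iff]
    refine ⟨-1, by simp, ?_⟩
    rw [Matrix.SpecialLinearGroup.coe_neg, Matrix.SpecialLinearGroup.coe_one]
    ext i j
    fin_cases i <;> fin_cases j <;> simp⟩
  have hc : orderOf c = 2 := by
    have : Fact (Nat.Prime 2) := ⟨Nat.prime_two⟩
    refine orderOf_eq_prime ?_ fun h => h2 ?_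
    · refine Subtype.ext ?_
      change (-1 : SL(2, K)) ^ 2 = 1
      rw [neg_one_sq]
    · have h4 : ((-1 : SL(2, K)) : 𝕄 K) 0 0 =
          (1 : 𝕄 K) 0 0 :=
        congrArg (fun c : Subgroup.center SL(2, K) =>
          (c.1 : 𝕄 K) 0 0) h
      rw [Matrix.SpecialLinearGroup.coe_neg, Matrix.SpecialLinearGroup.coe_one] at h4
      rw [Matrix.neg_apply, one_apply_eq] at h4
      linear_combination -h4
  have h5 := orderOf_dvd_natCard c
  rwa [hc] at h5

end Matrix

theorem exists_orderOf_eq_of_dvd {G : Type*} [Group G] [Finite G] [IsCyclic G] {d : ℕ}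
    (h : d ∣ Nat.card G) : ∃ g : G, orderOf g = d := by
  obtain ⟨g, hg⟩ := IsCyclic.exists_ofOrder_eq_natCard (α := G)
  obtain ⟨c, hc⟩ := h
  have hpos : 0 < Nat.card G := Nat.card_pos
  have hc0 : c ≠ 0 := by rintro rfl; omega
  refine ⟨g ^ c, ?_⟩
  rw [orderOf_pow_of_dvd hc0 ⟨d, by rw [hg, hc, mul_comm]⟩, hg, hc, Nat.mul_div_cancel _ (by omega)]

/-! ### Linear groups of degree two: dihedral and generalized quaternion groups -/

section LinearGroups

open Matrix MaxClass

variable {K : Type*} [Field K]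

theorem pow_eq_neg_one_of_orderOf {ζ : Kˣ} {m : ℕ} (h : orderOf ζ = 2 ^ (m + 1)) :
    ζ ^ 2 ^ m = -1 := by
  have h1 : ζ ^ 2 ^ m * ζ ^ 2 ^ m = 1 := by
    rw [← pow_add, ← mul_two, ← pow_succ, ← h, pow_orderOf_eq_one]
  have h2 : (ζ : K) ^ 2 ^ m * (ζ : K) ^ 2 ^ m = 1 := by
    simpa using congrArg Units.val h1
  rcases mul_self_eq_one_iff.1 h2 with h3 | h3
  · have h4 : ζ ^ 2 ^ m = 1 := Units.ext (by simpa using h3)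
    have h5 := orderOf_dvd_of_pow_eq_one h4
    rw [h, Nat.pow_dvd_pow_iff_le_right (by norm_num)] at h5
    omega
  · exact Units.ext (by simpa using h3)

theorem exists_unit_of_dvd [Finite K] {d : ℕ} (h : d ∣ Nat.card K - 1) : ∃ ζ : Kˣ, orderOf ζ = d :=
  exists_orderOf_eq_of_dvd (by rwa [Nat.card_units])

theorem units_neg_one_ne_one (h : (2 : K) ≠ 0) : (-1 : Kˣ) ≠ 1 := fun h1 => h (by
  have h2 : (-1 : K) = 1 := by simpa using congrArg Units.val h1
  linear_combination -h2)

theorem two_ne_zero_of_odd {p : ℕ} [Fact p.Prime] (h : p ≠ 2) : (2 : ZMod p) ≠ 0 := by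
  intro h1
  have h2 : ((2 : ℕ) : ZMod p) = 0 := by exact_mod_cast h1
  rw [ZMod.natCast_eq_zero_iff] at h2
  exact h (((Nat.prime_dvd_prime_iff_eq Fact.out Nat.prime_two).1 h2))

theorem exists_prime_sub_one (a : ℕ) (ha : 2 ≤ a) : ∃ (p c d : ℕ) (_ : Fact p.Prime), Odd c ∧
    Odd d ∧ p = 2 ^ a * c + 1 ∧ p + 1 = 2 * d ∧ Odd p ∧ (2 : ZMod p) ≠ 0 ∧
    ∃ ζ : (ZMod p)ˣ, orderOf ζ = 2 ^ a := by
  have h1 : Nat.Coprime (1 + 2 ^ a) (2 ^ (a + 1)) := by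
    refine Nat.Coprime.pow_right _ (Nat.coprime_two_right.2 ?_)
    exact odd_one.add_even ((Nat.even_pow.2 ⟨even_two, by omega⟩))
  obtain ⟨p, hp1, hp, hm⟩ := Nat.forall_exists_prime_gt_and_modEq (1 + 2 ^ a) (by positivity) h1
  have h2 := (Nat.modEq_iff_dvd' hp1.le).1 hm.symm
  obtain ⟨t, ht⟩ := h2
  have h4 : 2 ^ a = 4 * 2 ^ (a - 2) := by
    rw [show (4 : ℕ) = 2 ^ 2 by norm_num, ← pow_add]; congr 1; omega
  have h3 : p = 2 ^ a * (2 * t + 1) + 1 := by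
    have : p = 1 + 2 ^ a + 2 ^ (a + 1) * t := by omega
    rw [this, pow_succ]; ring
  have hp2 : p ≠ 2 := fun h => by
    rw [h4, mul_assoc] at h3
    omega
  have : Fact p.Prime := ⟨hp⟩
  refine ⟨p, 2 * t + 1, 2 * (2 ^ (a - 2) * (2 * t + 1)) + 1, this, ⟨t, rfl⟩, ⟨_, rfl⟩, h3, ?_,
    hp.odd_of_ne_two hp2, two_ne_zero_of_odd hp2, exists_unit_of_dvd ?_⟩
  · rw [h3, h4]
    ring
  · rw [Nat.card_zmod, Nat.sub_eq_of_eq_add h3]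
    exact dvd_mul_right _ _

theorem exists_prime_add_one (b : ℕ) (hb : 2 ≤ b) : ∃ (p c d : ℕ) (_ : Fact p.Prime), Odd c ∧
    Odd d ∧ p = 2 * c + 1 ∧ p + 1 = 2 ^ b * d ∧ Odd p ∧ (2 : ZMod p) ≠ 0 := by
  have h4 : 2 ^ b = 4 * 2 ^ (b - 2) := by
    rw [show (4 : ℕ) = 2 ^ 2 by norm_num, ← pow_add]; congr 1; omega
  have h0 : 0 < 2 ^ (b - 2) := by positivity
  have h1 : Nat.Coprime (2 ^ b - 1) (2 ^ (b + 1)) := by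
    refine Nat.Coprime.pow_right _ (Nat.coprime_two_right.2 ⟨2 * 2 ^ (b - 2) - 1, by omega⟩)
  obtain ⟨p, hp1, hp, hm⟩ := Nat.forall_exists_prime_gt_and_modEq (2 ^ b - 1) (by positivity) h1
  have h2 := (Nat.modEq_iff_dvd' hp1.le).1 hm.symm
  obtain ⟨t, ht⟩ := h2
  have h3 : p + 1 = 2 ^ b * (2 * t + 1) := by
    have : p + 1 = 2 ^ b + 2 ^ (b + 1) * t := by omega
    rw [this, pow_succ]; ring
  have h5 : 0 < 2 ^ (b - 2) * (2 * t + 1) := by positivity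
  have : Fact p.Prime := ⟨hp⟩
  have h6 : p = 2 * (2 * (2 ^ (b - 2) * (2 * t + 1) - 1) + 1) + 1 := by
    rw [h4, mul_assoc] at h3
    omega
  exact ⟨p, _, 2 * t + 1, this, ⟨_, rfl⟩, ⟨t, rfl⟩, h6, h3, ⟨_, h6⟩, two_ne_zero_of_odd (by omega)⟩

theorem orderOf_eq_two_pow {G : Type*} [Group G] {g : G} {m : ℕ} (h : g ^ 2 ^ m ≠ 1)
    (h' : g ^ 2 ^ (m + 1) = 1) : orderOf g = 2 ^ (m + 1) := by
  have : Fact (Nat.Prime 2) := ⟨Nat.prime_two⟩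
  exact orderOf_eq_prime_pow h h'

theorem MaxClass.w_eq_of_mul_self {G : Type*} [Group G] {X Y : G} {m : ℕ} (h : Y * Y = 1) :
    w X (m + 2) Y = X ^ 2 ^ (m + 1) := by
  rw [w, if_pos h, ← zpow_natCast]
  push_cast
  rfl

theorem MaxClass.w_eq_of_mul_self_ne {G : Type*} [Group G] {X Y : G} {m : ℕ} (h : Y * Y ≠ 1) :
    w X (m + 2) Y = X ^ 2 ^ m := by
  rw [w, if_neg h, ← zpow_natCast]
  push_cast
  rfl

/-- The diagonal matrices with entries `a`, `a⁻¹`. -/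
def slDiag : Kˣ →* SL(2, K) where
  toFun a := ⟨!![(a : K), 0; 0, ((a⁻¹ : Kˣ) : K)], by simp [det_fin_two]⟩
  map_one' := Subtype.ext (by simp [one_fin_two])
  map_mul' a b := Subtype.ext (by
    change !![((a * b : Kˣ) : K), 0; 0, (((a * b)⁻¹ : Kˣ) : K)] =
      !![(a : K), 0; 0, ((a⁻¹ : Kˣ) : K)] * !![(b : K), 0; 0, ((b⁻¹ : Kˣ) : K)]
    simp [mul_comm])

theorem coe_slDiag (a : Kˣ) : (slDiag a : 𝕄 K) =
    !![(a : K), 0; 0, ((a⁻¹ : Kˣ) : K)] := rfl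

variable (K) in
/-- The matrix that permutes the coordinates, with a sign. -/
def slFlip : SL(2, K) := ⟨!![0, 1; -1, 0], by simp [det_fin_two]⟩

theorem coe_slFlip : (slFlip K : 𝕄 K) = !![0, 1; -1, 0] := rfl

theorem slFlip_conj (a : Kˣ) : slFlip K * slDiag a * (slFlip K)⁻¹ = (slDiag a) ^ (-1 : ℤ) := by
  rw [mul_inv_eq_iff_eq_mul, _root_.zpow_neg_one, ← map_inv]
  refine Subtype.ext ?_
  rw [Matrix.SpecialLinearGroup.coe_mul, Matrix.SpecialLinearGroup.coe_mul, coe_slDiag, coe_slDiag,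
    coe_slFlip]
  simp

theorem slFlip_sq : slFlip K * slFlip K = slDiag (-1) := by
  refine Subtype.ext ?_
  rw [Matrix.SpecialLinearGroup.coe_mul, coe_slDiag, coe_slFlip]
  simp

theorem slDiag_neg_one : (slDiag (-1 : Kˣ) : 𝕄 K) = -1 := by
  rw [coe_slDiag]
  ext i j
  fin_cases i <;> fin_cases j <;> simp

theorem slDiag_injective : Function.Injective (slDiag : Kˣ →* _) := fun a b h => by
  have := congrArg (fun g : SL(2, K) =>
    (g : 𝕄 K) 0 0) h
  simp only [coe_slDiag] at this
  exact Units.ext (by simpa using this)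

theorem slDiag_mul_slFlip_sq (c : Kˣ) :
    slDiag c * slFlip K * (slDiag c * slFlip K) = slDiag (-1) := by
  have h1 : slFlip K * slDiag c = slDiag c⁻¹ * slFlip K := by
    rw [map_inv, ← _root_.zpow_neg_one, ← slFlip_conj, inv_mul_cancel_right]
  rw [mul_assoc, ← mul_assoc (slFlip K), h1, mul_assoc, slFlip_sq, ← map_mul, ← map_mul,
    mul_inv_cancel_left]

theorem rotates_slDiag (h2 : (2 : K) ≠ 0) {i : Kˣ} (hi : i * i = -1) (c : Kˣ) :
    Rotates (slDiag i) (slDiag c * slFlip K) := by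
  refine rotates_of_sl_two h2 ?_ ?_ ?_
  · rw [← Matrix.SpecialLinearGroup.coe_mul, ← map_mul, hi, slDiag_neg_one]
  · rw [← Matrix.SpecialLinearGroup.coe_mul, slDiag_mul_slFlip_sq, slDiag_neg_one]
  · have h1 : i⁻¹ = -i := by
      rw [inv_eq_iff_mul_eq_one, mul_neg, hi, neg_neg]
    rw [Matrix.SpecialLinearGroup.coe_mul, coe_slDiag, coe_slDiag, coe_slFlip, h1]
    ext i j
    fin_cases i <;> fin_cases j <;> simp [mul_comm]

end LinearGroups

namespace MaxClass

open FusionSystem Matrix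

variable {P : Type*} [Group P] [Finite P] {x y : P} {k : ℕ} {r s : ℤ} {F : FusionSystem P}

theorem exists_psl_two (D : MaxClass x y k (-1) 0) (hF : F.IsSaturated 2) (h1 : Has F x k y)
    (h2 : Has F x k (x * y)) : ∃ (K : Type) (_ : Field K) (_ : Finite K),
      (Nat.card K % 8 = 1 ∨ Nat.card K % 8 = 7) ∧
      F.IsFusionSystemOf 2 PSL(2, K) := by
  obtain ⟨m, rfl⟩ : ∃ m, k = m + 2 := ⟨k - 2, by have := D.two_le; omega⟩
  obtain ⟨p, c, d, _, hc, hd, hpc, hpd, hp, h2p, ζ, hζ⟩ := exists_prime_sub_one (m + 3) (by omega)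
  have hi : ζ ^ 2 ^ (m + 1) * ζ ^ 2 ^ (m + 1) = -1 := by
    rw [← pow_add, ← mul_two, ← pow_succ]
    exact pow_eq_neg_one_of_orderOf hζ
  let q := QuotientGroup.mk' (Subgroup.center SL(2, ZMod p))
  have hq : ∀ g, q g = 1 ↔ g ∈ Subgroup.center _ := fun g => QuotientGroup.eq_one_iff g
  have hneg : q (slDiag (-1)) = 1 := by
    rw [hq, Subgroup.mem_center_iff]
    intro g
    refine Subtype.ext ?_
    rw [Matrix.SpecialLinearGroup.coe_mul, Matrix.SpecialLinearGroup.coe_mul, slDiag_neg_one]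
    simp
  have hne : q (slDiag (ζ ^ 2 ^ (m + 1))) ≠ 1 := by
    rw [Ne, hq, Subgroup.mem_center_iff]
    intro h3
    have h4 := h3 (slFlip _)
    rw [← mul_inv_eq_iff_eq_mul, slFlip_conj, _root_.zpow_neg_one, ← map_inv] at h4
    have h5 := slDiag_injective h4
    rw [inv_eq_iff_mul_eq_one, hi] at h5
    exact units_neg_one_ne_one h2p h5
  have hsq : ∀ a, q (slDiag a * slFlip _) * q (slDiag a * slFlip _) = 1 := fun a => by
    rw [← map_mul, slDiag_mul_slFlip_sq, hneg]
  have hY : q (slFlip _) = q (slDiag 1 * slFlip _) := by rw [map_one, one_mul]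
  have hXY : q (slDiag ζ) * q (slFlip _) = q (slDiag ζ * slFlip _) := (map_mul q _ _).symm
  refine ⟨ZMod p, inferInstance, inferInstance, ?_, D.isFusionSystemOf hF (X := q (slDiag ζ))
    (Y := q (slFlip _)) ?_ ?_ ?_ ?_ (Or.inl ⟨h1, ?_⟩) (Or.inl ⟨h2, ?_⟩)⟩
  · left
    rw [Nat.card_zmod, hpc, pow_add, mul_comm (2 ^ m), mul_assoc]
    omega
  · refine orderOf_eq_two_pow ?_ ?_
    · rw [← map_pow, ← map_pow]
      exact hne
    · rw [← map_pow, ← map_pow, pow_eq_neg_one_of_orderOf hζ, hneg]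
  · rw [← map_inv, ← map_mul, ← map_mul, slFlip_conj, map_zpow]
  · rw [hY, hsq, zpow_zero]
  · intro h3
    have h4 := (mul_dvd_mul_left 2 h3).trans (two_mul_card_psl_two_dvd (K := ZMod p) h2p)
    rw [← pow_succ'] at h4
    refine not_dvd_of_eq_mul_odd (m := m + 4) (c := c * (d * p)) ?_ ?_ h4
    · exact hc.mul (hd.mul hp)
    · rw [Nat.card_zmod, cardSL, hpd, show p - 1 = 2 ^ (m + 3) * c by omega]
      ring
  · rw [hY, w_eq_of_mul_self (hsq 1), ← map_pow, ← map_pow]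
    exact (rotates_slDiag h2p hi 1).map q
  · rw [hXY, w_eq_of_mul_self (hsq ζ), ← map_pow, ← map_pow]
    exact (rotates_slDiag h2p hi ζ).map q

theorem exists_sl_two (hk : 3 ≤ k) (D : MaxClass x y k (-1) (2 ^ (k - 1))) (hF : F.IsSaturated 2)
    (h1 : Has F x k y) (h2 : Has F x k (x * y)) : ∃ (K : Type) (_ : Field K) (_ : Finite K),
      Odd (Nat.card K) ∧ F.IsFusionSystemOf 2 SL(2, K) := by
  obtain ⟨m, rfl⟩ : ∃ m, k = m + 2 := ⟨k - 2, by omega⟩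
  obtain ⟨p, c, d, _, hc, hd, hpc, hpd, hp, h2p, ζ, hζ⟩ := exists_prime_sub_one (m + 2) (by omega)
  have hi : ζ ^ 2 ^ m * ζ ^ 2 ^ m = -1 := by
    rw [← pow_add, ← mul_two, ← pow_succ]
    exact pow_eq_neg_one_of_orderOf hζ
  have hne : slDiag (-1 : (ZMod p)ˣ) ≠ 1 := by
    rw [← map_one slDiag]
    exact fun h3 => units_neg_one_ne_one h2p (slDiag_injective h3)
  have hsq : ∀ a : (ZMod p)ˣ, slDiag a * slFlip _ * (slDiag a * slFlip _) ≠ 1 := fun a => by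
    rwa [slDiag_mul_slFlip_sq]
  have hY : slFlip (ZMod p) = slDiag 1 * slFlip _ := by rw [map_one, one_mul]
  refine ⟨ZMod p, inferInstance, inferInstance, by rwa [Nat.card_zmod], D.isFusionSystemOf hF (X := slDiag ζ)
    (Y := slFlip _) ?_ ?_ ?_ ?_ (Or.inl ⟨h1, ?_⟩) (Or.inl ⟨h2, ?_⟩)⟩
  · rw [orderOf_injective _ slDiag_injective, hζ]
  · exact slFlip_conj ζ
  · rw [slFlip_sq, ← pow_eq_neg_one_of_orderOf hζ, map_pow, ← zpow_natCast]
    push_cast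
    rfl
  · refine not_dvd_of_eq_mul_odd (m := m + 3) (c := c * (d * p)) ?_ ?_
    · exact hc.mul (hd.mul hp)
    · rw [card_sl_two, Nat.card_zmod, cardSL, hpd, show p - 1 = 2 ^ (m + 2) * c by omega]
      ring
  · rw [hY, w_eq_of_mul_self_ne (hsq 1), ← map_pow]
    exact rotates_slDiag h2p hi 1
  · rw [w_eq_of_mul_self_ne (hsq ζ), ← map_pow]
    exact rotates_slDiag h2p hi ζ

end MaxClass

/-! ### Projective linear groups of degree two -/

section ProjectiveGroups

open Matrix MaxClass

variable {K : Type*} [Field K]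

theorem mul_self_of_conj {G : Type*} [Group G] {X Y : G} {r s : ℤ} (hc : Y * X * Y⁻¹ = X ^ r)
    (hs : Y * Y = X ^ s) : X * Y * (X * Y) = X ^ (1 + r + s) := by
  have h1 : Y * X = X ^ r * Y := by rw [← hc, inv_mul_cancel_right]
  rw [mul_assoc, ← mul_assoc Y, h1, mul_assoc, hs, ← _root_.zpow_add, ← _root_.zpow_one_add, add_assoc]

/-- The diagonal matrices with entries `a`, `1`. -/
def glDiag : Kˣ →* GL (Fin 2) K where
  toFun a := ⟨!![(a : K), 0; 0, 1], !![((a⁻¹ : Kˣ) : K), 0; 0, 1], by simp [one_fin_two],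
    by simp [one_fin_two]⟩
  map_one' := Units.ext (by simp [one_fin_two])
  map_mul' a b := Units.ext (by simp)

theorem coe_glDiag (a : Kˣ) : (glDiag a : 𝕄 K) = !![(a : K), 0; 0, 1] := rfl

variable (K) in
/-- The matrix that permutes the coordinates, with a sign, in the general linear group. -/
def glFlip : GL (Fin 2) K := Matrix.SpecialLinearGroup.toGL (slFlip K)

theorem coe_glFlip : (glFlip K : 𝕄 K) = !![0, 1; -1, 0] := rfl

theorem coe_scalar_two (a : Kˣ) : (glScalar a : 𝕄 K) =
    !![(a : K), 0; 0, (a : K)] := by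
  rw [GeneralLinearGroup.coe_scalar]
  ext i j
  fin_cases i <;> fin_cases j <;> simp

theorem glFlip_mul_glDiag (a : Kˣ) : glFlip K * glDiag a =
    glScalar a * glDiag a⁻¹ * glFlip K := by
  refine Units.ext ?_
  rw [Units.val_mul, Units.val_mul, Units.val_mul, coe_scalar_two, coe_glDiag, coe_glDiag,
    coe_glFlip]
  simp

theorem glFlip_mul_self : glFlip K * glFlip K = glScalar (-1) := by
  refine Units.ext ?_
  rw [Units.val_mul, coe_scalar_two, coe_glFlip]
  simp

theorem glDiag_mul_self (a : Kˣ) : glDiag (a * a) =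
    glScalar a * Matrix.SpecialLinearGroup.toGL (slDiag a) := by
  refine Units.ext ?_
  rw [Units.val_mul, coe_scalar_two, coe_glDiag, Matrix.SpecialLinearGroup.coe_GL_coe_matrix,
    coe_slDiag]
  simp

theorem det_glDiag (a : Kˣ) : GeneralLinearGroup.det (glDiag a) = a :=
  Units.ext (by
    change Matrix.det (glDiag a : 𝕄 K) = a
    rw [coe_glDiag]
    simp [det_fin_two])

theorem det_glFlip : GeneralLinearGroup.det (glFlip K) = 1 := Units.ext (slFlip K).2

end ProjectiveGroups

namespace MaxClass

open FusionSystem Matrix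

variable {P : Type*} [Group P] [Finite P] {x y : P} {k : ℕ} {r s : ℤ} {F : FusionSystem P}

theorem exists_pgl_two (D : MaxClass x y k (-1) 0) (hF : F.IsSaturated 2) (h1 : Has F x k y)
    (h2 : ¬ Has F x k (x * y)) : ∃ (K : Type) (_ : Field K) (_ : Finite K),
      Odd (Nat.card K) ∧ F.IsFusionSystemOf 2 (Matrix.ProjGenLinGroup (Fin 2) K) := by
  obtain ⟨m, rfl⟩ : ∃ m, k = m + 2 := ⟨k - 2, by have := D.two_le; omega⟩
  obtain ⟨p, c, d, _, hc, hd, hpc, hpd, hp, h2p, ζ, hζ⟩ := exists_prime_sub_one (m + 2) (by omega)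
  have hi' : ζ ^ 2 ^ (m + 1) = -1 := pow_eq_neg_one_of_orderOf hζ
  have hi : ζ ^ 2 ^ m * ζ ^ 2 ^ m = -1 := by
    rw [← pow_add, ← mul_two, ← pow_succ, hi']
  let q : GL (Fin 2) (ZMod p) →* ProjGenLinGroup (Fin 2) (ZMod p) := ProjGenLinGroup.mk
  have hscal : ∀ a, q (glScalar a) = 1 := ProjGenLinGroup.mk_scalar
  have hw : q (glDiag ζ) ^ 2 ^ (m + 1) =
      q (Matrix.SpecialLinearGroup.toGL (slDiag (ζ ^ 2 ^ m))) := by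
    rw [← map_pow, ← map_pow, hi', ← hi, glDiag_mul_self, map_mul, hscal, one_mul]
  have hcj : q (glFlip _) * q (glDiag ζ) * (q (glFlip _))⁻¹ = q (glDiag ζ) ^ (-1 : ℤ) := by
    rw [mul_inv_eq_iff_eq_mul, ← map_mul, glFlip_mul_glDiag, map_mul, map_mul, hscal, one_mul,
      map_inv, map_inv, _root_.zpow_neg_one]
  have hsq : q (glFlip _) * q (glFlip _) = q (glDiag ζ) ^ (0 : ℤ) := by
    rw [← map_mul, glFlip_mul_self, hscal, zpow_zero]
  have hsq' : q (glDiag ζ) * q (glFlip _) * (q (glDiag ζ) * q (glFlip _)) = 1 := by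
    rw [mul_self_of_conj hcj hsq]
    simp
  have : Finite (ProjGenLinGroup (Fin 2) (ZMod p)) :=
    Finite.of_surjective _ ProjGenLinGroup.mk_surjective
  refine ⟨ZMod p, inferInstance, inferInstance, by rwa [Nat.card_zmod], D.isFusionSystemOf hF (X := q (glDiag ζ))
    (Y := q (glFlip _)) ?_ hcj hsq ?_ (Or.inl ⟨h1, ?_⟩) (Or.inr ⟨h2, ?_⟩)⟩
  · refine orderOf_eq_two_pow ?_ ?_
    · rw [← map_pow, ← map_pow, hi', ← map_one q, Ne, ProjGenLinGroup.mk_eq_mk_iff]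
      rintro ⟨u, hu⟩
      have h3 := congrArg Units.val hu
      rw [Units.val_mul, coe_scalar_two, coe_glDiag] at h3
      have h4 := congrFun (congrFun h3 0) 0
      have h5 := congrFun (congrFun h3 1) 1
      simp at h4 h5
      refine h2p ?_
      rw [h5, Units.val_one] at h4
      linear_combination -h4
    · rw [← map_pow, ← map_pow, ← hζ, pow_orderOf_eq_one, map_one, map_one]
  · intro h3
    have h4 := h3.trans (card_pgl_two_dvd (K := ZMod p))
    refine not_dvd_of_eq_mul_odd (m := m + 3) (c := c * (d * p)) ?_ ?_ h4
    · exact hc.mul (hd.mul hp)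
    · rw [Nat.card_zmod, cardSL, hpd, show p - 1 = 2 ^ (m + 2) * c by omega]
      ring
  · rw [w_eq_of_mul_self (by rw [hsq, zpow_zero]), hw]
    have h3 := (rotates_slDiag h2p hi 1).map (q.comp Matrix.SpecialLinearGroup.toGL)
    rwa [map_one, one_mul] at h3
  · -- the subgroup of the classes of the matrices whose determinants are squares
    rw [w_eq_of_mul_self hsq', hw]
    refine ⟨((powMonoidHom 2 : (ZMod p)ˣ →* (ZMod p)ˣ).range.comap GeneralLinearGroup.det).map q,
      Subgroup.Normal.map inferInstance q ProjGenLinGroup.mk_surjective, ⟨_, ⟨1, ?_⟩, rfl⟩, ?_⟩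
    · rw [map_one]
      exact (Units.ext (slDiag (ζ ^ 2 ^ m)).2).symm
    · rintro ⟨A, ⟨a, ha⟩, hA⟩
      rw [← map_mul] at hA
      obtain ⟨u, hu⟩ := ProjGenLinGroup.mk_eq_mk_iff.1 hA
      have h3 := congrArg GeneralLinearGroup.det hu
      rw [map_mul, map_mul, GeneralLinearGroup.det_scalar, det_glDiag, det_glFlip, ← ha, mul_one,
        powMonoidHom_apply, Fintype.card_fin, ← mul_pow] at h3
      have h4 : ζ ^ (2 ^ (m + 1) * c) = 1 := by
        rw [← h3, ← pow_mul, ← mul_assoc, ← pow_succ', show 2 ^ (m + 1 + 1) * c = p - 1 from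
            (Nat.sub_eq_of_eq_add hpc).symm]
        exact ZMod.units_pow_card_sub_one_eq_one p _
      rw [pow_mul, hi', hc.neg_one_pow] at h4
      exact units_neg_one_ne_one h2p h4

end MaxClass

/-! ### Quadratic extensions of finite fields -/

/-- A field of prime order `p`, with `p - 1` exactly divisible by `2 ^ (m + 1)`, has an element `a`
of order `2 ^ (m + 1)`, which is not a square: the square roots of `a` in a quadratic extension have
order `2 ^ (m + 2)`. -/
theorem exists_not_square {m : ℕ} {p c : ℕ} [Fact p.Prime] (hc : Odd c)
    (hpc : p = 2 ^ (m + 1) * c + 1) :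
    ∃ a : ZMod p, a ^ 2 ^ m = -1 ∧ ∀ b : ZMod p, b ^ 2 ≠ a + 0 * b := by
  obtain ⟨η, hη⟩ := exists_unit_of_dvd (K := ZMod p) (d := 2 ^ (m + 1)) (by
    rw [Nat.card_zmod, (Nat.sub_eq_of_eq_add hpc)]; exact dvd_mul_right _ _)
  have h1 := pow_eq_neg_one_of_orderOf hη
  have hp2 : p ≠ 2 := by
    rintro rfl
    have h2 : 2 ^ (m + 1) * c = 1 := by omega
    have := Nat.eq_one_of_mul_eq_one_right h2
    simp [pow_succ] at this
  have h2p : (2 : ZMod p) ≠ 0 := two_ne_zero_of_odd hp2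
  have h2 : (η : ZMod p) ^ 2 ^ m = -1 := by simpa using congrArg Units.val h1
  refine ⟨η, h2, fun b hb => h2p ?_⟩
  rw [zero_mul, add_zero] at hb
  have hb0 : b ≠ 0 := by
    rintro rfl
    exact η.ne_zero (by rw [← hb]; simp)
  have h3 := ZMod.pow_card_sub_one_eq_one hb0
  rw [Nat.sub_eq_of_eq_add hpc, pow_succ', mul_assoc, pow_mul, hb, pow_mul, h2, hc.neg_one_pow] at h3
  linear_combination -h3

section SlTwoExtension

open Matrix QuadraticAlgebra

variable {K : Type*} [Field K] {a : K} [Fact (∀ r, r ^ 2 ≠ a + 0 * r)]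

instance [Finite K] {a b : K} : Finite (QuadraticAlgebra K a b) :=
  Finite.of_equiv _ (QuadraticAlgebra.equivProd a b).symm

theorem card_quadraticAlgebra [Finite K] {a b : K} :
    Nat.card (QuadraticAlgebra K a b) = Nat.card K * Nat.card K := by
  rw [Nat.card_congr (QuadraticAlgebra.equivProd a b), Nat.card_prod]

theorem omega_mul_self (a : K) : (⟨0, 1⟩ : 𝕃(K,a)) * ⟨0, 1⟩ = algebraMap K _ a := by
  ext <;> simp

/-- The square root `ω` of `a` as a unit. -/
noncomputable def omegaUnit (a : K) [Fact (∀ r, r ^ 2 ≠ a + 0 * r)] : 𝕃(K,a)ˣ :=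
  Units.mk0 ⟨0, 1⟩ (fun h => one_ne_zero (congrArg QuadraticAlgebra.im h : (1 : K) = 0))

theorem coe_omegaUnit : (omegaUnit a : 𝕃(K,a)) = ⟨0, 1⟩ := rfl

theorem omegaUnit_sq : (omegaUnit a : 𝕃(K,a)) ^ 2 = algebraMap K _ a := by
  rw [pow_two, coe_omegaUnit, omega_mul_self]

theorem omegaUnit_pow {m : ℕ} (h : a ^ 2 ^ m = -1) : omegaUnit a ^ 2 ^ (m + 1) = -1 := by
  refine Units.ext ?_
  rw [Units.val_pow_eq_pow_val, pow_succ', pow_mul, omegaUnit_sq, ← map_pow, h]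
  simp

variable (K a) in
/-- The natural map from `SL_2(q)` to the group `SL_2(q).C_2`. -/
noncomputable def toSlTwoExtension : SL(2, K) →*
    slTwoExtension K 𝕃(K,a) :=
  (Matrix.SpecialLinearGroup.map (algebraMap K 𝕃(K,a))).codRestrict _
    fun g => ⟨1, (g : 𝕄 K), by rw [one_smul]; rfl⟩

theorem coe_toSlTwoExtension (g : SL(2, K)) (i j : Fin 2) :
    ((toSlTwoExtension K a g).1 : 𝕄 𝕃(K,a)) i j =
      algebraMap K _ ((g : 𝕄 K) i j) := rfl

theorem toSlTwoExtension_injective : Function.Injective (toSlTwoExtension K a) := fun g h hgh => by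
  refine Matrix.SpecialLinearGroup.ext _ _ fun i j => ?_
  refine (algebraMap K 𝕃(K,a)).injective ?_
  rw [← coe_toSlTwoExtension, ← coe_toSlTwoExtension, hgh]

theorem mem_range_toSlTwoExtension {g : slTwoExtension K 𝕃(K,a)}
    {c : 𝕃(K,a)} {h : 𝕄 K}
    (hg : (g.1 : 𝕄 𝕃(K,a)) =
      c • h.map (algebraMap K 𝕃(K,a))) (hc : c.im = 0) :
    g ∈ (toSlTwoExtension K a).range := by
  have hc' : c = algebraMap K 𝕃(K,a) c.re := by ext <;> simp [hc]
  have hg' : (g.1 : 𝕄 𝕃(K,a)) =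
      (c.re • h).map (algebraMap K 𝕃(K,a)) := by
    rw [hg, hc']
    ext i j : 1
    simp
  have hd : (c.re • h).det = 1 := by
    refine (algebraMap K 𝕃(K,a)).injective ?_
    rw [RingHom.map_det, RingHom.mapMatrix_apply, ← hg', map_one]
    exact g.1.2
  exact ⟨⟨c.re • h, hd⟩, Subtype.ext (Subtype.ext hg'.symm)⟩

/-- The scalars in the definition of `SL_2(q).C_2` have a square in the smaller field. -/
theorem re_eq_zero_of_notMem (h2 : (2 : K) ≠ 0) {g : slTwoExtension K 𝕃(K,a)}
    {c : 𝕃(K,a)} {h : 𝕄 K}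
    (hg : (g.1 : 𝕄 𝕃(K,a)) =
      c • h.map (algebraMap K 𝕃(K,a)))
    (hc : g ∉ (toSlTwoExtension K a).range) : c.re = 0 := by
  have h1 : c ^ 2 * algebraMap K 𝕃(K,a) h.det = 1 := by
    rw [RingHom.map_det, RingHom.mapMatrix_apply, ← g.1.2, hg, det_smul, Fintype.card_fin]
  have h3 := congrArg QuadraticAlgebra.im h1
  have hd : h.det ≠ 0 := fun h0 => by simp [h0] at h1
  have hi : c.im ≠ 0 := fun h0 => hc (mem_range_toSlTwoExtension hg h0)
  have h4 : h.det * (2 * (c.im * c.re)) = 0 := by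
    rw [pow_two] at h3
    simp at h3
    rcases h3 with h3 | h3
    · linear_combination h.det * h3
    · exact absurd h3 hd
  simpa [hd, h2, hi] using h4

variable (a) in
/-- The diagonal matrix with entries `ω`, `ω⁻¹`. -/
noncomputable def omegaDiag : slTwoExtension K 𝕃(K,a) :=
  ⟨slDiag (omegaUnit a), omegaUnit a, !![1, 0; 0, a⁻¹], by
    have ha : a ≠ 0 := fun h0 => (Fact.out : ∀ r : K, r ^ 2 ≠ a + 0 * r) 0 (by simp [h0])
    have h1 : ((omegaUnit a)⁻¹ : 𝕃(K,a)) =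
        omegaUnit a * algebraMap K 𝕃(K,a) a⁻¹ := by
      refine inv_eq_of_mul_eq_one_right ?_
      rw [← mul_assoc, ← pow_two, omegaUnit_sq, ← map_mul, mul_inv_cancel₀ ha, map_one]
    rw [coe_slDiag]
    ext i j : 1
    fin_cases i <;> fin_cases j <;> simp [h1]⟩

theorem omegaDiag_notMem : omegaDiag a ∉ (toSlTwoExtension K a).range := by
  rintro ⟨g, hg⟩
  have h1 := congrArg (fun g : slTwoExtension K 𝕃(K,a) =>
    ((g.1 : 𝕄 𝕃(K,a)) 0 0).im) hg
  simp only [coe_toSlTwoExtension] at h1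
  rw [show (((omegaDiag a).1 : 𝕄 𝕃(K,a)) 0 0).im =
    (1 : K) from rfl] at h1
  simp at h1

theorem index_range_toSlTwoExtension (h2 : (2 : K) ≠ 0) :
    (toSlTwoExtension K a).range.index = 2 := by
  rw [Subgroup.index_eq_two_iff]
  refine ⟨omegaDiag a, fun b => ?_⟩
  by_cases hb : b ∈ (toSlTwoExtension K a).range
  · exact Or.inr ⟨hb, fun h3 => omegaDiag_notMem ((mul_mem_cancel_left hb).1 h3)⟩
  · refine Or.inl ⟨?_, hb⟩
    obtain ⟨c, h, hc⟩ := b.2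
    obtain ⟨d, h', hd⟩ := (omegaDiag a).2
    have hc0 := re_eq_zero_of_notMem h2 hc hb
    have hd0 := re_eq_zero_of_notMem h2 hd omegaDiag_notMem
    refine mem_range_toSlTwoExtension (c := c * d) (h := h * h') ?_ (by simp [hc0, hd0])
    rw [Subgroup.coe_mul, Matrix.SpecialLinearGroup.coe_mul, hc, hd, Matrix.map_mul]
    simp [smul_smul, mul_comm]

theorem card_slTwoExtension [Finite K] (h2 : (2 : K) ≠ 0) :
    Nat.card (slTwoExtension K 𝕃(K,a)) = cardSL (Nat.card K) * 2 := by
  rw [← (toSlTwoExtension K a).range.card_mul_index, index_range_toSlTwoExtension h2,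
    Nat.card_congr (MonoidHom.ofInjective toSlTwoExtension_injective).toEquiv.symm, card_sl_two]

end SlTwoExtension

namespace MaxClass

open FusionSystem Matrix

variable {P : Type*} [Group P] [Finite P] {x y : P} {k : ℕ} {r s : ℤ} {F : FusionSystem P}

theorem exists_slTwoExtension (hk : 3 ≤ k) (D : MaxClass x y k (-1) (2 ^ (k - 1)))
    (hF : F.IsSaturated 2) (h1 : Has F x k y) (h2 : ¬ Has F x k (x * y)) :
    ∃ (K L : Type) (_ : Field K) (_ : Field L) (_ : Algebra K L)
      (_ : Finite L), Odd (Nat.card L) ∧ Module.finrank K L = 2 ∧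
      F.IsFusionSystemOf 2 (slTwoExtension K L) := by
  obtain ⟨m, rfl⟩ : ∃ m, k = m + 1 + 2 := ⟨k - 3, by omega⟩
  obtain ⟨p, c, d, _, hc, hd, hpc, hpd, hp, h2p, -⟩ := exists_prime_sub_one (m + 1 + 1) (by omega)
  obtain ⟨a, ha, ha'⟩ := exists_not_square hc hpc
  have : Fact (∀ r, r ^ 2 ≠ a + 0 * r) := ⟨ha'⟩
  have hω := omegaUnit_pow ha
  have ha0 : a ≠ 0 := fun h0 => ha' 0 (by simp [h0])
  obtain ⟨η, hη⟩ : ∃ η : (ZMod p)ˣ, (η : ZMod p) = a := ⟨Units.mk0 a ha0, rfl⟩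
  have hi : η ^ 2 ^ m * η ^ 2 ^ m = -1 := by
    rw [← pow_add, ← mul_two, ← pow_succ]
    exact Units.ext (by simpa [hη] using ha)
  let f := toSlTwoExtension (ZMod p) a
  have hw : omegaDiag a ^ 2 ^ (m + 1) = f (slDiag (η ^ 2 ^ m)) := by
    have h3 : omegaUnit a ^ 2 ^ (m + 1) =
        Units.map (algebraMap (ZMod p) 𝕃(ZMod p,a) : _ →* _) (η ^ 2 ^ m) := by
      refine Units.ext ?_
      rw [Units.val_pow_eq_pow_val, pow_succ', pow_mul, omegaUnit_sq]
      simp [hη]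
    refine Subtype.ext ?_
    change (slDiag (omegaUnit a)) ^ 2 ^ (m + 1) = _
    rw [← map_pow, h3]
    generalize η ^ 2 ^ m = e
    refine Subtype.ext ?_
    rw [coe_slDiag]
    ext i j : 1
    match i, j with
    | 0, 0 => rfl
    | 0, 1 => exact (map_zero (algebraMap (ZMod p) 𝕃(ZMod p,a))).symm
    | 1, 0 => exact (map_zero (algebraMap (ZMod p) 𝕃(ZMod p,a))).symm
    | 1, 1 => rfl
  have hflip : (f (slFlip _)).1 = slFlip 𝕃(ZMod p,a) := by
    refine Subtype.ext ?_
    rw [coe_slFlip]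
    ext i j : 1
    fin_cases i <;> fin_cases j <;> simp [f, coe_toSlTwoExtension, coe_slFlip]
  have hcj : f (slFlip _) * omegaDiag a * (f (slFlip _))⁻¹ = omegaDiag a ^ (-1 : ℤ) := by
    refine Subtype.ext ?_
    rw [Subgroup.coe_mul, Subgroup.coe_mul, Subgroup.coe_inv, Subgroup.coe_zpow, hflip]
    exact slFlip_conj _
  have hneg : omegaDiag a ^ 2 ^ (m + 1 + 1) = f (slDiag (-1)) := by
    rw [pow_succ, pow_mul, hw, ← map_pow, ← map_pow, pow_two, hi]
  have hsq : f (slFlip _) * f (slFlip _) = omegaDiag a ^ (2 : ℤ) ^ (m + 1 + 2 - 1) := by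
    rw [← map_mul, slFlip_sq, ← hneg, ← zpow_natCast]
    push_cast
    rfl
  have hne : f (slDiag (-1)) ≠ 1 := by
    rw [← map_one f, ← map_one slDiag]
    exact fun h3 => units_neg_one_ne_one h2p (slDiag_injective (toSlTwoExtension_injective h3))
  have hsq1 : f (slFlip _) * f (slFlip _) ≠ 1 := by rwa [← map_mul, slFlip_sq]
  have hsq2 : omegaDiag a * f (slFlip _) * (omegaDiag a * f (slFlip _)) ≠ 1 := by
    rwa [mul_self_of_conj hcj hsq, show (1 : ℤ) + -1 + 2 ^ (m + 1 + 2 - 1) =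
      2 ^ (m + 1 + 2 - 1) by ring, ← hsq]
  refine ⟨ZMod p, 𝕃(ZMod p,a), inferInstance, inferInstance, inferInstance,
    inferInstance, ?_, QuadraticAlgebra.finrank_eq_two _ _, D.isFusionSystemOf hF
    (X := omegaDiag a) (Y := f (slFlip _)) ?_ hcj hsq ?_ (Or.inl ⟨h1, ?_⟩) (Or.inr ⟨h2, ?_⟩)⟩
  · rw [card_quadraticAlgebra, Nat.card_zmod]
    exact hp.mul hp
  · refine orderOf_eq_two_pow ?_ ?_
    · rwa [hneg]
    · rw [pow_succ, pow_mul, hneg, pow_two, ← map_mul, ← map_mul, mul_neg_one, neg_neg, map_one,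
        map_one]
  · refine not_dvd_of_eq_mul_odd (m := m + 4) (c := c * (d * p)) ?_ ?_
    · exact hc.mul (hd.mul hp)
    · rw [card_slTwoExtension h2p, Nat.card_zmod, cardSL, hpd, Nat.sub_eq_of_eq_add hpc]
      ring
  · rw [w_eq_of_mul_self_ne hsq1, hw]
    have h3 := (rotates_slDiag h2p hi 1).map f
    rwa [map_one, one_mul] at h3
  · rw [w_eq_of_mul_self_ne hsq2, hw]
    refine ⟨f.range, Subgroup.normal_of_index_eq_two (index_range_toSlTwoExtension h2p), ⟨_, rfl⟩,
      fun h3 => omegaDiag_notMem ((Subgroup.mul_mem_cancel_right _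
        (⟨slFlip _, rfl⟩ : f (slFlip _) ∈ f.range)).1 h3)⟩

end MaxClass

/-! ### Semidihedral groups -/

section Twisted

open Matrix QuadraticAlgebra

theorem not_isSquare_of_pow {K : Type*} [Field K] [Finite K] (h2 : (2 : K) ≠ 0) {z : Kˣ} {e : ℕ}
    (he : Nat.card K - 1 = 2 * e) (hz : z ^ e = -1) : ¬ IsSquare (z : K) := by
  rintro ⟨b, hb⟩
  have hb0 : b ≠ 0 := by
    rintro rfl
    exact z.ne_zero (by rw [hb, mul_zero])
  have h1 : (Units.mk0 b hb0) ^ (2 * e) = 1 := by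
    rw [← he, ← Nat.card_units, pow_card_eq_one']
  have h3 : z = Units.mk0 b hb0 ^ 2 := Units.ext (by
    rw [hb, Units.val_pow_eq_pow_val, Units.val_mk0, pow_two])
  rw [pow_mul, ← h3, hz] at h1
  exact units_neg_one_ne_one h2 h1

variable {K : Type*} [Field K] {a : K} [Fact (∀ r, r ^ 2 ≠ a + 0 * r)]

variable (a) in
/-- The automorphism `ω ↦ -ω` of a quadratic extension. -/
def quadConj : 𝕃(K,a) ≃ₐ[K] 𝕃(K,a) where
  toFun := star
  invFun := star
  left_inv := star_star
  right_inv := star_star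
  map_mul' := star_mul'
  map_add' := star_add
  commutes' r := by ext <;> simp

theorem quadConj_omega : quadConj a (omegaUnit a) = -(omegaUnit a : 𝕃(K,a)) := by
  change star (⟨0, 1⟩ : 𝕃(K,a)) = -⟨0, 1⟩
  ext <;> simp

theorem quadConj_mul_self : quadConj a * quadConj a = 1 := AlgEquiv.ext star_star

theorem quadConj_ne_one (h2 : (2 : K) ≠ 0) : quadConj a ≠ 1 := fun h => by
  have h1 := quadConj_omega (a := a)
  rw [h] at h1
  have h3 : (1 : K) = -1 := congrArg QuadraticAlgebra.im h1
  refine h2 ?_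
  linear_combination h3

section General

variable {L : Type*} [Field L] [Algebra K L] [Finite L] {hL : Odd (Nat.card L)}
  {hd : Module.finrank K L = 2}

/-- The special linear group inside the twisted group. -/
def slToTwisted : SL(2, L) →* twistedSubgroup K L hL hd :=
  (SemidirectProduct.inl.comp Matrix.SpecialLinearGroup.toGL).codRestrict _ fun g => by
    change IsSquare (g : 𝕄 L).det ↔ (1 : L ≃ₐ[K] L) = 1
    rw [g.2]
    simp

theorem coe_slToTwisted (g : SL(2, L)) :
    (slToTwisted (hL := hL) (hd := hd) g : SemilinearGroup K L) =
      SemidirectProduct.inl (Matrix.SpecialLinearGroup.toGL g) := rfl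

/-- The scalar matrices inside the twisted group. -/
def scalarToTwisted : Lˣ →* twistedSubgroup K L hL hd :=
  (SemidirectProduct.inl.comp (glScalar)).codRestrict _ fun u => by
    change IsSquare ((GeneralLinearGroup.det (glScalar u) : Lˣ) : L) ↔
      (1 : L ≃ₐ[K] L) = 1
    rw [GeneralLinearGroup.det_scalar, Fintype.card_fin, Units.val_pow_eq_pow_val]
    exact iff_of_true (IsSquare.sq _) rfl

theorem coe_scalarToTwisted (u : Lˣ) :
    (scalarToTwisted (hL := hL) (hd := hd) u : SemilinearGroup K L) =
      SemidirectProduct.inl (glScalar u) := rfl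

variable (hL hd) in
/-- The projection to the quotient by the scalar matrices. -/
def toTwistedPSL : twistedSubgroup K L hL hd →* TwistedPSL K L hL hd :=
  QuotientGroup.mk' _

theorem toTwistedPSL_eq_one {g : twistedSubgroup K L hL hd} : toTwistedPSL hL hd g = 1 ↔
    ∃ u : Lˣ, g = scalarToTwisted u := by
  rw [show toTwistedPSL hL hd g = 1 ↔ _ from QuotientGroup.eq_one_iff g, Subgroup.mem_subgroupOf,
    scalarSubgroup, GeneralLinearGroup.center_eq_range_scalar]
  constructor
  · rintro ⟨_, ⟨u, rfl⟩, h⟩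
    exact ⟨u, Subtype.ext h.symm⟩
  · rintro ⟨u, rfl⟩
    exact ⟨_, ⟨u, rfl⟩, rfl⟩

theorem toTwistedPSL_scalar (u : Lˣ) : toTwistedPSL hL hd (scalarToTwisted u) = 1 :=
  toTwistedPSL_eq_one.2 ⟨u, rfl⟩

theorem card_twistedPSL_dvd : Nat.card (TwistedPSL K L hL hd) ∣ cardSL (Nat.card L) := by
  have hgal : ∀ σ τ : L ≃ₐ[K] L, σ ≠ 1 → τ ≠ 1 → σ = τ := fun σ τ hσ hτ => by
    have h1 := (gal_mul_eq_one_iff hd σ τ).2 (iff_of_false hσ hτ)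
    have h2 := (gal_mul_eq_one_iff hd τ τ).2 Iff.rfl
    exact mul_right_cancel (h1.trans h2.symm)
  have hT : Nat.card (twistedSubgroup K L hL hd) = Nat.card (GL (Fin 2) L) := by
    refine Nat.card_eq_of_bijective (fun t : twistedSubgroup K L hL hd => t.1.left) ⟨?_, ?_⟩
    · rintro ⟨s, hs⟩ ⟨t, ht⟩ (hst : s.left = t.left)
      refine Subtype.ext (SemidirectProduct.ext hst ?_)
      change IsSquare (s.left.det : L) ↔ s.right = 1 at hs
      change IsSquare (t.left.det : L) ↔ t.right = 1 at ht
      rw [hst, ht] at hs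
      by_cases h : s.right = 1
      · rw [h, hs.2 h]
      · exact hgal _ _ h fun h' => h (hs.1 h')
    · intro g
      by_cases h : IsSquare (g.det : L)
      · exact ⟨⟨⟨g, 1⟩, iff_of_true h rfl⟩, rfl⟩
      · have : Finite K := Finite.of_injective _ (algebraMap K L).injective
        have hc : Nat.card (L ≃ₐ[K] L) = 2 := by rw [IsGalois.card_aut_eq_finrank, hd]
        have : Nontrivial (L ≃ₐ[K] L) := Finite.one_lt_card_iff_nontrivial.1 (by omega)
        obtain ⟨σ, hσ⟩ := exists_ne (1 : L ≃ₐ[K] L)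
        exact ⟨⟨⟨g, σ⟩, iff_of_false h hσ⟩, rfl⟩
  have h1 : 0 < Nat.card L - 1 := by have : 1 < Nat.card L := Finite.one_lt_card; omega
  have h2 := Subgroup.card_eq_card_quotient_mul_card_subgroup
    ((scalarSubgroup K L).subgroupOf (twistedSubgroup K L hL hd))
  have h3 : Nat.card L - 1 ∣ Nat.card ((scalarSubgroup K L).subgroupOf
      (twistedSubgroup K L hL hd)) := by
    have h4 : (scalarToTwisted (hL := hL) (hd := hd)).range ≤
        (scalarSubgroup K L).subgroupOf (twistedSubgroup K L hL hd) := by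
      rintro _ ⟨u, rfl⟩
      exact (QuotientGroup.eq_one_iff _).1 (toTwistedPSL_scalar u)
    have h5 := Subgroup.card_dvd_of_le h4
    have h6 : Function.Injective (scalarToTwisted (hL := hL) (hd := hd)) := fun u v huv => by
      have h7 := congrArg (fun g : twistedSubgroup K L hL hd =>
        (g.1.left : 𝕄 L) 0 0) huv
      simp only [coe_scalarToTwisted, SemidirectProduct.left_inl, coe_scalar_two] at h7
      exact Units.ext h7
    rwa [Nat.card_congr (MonoidHom.ofInjective h6).toEquiv.symm, Nat.card_units] at h5
  rw [hT, card_gl_two] at h2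
  refine Nat.dvd_of_mul_dvd_mul_right h1 ?_
  rw [mul_comm (cardSL _), h2]
  exact mul_dvd_mul_left _ h3

end General

theorem galAction_apply {L : Type*} [Field L] [Algebra K L] (σ : L ≃ₐ[K] L) (g : GL (Fin 2) L)
    (n l : Fin 2) : (galAction K L σ g : 𝕄 L) n l =
      σ ((g : 𝕄 L) n l) := rfl

theorem glDiag_mul_galAction : glDiag (omegaUnit a) *
    galAction K _ (quadConj a) (glFlip _ * glDiag (omegaUnit a)) =
      glScalar (-omegaUnit a) * glDiag (-1) * glFlip _ := by
  refine Units.ext ?_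
  rw [Units.val_mul, Units.val_mul, Units.val_mul, coe_scalar_two, coe_glDiag, coe_glDiag,
    coe_glFlip]
  ext n l : 1
  rw [mul_apply, Fin.sum_univ_two, galAction_apply, galAction_apply, Units.val_mul, coe_glDiag,
    coe_glFlip]
  fin_cases n <;> fin_cases l <;> simp [quadConj_omega]

theorem glDiag_mul_galAction_self : glDiag (omegaUnit a) *
    galAction K _ (quadConj a) (glDiag (omegaUnit a)) = glDiag (-(omegaUnit a ^ 2)) := by
  refine Units.ext ?_
  rw [Units.val_mul, coe_glDiag, coe_glDiag]
  ext n l : 1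
  rw [mul_apply, Fin.sum_univ_two, galAction_apply, galAction_apply, coe_glDiag]
  fin_cases n <;> fin_cases l <;> simp [quadConj_omega, pow_two]

variable [Finite K] {hL : Odd (Nat.card 𝕃(K,a))}
  {hd : Module.finrank K 𝕃(K,a) = 2}

variable (hL hd) in
/-- The product of a diagonal matrix with nonsquare determinant and the field automorphism. -/
noncomputable def twistedDiag (h2 : (2 : K) ≠ 0) (hns : ¬ IsSquare (omegaUnit a : 𝕃(K,a))) :
    twistedSubgroup K 𝕃(K,a) hL hd :=
  ⟨⟨glDiag (omegaUnit a), quadConj a⟩, by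
    change IsSquare _ ↔ quadConj a = 1
    rw [det_glDiag]
    exact iff_of_false hns (quadConj_ne_one h2)⟩

variable {h2 : (2 : K) ≠ 0} {hns : ¬ IsSquare (omegaUnit a : 𝕃(K,a))}

theorem twistedDiag_pow {m : ℕ} (hω : omegaUnit a ^ 2 ^ (m + 1 + 1) = -1) :
    (twistedDiag hL hd h2 hns ^ 2 ^ (m + 1 + 1)).1 = SemidirectProduct.inl (glDiag (-1)) := by
  have hX2 : (twistedDiag hL hd h2 hns ^ 2).1 =
      SemidirectProduct.inl (glDiag (-(omegaUnit a ^ 2))) := by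
    rw [pow_two]
    exact SemidirectProduct.ext glDiag_mul_galAction_self quadConj_mul_self
  rw [pow_succ', pow_mul, Subgroup.coe_pow, hX2, ← map_pow, ← map_pow,
    Even.neg_pow (by rw [pow_succ']; exact even_two_mul _), ← pow_mul, ← pow_succ', hω]

theorem twistedDiag_pow' {m : ℕ} {i : 𝕃(K,a)ˣ} (hi : i * i = -1)
    (hω : omegaUnit a ^ 2 ^ (m + 1 + 1) = -1) :
    twistedDiag hL hd h2 hns ^ 2 ^ (m + 1 + 1) = scalarToTwisted i * slToTwisted (slDiag i) := by
  refine Subtype.ext ?_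
  rw [twistedDiag_pow hω, ← hi, glDiag_mul_self, map_mul]
  rfl

theorem twistedDiag_mul {m : ℕ} (hω : omegaUnit a ^ 2 ^ (m + 1 + 1) = -1) :
    twistedDiag hL hd h2 hns * (slToTwisted (slFlip _) * twistedDiag hL hd h2 hns) =
      scalarToTwisted (-omegaUnit a) * twistedDiag hL hd h2 hns ^ 2 ^ (m + 1 + 1) *
        slToTwisted (slFlip _) := by
  refine Subtype.ext ?_
  rw [Subgroup.coe_mul _ (_ * _) (slToTwisted _), Subgroup.coe_mul _ (scalarToTwisted _),
    twistedDiag_pow hω, coe_scalarToTwisted, coe_slToTwisted, ← map_mul, ← map_mul]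
  refine SemidirectProduct.ext ?_ quadConj_mul_self
  exact glDiag_mul_galAction

theorem toTwistedPSL_twistedDiag_ne_one {m : ℕ} (hω : omegaUnit a ^ 2 ^ (m + 1 + 1) = -1) :
    toTwistedPSL hL hd (twistedDiag hL hd h2 hns) ^ 2 ^ (m + 1 + 1) ≠ 1 := by
  rw [← map_pow, Ne, toTwistedPSL_eq_one]
  rintro ⟨u, hu⟩
  have h3 := congrArg Subtype.val hu
  rw [twistedDiag_pow hω] at h3
  have h4 := SemidirectProduct.inl_injective h3
  have h5 := congrArg Units.val h4
  rw [coe_scalar_two, coe_glDiag] at h5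
  have h6 := congrFun (congrFun h5 0) 0
  have h7 := congrFun (congrFun h5 1) 1
  simp only [of_apply, cons_val_zero, cons_val_one, Units.val_neg, Units.val_one] at h6 h7
  rw [← h7] at h6
  have h8 : (-1 : K) = 1 := congrArg QuadraticAlgebra.re h6
  refine h2 ?_
  linear_combination -h8

theorem toTwistedPSL_conj {m : ℕ} (hω : omegaUnit a ^ 2 ^ (m + 1 + 1) = -1) :
    toTwistedPSL hL hd (slToTwisted (slFlip _)) * toTwistedPSL hL hd (twistedDiag hL hd h2 hns) *
      (toTwistedPSL hL hd (slToTwisted (slFlip _)))⁻¹ =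
        toTwistedPSL hL hd (twistedDiag hL hd h2 hns) ^ ((2 : ℤ) ^ (m + 1 + 1) - 1) := by
  have h3 := congrArg (toTwistedPSL hL hd) (twistedDiag_mul (hL := hL) (hd := hd) (h2 := h2)
    (hns := hns) hω)
  rw [map_mul, map_mul, map_mul, map_mul, toTwistedPSL_scalar, one_mul, map_pow] at h3
  rw [mul_inv_eq_iff_eq_mul, _root_.zpow_sub_one, (Commute.zpow_self _ _).inv_right.eq, mul_assoc,
    eq_inv_mul_iff_mul_eq, h3, ← zpow_natCast]
  push_cast
  rfl

theorem toTwistedPSL_flip_mul_self : toTwistedPSL hL hd (slToTwisted (slFlip _)) *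
    toTwistedPSL hL hd (slToTwisted (slFlip _)) = 1 := by
  rw [← map_mul, toTwistedPSL_eq_one]
  exact ⟨-1, Subtype.ext (congrArg SemidirectProduct.inl glFlip_mul_self)⟩

theorem separated_twistedDiag {m : ℕ} :
    Separated (toTwistedPSL hL hd (twistedDiag hL hd h2 hns) ^ 2 ^ (m + 1))
      (toTwistedPSL hL hd (twistedDiag hL hd h2 hns) *
        toTwistedPSL hL hd (slToTwisted (slFlip _))) := by
  let ρ : TwistedPSL K 𝕃(K,a) hL hd →* _ :=
    QuotientGroup.lift _ (SemidirectProduct.rightHom.comp (Subgroup.subtype _)) (by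
      intro g hg
      obtain ⟨u, rfl⟩ := toTwistedPSL_eq_one.1 ((QuotientGroup.eq_one_iff g).2 hg)
      rfl)
  have hρ : ρ (toTwistedPSL hL hd (twistedDiag hL hd h2 hns)) = quadConj a := rfl
  refine separated_of_hom ρ ?_ ?_
  · rw [map_pow, hρ, pow_succ', pow_mul, pow_two, quadConj_mul_self, one_pow]
  · rw [map_mul, hρ, show ρ (toTwistedPSL hL hd (slToTwisted (slFlip _))) = 1 from rfl, mul_one]
    exact quadConj_ne_one h2

end Twisted

namespace MaxClass

open FusionSystem Matrix

variable {P : Type*} [Group P] [Finite P] {x y : P} {k : ℕ} {r s : ℤ} {F : FusionSystem P}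

theorem exists_twistedPSL (hk : 3 ≤ k) (D : MaxClass x y k (2 ^ (k - 1) - 1) 0)
    (hF : F.IsSaturated 2) (h1 : Has F x k y) (h2 : ¬ Has F x k (x * y)) :
    ∃ (K L : Type) (_ : Field K) (_ : Field L) (_ : Algebra K L)
      (_ : Finite L) (hL : Odd (Nat.card L)) (hd : Module.finrank K L = 2),
      F.IsFusionSystemOf 2 (TwistedPSL K L hL hd) := by
  obtain ⟨m, rfl⟩ : ∃ m, k = m + 1 + 2 := ⟨k - 3, by omega⟩
  obtain ⟨p, c, d, _, hc, hd, hpc, hpd, hp, h2p, -⟩ := exists_prime_sub_one (m + 1 + 1) (by omega)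
  obtain ⟨a, ha, ha'⟩ := exists_not_square hc hpc
  have : Fact (∀ r, r ^ 2 ≠ a + 0 * r) := ⟨ha'⟩
  have hω : omegaUnit a ^ 2 ^ (m + 1 + 1) = -1 := omegaUnit_pow ha
  have h2L : (2 : 𝕃(ZMod p,a)) ≠ 0 := fun h => h2p (by
    have h3 : algebraMap (ZMod p) 𝕃(ZMod p,a) 2 = 0 := by rw [map_ofNat, h]
    simpa using h3)
  have hLc : Nat.card 𝕃(ZMod p,a) = p * p := by
    rw [card_quadraticAlgebra, Nat.card_zmod]
  have hLodd : Odd (Nat.card 𝕃(ZMod p,a)) := by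
    rw [hLc]
    exact hp.mul hp
  have hLd : Module.finrank (ZMod p) 𝕃(ZMod p,a) = 2 :=
    QuadraticAlgebra.finrank_eq_two _ _
  have hL1 : p * p - 1 = 2 * (2 ^ (m + 1 + 1) * (c * d)) := by
    refine Nat.sub_eq_of_eq_add ?_
    have h3 : p * p = (p + 1) * (2 ^ (m + 1 + 1) * c) + 1 := by
      generalize 2 ^ (m + 1 + 1) * c = e at hpc
      rw [hpc]
      ring
    rw [h3, hpd]
    ring
  have hns : ¬ IsSquare (omegaUnit a : 𝕃(ZMod p,a)) := by
    refine not_isSquare_of_pow h2L (by rw [hLc, hL1]) ?_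
    rw [pow_mul, hω, (hc.mul hd).neg_one_pow]
  obtain ⟨i, hi'⟩ : ∃ i, i = omegaUnit a ^ 2 ^ (m + 1) := ⟨_, rfl⟩
  have hi : i * i = -1 := by rw [hi', ← pow_add, ← mul_two, ← pow_succ, hω]
  obtain ⟨X, hX⟩ : ∃ X, X = toTwistedPSL hLodd hLd (twistedDiag hLodd hLd h2p hns) := ⟨_, rfl⟩
  obtain ⟨Y, hY⟩ : ∃ Y, Y = toTwistedPSL hLodd hLd (slToTwisted (slFlip _)) := ⟨_, rfl⟩
  have hw : X ^ 2 ^ (m + 1 + 1) = toTwistedPSL hLodd hLd (slToTwisted (slDiag i)) := by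
    rw [hX, ← map_pow, twistedDiag_pow' hi hω, map_mul, toTwistedPSL_scalar, one_mul]
  have hne : X ^ 2 ^ (m + 1 + 1) ≠ 1 := hX ▸ toTwistedPSL_twistedDiag_ne_one hω
  have hcj : Y * X * Y⁻¹ = X ^ ((2 : ℤ) ^ (m + 1 + 2 - 1) - 1) := by
    rw [hX, hY]
    exact toTwistedPSL_conj hω
  have hsq0 : Y * Y = 1 := hY ▸ toTwistedPSL_flip_mul_self
  have hsq : Y * Y = X ^ (0 : ℤ) := by rw [hsq0, zpow_zero]
  have hsq' : X * Y * (X * Y) = X ^ 2 ^ (m + 1 + 1) := by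
    rw [mul_self_of_conj hcj hsq, ← zpow_natCast, add_zero, add_sub_cancel]
    push_cast
    rfl
  have : Finite (SemilinearGroup (ZMod p) 𝕃(ZMod p,a)) :=
    Finite.of_equiv _ SemidirectProduct.equivProd.symm
  refine ⟨ZMod p, 𝕃(ZMod p,a), inferInstance, inferInstance, inferInstance,
    inferInstance, hLodd, hLd, D.isFusionSystemOf hF (X := X) (Y := Y) ?_ hcj hsq
    ?_ (Or.inl ⟨h1, ?_⟩) (Or.inr ⟨h2, ?_⟩)⟩
  · refine orderOf_eq_two_pow hne ?_
    rw [pow_succ, pow_mul, hw, pow_two, ← map_mul, ← map_mul, ← map_mul, hi, ← slFlip_sq, map_mul,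
      map_mul, ← hY, hsq0]
  · intro h3
    have h4 := h3.trans card_twistedPSL_dvd
    refine not_dvd_of_eq_mul_odd (m := m + 4) (c := c * d * (2 ^ (m + 1 + 1) * (c * d) + 1) * (p * p))
      ?_ ?_ h4
    · refine ((hc.mul hd).mul ?_).mul (hp.mul hp)
      refine Even.add_one ?_
      rw [pow_succ', mul_assoc]
      exact even_two_mul _
    · rw [hLc, cardSL, hL1, show p * p + 1 = 2 * (2 ^ (m + 1 + 1) * (c * d) + 1) by
        have : 0 < p * p := Nat.mul_pos hp.pos hp.pos
        omega]
      ring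
  · rw [w_eq_of_mul_self hsq0, hw, hY]
    have h3 := (rotates_slDiag h2L hi 1).map ((toTwistedPSL hLodd hLd).comp slToTwisted)
    rwa [map_one, one_mul] at h3
  · rw [w_eq_of_mul_self_ne (by rw [hsq']; exact hne), hX, hY]
    exact separated_twistedDiag

end MaxClass

/-! ### Semidihedral groups in `GL_2` and `PSL_3` -/

section Gauss

open Matrix QuadraticAlgebra

variable {K : Type*} [Field K]

/-- The matrix of the multiplication by an element of the algebra `K[i]` with `i ^ 2 = -1`. -/
def gaussToMatrix : 𝕃(K,-1) →* 𝕄 K where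
  toFun z := !![z.re, -z.im; z.im, z.re]
  map_one' := by simp [one_fin_two]
  map_mul' z w := by
    ext i j
    fin_cases i <;> fin_cases j <;> simp <;> ring

/-- The units of `K[i]` as matrices. -/
def gaussToGL : 𝕃(K,-1)ˣ →* GL (Fin 2) K := Units.map gaussToMatrix

theorem coe_gaussToGL (z : 𝕃(K,-1)ˣ) :
    (gaussToGL z : 𝕄 K) = !![z.1.re, -z.1.im; z.1.im, z.1.re] := rfl

theorem gaussToGL_neg_one : gaussToGL (-1) = glScalar (-1 : Kˣ) := by
  refine Units.ext ?_
  rw [coe_gaussToGL, coe_scalar_two]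
  ext i j
  fin_cases i <;> fin_cases j <;> simp

theorem det_gaussToGL (z : 𝕃(K,-1)ˣ) :
    algebraMap K 𝕃(K,-1) (GeneralLinearGroup.det (gaussToGL z) : Kˣ) =
      z.1 * star z.1 := by
  change algebraMap K _ (Matrix.det (gaussToGL z : 𝕄 K)) = _
  rw [coe_gaussToGL, det_fin_two]
  ext <;> simp <;> ring

theorem glDiag_conj_gaussToGL {z z' : 𝕃(K,-1)ˣ} (h : z'.1 = star z.1) :
    glDiag (-1) * gaussToGL z * (glDiag (-1))⁻¹ = gaussToGL z' := by
  rw [mul_inv_eq_iff_eq_mul]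
  refine Units.ext ?_
  rw [Units.val_mul, Units.val_mul, coe_gaussToGL, coe_gaussToGL, coe_glDiag, h]
  ext i j
  fin_cases i <;> fin_cases j <;> simp

/-- The Frobenius automorphism of the Gaussian numbers over a field of order `p`, with `p`
congruent to `3` modulo `4`. -/
theorem gauss_pow {p c : ℕ} [Fact p.Prime] (hp : p = 2 * c + 1) (hc : Odd c)
    (z : 𝕃(ZMod p,-1)) : z ^ p = star z := by
  have : CharP 𝕃(ZMod p,-1) p := charP_of_injective_algebraMap
    (R := ZMod p) (fun u v h => congrArg QuadraticAlgebra.re h) p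
  have h1 : z = algebraMap _ _ z.re + algebraMap _ _ z.im * ⟨0, 1⟩ := by ext <;> simp
  have h2 : (⟨0, 1⟩ : 𝕃(ZMod p,-1)) ^ p = -⟨0, 1⟩ := by
    rw [show (⟨0, 1⟩ : 𝕃(ZMod p,-1)) ^ p = ⟨0, 1⟩ ^ (2 * c + 1) from
      congrArg _ hp, pow_succ, pow_mul, pow_two, omega_mul_self, ← map_pow, hc.neg_one_pow]
    ext <;> simp
  rw [h1, add_pow_char, mul_pow, h2, ← map_pow, ← map_pow, ZMod.pow_card, ZMod.pow_card]
  ext <;> simp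

theorem exists_toGL_eq {g : GL (Fin 2) K} (h : GeneralLinearGroup.det g = 1) :
    ∃ A : SL(2, K), Matrix.SpecialLinearGroup.toGL A = g :=
  ⟨⟨g, congrArg Units.val h⟩, Units.ext rfl⟩

/-- A semidihedral group of order `2 ^ (m + 4)` in `GL_2(p)`: the normalizer of a cyclic subgroup
of the multiplicative group of the field of order `p ^ 2`. -/
theorem exists_semidihedral_gl_two {m p c d : ℕ} [Fact p.Prime] (hc : Odd c) (hd : Odd d)
    (hpc : p = 2 * c + 1) (hpd : p + 1 = 2 ^ (m + 2) * d) :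
    ∃ X : GL (Fin 2) (ZMod p), X ^ 2 ^ (m + 2) = glScalar (-1) ∧
      glDiag (-1) * X * (glDiag (-1))⁻¹ = X ^ ((2 : ℤ) ^ (m + 2) - 1) ∧
      GeneralLinearGroup.det X = -1 ∧
      ∃ I J : SL(2, ZMod p), Matrix.SpecialLinearGroup.toGL I =
        X ^ 2 ^ (m + 1) ∧ Matrix.SpecialLinearGroup.toGL J = X * glDiag (-1) ∧ Rotates I J := by
  have h2p : (2 : ZMod p) ≠ 0 := two_ne_zero_of_odd (by omega)
  have : Fact (∀ r : ZMod p, r ^ 2 ≠ -1 + 0 * r) := ⟨fun r hr => by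
    obtain ⟨t, rfl⟩ := hc
    refine ZMod.exists_sq_eq_neg_one_iff.1 ⟨r, ?_⟩ (show p % 4 = 3 by omega)
    rw [← pow_two, hr]
    ring⟩
  obtain ⟨θ, hθ⟩ := exists_unit_of_dvd (K := 𝕃(ZMod p,-1))
    (d := 2 ^ (m + 3)) (by
      rw [card_quadraticAlgebra, Nat.card_zmod]
      refine ⟨c * d, Nat.sub_eq_of_eq_add ?_⟩
      have h3 : p * p = (p + 1) * (2 * c) + 1 := by
        rw [hpc]
        ring
      rw [h3, hpd]
      ring)
  have hθ1 : θ ^ 2 ^ (m + 2) = -1 := pow_eq_neg_one_of_orderOf hθ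
  have hstar : θ.1 * star θ.1 = -1 := by
    rw [← gauss_pow hpc hc, ← pow_succ', hpd, pow_mul, ← Units.val_pow_eq_pow_val, hθ1,
      Units.val_neg, Units.val_one, hd.neg_one_pow]
  have hdet : GeneralLinearGroup.det (gaussToGL θ) = -1 := by
    refine Units.ext ((algebraMap (ZMod p) 𝕃(ZMod p,-1)).injective ?_)
    rw [det_gaussToGL, hstar]
    simp
  have hX : gaussToGL θ ^ 2 ^ (m + 2) = glScalar (-1) := by
    rw [← map_pow, hθ1, gaussToGL_neg_one]
  have hcj : glDiag (-1) * gaussToGL θ * (glDiag (-1))⁻¹ =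
      gaussToGL θ ^ ((2 : ℤ) ^ (m + 2) - 1) := by
    rw [← map_zpow]
    refine glDiag_conj_gaussToGL ?_
    have h3 : θ ^ ((2 : ℤ) ^ (m + 2) - 1) = -θ⁻¹ := by
      rw [_root_.zpow_sub_one, show (2 : ℤ) ^ (m + 2) = ((2 ^ (m + 2) : ℕ) : ℤ) by push_cast; rfl,
        zpow_natCast, hθ1, neg_one_mul]
    rw [h3, Units.val_neg, Units.val_inv_eq_inv_val, neg_eq_iff_eq_neg]
    refine inv_eq_of_mul_eq_one_right ?_
    rw [mul_neg, hstar, neg_neg]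
  generalize gaussToGL θ = X at hdet hX hcj
  have hsq : glDiag (-1 : (ZMod p)ˣ) * glDiag (-1) = X ^ (0 : ℤ) := by
    rw [← map_mul, mul_neg_one, neg_neg, map_one, zpow_zero]
  have hJ2 : X * glDiag (-1) * (X * glDiag (-1)) = glScalar (-1) := by
    rw [mul_self_of_conj hcj hsq, ← hX, ← zpow_natCast, add_zero, add_sub_cancel]
    push_cast
    rfl
  have hI2 : X ^ 2 ^ (m + 1) * X ^ 2 ^ (m + 1) = glScalar (-1) := by
    rw [← pow_add, ← mul_two, ← pow_succ, hX]
  have hJI : X * glDiag (-1) * X ^ 2 ^ (m + 1) =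
      glScalar (-1) * (X ^ 2 ^ (m + 1) * (X * glDiag (-1))) := by
    have h3 : ((2 : ℤ) ^ (m + 2) - 1) * ((2 ^ (m + 1) : ℕ) : ℤ) =
        ((2 ^ (m + 2) : ℕ) : ℤ) * ((2 * 2 ^ m : ℕ) : ℤ) - ((2 ^ (m + 1) : ℕ) : ℤ) := by
      push_cast; ring
    have h4 : X ^ (((2 : ℤ) ^ (m + 2) - 1) * ((2 ^ (m + 1) : ℕ) : ℤ)) =
        glScalar (-1) * X ^ 2 ^ (m + 1) := by
      have h5 : glScalar (-1 : (ZMod p)ˣ) ^ 2 = 1 := by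
        rw [← map_pow, neg_one_sq, map_one]
      rw [h3, _root_.zpow_sub, _root_.zpow_mul, zpow_natCast, zpow_natCast, zpow_natCast, hX, pow_mul, h5,
        one_pow, one_mul, inv_eq_iff_mul_eq_one, ← mul_assoc,
        ← GeneralLinearGroup.scalar_commute, mul_assoc, hI2, ← pow_two, h5]
    rw [mul_assoc, ← zpow_natCast, mul_zpow_of_conj hcj, h4, zpow_natCast, ← mul_assoc, ← mul_assoc,
      ← mul_assoc, ← GeneralLinearGroup.scalar_commute, mul_assoc (glScalar _),
      ← pow_succ', pow_succ, mul_assoc, mul_assoc, mul_assoc]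
  have hcoe : (glScalar (-1 : (ZMod p)ˣ) : 𝕄 (ZMod p)) = -1 := by
    rw [coe_scalar_two]
    ext i j
    fin_cases i <;> fin_cases j <;> simp
  obtain ⟨I, hI⟩ := exists_toGL_eq (g := X ^ 2 ^ (m + 1)) (by
    rw [map_pow, hdet, pow_succ', pow_mul, neg_one_sq, one_pow])
  obtain ⟨J, hJ⟩ := exists_toGL_eq (g := X * glDiag (-1)) (by
    rw [map_mul, hdet, det_glDiag, mul_neg_one, neg_neg])
  rw [← hI, ← hJ] at hJI
  rw [← hI] at hI2
  rw [← hJ] at hJ2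
  refine ⟨X, hX, hcj, hdet, I, J, hI, hJ, rotates_of_sl_two h2p ?_ ?_ ?_⟩
  · have h3 := congrArg Units.val hI2
    rwa [hcoe] at h3
  · have h3 := congrArg Units.val hJ2
    rwa [hcoe] at h3
  · have h3 := congrArg Units.val hJI
    rwa [Units.val_mul (glScalar _), hcoe, neg_one_mul] at h3

/-- The embedding of `GL_2` in `SL_3`. -/
def glToSlThree : GL (Fin 2) K →* SL(3, K) where
  toFun g := ⟨!![g.1 0 0, g.1 0 1, 0; g.1 1 0, g.1 1 1, 0;
      0, 0, ((GeneralLinearGroup.det g)⁻¹ : Kˣ)], by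
    have h : (g.1 0 0 * g.1 1 1 - g.1 0 1 * g.1 1 0) = (GeneralLinearGroup.det g : Kˣ) :=
      (det_fin_two g.1).symm
    rw [det_fin_three]
    simp only [of_apply, cons_val', cons_val_zero, cons_val_one, cons_val]
    rw [Units.val_inv_eq_inv_val, ← h]
    have h1 : g.1 0 0 * g.1 1 1 - g.1 0 1 * g.1 1 0 ≠ 0 := h ▸ Units.ne_zero _
    field_simp
    ring⟩
  map_one' := Subtype.ext (by
    ext i j
    fin_cases i <;> fin_cases j <;> simp)
  map_mul' g h := Subtype.ext (by
    change !![(g * h).1 0 0, (g * h).1 0 1, 0; (g * h).1 1 0, (g * h).1 1 1, 0;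
      0, 0, (((GeneralLinearGroup.det (g * h))⁻¹ : Kˣ) : K)] =
      !![g.1 0 0, g.1 0 1, 0; g.1 1 0, g.1 1 1, 0; 0, 0, (((GeneralLinearGroup.det g)⁻¹ : Kˣ) : K)] *
      !![h.1 0 0, h.1 0 1, 0; h.1 1 0, h.1 1 1, 0; 0, 0, (((GeneralLinearGroup.det h)⁻¹ : Kˣ) : K)]
    rw [Units.val_mul, map_mul, mul_inv, Units.val_mul]
    ext i j
    fin_cases i <;> fin_cases j <;>
      simp [mul_apply, Fin.sum_univ_two, Fin.sum_univ_three])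

theorem coe_glToSlThree (g : GL (Fin 2) K) : (glToSlThree g : Matrix (Fin 3) (Fin 3) K) =
    !![g.1 0 0, g.1 0 1, 0; g.1 1 0, g.1 1 1, 0; 0, 0, (((GeneralLinearGroup.det g)⁻¹ : Kˣ) : K)] :=
  rfl

variable (K) in
/-- The projection from `SL_3` to `PSL_3`. -/
def toPslThree : SL(3, K) →* PSL(3, K) :=
  QuotientGroup.mk' _

theorem toPslThree_eq_one {g : SL(3, K)} :
    toPslThree K g = 1 ↔ g ∈ Subgroup.center _ := QuotientGroup.eq_one_iff g

theorem apply_eq_of_toPslThree_eq_one {g : SL(3, K)}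
    (h : toPslThree K g = 1) (i j : Fin 3) : (g : Matrix (Fin 3) (Fin 3) K) i i =
      (g : Matrix (Fin 3) (Fin 3) K) j j := by
  obtain ⟨r, -, hr⟩ := Matrix.SpecialLinearGroup.mem_center_iff.1 (toPslThree_eq_one.1 h)
  rw [← hr]
  simp

/-- The diagonal involutions in `PSL_3` are permuted cyclically by a permutation matrix. -/
theorem rotates_psl_three : Rotates
    (toPslThree K (glToSlThree (glScalar (-1))))
    (toPslThree K (glToSlThree (glDiag (-1)))) := by
  refine Rotates.map ?_ (toPslThree K)
  obtain ⟨g, hg⟩ : ∃ g : SL(3, K), (g : Matrix (Fin 3) (Fin 3) K) =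
    !![0, 1, 0; 0, 0, 1; 1, 0, 0] := ⟨⟨_, by simp [det_fin_three]⟩, rfl⟩
  have h1 : GeneralLinearGroup.det (glScalar (-1 : Kˣ)) = 1 := by
    rw [GeneralLinearGroup.det_scalar]; simp
  have e1 : (glToSlThree (glScalar (-1 : Kˣ)) : Matrix (Fin 3) (Fin 3) K) =
      !![-1, 0, 0; 0, -1, 0; 0, 0, 1] := by
    rw [coe_glToSlThree, h1, coe_scalar_two]
    simp
  have e2 : (glToSlThree (glDiag (-1 : Kˣ)) : Matrix (Fin 3) (Fin 3) K) =
      !![-1, 0, 0; 0, 1, 0; 0, 0, -1] := by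
    rw [coe_glToSlThree, det_glDiag, coe_glDiag]
    simp
  refine ⟨g, ?_, ?_⟩
  · rw [mul_inv_eq_iff_eq_mul]
    refine Subtype.ext ?_
    rw [Matrix.SpecialLinearGroup.coe_mul, Matrix.SpecialLinearGroup.coe_mul, hg, e1, e2]
    simp
  · rw [mul_inv_eq_iff_eq_mul]
    refine Subtype.ext ?_
    rw [Matrix.SpecialLinearGroup.coe_mul, Matrix.SpecialLinearGroup.coe_mul,
      Matrix.SpecialLinearGroup.coe_mul, hg, e1, e2]
    simp

theorem card_psl_three_dvd [Finite K] : Nat.card PSL(3, K) ∣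
    Nat.card SL(3, K) :=
  Subgroup.card_quotient_dvd_card _

end Gauss

namespace MaxClass

open FusionSystem Matrix

variable {P : Type*} [Group P] [Finite P] {x y : P} {k : ℕ} {r s : ℤ} {F : FusionSystem P}

theorem exists_gl_two (hk : 3 ≤ k) (D : MaxClass x y k (2 ^ (k - 1) - 1) 0)
    (hF : F.IsSaturated 2) (h1 : ¬ Has F x k y) (h2 : Has F x k (x * y)) :
    ∃ (K : Type) (_ : Field K) (_ : Finite K), Nat.card K % 4 = 3 ∧
      F.IsFusionSystemOf 2 (GL (Fin 2) K) := by
  obtain ⟨m, rfl⟩ : ∃ m, k = m + 1 + 2 := ⟨k - 3, by omega⟩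
  obtain ⟨p, c, d, _, hc, hd, hpc, hpd, hp, h2p⟩ := exists_prime_add_one (m + 2) (by omega)
  have hneg := units_neg_one_ne_one h2p
  obtain ⟨X, hX, hcj, hdet, I, J, hI, hJ, hIJ⟩ := exists_semidihedral_gl_two hc hd hpc hpd
  have hsq0 : glDiag (-1 : (ZMod p)ˣ) * glDiag (-1) = 1 := by
    rw [← map_mul, mul_neg_one, neg_neg, map_one]
  have hsq : glDiag (-1 : (ZMod p)ˣ) * glDiag (-1) = X ^ (0 : ℤ) := by rw [hsq0, zpow_zero]
  have hne : X ^ 2 ^ (m + 1 + 1) ≠ 1 := by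
    rw [hX]
    intro h
    have h3 := congrArg Units.val h
    rw [coe_scalar_two] at h3
    have h4 := congrFun (congrFun h3 0) 0
    exact hneg (Units.ext (by simpa using h4))
  refine ⟨ZMod p, inferInstance, inferInstance, ?_, D.isFusionSystemOf hF (X := X)
    (Y := glDiag (-1)) ?_ hcj hsq ?_ (Or.inr ⟨h1, ?_⟩) (Or.inl ⟨h2, ?_⟩)⟩
  · rw [Nat.card_zmod]
    obtain ⟨t, rfl⟩ := hc
    omega
  · refine orderOf_eq_two_pow hne ?_
    rw [pow_succ, pow_mul, hX, pow_two, ← map_mul, mul_neg_one, neg_neg, map_one]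
  · refine not_dvd_of_eq_mul_odd (m := m + 4) (c := c * c * (d * p)) ?_ ?_
    · exact (hc.mul hc).mul (hd.mul hp)
    · change Nat.card (GL (Fin 2) (ZMod p)) = _
      rw [card_gl_two, Nat.card_zmod, cardSL, hpd, show p - 1 = 2 * c by omega]
      ring
  · rw [w_eq_of_mul_self hsq0, hX]
    refine separated_of_hom GeneralLinearGroup.det ?_ ?_
    · rw [GeneralLinearGroup.det_scalar]; simp
    · rwa [det_glDiag]
  · rw [w_eq_of_mul_self_ne, ← hI, ← hJ]
    · exact hIJ.map _
    · rw [mul_self_of_conj hcj hsq, add_zero, add_sub_cancel]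
      intro h
      refine hne ?_
      rw [← h, ← zpow_natCast]
      push_cast
      rfl

theorem exists_psl_three (hk : 3 ≤ k) (D : MaxClass x y k (2 ^ (k - 1) - 1) 0)
    (hF : F.IsSaturated 2) (h1 : Has F x k y) (h2 : Has F x k (x * y)) :
    ∃ (K : Type) (_ : Field K) (_ : Finite K), Nat.card K % 4 = 3 ∧
      F.IsFusionSystemOf 2 PSL(3, K) := by
  obtain ⟨m, rfl⟩ : ∃ m, k = m + 1 + 2 := ⟨k - 3, by omega⟩
  obtain ⟨p, c, d, _, hc, hd, hpc, hpd, hp, h2p⟩ := exists_prime_add_one (m + 2) (by omega)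
  obtain ⟨X, hX, hcj, hdet, I, J, hI, hJ, hIJ⟩ := exists_semidihedral_gl_two hc hd hpc hpd
  obtain ⟨f, hf⟩ : ∃ f, f = (toPslThree (ZMod p)).comp glToSlThree := ⟨_, rfl⟩
  have hcj' : f (glDiag (-1)) * f X * (f (glDiag (-1)))⁻¹ =
      f X ^ ((2 : ℤ) ^ (m + 1 + 2 - 1) - 1) := by
    rw [← map_inv, ← map_mul, ← map_mul, hcj, map_zpow]
    rfl
  have hsq0 : f (glDiag (-1 : (ZMod p)ˣ)) * f (glDiag (-1)) = 1 := by
    rw [← map_mul, ← map_mul, mul_neg_one, neg_neg, map_one, map_one]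
  have hsq : f (glDiag (-1 : (ZMod p)ˣ)) * f (glDiag (-1)) = f X ^ (0 : ℤ) := by
    rw [hsq0, zpow_zero]
  have hX' : f X ^ 2 ^ (m + 1 + 1) = f (glScalar (-1)) := by
    rw [← map_pow, hX]
  have hne : f X ^ 2 ^ (m + 1 + 1) ≠ 1 := by
    rw [hX', hf]
    intro h
    have h3 := apply_eq_of_toPslThree_eq_one h 0 2
    rw [coe_glToSlThree, coe_scalar_two, GeneralLinearGroup.det_scalar] at h3
    simp at h3
    refine h2p ?_
    linear_combination -h3
  refine ⟨ZMod p, inferInstance, inferInstance, ?_, D.isFusionSystemOf hF (X := f X)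
    (Y := f (glDiag (-1))) ?_ hcj' hsq ?_ (Or.inl ⟨h1, ?_⟩) (Or.inl ⟨h2, ?_⟩)⟩
  · rw [Nat.card_zmod]
    obtain ⟨t, rfl⟩ := hc
    omega
  · refine orderOf_eq_two_pow hne ?_
    rw [pow_succ, pow_mul, hX', pow_two, ← map_mul, ← map_mul, mul_neg_one, neg_neg, map_one,
      map_one]
  · intro h3
    have h4 := h3.trans (card_psl_three_dvd (K := ZMod p))
    refine not_dvd_of_eq_mul_odd (m := m + 4) (c := c * c * (d * (p ^ 3 * (p * (p + 1) + 1)))) ?_ ?_ h4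
    · refine (hc.mul hc).mul (hd.mul (hp.pow.mul ?_))
      exact (Nat.even_mul_succ_self p).add_one
    · rw [card_sl_three, Nat.card_zmod, show p - 1 = 2 * c by omega]
      generalize p ^ 3 * (p * (p + 1) + 1) = e
      rw [hpd]
      ring
  · rw [w_eq_of_mul_self hsq0, hX', hf]
    exact rotates_psl_three
  · rw [← map_mul, w_eq_of_mul_self_ne, ← map_pow, ← hI, ← hJ]
    · exact hIJ.map (f.comp Matrix.SpecialLinearGroup.toGL)
    · rw [map_mul, mul_self_of_conj hcj' hsq, add_zero, add_sub_cancel]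
      intro h
      refine hne ?_
      rw [← h, ← zpow_natCast]
      push_cast
      rfl

end MaxClass

/-! ### The systems on dihedral, semidihedral and quaternion groups -/

namespace MaxClass

open FusionSystem

variable {P P' : Type*} [Group P] [Group P'] {x y : P} {k : ℕ} {r s : ℤ}

theorem map (D : MaxClass x y k r s) (e : P ≃* P') : MaxClass (e x) (e y) k r s where
  two_le := D.two_le
  orderOf_x := by rw [MulEquiv.orderOf_eq, D.orderOf_x]
  conj := by rw [← map_inv, ← map_mul, ← map_mul, D.conj, map_zpow]
  sq := by rw [← map_mul, D.sq, map_zpow]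
  notMem := by
    rintro ⟨a, ha⟩
    exact D.notMem ⟨a, e.injective ((map_zpow e x a).trans ha)⟩
  cover g := by
    obtain ⟨a, h⟩ := D.cover (e.symm g)
    refine ⟨a, h.imp (fun h => ?_) fun h => ?_⟩
    · rw [← map_zpow, ← h, MulEquiv.apply_symm_apply]
    · rw [← map_zpow, ← map_mul, ← h, MulEquiv.apply_symm_apply]
  card := by rw [← Nat.card_congr e.toEquiv, D.card]
  dvd_r := D.dvd_r
  dvd_s := D.dvd_s
  small := D.small

theorem dihedral {k : ℕ} (hk : 2 ≤ k) :
    MaxClass (DihedralGroup.r 1 : DihedralGroup (2 ^ k)) (DihedralGroup.sr 0) k (-1) 0 where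
  two_le := hk
  orderOf_x := DihedralGroup.orderOf_r_one
  conj := by simp
  sq := by simp
  notMem := by
    rintro ⟨a, ha⟩
    simp at ha
  cover g := by
    rcases g with i | i
    · exact ⟨i.cast, Or.inl (by simp)⟩
    · exact ⟨(-i).cast, Or.inr (by simp [-ZMod.intCast_cast, -ZMod.cast_neg]; simp)⟩
  card := by rw [DihedralGroup.nat_card, pow_succ']
  dvd_r := by simp
  dvd_s := by simp
  small := Or.inr (by simp)

theorem _root_.QuaternionGroup.a_one_zpow {n : ℕ} (j : ℤ) :
    (QuaternionGroup.a 1 : QuaternionGroup n) ^ j = QuaternionGroup.a (j : ZMod (2 * n)) := by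
  obtain ⟨m, rfl | rfl⟩ := j.eq_nat_or_neg
  · rw [zpow_natCast, QuaternionGroup.a_one_pow, Int.cast_natCast]
  · rw [zpow_neg, zpow_natCast, QuaternionGroup.a_one_pow, inv_eq_iff_mul_eq_one,
      QuaternionGroup.a_mul_a, QuaternionGroup.one_def]
    simp

theorem _root_.QuaternionGroup.cover {n : ℕ} (g : QuaternionGroup n) :
    ∃ j : ℤ, g = QuaternionGroup.a 1 ^ j ∨ g = QuaternionGroup.a 1 ^ j * QuaternionGroup.xa 0 := by
  rcases g with i | i
  · exact ⟨i.cast, Or.inl (by rw [QuaternionGroup.a_one_zpow, ZMod.intCast_zmod_cast])⟩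
  · exact ⟨(-i).cast, Or.inr (by
      rw [QuaternionGroup.a_one_zpow, ZMod.intCast_zmod_cast, QuaternionGroup.a_mul_xa, zero_sub,
        neg_neg])⟩

theorem _root_.QuaternionGroup.xa_conj {n : ℕ} :
    (QuaternionGroup.xa 0 : QuaternionGroup n) * QuaternionGroup.a 1 * (QuaternionGroup.xa 0)⁻¹ =
      QuaternionGroup.a 1 ^ (-1 : ℤ) := by
  rw [QuaternionGroup.a_one_zpow, mul_inv_eq_iff_eq_mul, QuaternionGroup.xa_mul_a,
    QuaternionGroup.a_mul_xa]
  simp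

theorem _root_.QuaternionGroup.xa_sq' {n : ℕ} :
    (QuaternionGroup.xa 0 : QuaternionGroup n) * QuaternionGroup.xa 0 =
      QuaternionGroup.a 1 ^ (n : ℤ) := by
  rw [QuaternionGroup.a_one_zpow, QuaternionGroup.xa_mul_xa]
  simp

theorem _root_.QuaternionGroup.xa_notMem {n : ℕ} :
    (QuaternionGroup.xa 0 : QuaternionGroup n) ∉ zpowers (QuaternionGroup.a 1) := by
  rintro ⟨a, ha⟩
  simp only [QuaternionGroup.a_one_zpow] at ha
  cases ha

theorem quaternion {k : ℕ} (hk : 3 ≤ k) :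
    MaxClass (QuaternionGroup.a 1 : QuaternionGroup (2 ^ (k - 1))) (QuaternionGroup.xa 0) k (-1)
      (2 ^ (k - 1)) where
  two_le := by omega
  orderOf_x := by
    rw [QuaternionGroup.orderOf_a_one, ← pow_succ']
    congr 1
    omega
  conj := QuaternionGroup.xa_conj
  sq := by
    rw [QuaternionGroup.xa_sq']
    push_cast
    rfl
  notMem := QuaternionGroup.xa_notMem
  cover := QuaternionGroup.cover
  card := by
    rw [Nat.card_eq_fintype_card, QuaternionGroup.card, show k + 1 = 2 + (k - 1) by omega, pow_add]
    rfl
  dvd_r := by simp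
  dvd_s := by simp
  small := Or.inl hk

theorem of_isSemidihedral {n : ℕ} (h : IsSemidihedral n P) :
    ∃ x y : P, MaxClass x y (n - 1) (2 ^ (n - 1 - 1) - 1) 0 := by
  obtain ⟨hn, hcard, x, y, hx, hy, hyx, hxy⟩ := h
  obtain ⟨m, rfl⟩ : ∃ m, n = m + 4 := ⟨n - 4, by omega⟩
  simp only [show m + 4 - 1 = m + 3 by omega, show m + 4 - 2 = m + 2 by omega,
    show m + 3 - 1 = m + 2 by omega] at *
  have hc : y * x * y⁻¹ = x ^ ((2 : ℤ) ^ (m + 2) - 1) := by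
    rw [hyx, ← zpow_natCast, Nat.cast_sub Nat.one_le_two_pow]
    push_cast
    rfl
  have hs : y * y = x ^ (0 : ℤ) := by rw [zpow_zero, ← pow_two, ← hy, pow_orderOf_eq_one]
  have hcov : metacyclic hc hs = ⊤ := by
    rw [eq_top_iff, ← hxy, closure_le]
    rintro g (rfl | hg)
    · exact mem_metacyclic.2 ⟨1, Or.inl (zpow_one _).symm⟩
    · exact mem_metacyclic.2 ⟨0, Or.inr (by rw [zpow_zero, one_mul]; exact hg)⟩
  refine ⟨x, y, ?_⟩
  exact
  { two_le := by omega
    orderOf_x := hx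
    conj := hc
    sq := hs
    notMem := fun hyz => by
      have h1 : zpowers x = ⊤ := by
        rw [eq_top_iff, ← hxy, closure_le]
        rintro g (rfl | hg)
        · exact mem_zpowers _
        · rw [Set.mem_singleton_iff.1 hg]
          exact hyz
      have h2 := Nat.card_zpowers x
      rw [h1, Subgroup.card_top, hcard, hx] at h2
      have := Nat.pow_right_injective le_rfl h2
      omega
    cover := fun g => mem_metacyclic.1 (hcov ▸ mem_top g)
    card := hcard
    dvd_r := by simp
    dvd_s := by simp
    small := Or.inl (by omega) }

variable [Finite P] {F : FusionSystem P}

theorem classification_dihedral (D : MaxClass x y k (-1) 0) (hF : F.IsSaturated 2) :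
    F.essentialRank 2 ≤ 2 ∧
      ((F.essentialRank 2 = 0 ∧ F.IsFusionSystemOf 2 P) ∨
      (F.essentialRank 2 = 1 ∧ ∃ (K : Type) (_ : Field K) (_ : Finite K), Odd (Nat.card K) ∧
        F.IsFusionSystemOf 2 (Matrix.ProjGenLinGroup (Fin 2) K)) ∨
      (F.essentialRank 2 = 2 ∧ ∃ (K : Type) (_ : Field K) (_ : Finite K),
        (Nat.card K % 8 = 1 ∨ Nat.card K % 8 = 7) ∧
        F.IsFusionSystemOf 2 PSL(2, K))) := by
  have D' : MaxClass x (x * y) k (-1) 0 := by simpa using D.swap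
  by_cases h1 : Has F x k y <;> by_cases h2 : Has F x k (x * y)
  · have h := D.rank_two hF h1 h2
    exact ⟨h.le, Or.inr (Or.inr ⟨h, D.exists_psl_two hF h1 h2⟩)⟩
  · have h := D.rank_one_left h1 h2
    exact ⟨by omega, Or.inr (Or.inl ⟨h, D.exists_pgl_two hF h1 h2⟩)⟩
  · have h := D.rank_one_right h1 h2
    exact ⟨by omega, Or.inr (Or.inl ⟨h, D'.exists_pgl_two hF h2 (by rwa [D.has_swap_iff])⟩)⟩
  · have h := D.rank_zero hF h1 h2
    exact ⟨by omega, Or.inl h⟩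

theorem classification_quaternion (hk : 3 ≤ k) (D : MaxClass x y k (-1) (2 ^ (k - 1)))
    (hF : F.IsSaturated 2) : F.essentialRank 2 ≤ 2 ∧
      ((F.essentialRank 2 = 0 ∧ F.IsFusionSystemOf 2 P) ∨
      (F.essentialRank 2 = 1 ∧ ∃ (K L : Type) (_ : Field K) (_ : Field L) (_ : Algebra K L)
        (_ : Finite L), Odd (Nat.card L) ∧ Module.finrank K L = 2 ∧
        F.IsFusionSystemOf 2 (slTwoExtension K L)) ∨
      (F.essentialRank 2 = 2 ∧ ∃ (K : Type) (_ : Field K) (_ : Finite K), Odd (Nat.card K) ∧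
        F.IsFusionSystemOf 2 SL(2, K))) := by
  have D' : MaxClass x (x * y) k (-1) (2 ^ (k - 1)) := by simpa using D.swap
  by_cases h1 : Has F x k y <;> by_cases h2 : Has F x k (x * y)
  · have h := D.rank_two hF h1 h2
    exact ⟨h.le, Or.inr (Or.inr ⟨h, D.exists_sl_two hk hF h1 h2⟩)⟩
  · have h := D.rank_one_left h1 h2
    exact ⟨by omega, Or.inr (Or.inl ⟨h, D.exists_slTwoExtension hk hF h1 h2⟩)⟩
  · have h := D.rank_one_right h1 h2
    exact ⟨by omega,
      Or.inr (Or.inl ⟨h, D'.exists_slTwoExtension hk hF h2 (by rwa [D.has_swap_iff])⟩)⟩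
  · have h := D.rank_zero hF h1 h2
    exact ⟨by omega, Or.inl h⟩

theorem classification_semidihedral (hk : 3 ≤ k) (D : MaxClass x y k (2 ^ (k - 1) - 1) 0)
    (hF : F.IsSaturated 2) : F.essentialRank 2 ≤ 2 ∧
      ((F.essentialRank 2 = 0 ∧ F.IsFusionSystemOf 2 P) ∨
      (F.essentialRank 2 = 1 ∧ ∃ (K L : Type) (_ : Field K) (_ : Field L) (_ : Algebra K L)
        (_ : Finite L) (hL : Odd (Nat.card L)) (hd : Module.finrank K L = 2),
        F.IsFusionSystemOf 2 (TwistedPSL K L hL hd)) ∨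
      (F.essentialRank 2 = 1 ∧ ∃ (K : Type) (_ : Field K) (_ : Finite K), Nat.card K % 4 = 3 ∧
        F.IsFusionSystemOf 2 (GL (Fin 2) K)) ∨
      (F.essentialRank 2 = 2 ∧ ∃ (K : Type) (_ : Field K) (_ : Finite K), Nat.card K % 4 = 3 ∧
        F.IsFusionSystemOf 2 PSL(3, K))) := by
  by_cases h1 : Has F x k y <;> by_cases h2 : Has F x k (x * y)
  · have h := D.rank_two hF h1 h2
    exact ⟨h.le, Or.inr (Or.inr (Or.inr ⟨h, D.exists_psl_three hk hF h1 h2⟩))⟩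
  · have h := D.rank_one_left h1 h2
    exact ⟨by omega, Or.inr (Or.inl ⟨h, D.exists_twistedPSL hk hF h1 h2⟩)⟩
  · have h := D.rank_one_right h1 h2
    exact ⟨by omega, Or.inr (Or.inr (Or.inl ⟨h, D.exists_gl_two hk hF h1 h2⟩))⟩
  · have h := D.rank_zero hF h1 h2
    exact ⟨by omega, Or.inl h⟩

end MaxClass

/-! ### The quaternion group of order eight -/

section QuaternionEight

open FusionSystem QuaternionGroup

theorem QuaternionGroup.exists_quatPair : ∀ y : QuaternionGroup 2, y * y ≠ 1 →
    ∃ u : QuaternionGroup 2, (u * y * u⁻¹ = y⁻¹ ∧ u * u = y * y ∧ y ^ 4 = 1 ∧ y ≠ 1 ∧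
      ∀ a : Fin 4, y ^ (a : ℕ) ≠ u) ∧
      ∀ g, ∃ a : Fin 4, g = y ^ (a : ℕ) ∨ g = y ^ (a : ℕ) * u := by
  decide

theorem QuaternionGroup.central_of_sq_eq_one :
    ∀ x y : QuaternionGroup 2, x ^ 2 = 1 → x * y = y * x := by
  decide

theorem QuaternionGroup.commutator_sq :
    ∀ x y : QuaternionGroup 2, (x * y * x⁻¹ * y⁻¹) ^ 2 = 1 := by
  decide

theorem QuaternionGroup.card_sq_ne_one :
    Fintype.card {y : QuaternionGroup 2 // y * y ≠ 1} = 6 := by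
  decide

variable {P : Type*} [Group P]

/-- Each element of order four of the quaternion group of order eight is part of a pair of
generators. -/
theorem exists_quatPair_of_sq_ne_one (e : P ≃* QuaternionGroup 2) {y : P} (hy : y * y ≠ 1) :
    ∃ u, QuatPair y u ∧ ∀ g : P, ∃ a : ℤ, g = y ^ a ∨ g = y ^ a * u := by
  obtain ⟨u, ⟨h1, h2, h3, h4, h5⟩, h6⟩ := QuaternionGroup.exists_quatPair (e y) (fun h => hy
    (e.injective (by rw [map_mul, h, map_one])))
  obtain ⟨u, rfl⟩ := e.surjective u
  have h3' : y ^ 4 = 1 := e.injective (by rw [map_pow, h3, map_one])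
  refine ⟨u, ⟨e.injective (by simpa using h1), e.injective (by simpa using h2), h3',
    fun h => h4 (by rw [h, map_one]), ?_⟩, fun g => ?_⟩
  · rintro ⟨a, rfl⟩
    have h7 : 0 ≤ a % 4 := Int.emod_nonneg a (by norm_num)
    have h8 : a % 4 < 4 := Int.emod_lt_of_pos a (by norm_num)
    refine h5 ⟨(a % 4).toNat, by omega⟩ ?_
    simp only
    rw [← zpow_natCast, Int.toNat_of_nonneg h7, ← map_zpow]
    congr 1
    conv_rhs => rw [← Int.mul_ediv_add_emod a 4, zpow_add, zpow_mul]
    rw [show (4 : ℤ) = ((4 : ℕ) : ℤ) by norm_num, zpow_natCast, h3', one_zpow, one_mul]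
  · obtain ⟨a, h7⟩ := h6 (e g)
    refine ⟨(a : ℕ), h7.imp (fun h => e.injective ?_) fun h => e.injective ?_⟩
    · rw [h, zpow_natCast, map_pow]
    · rw [h, zpow_natCast, map_mul, map_pow]

variable [Finite P]

theorem card_dvd_three_of_quaternion (e : P ≃* QuaternionGroup 2) {K : Subgroup (MulAut P)}
    (hK : Odd (Nat.card K)) : Nat.card K ∣ 3 := by
  have h1 : Nat.card K ∣ Nat.card {y : P | y * y ≠ 1} := by
    refine card_dvd_of_free (fun α _ y hy h => hy ?_) fun α hα y hy h => ?_
    · rw [← map_mul] at h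
      exact (map_eq_one_iff α α.injective).1 h
    · by_contra hα1
      obtain ⟨u, hu, hcov⟩ := exists_quatPair_of_sq_ne_one e hy
      obtain ⟨j, hj⟩ := hu.exists_apply_eq hcov
        (Odd.of_dvd_nat hK (Subgroup.orderOf_dvd_natCard K hα)) hα1
      rw [h] at hj
      refine hu.notMem ⟨1 - j, ?_⟩
      simp only
      rw [sub_eq_neg_add, zpow_add, zpow_neg, zpow_one, inv_mul_eq_iff_eq_mul]
      exact hj
  have h2 : Nat.card {y : P | y * y ≠ 1} = 6 := by
    rw [← QuaternionGroup.card_sq_ne_one, ← Nat.card_eq_fintype_card]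
    refine Nat.card_congr (e.toEquiv.subtypeEquiv fun y => ?_)
    change y * y ≠ 1 ↔ e y * e y ≠ 1
    rw [← map_mul, Ne, Ne, map_eq_one_iff e e.injective]
  rw [h2] at h1
  exact (Nat.Coprime.dvd_of_dvd_mul_left (Nat.coprime_two_right.2 hK) (m := 2) (n := 3) h1)

/-- The fusion system of `SL_2(p)` for some prime `p` with Sylow 2-subgroups of order eight. -/
theorem exists_sl_two_of_quaternion (e : P ≃* QuaternionGroup 2) :
    ∃ (K : Type) (_ : Field K) (_ : Finite K) (F : FusionSystem P), Odd (Nat.card K) ∧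
      F.IsSaturated 2 ∧ F.HasCoprimeAut 2 ⊤ ∧
      F.IsFusionSystemOf 2 SL(2, K) := by
  obtain ⟨p, c, d, _, hc, hd, hpc, hpd, hp, h2p, ζ, hζ⟩ := exists_prime_sub_one 2 le_rfl
  have hi : ζ * ζ = -1 := by
    have := pow_eq_neg_one_of_orderOf (m := 1) hζ
    rwa [pow_one, pow_two] at this
  obtain ⟨x, hx⟩ := e.surjective (a 1)
  obtain ⟨y, hy⟩ := e.surjective (xa 0)
  have h1 : y * x * y⁻¹ = x ^ (-1 : ℤ) := e.injective (by
    rw [map_mul, map_mul, map_inv, map_zpow, hx, hy, xa_conj])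
  have h2 : y * y = x ^ (2 : ℤ) := e.injective (by
    rw [map_mul, map_zpow, hx, hy, xa_sq']; rfl)
  have h3 : y ∉ zpowers x := by
    rintro ⟨j, hj⟩
    refine xa_notMem (n := 2) ⟨j, ?_⟩
    simp only
    rw [← hx, ← hy, ← hj, map_zpow]
  have h4 : metacyclic h1 h2 = ⊤ := (Subgroup.eq_top_iff' _).2 fun g => by
    obtain ⟨j, hj⟩ := QuaternionGroup.cover (e g)
    rw [← hx, ← hy] at hj
    refine mem_metacyclic.2 ⟨j, hj.imp (fun h => e.injective ?_) fun h => e.injective ?_⟩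
    · rw [h, map_zpow]
    · rw [h, map_mul, map_zpow]
  have ho : orderOf x = 4 := by
    rw [← MulEquiv.orderOf_eq e, hx, orderOf_a_one]
  have hpair : QuatPair x y :=
    { conj := by rw [h1, zpow_neg_one]
      sq := by rw [h2, zpow_two]
      four := by rw [← ho, pow_orderOf_eq_one]
      ne := by
        rintro rfl
        rw [orderOf_one] at ho
        omega
      notMem := h3 }
  obtain ⟨i, hi', hix, hiy⟩ := exists_monoidHom_of_metacyclic h1 h2 (slFlip_conj ζ)
    (by rw [slFlip_sq, ← hi, map_mul, zpow_two])
    (by rw [orderOf_injective _ slDiag_injective, hζ, ho]; rfl) h3 (by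
      rintro ⟨j, hj⟩
      -- an element of `⟨X⟩` commutes with `X` and does not invert it
      have h5 := slFlip_conj ζ
      simp only at hj
      rw [← hj, ((Commute.refl (slDiag ζ)).zpow_left j).eq, mul_inv_cancel_right, zpow_neg_one, eq_inv_iff_mul_eq_one,
        ← map_mul, hi, ← map_one slDiag] at h5
      exact units_neg_one_ne_one h2p (slDiag_injective h5)) h4
  have hP : Nat.card P = 2 ^ 3 := by
    rw [Nat.card_congr e.toEquiv, Nat.card_eq_fintype_card, QuaternionGroup.card]; rfl
  have hidx : ¬ 2 ∣ i.range.index := not_dvd_index_range hi' hP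
    (not_dvd_of_eq_mul_odd (m := 3) (c := c * (d * p)) (hc.mul (hd.mul hp)) (by
      rw [card_sl_two, Nat.card_zmod, cardSL, hpd, show p - 1 = 2 ^ 2 * c by omega]
      ring))
  have hP2 : IsPGroup 2 P := IsPGroup.of_card hP
  have htop : closure {x, y} = ⊤ := (Subgroup.eq_top_iff' _).2 fun g =>
    hpair.mem_closure.2 (mem_metacyclic.1 (h4 ▸ mem_top g))
  obtain ⟨g, hg1, hg2⟩ := rotates_slDiag h2p hi 1
  rw [map_one, one_mul] at hg1 hg2
  refine ⟨ZMod p, inferInstance, inferInstance, ofEmb i hi', by rwa [Nat.card_zmod],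
    isSaturated_ofEmb hP2 hidx, ?_,
    isFusionSystemOf_ofEmb hP2 hidx⟩
  rw [← htop]
  exact hpair.hasCoprimeAut (g := g) (by rw [hix, hiy, hg1]) (by rw [map_mul, hix, hiy, hg2])

theorem isPGroup_aut_top_of_isIso (hP : IsPGroup 2 P) {F : FusionSystem P}
    (h : F.IsIso (ofEmb (MonoidHom.id P) Function.injective_id)) : IsPGroup 2 (F.aut ⊤) := by
  have h1 : IsPGroup 2 (ofEmb (MonoidHom.id P) Function.injective_id).autTop := by
    have h2 : (ofEmb (MonoidHom.id P) Function.injective_id).autTop = inn P :=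
      Subgroup.ext autTop_ofEmb_id
    rw [h2]
    exact hP.of_surjective (MulAut.conj : P →* MulAut P).rangeRestrict
      (MonoidHom.rangeRestrict_surjective _)
  obtain ⟨n, hn⟩ := IsPGroup.iff_card.1 h1
  have h3 : IsPGroup 2 F.autTop := IsPGroup.of_card (h.card_autTop_eq.trans hn)
  have h4 : F.aut ⊤ ≤ F.autTop.map (MulAut.congr (topEquiv (G := P)).symm).toMonoidHom := by
    rw [autTop, Subgroup.map_comap_eq_self_of_surjective
      (MulAut.congr (topEquiv (G := P)).symm).surjective]
  exact (h3.map _).to_le h4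

theorem HasCoprimeAut.not_isPGroup {Q : Subgroup P} {F : FusionSystem P}
    (h : F.HasCoprimeAut 2 Q) : ¬ IsPGroup 2 (F.aut Q) := fun h1 => by
  obtain ⟨α, hα, hα1, hα2⟩ := h
  obtain ⟨k, hk⟩ := IsPGroup.iff_orderOf.1 h1 ⟨α, hα⟩
  rw [Subgroup.orderOf_mk] at hk
  rcases k with _ | k
  · exact hα1 (orderOf_eq_one_iff.1 hk)
  · exact hα2 (hk ▸ dvd_pow_self 2 k.succ_ne_zero)

/-- There are two saturated fusion systems on the quaternion group of order eight. -/
theorem FusionSystem.classification_quaternion_eight (e : P ≃* QuaternionGroup 2)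
    {F : FusionSystem P} (hF : F.IsSaturated 2) : F.essentialRank 2 = 0 ∧
      (F.IsFusionSystemOf 2 P ∨
      ∃ (K : Type) (_ : Field K) (_ : Finite K), Odd (Nat.card K) ∧
        F.IsFusionSystemOf 2 SL(2, K)) := by
  have hP : IsPGroup 2 P := IsPGroup.of_card (n := 3) (by
    rw [Nat.card_congr e.toEquiv, Nat.card_eq_fintype_card, QuaternionGroup.card]; rfl)
  have hn : ∀ F : FusionSystem P, F.IsSaturated 2 → ∀ Q, ¬ F.IsEssential 2 Q := fun F hF Q =>
    hF.not_isEssential_of_central hP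
      (fun x y h => e.injective (by
        rw [map_mul, map_mul]
        exact central_of_sq_eq_one _ _ (by rw [← map_pow, h, map_one])))
      fun x y => e.injective (by
        simp only [map_pow, map_mul, map_inv, map_one]
        exact commutator_sq _ _)
  refine ⟨essentialRank_eq_zero (hn F hF), ?_⟩
  by_cases hA : IsPGroup 2 (F.aut ⊤)
  · exact Or.inl (hF.isFusionSystemOf_self hP (hn F hF) (hF.aut_top_le_of_isPGroup hA))
  obtain ⟨K, _, _, F', hK, hF', hF'A, hiso⟩ := exists_sl_two_of_quaternion e
  obtain ⟨α, hα, hα1, hα2⟩ := id hF'A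
  have hα3 : orderOf α = 3 := by
    have h := card_dvd_three_of_quaternion e
      (K := zpowers (MulAut.congr (topEquiv (G := P)) α)) (by
        rw [Nat.card_zpowers, MulEquiv.orderOf_eq]
        exact Nat.odd_of_not_two_dvd hα2)
    rw [Nat.card_zpowers, MulEquiv.orderOf_eq, Nat.dvd_prime Nat.prime_three] at h
    exact h.resolve_left fun h => hα1 (orderOf_eq_one_iff.1 h)
  have h2 := (classification_of_card_dvd_three hP hn
    (fun K hK => card_dvd_three_of_quaternion e hK)
    (γ := MulAut.congr (topEquiv (G := P)) α) (by
      rw [MulEquiv.orderOf_eq, hα3])).2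
  have h3 : F.IsIso F' := by
    let q := Quotient.mk (isoSetoid 2 P)
    have hid := isSaturated_ofEmb (hi := Function.injective_id) hP not_dvd_index_range_id
    obtain ⟨a, b, -, hu⟩ := Nat.card_eq_two_iff.1 h2
    have h4 : ∀ c, c = a ∨ c = b := fun c => by
      have : c ∈ ({a, b} : Set _) := hu ▸ Set.mem_univ c
      simpa using this
    have h5 : q ⟨F, hF⟩ ≠ q ⟨_, hid⟩ := fun h => hA (isPGroup_aut_top_of_isIso hP (Quotient.exact h))
    have h6 : q ⟨F', hF'⟩ ≠ q ⟨_, hid⟩ := fun h =>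
      HasCoprimeAut.not_isPGroup hF'A (isPGroup_aut_top_of_isIso hP (Quotient.exact h))
    have h7 : q ⟨F, hF⟩ = q ⟨F', hF'⟩ := by
      rcases h4 (q ⟨F, hF⟩) with h | h <;> rcases h4 (q ⟨F', hF'⟩) with h' | h' <;>
        rcases h4 (q ⟨_, hid⟩) with h'' | h'' <;> simp_all
    exact Quotient.exact h7
  obtain ⟨S, hS⟩ := hiso
  exact Or.inr ⟨K, inferInstance, inferInstance, hK, S, h3.trans hS⟩

end QuaternionEight

/-! ### Wreathed groups -/

/-- The involution `t` exchanges the commuting elements `a` and `b`. -/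
structure WreathRel {G : Type*} [Group G] (a b t : G) : Prop where
  comm : a * b = b * a
  conj : t * a * t⁻¹ = b
  sq : t * t = 1

namespace WreathRel

variable {G : Type*} [Group G] {a b t : G} (h : WreathRel a b t)

include h

theorem zpow_comm (i j : ℤ) : b ^ j * a ^ i = a ^ i * b ^ j :=
  ((show Commute a b from h.comm).zpow_zpow i j).eq.symm

theorem mul_eq (i j k l : ℤ) : a ^ i * b ^ j * (a ^ k * b ^ l) = a ^ (i + k) * b ^ (j + l) := by
  rw [mul_assoc, ← mul_assoc (b ^ j), h.zpow_comm, zpow_add, zpow_add]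
  simp only [mul_assoc]

theorem t_mul (i j : ℤ) : t * (a ^ i * b ^ j) = a ^ j * b ^ i * t := by
  have h0 : t⁻¹ = t := inv_eq_of_mul_eq_one_right h.sq
  have h1 : t * a ^ i * t⁻¹ = b ^ i := by rw [← h.conj, conj_zpow]
  have h2 : t * b ^ j * t⁻¹ = a ^ j := by
    rw [← h.conj, conj_zpow, h0, ← mul_assoc, ← mul_assoc, h.sq, one_mul, mul_assoc, h.sq, mul_one]
  rw [← h.zpow_comm, ← h1, ← h2]
  group

theorem outer_mul (i j k l : ℤ) :
    a ^ i * b ^ j * t * (a ^ k * b ^ l) = a ^ (i + l) * b ^ (j + k) * t := by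
  rw [mul_assoc, h.t_mul, ← mul_assoc, h.mul_eq]

theorem outer_mul_outer (i j k l : ℤ) :
    a ^ i * b ^ j * t * (a ^ k * b ^ l * t) = a ^ (i + l) * b ^ (j + k) := by
  rw [← mul_assoc, h.outer_mul, mul_assoc, h.sq, mul_one]

theorem zpow_eq (i : ℤ) : (a * b) ^ i = a ^ i * b ^ i := (show Commute a b from h.comm).mul_zpow i

/-- The abelian subgroup generated by `a` and `b`. -/
def base : Subgroup G where
  carrier := {g | ∃ i j : ℤ, g = a ^ i * b ^ j}
  one_mem' := ⟨0, 0, by simp⟩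
  mul_mem' := by
    rintro _ _ ⟨i, j, rfl⟩ ⟨k, l, rfl⟩
    exact ⟨_, _, h.mul_eq i j k l⟩
  inv_mem' := by
    rintro _ ⟨i, j, rfl⟩
    exact ⟨-i, -j, by rw [mul_inv_rev, ← zpow_neg, ← zpow_neg, h.zpow_comm]⟩

/-- The subgroup generated by `a`, `b` and `t`. -/
def span : Subgroup G where
  carrier := {g | ∃ i j : ℤ, g = a ^ i * b ^ j ∨ g = a ^ i * b ^ j * t}
  one_mem' := ⟨0, 0, by simp⟩
  mul_mem' := by
    rintro _ _ ⟨i, j, rfl | rfl⟩ ⟨k, l, rfl | rfl⟩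
    · exact ⟨_, _, Or.inl (h.mul_eq i j k l)⟩
    · exact ⟨_, _, Or.inr (by rw [← mul_assoc, h.mul_eq i j k l])⟩
    · exact ⟨_, _, Or.inr (h.outer_mul i j k l)⟩
    · exact ⟨_, _, Or.inl (h.outer_mul_outer i j k l)⟩
  inv_mem' := by
    rintro _ ⟨i, j, rfl | rfl⟩
    · exact ⟨-i, -j, Or.inl (by rw [mul_inv_rev, ← zpow_neg, ← zpow_neg, h.zpow_comm])⟩
    · refine ⟨-j, -i, Or.inr ?_⟩
      refine inv_eq_of_mul_eq_one_right ?_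
      rw [h.outer_mul_outer]
      simp

theorem mem_base {g : G} : g ∈ h.base ↔ ∃ i j : ℤ, g = a ^ i * b ^ j := Iff.rfl

theorem left_mem : a ∈ h.base := ⟨1, 0, by simp⟩

theorem right_mem : b ∈ h.base := ⟨0, 1, by simp⟩

theorem base_comm {g g' : G} (hg : g ∈ h.base) (hg' : g' ∈ h.base) : g * g' = g' * g := by
  obtain ⟨i, j, rfl⟩ := hg
  obtain ⟨k, l, rfl⟩ := hg'
  rw [h.mul_eq, h.mul_eq, add_comm i, add_comm j]

end WreathRel

/-- The subgroup generated by `a`, `b` and `t` is the wreath product of a cyclic group of order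
`2 ^ n` by a group of order two. -/
structure Wreathed {G : Type*} [Group G] (a b t : G) (n : ℕ) : Prop extends WreathRel a b t where
  two_le : 2 ≤ n
  indep : ∀ i j : ℤ, a ^ i * b ^ j = 1 ↔ (2 : ℤ) ^ n ∣ i ∧ (2 : ℤ) ^ n ∣ j

namespace Wreathed

variable {G : Type*} [Group G] {a b t : G} {n : ℕ} (h : Wreathed a b t n)

include h

theorem eq_iff (i j k l : ℤ) : a ^ i * b ^ j = a ^ k * b ^ l ↔
    (2 : ℤ) ^ n ∣ i - k ∧ (2 : ℤ) ^ n ∣ j - l := by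
  rw [← h.indep, ← mul_inv_eq_one, mul_inv_rev, ← zpow_neg, ← zpow_neg, h.zpow_comm, h.mul_eq]
  rfl

theorem two_dvd : (2 : ℤ) ∣ 2 ^ (n - 1) := dvd_pow_self 2 (by have := h.two_le; omega)

theorem pow_n : (2 : ℤ) ^ n = 2 ^ (n - 1) * 2 := by
  rw [← pow_succ, Nat.sub_add_cancel (by have := h.two_le; omega)]

theorem notMem : t ∉ h.base := by
  intro ht
  have h1 := h.base_comm ht h.left_mem
  have h2 : b = a := by rw [← h.conj, h1, mul_inv_cancel_right]
  have h3 := (h.indep 1 (-1)).1 (by rw [h2]; simp)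
  rw [h.pow_n] at h3
  have := (dvd_mul_left (2 : ℤ) (2 ^ (n - 1))).trans h3.1
  norm_num at this

theorem outer_notMem (i j : ℤ) : a ^ i * b ^ j * t ∉ h.base := fun h1 =>
  h.notMem ((mul_mem_cancel_left (h.mem_base.2 ⟨i, j, rfl⟩)).1 h1)

theorem z_zpow_eq_one {i : ℤ} : (a * b) ^ i = 1 ↔ (2 : ℤ) ^ n ∣ i := by
  rw [h.zpow_eq, h.indep, and_self]

end Wreathed

/-- The elements `a`, `b` and `t` generate the group `P`, which is the wreath product of a cyclic
group of order `2 ^ n` by a group of order two. -/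
structure WreathedTop {P : Type*} [Group P] (a b t : P) (n : ℕ) : Prop extends
    Wreathed a b t n where
  card : Nat.card P = 2 ^ (2 * n + 1)

namespace WreathedTop

variable {P : Type*} [Group P] {a b t u : P} {n : ℕ} (D : WreathedTop a b t n)

include D

theorem isPGroup : IsPGroup 2 P := IsPGroup.of_card D.card

theorem cover (g : P) : ∃ i j : ℤ, g = a ^ i * b ^ j ∨ g = a ^ i * b ^ j * t := by
  have : Finite P := Nat.finite_of_card_ne_zero (by rw [D.card]; positivity)
  let f : Fin (2 ^ n) × Fin (2 ^ n) × Bool → P := fun p =>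
    a ^ (p.1 : ℤ) * b ^ (p.2.1 : ℤ) * if p.2.2 then t else 1
  have key : ∀ i j : Fin (2 ^ n), (2 : ℤ) ^ n ∣ (i : ℤ) - j → i = j := fun i j hd => by
    refine Fin.ext ?_
    have h1 : (j : ℕ) ≡ i [MOD 2 ^ n] := by
      rw [Nat.modEq_iff_dvd]
      exact_mod_cast hd
    exact Nat.ModEq.eq_of_lt_of_lt h1.symm i.2 j.2
  have hf : Function.Injective f := by
    rintro ⟨i, j, e⟩ ⟨k, l, e'⟩ h
    have h1 : e = e' := by
      by_contra h1
      cases e <;> cases e' <;> simp [f] at h h1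
      · exact D.outer_notMem (k : ℕ) (l : ℕ) ⟨(i : ℕ), (j : ℕ), by simpa using h.symm⟩
      · exact D.outer_notMem (i : ℕ) (j : ℕ) ⟨(k : ℕ), (l : ℕ), by simpa using h⟩
    subst h1
    have h2 := (D.eq_iff _ _ _ _).1 (mul_right_cancel h)
    rw [key i k h2.1, key j l h2.2]
  have hb := hf.bijective_of_nat_card_le (by
    rw [D.card]
    simp [pow_succ, two_mul, pow_add, mul_assoc])
  obtain ⟨⟨i, j, e⟩, rfl⟩ := hb.2 g
  refine ⟨i, j, ?_⟩
  cases e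
  · left; simp [f]
  · right; simp [f]

theorem exists_eq (hu : u ∉ D.base) : ∃ i j : ℤ, u = a ^ i * b ^ j * t := by
  obtain ⟨i, j, h | h⟩ := D.cover u
  · exact absurd ⟨i, j, h⟩ hu
  · exact ⟨i, j, h⟩

theorem mul_mem_base {v : P} (hu : u ∉ D.base) (hv : v ∉ D.base) : u * v ∈ D.base := by
  obtain ⟨i, j, rfl⟩ := D.exists_eq hu
  obtain ⟨k, l, rfl⟩ := D.exists_eq hv
  exact ⟨_, _, D.outer_mul_outer i j k l⟩

theorem mul_inv_mem_base {v : P} (hu : u ∉ D.base) (hv : v ∉ D.base) : u * v⁻¹ ∈ D.base :=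
  D.mul_mem_base hu fun h => hv (by simpa using inv_mem h)

theorem z_comm (g : P) : a * b * g = g * (a * b) := by
  have h0 : a * b = a ^ (1 : ℤ) * b ^ (1 : ℤ) := by simp
  obtain ⟨i, j, rfl | rfl⟩ := D.cover g
  · exact D.base_comm ⟨1, 1, h0⟩ ⟨i, j, rfl⟩
  · rw [h0, ← mul_assoc, D.mul_eq, D.outer_mul, add_comm 1, add_comm 1]

theorem outer_sq (hu : u ∉ D.base) : ∃ i : ℤ, u * u = (a * b) ^ i := by
  obtain ⟨i, j, rfl⟩ := D.exists_eq hu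
  exact ⟨i + j, by rw [D.outer_mul_outer, D.zpow_eq, add_comm j i]⟩

/-- The elements of the abelian subgroup that commute with an element outside it are central. -/
theorem mem_of_commute {g : P} (hg : g ∈ D.base) (hu : u ∉ D.base) (h : g * u = u * g) :
    g ∈ zpowers (a * b) := by
  obtain ⟨i, j, rfl⟩ := D.exists_eq hu
  obtain ⟨k, l, rfl⟩ := hg
  rw [← mul_assoc, D.mul_eq, D.outer_mul] at h
  have h1 := ((D.eq_iff _ _ _ _).1 (mul_right_cancel h)).1
  refine ⟨l, ?_⟩
  simp only
  rw [D.zpow_eq, D.eq_iff]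
  refine ⟨?_, by simp⟩
  obtain ⟨c, hc⟩ := h1
  exact ⟨-c, by linarith⟩

/-- The involutions outside the abelian subgroup are conjugate to `t`. -/
theorem exists_conj (hu : u ∉ D.base) (h : u * u = 1) : ∃ i : ℤ, a ^ i * t * (a ^ i)⁻¹ = u := by
  obtain ⟨i, j, rfl⟩ := D.exists_eq hu
  rw [D.outer_mul_outer, D.indep] at h
  refine ⟨i, ?_⟩
  have h1 := D.t_mul (-i) 0
  rw [zpow_zero, zpow_zero, one_mul, mul_one] at h1
  rw [mul_assoc, ← zpow_neg, h1, ← mul_assoc]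
  congr 1
  rw [D.eq_iff]
  obtain ⟨c, hc⟩ := h.1
  exact ⟨by simp, -c, by linarith⟩

/-- Another choice of the involution outside the abelian subgroup. -/
theorem change (hu : u ∉ D.base) (h : u * u = 1) : WreathedTop a b u n where
  comm := D.comm
  conj := by
    obtain ⟨i, j, rfl⟩ := D.exists_eq hu
    have h1 := D.outer_mul i j 1 0
    rw [zpow_one, zpow_zero, mul_one] at h1
    rw [h1, mul_inv_eq_iff_eq_mul, ← mul_assoc]
    congr 1
    have h2 := D.mul_eq 0 1 i j
    rw [zpow_zero, zpow_one, one_mul] at h2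
    rw [h2, add_zero, zero_add, add_comm]
  sq := h
  two_le := D.two_le
  indep := D.indep
  card := D.card

/-- A wreathed group embeds in every group with elements that satisfy the same relations. -/
theorem exists_monoidHom {G : Type*} [Group G] {X Y T : G} (E : Wreathed X Y T n) :
    ∃ i : P →* G, Function.Injective i ∧ i a = X ∧ i b = Y ∧ i t = T := by
  have hΓ : WreathRel (a, X) (b, Y) (t, T) :=
    ⟨Prod.ext D.comm E.comm, Prod.ext D.conj E.conj, Prod.ext D.sq E.sq⟩
  obtain ⟨i, hi, h1⟩ := exists_monoidHom_of_graph hΓ.span (by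
    rintro _ ⟨i, j, rfl | rfl⟩
    · exact (D.indep i j).trans (E.indep i j).symm
    · exact iff_of_false (fun e => D.outer_notMem i j (by
        change a ^ i * b ^ j * t = 1 at e
        rw [e]; exact one_mem _)) fun e => E.outer_notMem i j (by
        change X ^ i * Y ^ j * T = 1 at e
        rw [e]; exact one_mem _)) fun g => by
    obtain ⟨i, j, rfl | rfl⟩ := D.cover g
    · exact ⟨(a, X) ^ i * (b, Y) ^ j, ⟨i, j, Or.inl rfl⟩, rfl⟩
    · exact ⟨(a, X) ^ i * (b, Y) ^ j * (t, T), ⟨i, j, Or.inr rfl⟩, rfl⟩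
  exact ⟨i, hi, h1 (a, X) ⟨1, 0, by simp⟩, h1 (b, Y) ⟨0, 1, by simp⟩, h1 (t, T) ⟨0, 0, by simp⟩⟩

end WreathedTop

/-! ### Automorphisms of odd order in wreathed groups -/

namespace WreathedTop

/-- The central product of the center `⟨ab⟩` and the dihedral group of order eight that is generated
by `t` and an involution of `⟨a⟩`. -/
def core {P : Type*} [Group P] (a b t : P) (n : ℕ) : Subgroup P :=
  closure {a * b, a ^ (2 : ℤ) ^ (n - 1), t}

variable {P : Type*} [Group P] {a b t u : P} {n : ℕ}

theorem z_mem_core : a * b ∈ core a b t n := subset_closure (by simp)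

theorem w_mem_core : a ^ (2 : ℤ) ^ (n - 1) ∈ core a b t n := subset_closure (by simp)

theorem t_mem_core : t ∈ core a b t n := subset_closure (by simp)

variable (D : WreathedTop a b t n)

include D

theorem z_mem_base : a * b ∈ D.base := mul_mem D.left_mem D.right_mem

theorem z_pow : (a * b) ^ 2 ^ n = 1 := by
  rw [← zpow_natCast, D.z_zpow_eq_one]
  push_cast
  rfl

theorem z_zpow_comm (i : ℤ) (e : P) : (a * b) ^ i * e = e * (a * b) ^ i :=
  ((show Commute (a * b) e from D.z_comm e).zpow_left i).eq

theorem not_dvd : ¬ (2 : ℤ) ^ n ∣ 2 ^ (n - 1) := fun h => by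
  have := Int.le_of_dvd (by positivity) h
  rw [D.pow_n] at this
  have : (0 : ℤ) < 2 ^ (n - 1) := by positivity
  linarith

theorem coe_zpow_eq_one {Q : Subgroup P} {z : Q} (hz : (z : P) = a * b) {i : ℤ} :
    z ^ i = 1 ↔ (2 : ℤ) ^ n ∣ i := by
  rw [← D.z_zpow_eq_one, ← hz, ← Subtype.val_inj]
  simp

theorem z_zpow_cases {i : ℤ} (hi : (a * b) ^ i * (a * b) ^ i = 1) :
    (a * b) ^ i = 1 ∨ (a * b) ^ i = (a * b) ^ (2 : ℤ) ^ (n - 1) := by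
  rw [← zpow_add, D.z_zpow_eq_one, ← mul_two, D.pow_n] at hi
  obtain ⟨c, rfl⟩ := Int.dvd_of_mul_dvd_mul_right two_ne_zero hi
  obtain ⟨d, rfl | rfl⟩ := Int.even_or_odd' c
  · left
    rw [D.z_zpow_eq_one, D.pow_n]
    exact ⟨d, by ring⟩
  · right
    rw [← mul_inv_eq_one, ← zpow_neg, ← zpow_add, D.z_zpow_eq_one, D.pow_n]
    exact ⟨d, by ring⟩

theorem w_sq : a ^ (2 : ℤ) ^ (n - 1) * a ^ (2 : ℤ) ^ (n - 1) = 1 := by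
  have := (D.indep (2 ^ n) 0).2 (by simp)
  rwa [zpow_zero, mul_one, D.pow_n, mul_two, zpow_add] at this

theorem w_mem_base : a ^ (2 : ℤ) ^ (n - 1) ∈ D.base := zpow_mem D.left_mem _

theorem w_notMem : a ^ (2 : ℤ) ^ (n - 1) ∉ zpowers (a * b) := by
  rintro ⟨i, hi⟩
  simp only at hi
  have h1 := (D.eq_iff i i (2 ^ (n - 1)) 0).1 (by rw [← D.zpow_eq, hi, zpow_zero, mul_one])
  rw [sub_zero] at h1
  exact D.not_dvd (by simpa using dvd_sub h1.2 h1.1)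

/-- The elements of the abelian subgroup whose square is central. -/
theorem mem_of_sq_mem {g : P} (hg : g ∈ D.base) (h : g * g ∈ zpowers (a * b)) :
    ∃ i : ℤ, g = (a * b) ^ i ∨ g = (a * b) ^ i * a ^ (2 : ℤ) ^ (n - 1) := by
  obtain ⟨i, j, rfl⟩ := hg
  obtain ⟨k, hk⟩ := h
  simp only at hk
  rw [D.mul_eq, D.zpow_eq, D.eq_iff] at hk
  have h1 : (2 : ℤ) ^ (n - 1) * 2 ∣ (i - j) * 2 := by
    rw [← D.pow_n]
    have := dvd_sub hk.2 hk.1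
    rwa [show k - (j + j) - (k - (i + i)) = (i - j) * 2 by ring] at this
  obtain ⟨c, hc⟩ := Int.dvd_of_mul_dvd_mul_right two_ne_zero h1
  obtain ⟨d, rfl | rfl⟩ := Int.even_or_odd' c
  · refine ⟨j, Or.inl ?_⟩
    rw [D.zpow_eq, D.eq_iff]
    exact ⟨⟨d, by rw [D.pow_n, hc]; ring⟩, by simp⟩
  · refine ⟨j, Or.inr ?_⟩
    have h2 := D.mul_eq j j (2 ^ (n - 1)) 0
    rw [zpow_zero, mul_one] at h2
    rw [D.zpow_eq, h2, D.eq_iff]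
    exact ⟨⟨d, by rw [D.pow_n, show i - (j + 2 ^ (n - 1)) = i - j - 2 ^ (n - 1) by ring, hc]; ring⟩,
      by simp⟩

variable {Q : Subgroup P} {α : MulAut Q}

/-- An automorphism of odd order fixes the elements of the center of `P`. -/
theorem apply_z (hz : a * b ∈ Q) (hQ : ¬ Q ≤ D.base) (hα : Odd (orderOf α)) :
    α ⟨a * b, hz⟩ = ⟨a * b, hz⟩ := by
  obtain ⟨u, huQ, hu⟩ := SetLike.not_le_iff_exists.1 hQ
  obtain ⟨z, hze⟩ : ∃ z : Q, z = ⟨a * b, hz⟩ := ⟨_, rfl⟩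
  have hzv : (z : P) = a * b := by rw [hze]
  rw [← hze]
  have hzp : ∀ e : Q, (e : P) ∈ zpowers (a * b) → ∃ i : ℤ, e = z ^ i := by
    rintro e ⟨i, hi⟩
    exact ⟨i, Subtype.ext (by rw [← hi]; simp [hzv])⟩
  have hz1 : ∀ i : ℤ, z ^ i = 1 ↔ (2 : ℤ) ^ n ∣ i := fun _ => D.coe_zpow_eq_one hzv
  have hzn : z ^ 2 ^ n = 1 := Subtype.ext (by simp [hzv, D.z_pow])
  have hzc : ∀ e, z * e = e * z := fun e => Subtype.ext (by simp [hzv, D.z_comm])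
  have hc : ∀ e, α z * e = e * α z := fun e => by
    obtain ⟨f, rfl⟩ := α.surjective e
    rw [← map_mul, hzc, map_mul]
  by_cases hb : (α z : P) ∈ D.base
  · obtain ⟨i, hi⟩ := hzp _ (D.mem_of_commute hb hu (congrArg Subtype.val (hc ⟨u, huQ⟩)))
    exact MulAut.apply_eq_of_mem_zpowers hα hzn ⟨i, hi.symm⟩
  -- otherwise `Q` is abelian, and `Q ∩ ⟨a, b⟩ = ⟨z⟩`
  exfalso
  have hB : ∀ e : Q, (e : P) ∈ D.base → ∃ i : ℤ, e = z ^ i := fun e he =>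
    hzp e (D.mem_of_commute he hb (congrArg Subtype.val (hc e).symm))
  have hout : ∀ e f : Q, (e : P) ∉ D.base → (f : P) ∈ D.base → ((e * f : Q) : P) ∉ D.base :=
    fun e f he hf h => he ((mul_mem_cancel_right hf).1 h)
  have hzb : (z : P) ∈ D.base := hzv ▸ D.z_mem_base
  have h2 : α (z * z) = z * z := by
    obtain ⟨m, hm⟩ := hB (α (z * z)) (by rw [map_mul]; exact D.mul_mem_base hb hb)
    have h3 : z ^ (m * 2 ^ (n - 1)) = 1 := by
      rw [zpow_mul, ← hm, ← map_zpow, ← zpow_two, ← zpow_mul, mul_comm, ← D.pow_n, (hz1 _).2 dvd_rfl,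
        map_one]
    rw [hz1, D.pow_n, mul_comm m] at h3
    obtain ⟨c, rfl⟩ := Int.dvd_of_mul_dvd_mul_left (by positivity) h3
    refine MulAut.apply_eq_of_mem_zpowers hα (l := n) ?_ ⟨c, ?_⟩
    · rw [← pow_two, ← pow_mul, mul_comm, pow_mul, hzn, one_pow]
    · simp only
      rw [hm, zpow_mul, zpow_two]
  have hfix : ∀ e : Q, e * e = 1 → (e : P) ∈ D.base → α e = e := fun e he heb => by
    obtain ⟨i, rfl⟩ := hB e heb
    rw [← zpow_add, hz1, ← mul_two, D.pow_n] at he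
    obtain ⟨c, rfl⟩ := D.two_dvd.trans (Int.dvd_of_mul_dvd_mul_right two_ne_zero he)
    rw [zpow_mul, zpow_two, map_zpow, h2]
  obtain ⟨y, hy⟩ : ∃ y, y = α z * z⁻¹ := ⟨_, rfl⟩
  have hyz : α z = y * z := by rw [hy, inv_mul_cancel_right]
  have hyb : (y : P) ∉ D.base := hy ▸ hout _ _ hb (inv_mem hzb)
  have hyc : ∀ e, Commute y e := fun e => by
    rw [hy]
    exact (show Commute (α z) e from hc e).mul_left (show Commute z e from hzc e).inv_left
  have hy2 : y * y = 1 := by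
    have h3 : y * y * (z * z) = z * z := by
      rw [(hyc z).mul_mul_mul_comm, ← hyz, ← map_mul, h2]
    exact mul_eq_right.1 h3
  have hyα : (α y : P) ∉ D.base := fun h => by
    have h3 := hfix (α y) (by rw [← map_mul, hy2, map_one]) h
    rw [α.injective h3] at h
    exact hyb h
  have h3 : α y * y⁻¹ * (α y * y⁻¹) = 1 := by
    rw [(hyc (α y)).inv_left.mul_mul_mul_comm, ← map_mul, hy2, map_one, ← mul_inv_rev, hy2, inv_one,
      one_mul]
  have h4 : α (α y * y⁻¹) = α y * y⁻¹ := hfix _ h3 (D.mul_inv_mem_base hyα hyb)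
  have h5 : α y = y := MulAut.apply_eq_of_mul hα h4 (j := 1) (by rw [pow_one, pow_two, h3]) (by group)
  have h6 : α z = z := MulAut.apply_eq_of_mul hα h5 (j := 1) (by rw [pow_one, pow_two, hy2]) hyz
  rw [h6] at hb
  exact hb hzb

/-- An automorphism of odd order that maps the intersection with the abelian subgroup to itself is
trivial. -/
theorem exists_apply_notMem (hz : a * b ∈ Q) (hQ : ¬ Q ≤ D.base) (hα : Odd (orderOf α))
    (hα1 : α ≠ 1) : ∃ e : Q, (e : P) ∈ D.base ∧ (α e : P) ∉ D.base := by
  by_contra hcon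
  push Not at hcon
  refine hα1 ?_
  have hαz := D.apply_z hz hQ hα
  obtain ⟨z, hze⟩ : ∃ z : Q, z = ⟨a * b, hz⟩ := ⟨_, rfl⟩
  have hzv : (z : P) = a * b := by rw [hze]
  rw [← hze] at hαz
  have hzn : z ^ 2 ^ n = 1 := Subtype.ext (by simp [hzv, D.z_pow])
  have hmul : ∀ (i : ℤ) (e f : Q), f = z ^ i * e → α e = f → α e = e := fun i e f h1 h2 =>
    MulAut.apply_eq_of_mul hα (c := z ^ i) (by rw [map_zpow, hαz]) (j := n) (by
      rw [← zpow_natCast, ← zpow_mul, mul_comm, zpow_mul, zpow_natCast, hzn, one_zpow]) (h2.trans h1)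
  have hz0 : ∀ (e : Q) (i : ℤ), (e : P) = (a * b) ^ i → e = z ^ i := fun e i hi =>
    Subtype.ext (by rw [hi]; simp [hzv])
  have hinv : ∀ e : Q, (e : P) ∈ D.base → e * e = 1 → α e = e := fun e he he2 => by
    have key : ∀ f : Q, (f : P) ∈ D.base → f * f = 1 → ∃ i : ℤ, (f : P) = (a * b) ^ i ∨
        (f : P) = (a * b) ^ i * a ^ (2 : ℤ) ^ (n - 1) := fun f hf hf2 =>
      D.mem_of_sq_mem hf (by rw [show (f : P) * f = 1 from congrArg Subtype.val hf2]; exact one_mem _)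
    have hfz : ∀ (f : Q) (i : ℤ), (f : P) = (a * b) ^ i → α f = f := fun f i hi => by
      rw [hz0 f i hi, map_zpow, hαz]
    obtain ⟨i, hi | hi⟩ := key e he he2
    · exact hfz e i hi
    · obtain ⟨j, hj | hj⟩ := key (α e) (hcon e he) (by rw [← map_mul, he2, map_one])
      · exact α.injective (hfz _ j hj)
      · refine hmul (j - i) e (α e) (Subtype.ext ?_) rfl
        rw [hj, Subgroup.coe_mul, hi, ← mul_assoc, Subgroup.coe_zpow, hzv, ← zpow_add,
          sub_add_cancel]
  have hB : ∀ (l : ℕ) (e : Q), (e : P) ∈ D.base → e ^ 2 ^ l = 1 → α e = e := fun l => by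
    induction l with
    | zero => intro e _ he; rw [pow_zero, pow_one] at he; rw [he, map_one]
    | succ l ih =>
      intro e he hel
      have h1 : α (e ^ 2) = e ^ 2 := ih _ (pow_mem he 2) (by rw [← pow_mul, ← pow_succ']; exact hel)
      have hc : Commute (α e) e⁻¹ :=
        Subtype.ext (D.base_comm (hcon e he) (inv_mem he))
      have h2 : (α e * e⁻¹) ^ 2 = 1 := by
        rw [hc.mul_pow, ← map_pow, h1, inv_pow, mul_inv_cancel]
      exact MulAut.apply_eq_of_mul hα (hinv _ (mul_mem (hcon e he) (inv_mem he)) (by rw [← pow_two, h2]))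
        (j := 1) (by rwa [pow_one]) (by group)
  have hB' : ∀ e : Q, (e : P) ∈ D.base → α e = e := fun e he => by
    obtain ⟨l, hl⟩ := (isPGroup_iff_pow_pow_eq_one.1 D.isPGroup) e
    exact hB l e he (Subtype.ext hl)
  refine MulEquiv.ext fun e => ?_
  by_cases he : (e : P) ∈ D.base
  · exact hB' e he
  · have he' : (α e : P) ∉ D.base := fun h => he (by
      rw [← α.injective (hB' _ h)]
      exact h)
    have h1 := D.mul_inv_mem_base he' he
    obtain ⟨l, hl⟩ := (isPGroup_iff_pow_pow_eq_one.1 D.isPGroup) ((α e * e⁻¹ : Q) : P)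
    exact MulAut.apply_eq_of_mul hα (c := α e * e⁻¹) (hB' _ h1) (j := l) (Subtype.ext hl) (by group)

/-- A subgroup outside the abelian subgroup with a nontrivial automorphism of odd order. -/
theorem eq_closure (hz : a * b ∈ Q) (hQ : ¬ Q ≤ D.base) (hα : Odd (orderOf α))
    (hα1 : α ≠ 1) : ∃ hw : a ^ (2 : ℤ) ^ (n - 1) ∈ Q, (α ⟨_, hw⟩ : P) ∉ D.base ∧
      (α ⟨_, hw⟩ : P) * α ⟨_, hw⟩ = 1 ∧
      Q = core a b (α ⟨_, hw⟩ : P) n := by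
  have hαz := D.apply_z hz hQ hα
  have hzp : ∀ (e : Q) (i : ℤ), (e : P) = (a * b) ^ i → e = ⟨a * b, hz⟩ ^ i := fun e i hi =>
    Subtype.ext (by rw [hi]; simp)
  -- the elements that leave the abelian subgroup are in `z ^ i * w`
  have key : ∀ e : Q, (e : P) ∈ D.base → (α e : P) ∉ D.base →
      ∃ i : ℤ, (e : P) = (a * b) ^ i * a ^ (2 : ℤ) ^ (n - 1) := fun e he he' => by
    obtain ⟨m, hm⟩ := D.outer_sq he'
    have h1 : e * e = ⟨a * b, hz⟩ ^ m := α.injective (by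
      rw [map_zpow, hαz, map_mul]
      exact Subtype.ext (by rw [Subgroup.coe_mul, hm]; simp))
    obtain ⟨i, hi | hi⟩ := D.mem_of_sq_mem he ⟨m, by
      have := congrArg Subtype.val h1
      simpa using this.symm⟩
    · refine absurd ?_ he'
      rw [hzp e i hi, map_zpow, hαz]
      exact zpow_mem D.z_mem_base i
    · exact ⟨i, hi⟩
  obtain ⟨e, he, he'⟩ := D.exists_apply_notMem hz hQ hα hα1
  obtain ⟨i, hi⟩ := key e he he'
  have hw : a ^ (2 : ℤ) ^ (n - 1) ∈ Q :=
    (Subgroup.mul_mem_cancel_left Q (zpow_mem hz i)).1 (hi ▸ e.2)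
  have hwα : (α ⟨_, hw⟩ : P) ∉ D.base := fun h => he' (by
    have h1 : e = ⟨a * b, hz⟩ ^ i * ⟨_, hw⟩ := Subtype.ext (by rw [hi]; simp)
    rw [h1, map_mul, map_zpow, hαz]
    exact mul_mem (zpow_mem D.z_mem_base i) h)
  refine ⟨hw, hwα, ?_, le_antisymm (fun g hg => ?_) ?_⟩
  · rw [← Subgroup.coe_mul, ← map_mul, show (⟨_, hw⟩ : Q) * ⟨_, hw⟩ = 1 from Subtype.ext D.w_sq,
      map_one]
    rfl
  · have hB : ∀ g ∈ Q, g ∈ D.base → g ∈ core a b (α ⟨_, hw⟩ : P) n := fun g hg hgb => by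
      by_cases h1 : (α ⟨g, hg⟩ : P) ∈ D.base
      · obtain ⟨j, hj⟩ := key (⟨g, hg⟩ * ⟨_, hw⟩) (mul_mem hgb D.w_mem_base) (fun h2 => hwα (by
          rw [map_mul] at h2
          exact (mul_mem_cancel_left h1).1 h2))
        rw [mul_right_cancel (a := g) hj]
        exact zpow_mem z_mem_core j
      · obtain ⟨j, hj⟩ := key ⟨g, hg⟩ hgb h1
        rw [show g = _ from hj]
        exact mul_mem (zpow_mem z_mem_core j) w_mem_core
    by_cases hgb : g ∈ D.base
    · exact hB g hg hgb
    · have h1 := hB (g * (α ⟨_, hw⟩ : P)⁻¹) (mul_mem hg (inv_mem (α ⟨_, hw⟩).2))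
        (D.mul_inv_mem_base hgb hwα)
      simpa using mul_mem h1 t_mem_core
  · refine (closure_le _).2 ?_
    rintro g (rfl | rfl | hg)
    · exact hz
    · exact hw
    · rw [Set.mem_singleton_iff.1 hg]
      exact (α ⟨_, hw⟩).2

end WreathedTop

/-! ### Automorphisms of the nonabelian candidates -/

section CentralProduct

variable {E : Type*} [Group E] {z w u : E} {m : ℤ}

/-- Let `E` be the central product of a cyclic 2-group `⟨z⟩` and a dihedral group of order eight
generated by the involutions `w` and `u`. A group of automorphisms of `E` that contains the inner
ones, one that fixes `w` and maps `u` to the coset of `wu`, and one of odd order, contains all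
automorphisms that fix `z`. -/
theorem mem_of_fixes_center (hzc : ∀ e, z * e = e * z) (hw : w * w = 1) (hu : u * u = 1)
    (huw : u * w * u⁻¹ = z ^ m * w) (hz2 : ∀ i : ℤ, z ^ i * z ^ i = 1 → z ^ i = 1 ∨ z ^ i = z ^ m)
    {j : ℕ} (hzn : z ^ 2 ^ j = 1)
    (hcov : ∀ g, ∃ i c : ℤ, g = z ^ i * w ^ c ∨ g = z ^ i * w ^ c * u) (hw0 : w ∉ zpowers z)
    (hu0 : ∀ c : ℤ, w ^ c * u ∉ zpowers z) {H : Subgroup (MulAut E)}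
    (hinn : ∀ g : E, MulAut.conj g ∈ H) {τ ρ : MulAut E} (hτ : τ ∈ H) (hτz : τ z = z)
    (hτw : τ w = w) {c : ℤ} (hτu : τ u = z ^ c * (w * u)) (hρ : ρ ∈ H) (hρz : ρ z = z)
    (hρodd : Odd (orderOf ρ)) (hρ1 : ρ ≠ 1) {β : MulAut E} (hβ : β z = z) : β ∈ H := by
  let N : Subgroup E := zpowers z
  have hzp : ∀ (i : ℤ) e, z ^ i * e = e * z ^ i := fun i e =>
    ((show Commute z e from hzc e).zpow_left i).eq
  have : N.Normal := ⟨by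
    rintro _ ⟨i, rfl⟩ g
    simp only
    rw [← hzp, mul_inv_cancel_right]
    exact ⟨i, rfl⟩⟩
  let q := QuotientGroup.mk' N
  have hq : ∀ n, q n = 1 ↔ n ∈ N := fun n => QuotientGroup.eq_one_iff n
  have hqz : ∀ i : ℤ, q (z ^ i) = 1 := fun i => (hq _).2 ⟨i, rfl⟩
  have hfix : ∀ α : MulAut E, α z = z → ∀ n, q n = 1 → α n = n := fun α hα n hn => by
    obtain ⟨i, rfl⟩ := (hq n).1 hn
    simp only
    rw [map_zpow, hα]
  have hwc : ∀ c : ℤ, w ^ c = 1 ∨ w ^ c = w := fun c => by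
    obtain ⟨d, rfl | rfl⟩ := Int.even_or_odd' c
    · left; rw [zpow_mul, zpow_two, hw, one_zpow]
    · right; rw [zpow_add, zpow_mul, zpow_two, hw, one_zpow, one_mul, zpow_one]
  have hV0 : ∀ v : E ⧸ N, v = 1 ∨ v = q w ∨ v = q u ∨ v = q w * q u := fun v => by
    obtain ⟨e, rfl⟩ := QuotientGroup.mk'_surjective N v
    change q e = _ ∨ q e = _ ∨ q e = _ ∨ q e = _
    obtain ⟨i, c, rfl | rfl⟩ := hcov e <;> rcases hwc c with h | h <;> simp [h, hqz]
  have hqc : q u * q w = q w * q u := by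
    have h1 := congrArg q huw
    rw [map_mul, map_mul, map_mul, map_inv, hqz, one_mul, mul_inv_eq_iff_eq_mul] at h1
    exact h1
  have hqw : q w * q w = 1 := by rw [← map_mul, hw, map_one]
  have hqu : q u * q u = 1 := by rw [← map_mul, hu, map_one]
  have h2 : ∀ v : E ⧸ N, v * v = 1 := fun v => by
    rcases hV0 v with rfl | rfl | rfl | rfl
    · exact one_mul 1
    · exact hqw
    · exact hqu
    · rw [mul_assoc, ← mul_assoc (q u), hqc, mul_assoc, hqu, mul_one, hqw]
  have hV := eq_of_exponent_two hV0 h2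
  refine mem_of_fixes_ker (q := q) (w := w) (u := u) h2 hV (fun n hn => ⟨j, ?_⟩)
    (fun α hα hα' => ?_) hτ hρ (hfix τ hτz) (hfix ρ hρz) (fun h => hw0 ((hq _).1 h))
    (fun h => hu0 0 (by rw [zpow_zero, one_mul]; exact (hq _).1 h)) (fun h => hu0 1 ?_)
    (by rw [hτw]) (by rw [hτu, map_mul, hqz, one_mul, map_mul]) hρodd hρ1 (hfix β hβ)
  · obtain ⟨i, rfl⟩ := (hq n).1 hn
    simp only
    rw [← zpow_natCast, ← zpow_mul, mul_comm, zpow_mul, zpow_natCast, hzn, one_zpow]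
  · -- automorphisms that are trivial on `⟨z⟩` and modulo `⟨z⟩` are inner
    have hαz : α z = z := hα z ((hq z).2 (mem_zpowers z))
    have h3 : ∀ e : E, e * e = 1 → α e = e ∨ α e = z ^ m * e := fun e he => by
      have h4 : q (α e * e⁻¹) = 1 := by rw [map_mul, hα', map_inv, mul_inv_cancel]
      obtain ⟨i, hi⟩ := (hq _).1 h4
      have h5 : α e = z ^ i * e := by simp only at hi; rw [hi, inv_mul_cancel_right]
      have h6 : z ^ i * z ^ i = 1 := by
        have h7 : α e * α e = 1 := by rw [← map_mul, he, map_one]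
        rw [h5, mul_assoc, ← mul_assoc e, ← hzp, mul_assoc, he, mul_one] at h7
        exact h7
      rcases hz2 i h6 with h | h
      · left; rw [h5, h, one_mul]
      · right; rw [h5, h]
    have hwu : w * u * w⁻¹ = z ^ m * u := by
      rw [inv_eq_of_mul_eq_one_right hw, mul_assoc, mul_inv_eq_iff_eq_mul.1 huw, ← mul_assoc,
        ← mul_assoc, ← hzp, mul_assoc (z ^ m), hw, mul_one]
    refine mem_of_apply_eq_or (hzp m w).symm hwu huw hinn (fun g h5 h6 => MulEquiv.ext fun e => ?_)
      (h3 w hw) (h3 u hu)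
    have h4 : MulAut.conj g z = z := by rw [MulAut.conj_apply, ← hzc, mul_inv_cancel_right]
    obtain ⟨i, c, rfl | rfl⟩ := hcov e <;> simp only [map_mul, map_zpow, h4, h5, h6, hαz]
  · rw [zpow_one, ← hq, map_mul, h, hqu]

end CentralProduct

namespace WreathedTop

open FusionSystem

variable {P : Type*} [Group P] {a b t u : P} {n : ℕ} (D : WreathedTop a b t n)

include D

theorem t_conj_w : t * a ^ (2 : ℤ) ^ (n - 1) * t⁻¹ =
    (a * b) ^ (2 : ℤ) ^ (n - 1) * a ^ (2 : ℤ) ^ (n - 1) := by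
  have h1 := D.t_mul (2 ^ (n - 1)) 0
  simp only [zpow_zero, mul_one, one_mul] at h1
  rw [h1, mul_inv_cancel_right, D.zpow_eq, mul_assoc, D.zpow_comm, ← mul_assoc, D.w_sq, one_mul]

theorem mem_core {g : P} (hg : g ∈ core a b t n) : ∃ i c : ℤ,
    g = (a * b) ^ i * (a ^ (2 : ℤ) ^ (n - 1)) ^ c ∨
      g = (a * b) ^ i * (a ^ (2 : ℤ) ^ (n - 1)) ^ c * t := by
  have hzp : ∀ (i : ℤ) e, e * (a * b) ^ i = (a * b) ^ i * e := fun i e => (D.z_zpow_comm i e).symm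
  have ht : ∀ c : ℤ, t * (a ^ (2 : ℤ) ^ (n - 1)) ^ c =
      (a * b) ^ ((2 : ℤ) ^ (n - 1) * c) * (a ^ (2 : ℤ) ^ (n - 1)) ^ c * t := fun c => by
    rw [zpow_mul, ← (show Commute ((a * b) ^ (2 : ℤ) ^ (n - 1)) (a ^ (2 : ℤ) ^ (n - 1)) from
      (hzp _ _).symm).mul_zpow, ← D.t_conj_w, conj_zpow, inv_mul_cancel_right]
  have hmul : ∀ i c j d : ℤ, (a * b) ^ i * (a ^ (2 : ℤ) ^ (n - 1)) ^ c *
      ((a * b) ^ j * (a ^ (2 : ℤ) ^ (n - 1)) ^ d) =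
      (a * b) ^ (i + j) * (a ^ (2 : ℤ) ^ (n - 1)) ^ (c + d) := fun i c j d => by
    rw [mul_assoc, ← mul_assoc _ ((a * b) ^ j), hzp, zpow_add, zpow_add]
    simp only [mul_assoc]
  have htm : ∀ i c : ℤ, t * ((a * b) ^ i * (a ^ (2 : ℤ) ^ (n - 1)) ^ c) =
      (a * b) ^ (i + (2 : ℤ) ^ (n - 1) * c) * (a ^ (2 : ℤ) ^ (n - 1)) ^ c * t := fun i c => by
    rw [← mul_assoc, hzp, mul_assoc, ht, zpow_add]
    simp only [mul_assoc]
  induction hg using Subgroup.closure_induction with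
  | mem g hg =>
    rcases hg with rfl | rfl | hg
    · exact ⟨1, 0, Or.inl (by simp)⟩
    · exact ⟨0, 1, Or.inl (by simp)⟩
    · exact ⟨0, 0, Or.inr (by simpa using hg)⟩
  | one => exact ⟨0, 0, Or.inl (by simp)⟩
  | mul g k _ _ hg hk =>
    obtain ⟨i, c, rfl | rfl⟩ := hg <;> obtain ⟨j, d, rfl | rfl⟩ := hk
    · exact ⟨_, _, Or.inl (hmul i c j d)⟩
    · exact ⟨_, _, Or.inr (by rw [← mul_assoc, hmul i c j d])⟩
    · exact ⟨_, _, Or.inr (by rw [mul_assoc, htm, ← mul_assoc, hmul])⟩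
    · exact ⟨_, _, Or.inl (by
        rw [mul_assoc, ← mul_assoc t, htm, mul_assoc _ t t, D.sq, mul_one, hmul])⟩
  | inv g _ hg =>
    obtain ⟨i, c, rfl | rfl⟩ := hg
    · exact ⟨-i, -c, Or.inl (by rw [mul_inv_rev, ← zpow_neg, ← zpow_neg, hzp])⟩
    · refine ⟨-i + (2 : ℤ) ^ (n - 1) * -c, -c, Or.inr ?_⟩
      rw [← htm, mul_inv_rev, inv_eq_of_mul_eq_one_right D.sq, mul_inv_rev, ← zpow_neg, ← zpow_neg,
        hzp]

theorem a_notMem_core : a ∉ core a b t n := fun h => by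
  obtain ⟨i, c, h1 | h1⟩ := D.mem_core h
  · have h2 := D.mul_eq i i (2 ^ (n - 1) * c) 0
    rw [zpow_zero, mul_one, ← D.zpow_eq, zpow_mul, ← h1] at h2
    have h3 := (D.eq_iff 1 0 (i + 2 ^ (n - 1) * c) (i + 0)).1 (by
      rw [← h2, zpow_one, zpow_zero, mul_one])
    have h4 : (2 : ℤ) ∣ 2 ^ n := D.pow_n ▸ dvd_mul_left _ _
    have h5 := dvd_sub (h4.trans h3.1) (h4.trans h3.2)
    have h6 : (2 : ℤ) ∣ 2 ^ (n - 1) * c := D.two_dvd.mul_right c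
    omega
  · refine D.notMem ((mul_mem_cancel_left (mul_mem (zpow_mem D.z_mem_base i)
      (zpow_mem D.w_mem_base c))).1 (h1 ▸ D.left_mem))

theorem not_core_le : ¬ core a b t n ≤ D.base := fun h => D.notMem (h t_mem_core)

theorem core_eq_map (i : ℤ) (h : a ^ i * t * (a ^ i)⁻¹ = u) :
    core a b u n = (core a b t n).map (MulAut.conj (a ^ i)).toMonoidHom := by
  have h1 : a ^ i * (a * b) * (a ^ i)⁻¹ = a * b := by rw [← D.z_comm, mul_inv_cancel_right]
  have h2 : a ^ i * a ^ (2 : ℤ) ^ (n - 1) * (a ^ i)⁻¹ = a ^ (2 : ℤ) ^ (n - 1) := by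
    rw [zpow_mul_comm, mul_inv_cancel_right]
  rw [core, core, MonoidHom.map_closure, Set.image_insert_eq, Set.image_pair]
  simp only [MulEquiv.coe_toMonoidHom, MulAut.conj_apply, h1, h2, h]

variable [Finite P] {F F' : FusionSystem P}

theorem isPGroup_aut_top (F : FusionSystem P) : IsPGroup 2 (F.aut ⊤) := by
  by_contra h
  obtain ⟨α, hα1, hα⟩ := exists_coprime_of_not_isPGroup h
  obtain ⟨hw, hu, hu2, h1⟩ := D.eq_closure (Q := ⊤) (mem_top _)
    (fun h => D.notMem (h (mem_top t))) (α := (α : MulAut _))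
    (by rw [Subgroup.orderOf_coe]; exact Nat.odd_of_not_two_dvd hα) (fun h => hα1 (Subtype.ext h))
  exact (D.change hu hu2).a_notMem_core (h1.le (mem_top a))

theorem aut_top_le (hF : F.IsSaturated 2) : F.aut ⊤ ≤ autP ⊤ :=
  hF.aut_top_le_of_isPGroup (D.isPGroup_aut_top F)

/-- The essential subgroups other than the abelian subgroup of index two. -/
theorem eq_base_or {Q : Subgroup P} (hQ : F.IsEssential 2 Q) : Q = D.base ∨
    ∃ u, u ∉ D.base ∧ u * u = 1 ∧ Q = core a b u n := by
  have hc := hQ.1 Q (FusionSystem.IsConj.refl F Q)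
  by_cases h : Q ≤ D.base
  · refine Or.inl (le_antisymm h fun g hg => hc ?_)
    exact mem_centralizer_iff.2 fun e he => D.base_comm (h he) hg
  · obtain ⟨α, -, hα1, hα⟩ := hQ.hasCoprimeAut
    have hz : a * b ∈ Q := hc (mem_centralizer_iff.2 fun g _ => (D.z_comm g).symm)
    obtain ⟨hw, hu, hu2, h1⟩ := D.eq_closure hz h (Nat.odd_of_not_two_dvd hα) hα1
    exact Or.inr ⟨_, hu, hu2, h1⟩

theorem isConj_core (F : FusionSystem P) (hu : u ∉ D.base) (hu2 : u * u = 1) :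
    F.IsConj (core a b u n) (core a b t n) := by
  obtain ⟨i, hi⟩ := D.exists_conj hu hu2
  rw [D.core_eq_map i hi]
  exact (F.isConj_conj _ _).symm

/-- An automorphism in a saturated fusion system acts trivially on the center of `P`, since its
restriction to the center extends to `P`. -/
theorem aut_core_z (hF : F.IsSaturated 2) {α : MulAut (core a b t n)} (hα : α ∈ F.aut _) :
    α ⟨a * b, z_mem_core⟩ = ⟨a * b, z_mem_core⟩ := by
  have hcen : ∀ α : MulAut (core a b t n),
      (α ⟨a * b, z_mem_core⟩ : P) ∈ zpowers (a * b) := fun α => by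
    have hc : ∀ e, α ⟨a * b, z_mem_core⟩ * e = e * α ⟨a * b, z_mem_core⟩ := fun e => by
      obtain ⟨f, rfl⟩ := α.surjective e
      rw [← map_mul, ← map_mul, show (⟨a * b, z_mem_core⟩ : core a b t n) * f = f * ⟨a * b, z_mem_core⟩ from
          Subtype.ext (D.z_comm f)]
    by_cases h : (α ⟨a * b, z_mem_core⟩ : P) ∈ D.base
    · exact D.mem_of_commute h D.notMem (congrArg Subtype.val (hc ⟨t, t_mem_core⟩))
    · exact absurd (D.mem_of_commute D.w_mem_base h
        (congrArg Subtype.val (hc ⟨_, w_mem_core⟩)).symm) D.w_notMem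
  let f : P → P := autFun α
  have hf : ∀ (x : P) (hx : x ∈ core a b t n), f x = α ⟨x, hx⟩ := fun x hx =>
    autFun_apply α ⟨x, hx⟩
  have hle : zpowers (a * b) ≤ core a b t n := zpowers_le.2 z_mem_core
  have hpow : ∀ (α : MulAut (core a b t n)) (k : ℤ), (α ⟨(a * b) ^ k, hle ⟨k, rfl⟩⟩ : P) =
      (α ⟨a * b, z_mem_core⟩ : P) ^ k := fun α k => by
    rw [← Subgroup.coe_zpow, ← map_zpow]
    rfl
  have hmor : F.Mor (zpowers (a * b)) f := (mor_of_mem_aut hα).mono hle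
  have htop : centralizer (zpowers (a * b) : Set P) = ⊤ := by
    refine (Subgroup.eq_top_iff' _).2 fun g => mem_centralizer_iff.2 ?_
    rintro _ ⟨k, rfl⟩
    exact D.z_zpow_comm k g
  obtain ⟨N, f', hf', hff', hN⟩ := hF.exists_extension hmor (R := zpowers (a * b)) (fun y => by
    constructor
    · rintro ⟨k, rfl⟩
      have h1 := (zpowers (a * b)).zpow_mem (hcen α⁻¹) k
      rw [← hpow] at h1
      refine ⟨_, h1, ?_⟩
      rw [hf _ (hle h1)]
      simp
    · rintro ⟨_, ⟨k, rfl⟩, rfl⟩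
      rw [hf _ (hle ⟨k, rfl⟩), hpow]
      exact zpow_mem (hcen α) k) (fun R _ => by
    rw [htop]
    exact Nat.card_mono (Set.toFinite _) le_top)
  have hNt : N = ⊤ := (Subgroup.eq_top_iff' _).2 fun x => by
    have hx : ∀ u ∈ zpowers (a * b), x * u * x⁻¹ = u := by
      rintro _ ⟨k, rfl⟩
      simp only
      rw [← D.z_zpow_comm, mul_inv_cancel_right]
    refine (hN x).2 ⟨?_, 1, one_mem _, fun u hu => by rw [hx u hu]; simp⟩
    refine Subgroup.centralizer_le_normalizer _ ?_
    rw [htop]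
    exact mem_top x
  subst hNt
  obtain ⟨β, hβ, hβ'⟩ := hf'.exists_aut fun _ _ => mem_top _
  obtain ⟨g, rfl⟩ := D.aut_top_le hF hβ
  have h1 := hβ' ⟨a * b, mem_top _⟩
  rw [hff' _ (mem_zpowers _), hf _ z_mem_core] at h1
  refine Subtype.ext (h1.symm.trans ?_)
  change (g : P) * (a * b) * (g : P)⁻¹ = a * b
  rw [← D.z_comm, mul_inv_cancel_right]

/-- If `F'` has an automorphism of odd order, it contains the automorphisms of every saturated
fusion system. -/
theorem aut_core_le (hF : F.IsSaturated 2) (hF' : F'.HasCoprimeAut 2 (core a b t n)) :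
    F.aut (core a b t n) ≤ F'.aut (core a b t n) := fun β hβ => by
  obtain ⟨ρ, hρ, hρ1, hρ2⟩ := hF'
  have hρodd := Nat.odd_of_not_two_dvd hρ2
  obtain ⟨m, hm⟩ : ∃ m, n = m + 2 := ⟨n - 2, by have := D.two_le; omega⟩
  have hconj : a ^ (2 : ℤ) ^ (n - 2) * t * (a ^ (2 : ℤ) ^ (n - 2))⁻¹ =
      (a * b) ^ (-(2 : ℤ) ^ (n - 2)) * (a ^ (2 : ℤ) ^ (n - 1) * t) := by
    have h1 := D.t_mul (-2 ^ (n - 2)) 0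
    have h2 := D.mul_eq (-2 ^ (n - 2)) (-2 ^ (n - 2)) (2 ^ (n - 1)) 0
    rw [zpow_zero, zpow_zero, one_mul, mul_one] at h1
    rw [zpow_zero, mul_one] at h2
    rw [mul_assoc, ← zpow_neg, h1, D.zpow_eq, ← mul_assoc, ← mul_assoc, h2]
    congr 3
    · rw [hm, show m + 2 - 1 = m + 1 by omega, show m + 2 - 2 = m by omega, pow_succ]
      ring
    · simp
  have hcz : a ^ (2 : ℤ) ^ (n - 2) * (a * b) * (a ^ (2 : ℤ) ^ (n - 2))⁻¹ = a * b := by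
    rw [← D.z_comm, mul_inv_cancel_right]
  have hcw : a ^ (2 : ℤ) ^ (n - 2) * a ^ (2 : ℤ) ^ (n - 1) * (a ^ (2 : ℤ) ^ (n - 2))⁻¹ =
      a ^ (2 : ℤ) ^ (n - 1) := by
    rw [zpow_mul_comm, mul_inv_cancel_right]
  obtain ⟨τ, hτ, hτ'⟩ := F'.exists_aut_conj (d := a ^ (2 : ℤ) ^ (n - 2))
    (s := {a * b, a ^ (2 : ℤ) ^ (n - 1), t}) (by
      rintro _ (rfl | rfl | rfl)
      exacts [by rw [hcz]; exact z_mem_core, by rw [hcw]; exact w_mem_core,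
        hconj ▸ mul_mem (zpow_mem z_mem_core _) (mul_mem w_mem_core t_mem_core)])
  refine mem_of_fixes_center (z := ⟨a * b, z_mem_core⟩) (w := ⟨_, w_mem_core⟩) (u := ⟨t, t_mem_core⟩)
    (m := 2 ^ (n - 1)) (j := n) (c := -2 ^ (n - 2)) (τ := τ) (ρ := ρ)
    (fun e => Subtype.ext (D.z_comm e)) (Subtype.ext D.w_sq) (Subtype.ext D.sq) ?_ (fun i hi => ?_) ?_
    (fun g => ?_) ?_ (fun c => ?_) (fun g => F'.inn_le_aut _ ⟨g, rfl⟩) hτ ?_ ?_ ?_ hρ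
    (D.apply_z _ D.not_core_le hρodd) hρodd hρ1 (D.aut_core_z hF hβ)
  · refine Subtype.ext ?_
    have := D.t_conj_w
    simpa using this
  · exact (D.z_zpow_cases (congrArg Subtype.val hi)).imp Subtype.ext Subtype.ext
  · exact Subtype.ext D.z_pow
  · obtain ⟨i, c, h⟩ := D.mem_core g.2
    exact ⟨i, c, h.imp (fun h => Subtype.ext (by simpa using h)) fun h => Subtype.ext (by simpa using h)⟩
  · rintro ⟨i, hi⟩
    refine D.w_notMem ⟨i, ?_⟩
    have := congrArg Subtype.val hi
    simpa using this
  · rintro ⟨i, hi⟩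
    have h1 := congrArg Subtype.val hi
    simp at h1
    refine D.notMem ((mul_mem_cancel_left (zpow_mem D.w_mem_base c)).1 ?_)
    rw [← h1]
    exact zpow_mem D.z_mem_base i
  · exact Subtype.ext ((hτ' _).trans hcz)
  · exact Subtype.ext ((hτ' _).trans hcw)
  · refine Subtype.ext ((hτ' _).trans (hconj.trans ?_))
    simp

end WreathedTop

/-! ### Automorphisms of the abelian subgroup of index two -/

namespace WreathedTop

open FusionSystem

variable {P : Type*} [Group P] {a b t u : P} {n : ℕ} (D : WreathedTop a b t n)

include D

theorem base_isPGroup : IsPGroup 2 D.base := D.isPGroup.to_subgroup _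

theorem comm_base (x y : D.base) : x * y = y * x := Subtype.ext (D.base_comm x.2 y.2)

theorem base_ext {α β : MulAut D.base} (h1 : α ⟨a, D.left_mem⟩ = β ⟨a, D.left_mem⟩)
    (h2 : α ⟨b, D.right_mem⟩ = β ⟨b, D.right_mem⟩) : α = β := by
  refine MulEquiv.ext ?_
  rintro ⟨_, i, j, rfl⟩
  have h3 : (⟨a ^ i * b ^ j, i, j, rfl⟩ : D.base) =
      (⟨a, D.left_mem⟩ : D.base) ^ i * (⟨b, D.right_mem⟩ : D.base) ^ j := rfl
  rw [h3, map_mul, map_mul, map_zpow, map_zpow, map_zpow, map_zpow, h1, h2]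

theorem left_ne_right : a ≠ b := fun h => D.notMem ⟨0, 0, by
  have h1 := (D.indep 1 (-1)).1 (by rw [h]; simp)
  rw [D.pow_n] at h1
  have := (dvd_mul_left (2 : ℤ) (2 ^ (n - 1))).trans h1.1
  omega⟩

theorem eq_of_sq_eq_one {e : D.base} (he : e ^ 2 = 1) :
    (e : P) = 1 ∨ (e : P) = (a * b) ^ (2 : ℤ) ^ (n - 1) ∨ (e : P) = a ^ (2 : ℤ) ^ (n - 1) ∨
      (e : P) = (a * b) ^ (2 : ℤ) ^ (n - 1) * a ^ (2 : ℤ) ^ (n - 1) := by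
  have he' : (e : P) * e = 1 := by
    rw [pow_two] at he
    exact congrArg Subtype.val he
  obtain ⟨i, hi | hi⟩ := D.mem_of_sq_mem e.2 (by rw [he']; exact one_mem _)
  · rw [hi] at he' ⊢
    rcases D.z_zpow_cases he' with h | h <;> simp [h]
  · have h1 : (a * b) ^ i * (a * b) ^ i = 1 := by
      rw [hi, (show Commute _ _ from (D.z_zpow_comm i _).symm).mul_mul_mul_comm, D.w_sq,
        mul_one] at he'
      exact he'
    rw [hi]
    rcases D.z_zpow_cases h1 with h | h <;> simp [h]

theorem exists_involution : ∃ s : D.base, (s : P) = (a * b) ^ (2 : ℤ) ^ (n - 1) ∧ s ≠ 1 ∧ s ^ 2 = 1 := by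
  refine ⟨⟨_, zpow_mem D.z_mem_base _⟩, rfl, fun h => ?_, Subtype.ext ?_⟩
  · exact D.not_dvd (D.z_zpow_eq_one.1 (congrArg Subtype.val h))
  · change ((a * b) ^ (2 : ℤ) ^ (n - 1)) ^ 2 = 1
    rw [pow_two, ← zpow_add, ← mul_two, ← D.pow_n, D.z_zpow_eq_one.2 dvd_rfl]

theorem card_sq_eq_one : Nat.card {x : D.base | x ^ 2 = 1} ≤ 4 := by
  classical
  have h : {x : D.base | x ^ 2 = 1} ⊆ (({1, ⟨_, zpow_mem D.z_mem_base (2 ^ (n - 1))⟩,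
      ⟨_, D.w_mem_base⟩, ⟨_, mul_mem (zpow_mem D.z_mem_base (2 ^ (n - 1))) D.w_mem_base⟩} :
      Finset D.base) : Set D.base) := fun x hx => by
    have := D.eq_of_sq_eq_one hx
    simp only [Finset.coe_insert, Finset.coe_singleton, Set.mem_insert_iff, Set.mem_singleton_iff]
    exact this.imp Subtype.ext (Or.imp Subtype.ext (Or.imp Subtype.ext Subtype.ext))
  refine (Set.ncard_le_ncard h (Finset.finite_toSet _)).trans ?_
  rw [Set.ncard_coe_finset]
  exact Finset.card_le_four

theorem eq_one_of_fixed [Finite P] {ρ : MulAut D.base} (hρ : Odd (orderOf ρ)) (hρ1 : ρ ≠ 1)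
    {x : D.base} (hx : ρ x = x) : x = 1 := by
  by_contra hx1
  obtain ⟨k, hk⟩ := IsPGroup.iff_orderOf.1 D.base_isPGroup x
  rcases k with _ | k
  · exact hx1 (orderOf_eq_one_iff.1 (hk.trans (pow_zero 2)))
  · refine hρ1 (MulAut.eq_one_of_fixes_involution hρ D.base_isPGroup D.comm_base D.card_sq_eq_one
      (y := x ^ 2 ^ k) ?_ ?_ ?_)
    · rw [← pow_mul, ← pow_succ, ← hk, pow_orderOf_eq_one]
    · intro h
      have h1 := orderOf_dvd_of_pow_eq_one h
      rw [hk] at h1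
      have h2 := Nat.le_of_dvd (by positivity) h1
      have h3 : 0 < 2 ^ k := by positivity
      rw [pow_succ] at h2
      omega
    · rw [map_pow, hx]

theorem exists_tau (F : FusionSystem P) [Finite P] : ∃ τ ∈ F.aut D.base,
    (∀ x : D.base, (τ x : P) = t * x * t⁻¹) ∧ orderOf τ = 2 := by
  obtain ⟨τ, hτ, hτ'⟩ := (F.mor_conj D.base t).exists_aut (by
    rintro _ ⟨i, j, rfl⟩
    rw [D.t_mul, mul_inv_cancel_right]
    exact ⟨j, i, rfl⟩)
  refine ⟨τ, hτ, hτ', orderOf_eq_prime ?_ fun h => ?_⟩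
  · refine MulEquiv.ext fun x => Subtype.ext ?_
    rw [pow_two, MulAut.mul_apply, hτ', hτ', MulAut.one_apply, inv_eq_of_mul_eq_one_right D.sq,
      ← mul_assoc, ← mul_assoc, D.sq, one_mul, mul_assoc, D.sq, mul_one]
  · have h1 := hτ' ⟨a, D.left_mem⟩
    rw [h] at h1
    exact D.left_ne_right (h1.trans D.conj)

variable [Finite P] {F F' : FusionSystem P}

/-- If the abelian subgroup is essential, its automorphism group acts faithfully on the three
involutions. -/
theorem card_aut_base_dvd (hA : F.IsEssential 2 D.base) : Nat.card (F.aut D.base) ∣ 6 := by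
  have hinn : ∀ α ∈ inn D.base, α = 1 := by
    rintro _ ⟨g, rfl⟩
    refine MulEquiv.ext fun x => ?_
    rw [MulAut.conj_apply, D.comm_base, inv_mul_cancel_left, MulAut.one_apply]
  let Y : Set D.base := {x | x ^ 2 = 1} \ {1}
  have hY : ∀ (α : MulAut D.base) (x : D.base), α.toEquiv x ∈ Y ↔ x ∈ Y := fun α x => by
    change α x ^ 2 = 1 ∧ ¬ α x = 1 ↔ x ^ 2 = 1 ∧ ¬ x = 1
    rw [← map_pow, map_eq_one_iff α α.injective, map_eq_one_iff α α.injective]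
  let f : MulAut D.base →* Equiv.Perm Y :=
    { toFun := fun α => Equiv.Perm.subtypePerm α.toEquiv (hY α)
      map_one' := rfl
      map_mul' := fun α β => rfl }
  have h1 : F.aut D.base ⊓ f.ker ≤ inn D.base := by
    refine hA.le_inn (fun α hα β hβ => ⟨mul_mem (mul_mem hα hβ.1) ((F.aut D.base).inv_mem hα),
      f.normal_ker.conj_mem β hβ.2 α⟩) ?_ inf_le_left
    by_contra h
    obtain ⟨α, hα1, hα⟩ := exists_coprime_of_not_isPGroup h
    refine hα1 (Subtype.ext (MulAut.eq_one_of_fixes_involutions ?_ D.base_isPGroup D.comm_base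
      fun x hx => ?_))
    · rw [Subgroup.orderOf_coe]
      exact Nat.odd_of_not_two_dvd hα
    · by_cases hx1 : x = 1
      · rw [hx1, map_one]
      · exact congrArg Subtype.val (Equiv.ext_iff.1 α.2.2 ⟨x, hx, hx1⟩)
  have hf : Function.Injective (f.comp (F.aut D.base).subtype) := by
    rw [injective_iff_map_eq_one]
    exact fun α hα => Subtype.ext (hinn α (h1 ⟨α.2, hα⟩))
  have hcard : Nat.card Y ≤ 3 := by
    have h1 : Nat.card Y + 1 = Nat.card {x : D.base | x ^ 2 = 1} :=
      Set.ncard_sdiff_singleton_add_one (show (1 : D.base) ∈ {x : D.base | x ^ 2 = 1} from one_pow 2)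
    have := D.card_sq_eq_one
    omega
  refine (Subgroup.card_dvd_of_injective _ hf).trans ?_
  rw [Nat.card_perm]
  exact Nat.factorial_dvd_factorial hcard

/-- The automorphism group of the essential abelian subgroup is the symmetric group generated by
the conjugation by `t` and an element of order three. -/
theorem exists_rho (hA : F.IsEssential 2 D.base) : ∃ ρ ∈ F.aut D.base, orderOf ρ = 3 ∧
    ∀ τ ∈ F.aut D.base, (∀ x : D.base, (τ x : P) = t * x * t⁻¹) → τ * ρ = ρ⁻¹ * τ := by
  obtain ⟨ρ, hρ, hρ1, hρ2⟩ := hA.hasCoprimeAut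
  have hodd := Nat.odd_of_not_two_dvd hρ2
  have h3 : orderOf ρ = 3 := by
    have h1 : orderOf ρ ∣ 2 * 3 :=
      (Subgroup.orderOf_dvd_natCard _ hρ).trans (D.card_aut_base_dvd hA)
    have h2 := Nat.Coprime.dvd_of_dvd_mul_left (Nat.coprime_two_right.2 hodd) h1
    rw [Nat.dvd_prime Nat.prime_three] at h2
    exact h2.resolve_left fun h => hρ1 (orderOf_eq_one_iff.1 h)
  refine ⟨ρ, hρ, h3, fun τ hτ hτ' => ?_⟩
  obtain ⟨τ₀, hτ₀, hτ₀', hτ2⟩ := D.exists_tau F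
  have h0 : τ = τ₀ := MulEquiv.ext fun x => Subtype.ext (by rw [hτ', hτ₀'])
  rw [← h0] at hτ2
  let H := F.aut D.base
  have hcard : Nat.card H = 6 := by
    refine Nat.dvd_antisymm (D.card_aut_base_dvd hA) ?_
    refine Nat.Coprime.mul_dvd_of_dvd_of_dvd (m := 2) (n := 3) (by norm_num) ?_ ?_
    · rw [← hτ2]; exact Subgroup.orderOf_dvd_natCard _ hτ
    · rw [← h3]; exact Subgroup.orderOf_dvd_natCard _ hρ
  have hidx : (zpowers (⟨ρ, hρ⟩ : H)).index = 2 := by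
    have h1 := (zpowers (⟨ρ, hρ⟩ : H)).card_mul_index
    rw [Nat.card_zpowers, Subgroup.orderOf_mk, h3, hcard] at h1
    omega
  have hn := Subgroup.normal_of_index_eq_two hidx
  obtain ⟨k, hk⟩ := hn.conj_mem _ (mem_zpowers _) (⟨τ, hτ⟩ : H)
  have hk' : τ * ρ * τ⁻¹ = ρ ^ k := (congrArg Subtype.val hk).symm
  have hρ3 : ρ ^ (3 : ℤ) = 1 := by
    rw [show (3 : ℤ) = ((3 : ℕ) : ℤ) from rfl, zpow_natCast, ← h3, pow_orderOf_eq_one]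
  have hkm : ρ ^ k = ρ ^ (k % 3) := by
    conv_lhs => rw [← Int.mul_ediv_add_emod k 3, zpow_add, zpow_mul, hρ3, one_zpow, one_mul]
  have hk3 : k % 3 = 0 ∨ k % 3 = 1 ∨ k % 3 = 2 := by omega
  rw [hkm] at hk'
  rcases hk3 with h | h | h
  · rw [h, zpow_zero, mul_inv_eq_one, mul_eq_left] at hk'
    exact absurd hk' hρ1
  · -- otherwise the involution of `⟨z⟩` would be fixed
    rw [h, zpow_one, mul_inv_eq_iff_eq_mul] at hk'
    obtain ⟨s, hs, hs1, hs2⟩ := D.exists_involution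
    have hτs : τ s = s := Subtype.ext (by
      rw [hτ', hs, ← D.z_zpow_comm, mul_inv_cancel_right])
    have hτρ : τ (ρ s) = ρ s := by
      rw [← MulAut.mul_apply, hk', MulAut.mul_apply, hτs]
    have h1 : ((ρ s : D.base) : P) ∈ zpowers (a * b) := by
      refine D.mem_of_commute (ρ s).2 D.notMem ?_
      have h2 := hτ' (ρ s)
      rw [hτρ] at h2
      rw [eq_mul_inv_iff_mul_eq] at h2
      exact h2
    refine absurd (D.eq_one_of_fixed hodd hρ1 (x := s) (Subtype.ext ?_)) hs1
    rcases D.eq_of_sq_eq_one (e := ρ s) (by rw [← map_pow, hs2, map_one]) with h2 | h2 | h2 | h2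
    · exact absurd ((map_eq_one_iff ρ ρ.injective).1 (Subtype.ext h2)) hs1
    · rw [h2, hs]
    · exact absurd (h2 ▸ h1) D.w_notMem
    · rw [h2, mul_mem_cancel_left (zpow_mem (mem_zpowers _) _)] at h1
      exact absurd h1 D.w_notMem
  · rw [h, mul_inv_eq_iff_eq_mul] at hk'
    rw [hk']
    congr 1
    refine eq_inv_of_mul_eq_one_left ?_
    rw [← zpow_add_one]
    exact hρ3

/-- If the abelian subgroup is essential, its generators can be chosen in such a way that an
automorphism permutes `a`, `b` and `(ab)⁻¹`: one takes the images of `ab` under the powers of an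
automorphism of order three. -/
theorem exists_adapted (hA : F.IsEssential 2 D.base) : ∃ (a' b' : P) (D' : WreathedTop a' b' t n),
    D'.base = D.base ∧ ∃ α ∈ F.aut D'.base, (α ⟨a', D'.left_mem⟩ : P) = b' ∧
      (α ⟨b', D'.right_mem⟩ : P) = (a' * b')⁻¹ := by
  obtain ⟨ρ, hρ, hρ3, hτρ⟩ := D.exists_rho hA
  obtain ⟨τ, hτ, hτ', -⟩ := D.exists_tau F
  replace hτρ := hτρ τ hτ hτ'
  have hodd : Odd (orderOf ρ) := by rw [hρ3]; decide
  have hρ1 : ρ ≠ 1 := by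
    rintro rfl
    rw [orderOf_one] at hρ3
    omega
  have hρ0 : ∀ x, ρ (ρ (ρ x)) = x := fun x => by
    have h1 : ρ ^ 3 = 1 := hρ3 ▸ pow_orderOf_eq_one ρ
    exact DFunLike.congr_fun h1 x
  have hinv : ∀ x, ρ⁻¹ x = ρ (ρ x) := fun x => by
    rw [← hρ0 (ρ⁻¹ x), MulAut.apply_inv_self]
  obtain ⟨z, hz⟩ : ∃ z : D.base, (z : P) = a * b := ⟨⟨_, D.z_mem_base⟩, rfl⟩
  have hz1 : ∀ i : ℤ, z ^ i = 1 ↔ (2 : ℤ) ^ n ∣ i := fun _ => D.coe_zpow_eq_one hz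
  have hτz : ∀ i : ℤ, τ (z ^ i) = z ^ i := fun i => Subtype.ext (by
    rw [hτ', Subgroup.coe_zpow, hz, ← D.z_zpow_comm, mul_inv_cancel_right])
  have hτρz : ∀ i : ℤ, τ (ρ (z ^ i)) = ρ (ρ (z ^ i)) := fun i => by
    rw [← MulAut.mul_apply, hτρ, MulAut.mul_apply, hτz, hinv]
  have hnorm : z * ρ z * ρ (ρ z) = 1 := D.eq_one_of_fixed hodd hρ1 (by
    rw [map_mul, map_mul, hρ0, D.comm_base, ← mul_assoc])
  have hWr : WreathRel ((ρ z : D.base) : P) ((ρ (ρ z) : D.base) : P) t :=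
    ⟨D.base_comm (ρ z).2 (ρ (ρ z)).2, by
      rw [← hτ']
      have := hτρz 1
      rw [zpow_one] at this
      rw [this], D.sq⟩
  have hW : WreathedTop ((ρ z : D.base) : P) ((ρ (ρ z) : D.base) : P) t n :=
    { hWr with
      two_le := D.two_le
      indep := fun i j => by
        have h1 : ((ρ z : D.base) : P) ^ i * ((ρ (ρ z) : D.base) : P) ^ j = 1 ↔
            z ^ i = ρ (z ^ (-j)) := by
          rw [← Subgroup.coe_zpow, ← Subgroup.coe_zpow, ← map_zpow, ← map_zpow, ← map_zpow,
            ← Subgroup.coe_mul, ← map_mul, OneMemClass.coe_eq_one, map_eq_one_iff ρ ρ.injective,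
            mul_eq_one_iff_eq_inv, ← map_inv, zpow_neg]
        rw [h1]
        constructor
        · intro h2
          have h3 : ρ (z ^ i) = z ^ i := by
            conv_rhs => rw [← hτz, h2, hτρz, ← h2]
          have h4 := D.eq_one_of_fixed hodd hρ1 h3
          rw [h4, eq_comm, map_eq_one_iff ρ ρ.injective, hz1, dvd_neg] at h2
          exact ⟨(hz1 i).1 h4, h2⟩
        · rintro ⟨h2, h3⟩
          rw [(hz1 i).2 h2, (hz1 (-j)).2 ((dvd_neg).2 h3), map_one]
      card := D.card }
  have hbase : hW.base = D.base := by
    refine le_antisymm ?_ fun g hg => ?_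
    · rintro _ ⟨i, j, rfl⟩
      exact mul_mem (zpow_mem (ρ z).2 i) (zpow_mem (ρ (ρ z)).2 j)
    · obtain ⟨i, j, h | h⟩ := hW.cover g
      · exact ⟨i, j, h⟩
      · exact absurd ((mul_mem_cancel_left (mul_mem (zpow_mem (ρ z).2 i)
          (zpow_mem (ρ (ρ z)).2 j))).1 (h ▸ hg)) D.notMem
  refine ⟨_, _, hW, hbase, ?_⟩
  have hm := (mor_of_mem_aut hρ).mono hbase.le
  have hv := autFun_apply ρ
  obtain ⟨α, hα, hα'⟩ := hm.exists_aut fun x hx => by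
    rw [hbase] at hx ⊢
    exact autFun_mem hx
  refine ⟨α, hα, ?_, ?_⟩
  · rw [hα', hv (ρ z)]
  · rw [hα', hv (ρ (ρ z)), hρ0]
    refine eq_inv_of_mul_eq_one_left ?_
    rw [← mul_assoc]
    exact congrArg Subtype.val hnorm

theorem aut_base_le (hA : F.IsEssential 2 D.base) {α α' : MulAut D.base} (hα : α ∈ F.aut D.base)
    (hα' : α' ∈ F'.aut D.base) (h1 : (α ⟨a, D.left_mem⟩ : P) = b)
    (h2 : (α ⟨b, D.right_mem⟩ : P) = (a * b)⁻¹) (h1' : (α' ⟨a, D.left_mem⟩ : P) = b)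
    (h2' : (α' ⟨b, D.right_mem⟩ : P) = (a * b)⁻¹) : F.aut D.base ≤ F'.aut D.base := by
  have h : α = α' := D.base_ext (Subtype.ext (h1.trans h1'.symm)) (Subtype.ext (h2.trans h2'.symm))
  subst h
  obtain ⟨τ, hτ, hτ', hτ2⟩ := D.exists_tau F
  obtain ⟨τ', hτF', hτ'', -⟩ := D.exists_tau F'
  have h0 : τ = τ' := MulEquiv.ext fun x => Subtype.ext (by rw [hτ', hτ''])
  rw [← h0] at hτF'
  have hα3 : orderOf α = 3 := by
    have : Fact (Nat.Prime 3) := ⟨Nat.prime_three⟩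
    have ha : α ⟨a, D.left_mem⟩ = ⟨b, D.right_mem⟩ := Subtype.ext h1
    have hb : α ⟨b, D.right_mem⟩ = (⟨a, D.left_mem⟩ * ⟨b, D.right_mem⟩)⁻¹ := Subtype.ext h2
    have hab : α (⟨a, D.left_mem⟩ * ⟨b, D.right_mem⟩)⁻¹ = ⟨a, D.left_mem⟩ := by
      rw [map_inv, map_mul, ha, hb, mul_inv_rev, inv_inv, mul_inv_cancel_right]
    refine orderOf_eq_prime (D.base_ext ?_ ?_) fun h => ?_
    · change α (α (α _)) = _
      rw [ha, hb, hab]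
      rfl
    · change α (α (α _)) = _
      rw [hb, hab, ha]
      rfl
    · rw [h] at h1
      exact D.left_ne_right h1
  have h6 : 6 ∣ Nat.card (F.aut D.base ⊓ F'.aut D.base : Subgroup _) := by
    refine Nat.Coprime.mul_dvd_of_dvd_of_dvd (m := 2) (n := 3) (by norm_num) ?_ ?_
    · rw [← hτ2]; exact Subgroup.orderOf_dvd_natCard _ ⟨hτ, hτF'⟩
    · rw [← hα3]; exact Subgroup.orderOf_dvd_natCard _ ⟨hα, hα'⟩
  have h7 := Subgroup.eq_of_le_of_card_ge (inf_le_left : F.aut D.base ⊓ F'.aut D.base ≤ F.aut D.base)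
    (Nat.le_of_dvd Nat.card_pos ((D.card_aut_base_dvd hA).trans h6))
  rw [← h7]
  exact inf_le_right

end WreathedTop

/-! ### Comparison of fusion systems on wreathed groups with finite groups -/

namespace WreathedTop

open FusionSystem
open scoped commutatorElement

/-- Some essential subgroup is conjugate to the nonabelian group attached to `a`, `b` and `t`. -/
def Has {P : Type*} [Group P] (F : FusionSystem P) (a b t : P) (n : ℕ) : Prop :=
  F.HasEssentialConj 2 (core a b t n)

variable {P : Type*} [Group P] {a b t u : P} {n : ℕ} (D : WreathedTop a b t n)

include D

theorem base_eq_closure : D.base = closure {a, b} := by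
  refine le_antisymm ?_ ((closure_le _).2 ?_)
  · rintro _ ⟨i, j, rfl⟩
    exact mul_mem (zpow_mem (subset_closure (by simp)) i)
      (zpow_mem (subset_closure (by simp)) j)
  · rintro _ (rfl | rfl)
    exacts [D.left_mem, D.right_mem]

theorem not_isConj_core_base (F : FusionSystem P) : ¬ F.IsConj (core a b t n) D.base := fun h => by
  obtain ⟨f, hf, hR⟩ := isConj_iff.1 h
  have hw := w_mem_core (a := a) (b := b) (t := t) (n := n)
  have ht := t_mem_core (a := a) (b := b) (t := t) (n := n)
  have h1 := D.base_comm ((hR _).2 ⟨_, hw, rfl⟩) ((hR _).2 ⟨_, ht, rfl⟩)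
  rw [← hf.map_mul hw ht, ← hf.map_mul ht hw] at h1
  have h2 := hf.injOn (mul_mem hw ht) (mul_mem ht hw) h1
  exact D.w_notMem (D.mem_of_commute D.w_mem_base D.notMem h2)

variable [Finite P] {F F' : FusionSystem P}

theorem isConj_or (Q : Subgroup P) (hQ : F.IsEssential 2 Q) :
    F.IsConj Q D.base ∨ F.IsConj Q (core a b t n) := by
  rcases D.eq_base_or hQ with rfl | ⟨u, hu, hu2, rfl⟩
  exacts [Or.inl (FusionSystem.IsConj.refl F _), Or.inr (D.isConj_core F hu hu2)]

theorem hasEssentialConj_base : F.HasEssentialConj 2 D.base ↔ F.IsEssential 2 D.base := by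
  refine ⟨?_, fun h => ⟨_, h, FusionSystem.IsConj.refl F _⟩⟩
  rintro ⟨Q, hQ, h⟩
  rcases D.eq_base_or hQ with rfl | ⟨u, hu, hu2, rfl⟩
  · exact hQ
  · exact absurd ((D.isConj_core F hu hu2).symm.trans h) (D.not_isConj_core_base F)

theorem rank_zero (hF : F.IsSaturated 2) (h1 : ¬ F.IsEssential 2 D.base) (h2 : ¬ Has F a b t n) :
    F.essentialRank 2 = 0 ∧ F.IsFusionSystemOf 2 P := by
  have h : ∀ Q, ¬ F.IsEssential 2 Q := fun Q hQ => by
    rcases D.isConj_or Q hQ with h | h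
    exacts [h1 (D.hasEssentialConj_base.1 ⟨Q, hQ, h⟩), h2 ⟨Q, hQ, h⟩]
  exact ⟨essentialRank_eq_zero h, hF.isFusionSystemOf_self D.isPGroup h (D.aut_top_le hF)⟩

theorem rank_one_left (h1 : F.IsEssential 2 D.base) (h2 : ¬ Has F a b t n) :
    F.essentialRank 2 = 1 :=
  essentialRank_eq_one D.isConj_or (D.hasEssentialConj_base.2 h1) h2

theorem rank_one_right (h1 : ¬ F.IsEssential 2 D.base) (h2 : Has F a b t n) :
    F.essentialRank 2 = 1 :=
  essentialRank_eq_one (fun Q hQ => (D.isConj_or Q hQ).symm) h2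
    fun h => h1 (D.hasEssentialConj_base.1 h)

theorem rank_two (h1 : F.IsEssential 2 D.base) (h2 : Has F a b t n) : F.essentialRank 2 = 2 :=
  essentialRank_eq_two D.isConj_or (D.hasEssentialConj_base.2 h1) h2
    fun h => D.not_isConj_core_base F h.symm

/-- Comparison of two saturated fusion systems by means of the two classes of subgroups that can be
essential. -/
theorem mor_of_le (hF : F.IsSaturated 2)
    (h1 : F.IsEssential 2 D.base → F.aut D.base ≤ F'.aut D.base)
    (h2 : Has F a b t n → F'.HasCoprimeAut 2 (core a b t n)) {Q : Subgroup P} {f : P → P}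
    (hf : F.Mor Q f) : F'.Mor Q f := by
  refine hF.mor_of_aut_le D.isPGroup ((D.aut_top_le hF).trans (autP_le_aut F' ⊤)) (fun R hR => ?_) hf
  rcases D.eq_base_or hR with rfl | ⟨u, hu, hu2, rfl⟩
  · exact h1 hR
  · exact (D.change hu hu2).aut_core_le hF ((h2 ⟨_, hR, D.isConj_core F hu hu2⟩).of_isConj
      (D.isConj_core F' hu hu2).symm)

variable {G : Type*} [Group G] {i : P →* G} {hi : Function.Injective i}

/-- An automorphism of odd order of the abelian subgroup that is induced by `G` moves the central
involution `w * t * w * t⁻¹`, which is a commutator, to an involution of the form `w` or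
`t * w * t⁻¹`. -/
theorem mem_commutator_of_hasCoprimeAut (h : (ofEmb i hi).HasCoprimeAut 2 D.base) :
    i (a ^ (2 : ℤ) ^ (n - 1)) ∈ commutator G := by
  obtain ⟨α, hα, hα1, hα2⟩ := h
  obtain ⟨g, hg⟩ := mem_aut_ofEmb.1 hα
  obtain ⟨s, hs, hs1, hs2⟩ := D.exists_involution
  have hsw : (s : P) = ⁅t, a ^ (2 : ℤ) ^ (n - 1)⁆ := by
    rw [hs, commutatorElement_def, D.t_conj_w, mul_assoc, mul_inv_cancel, mul_one]
  have hsM : i s ∈ commutator G := by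
    rw [hsw, map_commutatorElement]
    exact Subgroup.commutator_mem_commutator (mem_top _) (mem_top _)
  have hαM : i (α s) ∈ commutator G := by
    rw [hg]
    exact (inferInstance : (commutator G).Normal).conj_mem _ hsM g
  rcases D.eq_of_sq_eq_one (e := α s) (by rw [← map_pow, hs2, map_one]) with h2 | h2 | h2 | h2
  · exact absurd ((map_eq_one_iff α α.injective).1 (Subtype.ext h2)) hs1
  · exact absurd (D.eq_one_of_fixed (Nat.odd_of_not_two_dvd hα2) hα1
      (Subtype.ext (h2.trans hs.symm))) hs1
  · rwa [h2] at hαM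
  · rw [h2, ← hs, map_mul] at hαM
    exact (mul_mem_cancel_left hsM).1 hαM

theorem mem_of_hasCoprimeAut (h : (ofEmb i hi).HasCoprimeAut 2 (core a b t n)) {M : Subgroup G}
    (hM : M.Normal) (ha : i a ∈ M) : i t ∈ M := by
  obtain ⟨α, hα, hα1, hα2⟩ := h
  obtain ⟨g, hg⟩ := mem_aut_ofEmb.1 hα
  have hb : i b ∈ M := by
    rw [← D.conj, map_mul, map_mul, map_inv]
    exact hM.conj_mem _ ha _
  obtain ⟨e, ⟨j, k, he⟩, he'⟩ := D.exists_apply_notMem z_mem_core D.not_core_le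
    (Nat.odd_of_not_two_dvd hα2) hα1
  have h1 : i (α e) ∈ M := by
    rw [hg, he, map_mul, map_zpow, map_zpow]
    exact hM.conj_mem _ (mul_mem (zpow_mem ha _) (zpow_mem hb _)) g
  obtain ⟨j', k', h2⟩ := D.exists_eq he'
  rw [h2, map_mul, map_mul, map_zpow, map_zpow] at h1
  exact (mul_mem_cancel_left (mul_mem (zpow_mem ha _) (zpow_mem hb _))).1 h1

theorem hasCoprimeAut_core {g : G} {c : ℤ} (hc : (2 : ℤ) ^ n = c * 2 * 2)
    (hz : g * i (a * b) * g⁻¹ = i (a * b))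
    (hw : g * i (a ^ (2 : ℤ) ^ (n - 1)) * g⁻¹ = i t)
    (ht : g * i t * g⁻¹ = i ((a * b) ^ c * a ^ (2 : ℤ) ^ (n - 1) * t)) :
    (ofEmb i hi).HasCoprimeAut 2 (core a b t n) := by
  have hzm := z_mem_core (a := a) (b := b) (t := t) (n := n)
  have hwm := w_mem_core (a := a) (b := b) (t := t) (n := n)
  have htm := t_mem_core (a := a) (b := b) (t := t) (n := n)
  obtain ⟨α, hα, hα'⟩ := exists_aut_ofEmb (hi := hi) (Q := core a b t n) (g := g) rfl (by
    rintro _ (rfl | rfl | rfl)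
    exacts [⟨_, hzm, hz.symm⟩, ⟨_, htm, hw.symm⟩, ⟨_, mul_mem (mul_mem (zpow_mem hzm c) hwm) htm, ht.symm⟩])
  have az : α ⟨_, hzm⟩ = ⟨_, hzm⟩ := Subtype.ext (hi ((hα' _).trans hz))
  have aw : α ⟨_, hwm⟩ = ⟨_, htm⟩ := Subtype.ext (hi ((hα' _).trans hw))
  have at' : α ⟨_, htm⟩ = ⟨_, hzm⟩ ^ c * ⟨_, hwm⟩ * ⟨_, htm⟩ := Subtype.ext (hi ((hα' _).trans ht))
  have key : (⟨_, hzm⟩ ^ c * ⟨_, htm⟩ * (⟨_, hzm⟩ ^ c * ⟨_, hwm⟩ * ⟨_, htm⟩) : core a b t n) =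
      ⟨_, hwm⟩ := by
    refine Subtype.ext ?_
    change (a * b) ^ c * t * ((a * b) ^ c * a ^ (2 : ℤ) ^ (n - 1) * t) = a ^ (2 : ℤ) ^ (n - 1)
    have h1 := (D.z_zpow_comm c t).symm
    have h2 : (2 : ℤ) ^ (n - 1) = c + c := by
      have := D.pow_n
      linarith
    have h3 := D.t_conj_w
    rw [inv_eq_of_mul_eq_one_right D.sq] at h3
    rw [mul_assoc, ← mul_assoc t, ← mul_assoc t, h1, mul_assoc _ t, mul_assoc _ (t * _), h3,
      ← mul_assoc, ← mul_assoc, ← zpow_add, ← h2, ← zpow_add, ← mul_two, ← D.pow_n,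
      D.z_zpow_eq_one.2 dvd_rfl, one_mul]
  have : Fact (Nat.Prime 3) := ⟨Nat.prime_three⟩
  have hne : α ≠ 1 := fun h => D.notMem (by
    rw [h] at aw
    have h1 : a ^ (2 : ℤ) ^ (n - 1) = t := congrArg Subtype.val aw
    exact h1 ▸ D.w_mem_base)
  have h3 : α ^ 3 = 1 := by
    have fz : (α ^ 3) ⟨_, hzm⟩ = ⟨_, hzm⟩ := by
      change α (α (α _)) = _
      rw [az, az, az]
    have fw : (α ^ 3) ⟨_, hwm⟩ = ⟨_, hwm⟩ := by
      change α (α (α _)) = _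
      rw [aw, at', map_mul, map_mul, map_zpow, az, aw, at', key]
    have ft : (α ^ 3) ⟨_, htm⟩ = ⟨_, htm⟩ := by
      have h1 : ⟨_, htm⟩ = α ⟨_, hwm⟩ := aw.symm
      rw [h1]
      change α ((α ^ 3) _) = _
      rw [fw]
    refine MulEquiv.ext fun x => ?_
    obtain ⟨j, k, h | h⟩ := D.mem_core x.2
    · have hx : x = ⟨_, hzm⟩ ^ j * ⟨_, hwm⟩ ^ k := Subtype.ext h
      rw [hx, map_mul, map_zpow, map_zpow, fz, fw, MulAut.one_apply]
    · have hx : x = ⟨_, hzm⟩ ^ j * ⟨_, hwm⟩ ^ k * ⟨_, htm⟩ := Subtype.ext h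
      rw [hx, map_mul, map_mul, map_zpow, map_zpow, fz, fw, ft, MulAut.one_apply]
  exact ⟨α, hα, hne, by rw [orderOf_eq_prime h3 hne]; norm_num⟩

/-- A saturated fusion system on `P` is the fusion system of a group `G` with a subgroup of odd
index that is isomorphic to `P` if the same two classes of subgroups have automorphisms of order
three in `G`. -/
theorem isFusionSystemOf (hF : F.IsSaturated 2) [Finite G] {X Y T : G} (E : Wreathed X Y T n)
    (hcard : ¬ 2 ^ (2 * n + 1 + 1) ∣ Nat.card G)
    (h1 : F.IsEssential 2 D.base ∧ (∃ α ∈ F.aut D.base, (α ⟨a, D.left_mem⟩ : P) = b ∧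
          (α ⟨b, D.right_mem⟩ : P) = (a * b)⁻¹) ∧
          (∃ g : G, g * X * g⁻¹ = Y ∧ g * Y * g⁻¹ = (X * Y)⁻¹) ∨
        ¬ F.IsEssential 2 D.base ∧ X ^ (2 : ℤ) ^ (n - 1) ∉ commutator G)
    (h2 : Has F a b t n ∧ (∃ (g : G) (c : ℤ), (2 : ℤ) ^ n = c * 2 * 2 ∧
          g * (X * Y) * g⁻¹ = X * Y ∧ g * X ^ (2 : ℤ) ^ (n - 1) * g⁻¹ = T ∧
          g * T * g⁻¹ = (X * Y) ^ c * X ^ (2 : ℤ) ^ (n - 1) * T) ∨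
        ¬ Has F a b t n ∧ ∃ M : Subgroup G, M.Normal ∧ X ∈ M ∧ T ∉ M) :
    F.IsFusionSystemOf 2 G := by
  obtain ⟨i, hi, rfl, rfl, rfl⟩ := D.exists_monoidHom E
  have hidx := not_dvd_index_range hi D.card hcard
  have hF' : (ofEmb i hi).IsSaturated 2 := isSaturated_ofEmb D.isPGroup hidx
  have hA : (F.IsEssential 2 D.base → F.aut D.base ≤ (ofEmb i hi).aut D.base) ∧
      ((ofEmb i hi).IsEssential 2 D.base → (ofEmb i hi).aut D.base ≤ F.aut D.base) := by
    rcases h1 with ⟨hA, ⟨α, hα, ha, hb⟩, g, hg1, hg2⟩ | ⟨hA, hX⟩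
    · obtain ⟨β, hβ, hβ'⟩ := exists_aut_ofEmb (hi := hi) (Q := D.base) (g := g) D.base_eq_closure (by
        rintro _ (rfl | rfl)
        · exact ⟨_, D.right_mem, hg1.symm⟩
        · exact ⟨_, inv_mem D.z_mem_base, by rw [hg2, map_inv, map_mul]⟩)
      have hβa : (β ⟨a, D.left_mem⟩ : P) = b := hi ((hβ' _).trans hg1)
      have hβb : (β ⟨b, D.right_mem⟩ : P) = (a * b)⁻¹ :=
        hi ((hβ' _).trans (by rw [hg2, map_inv, map_mul]))
      exact ⟨fun h => D.aut_base_le h hα hβ ha hb hβa hβb,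
        fun h => D.aut_base_le h hβ hα hβa hβb ha hb⟩
    · refine ⟨fun h => absurd h hA, fun h => absurd ?_ hX⟩
      rw [← map_zpow]
      exact D.mem_commutator_of_hasCoprimeAut h.hasCoprimeAut
  have hB : (Has F a b t n → (ofEmb i hi).HasCoprimeAut 2 (core a b t n)) ∧
      (Has (ofEmb i hi) a b t n → F.HasCoprimeAut 2 (core a b t n)) := by
    rcases h2 with ⟨⟨Q, hQ, hQc⟩, g, c, hc, hz, hw, ht⟩ | ⟨hB, M, hM, hX, hT⟩
    · simp only [← map_mul, ← map_zpow] at hz hw ht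
      exact ⟨fun _ => D.hasCoprimeAut_core hc hz hw ht, fun _ => hQ.hasCoprimeAut.of_isConj hQc⟩
    · refine ⟨fun h => absurd h hB, fun ⟨Q, hQ, hQc⟩ => absurd ?_ hT⟩
      exact D.mem_of_hasCoprimeAut (hQ.hasCoprimeAut.of_isConj hQc) hM hX
  rw [ext_of_mor fun Q f => ⟨D.mor_of_le hF hA.1 hB.1, D.mor_of_le hF' hA.2 hB.2⟩]
  exact isFusionSystemOf_ofEmb D.isPGroup hidx

end WreathedTop

/-! ### The systems on wreathed groups -/

section Presentation

open RegularWreathProduct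

theorem WreathedTop.map {P P' : Type*} [Group P] [Group P'] {a b t : P} {n : ℕ}
    (D : WreathedTop a b t n) (e : P ≃* P') : WreathedTop (e a) (e b) (e t) n where
  comm := by rw [← map_mul, D.comm, map_mul]
  conj := by rw [← map_inv, ← map_mul, ← map_mul, D.conj]
  sq := by rw [← map_mul, D.sq, map_one]
  two_le := D.two_le
  indep i j := by rw [← map_zpow, ← map_zpow, ← map_mul, map_eq_one_iff e e.injective, D.indep]
  card := by rw [← Nat.card_congr e.toEquiv, D.card]

theorem Cyc.ofAdd_one_zpow_eq_one (m : ℕ) (i : ℤ) :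
    (Multiplicative.ofAdd 1 : Cyc m) ^ i = 1 ↔ (m : ℤ) ∣ i := by
  rw [← ofAdd_zsmul, zsmul_one, ofAdd_eq_one, ZMod.intCast_zmod_eq_zero_iff_dvd]

theorem WreathedTop.exists_of_mulEquiv {P : Type*} [Group P] {n : ℕ} (hn : 2 ≤ n)
    (e : P ≃* RegularWreathProduct (Cyc (2 ^ n)) (Cyc 2)) : ∃ a b t : P, WreathedTop a b t n := by
  let f : (Cyc 2 → Cyc (2 ^ n)) →* RegularWreathProduct (Cyc (2 ^ n)) (Cyc 2) :=
    { toFun := fun v => ⟨v, 1⟩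
      map_one' := rfl
      map_mul' := fun v w => by ext <;> simp }
  have hf : Function.Injective f := fun v w h => congrArg RegularWreathProduct.left h
  have hs : ∀ c : Cyc 2, c = 1 ∨ c = Multiplicative.ofAdd 1 := by decide
  have hs1 : (Multiplicative.ofAdd 1 : Cyc 2) ≠ 1 := by decide
  refine ⟨_, _, _, (WreathedTop.map (a := f (Pi.mulSingle 1 (Multiplicative.ofAdd 1)))
    (b := f (Pi.mulSingle (Multiplicative.ofAdd 1) (Multiplicative.ofAdd 1)))
    (t := inl (Multiplicative.ofAdd 1)) ?_ e.symm)⟩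
  exact
  { comm := by rw [← map_mul, mul_comm, map_mul]
    conj := by
      rw [mul_inv_eq_iff_eq_mul]
      refine RegularWreathProduct.ext (funext fun c => ?_) ?_
      · rcases hs c with rfl | rfl <;> simp [f, Pi.mulSingle_apply, hs1, hs1.symm]
      · simp [f]
    sq := by
      rw [← map_mul]
      rfl
    two_le := hn
    indep := fun i j => by
      have h0 := Cyc.ofAdd_one_zpow_eq_one (2 ^ n)
      push_cast at h0
      rw [← map_zpow, ← map_zpow, ← map_mul, map_eq_one_iff f hf, ← h0, ← h0]
      constructor
      · intro h
        have h1 := congrFun h 1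
        have h2 := congrFun h (Multiplicative.ofAdd 1)
        simpa [Pi.mulSingle_apply, hs1, hs1.symm] using And.intro h1 h2
      · rintro ⟨h1, h2⟩
        rw [← Pi.mulSingle_zpow, ← Pi.mulSingle_zpow, h1, h2, Pi.mulSingle_one, Pi.mulSingle_one,
          mul_one]
    card := by
      rw [RegularWreathProduct.card]
      simp [Cyc]
      ring }

end Presentation

section Torus

open Matrix

variable {K : Type*} [Field K]

/-- The diagonal matrices of size two. -/
def glTorus : Kˣ × Kˣ →* GL (Fin 2) K where
  toFun u := ⟨!![(u.1 : K), 0; 0, (u.2 : K)], !![((u.1⁻¹ : Kˣ) : K), 0; 0, ((u.2⁻¹ : Kˣ) : K)],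
    by simp [one_fin_two], by simp [one_fin_two]⟩
  map_one' := Units.ext (by simp [one_fin_two])
  map_mul' a b := Units.ext (by simp)

theorem coe_glTorus (u : Kˣ × Kˣ) :
    (glTorus u : 𝕄 K) = !![(u.1 : K), 0; 0, (u.2 : K)] := rfl

theorem glTorus_injective : Function.Injective (glTorus : _ →* GL (Fin 2) K) := fun u v h => by
  have h1 := congrArg Units.val h
  rw [coe_glTorus, coe_glTorus] at h1
  have h2 := congrFun (congrFun h1 0) 0
  have h3 := congrFun (congrFun h1 1) 1
  exact Prod.ext (Units.ext h2) (Units.ext h3)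

theorem det_glTorus (u : Kˣ × Kˣ) : GeneralLinearGroup.det (glTorus u) = u.1 * u.2 :=
  Units.ext (by
    change Matrix.det (glTorus u : 𝕄 K) = _
    rw [coe_glTorus]
    simp [det_fin_two])

variable (K) in
/-- The matrix that permutes the coordinates. -/
def glSwap : GL (Fin 2) K :=
  ⟨!![0, 1; 1, 0], !![0, 1; 1, 0], by simp [one_fin_two], by simp [one_fin_two]⟩

theorem coe_glSwap : (glSwap K : 𝕄 K) = !![0, 1; 1, 0] := rfl

theorem wreathRel_glTorus (u v : Kˣ) : WreathRel (glTorus (u, v)) (glTorus (v, u)) (glSwap K) where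
  comm := by rw [← map_mul, mul_comm, map_mul]
  conj := by
    rw [mul_inv_eq_iff_eq_mul]
    refine Units.ext ?_
    rw [Units.val_mul, Units.val_mul, coe_glTorus, coe_glTorus, coe_glSwap]
    simp
  sq := Units.ext (by simp [coe_glSwap, one_fin_two])

theorem glTorus_comm (u : Kˣ) (g : GL (Fin 2) K) : glTorus (u, u) * g = g * glTorus (u, u) := by
  have h3 : glTorus (u, u) = glScalar u :=
    Units.ext (by rw [coe_glTorus, coe_scalar_two])
  rw [h3]
  exact GeneralLinearGroup.scalar_commute _ _

/-- The matrices `diag(e, -e)` and `glSwap` are, up to scalars, generators of a quaternion group in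
`SL_2`, with an element of order three in its normalizer. -/
theorem exists_conj_glTorus (h2 : (2 : K) ≠ 0) {e j : Kˣ} (he : e * e = 1) (hj : j * j = -1) :
    ∃ g : GL (Fin 2) K, g * glTorus (e, -e) * g⁻¹ = glSwap K ∧
      g * glSwap K * g⁻¹ = glTorus (j, j) * glTorus (e, -e) * glSwap K := by
  have hje : j * e * (j * e) = -1 := by rw [mul_mul_mul_comm, hj, he, mul_one]
  have hj' : j⁻¹ = -j := by rw [inv_eq_iff_mul_eq_one, mul_neg, hj, neg_neg]
  have hje' : (j * e)⁻¹ = -(j * e) := by rw [inv_eq_iff_mul_eq_one, mul_neg, hje, neg_neg]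
  have hI : Matrix.SpecialLinearGroup.toGL (slDiag (j * e)) = glTorus (j, j) * glTorus (e, -e) := by
    refine Units.ext ?_
    rw [← map_mul, coe_glTorus, Matrix.SpecialLinearGroup.coe_GL_coe_matrix, coe_slDiag, hje']
    simp
  have hJ : Matrix.SpecialLinearGroup.toGL (slDiag j * slFlip K) = glTorus (j, j) * glSwap K := by
    refine Units.ext ?_
    rw [Units.val_mul, coe_glTorus, coe_glSwap, Matrix.SpecialLinearGroup.coe_GL_coe_matrix,
      Matrix.SpecialLinearGroup.coe_mul, coe_slDiag, coe_slFlip, hj']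
    simp
  obtain ⟨g, hg1, hg2⟩ := (rotates_slDiag h2 hje j).map Matrix.SpecialLinearGroup.toGL
  rw [hI, hJ] at hg1 hg2
  have key : ∀ u : GL (Fin 2) K, g * (glTorus (j, j) * u) * g⁻¹ = glTorus (j, j) * (g * u * g⁻¹) :=
    fun u => by rw [← mul_assoc g, ← glTorus_comm, mul_assoc, mul_assoc, ← mul_assoc g]
  rw [key] at hg1 hg2
  refine ⟨g, mul_left_cancel hg1, mul_left_cancel (a := glTorus (j, j)) ?_⟩
  rw [hg2, ← mul_assoc, ← mul_assoc, mul_assoc (glTorus (j, j)), ← glTorus_comm, ← mul_assoc]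

/-- A permutation matrix permutes the diagonal entries cyclically. -/
theorem exists_conj_glToSlThree : ∃ g : SL(3, K), ∀ u v : Kˣ,
    g * glToSlThree (glTorus (u, v)) * g⁻¹ = glToSlThree (glTorus ((u * v)⁻¹, u)) := by
  obtain ⟨g, hg⟩ : ∃ g : SL(3, K), (g : Matrix (Fin 3) (Fin 3) K) =
    !![0, 0, 1; 1, 0, 0; 0, 1, 0] := ⟨⟨_, by simp [det_fin_three]⟩, rfl⟩
  refine ⟨g, fun u v => ?_⟩
  rw [mul_inv_eq_iff_eq_mul]
  refine Subtype.ext ?_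
  rw [Matrix.SpecialLinearGroup.coe_mul, Matrix.SpecialLinearGroup.coe_mul, hg, coe_glToSlThree,
    coe_glToSlThree, det_glTorus, det_glTorus, coe_glTorus, coe_glTorus]
  simp

theorem zpow_eq_one_iff_of_orderOf {G : Type*} [Group G] {g : G} {n : ℕ} (h : orderOf g = 2 ^ n)
    (i : ℤ) : g ^ i = 1 ↔ (2 : ℤ) ^ n ∣ i := by
  rw [← orderOf_dvd_iff_zpow_eq_one, h]
  push_cast
  rfl

theorem wreathed_gl_two {ζ : Kˣ} {n : ℕ} (hn : 2 ≤ n) (hζ : orderOf ζ = 2 ^ n) :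
    Wreathed (glTorus (ζ, 1)) (glTorus (1, ζ)) (glSwap K) n :=
  { wreathRel_glTorus ζ 1 with
    two_le := hn
    indep := fun i j => by
      rw [← map_zpow, ← map_zpow, ← map_mul, map_eq_one_iff _ glTorus_injective,
        ← zpow_eq_one_iff_of_orderOf hζ, ← zpow_eq_one_iff_of_orderOf hζ, Prod.ext_iff]
      simp }

theorem mul_eq_one_of_toPslThree {u v : Kˣ} (h : toPslThree K (glToSlThree (glTorus (u, v))) = 1) :
    u * (u * v) = 1 ∧ v * (u * v) = 1 := by
  have h1 := apply_eq_of_toPslThree_eq_one h 0 2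
  have h2 := apply_eq_of_toPslThree_eq_one h 1 2
  rw [coe_glToSlThree, det_glTorus, coe_glTorus] at h1 h2
  exact ⟨mul_eq_one_iff_eq_inv.2 (Units.ext h1), mul_eq_one_iff_eq_inv.2 (Units.ext h2)⟩

theorem wreathed_psl_three {ζ : Kˣ} {n : ℕ} (hn : 2 ≤ n) (hζ : orderOf ζ = 2 ^ n) :
    Wreathed (toPslThree K (glToSlThree (glTorus (ζ ^ (-2 : ℤ), ζ))))
      (toPslThree K (glToSlThree (glTorus (ζ, ζ ^ (-2 : ℤ)))))
      (toPslThree K (glToSlThree (glSwap K))) n where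
  comm := by simp only [← map_mul, mul_comm]
  conj := by simp only [← map_mul, ← map_inv, (wreathRel_glTorus _ _).conj]
  sq := by simp only [← map_mul, (wreathRel_glTorus (1 : Kˣ) 1).sq, map_one]
  two_le := hn
  indep i j := by
    simp only [← map_mul, ← map_zpow, Prod.pow_mk, Prod.mk_mul_mk, ← _root_.zpow_mul]
    have h3 : ∀ k : ℤ, (2 : ℤ) ^ n ∣ 3 * k → (2 : ℤ) ^ n ∣ k := fun k hk =>
      (IsCoprime.pow_left (by norm_num)).dvd_of_dvd_mul_left hk
    rw [← zpow_eq_one_iff_of_orderOf hζ, ← zpow_eq_one_iff_of_orderOf hζ]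
    constructor
    · intro h
      obtain ⟨h4, h5⟩ := mul_eq_one_of_toPslThree h
      simp only [← _root_.zpow_add] at h4 h5
      rw [zpow_eq_one_iff_of_orderOf hζ] at h4 h5 ⊢
      rw [zpow_eq_one_iff_of_orderOf hζ]
      refine ⟨h3 _ ?_, h3 _ ?_⟩
      · obtain ⟨q, hq⟩ := h4
        exact ⟨-q, by linear_combination -hq⟩
      · obtain ⟨q, hq⟩ := h5
        exact ⟨-q, by linear_combination -hq⟩
    · rintro ⟨h4, h5⟩
      rw [mul_comm (-2), mul_comm (-2), _root_.zpow_mul, _root_.zpow_mul, h4, h5, _root_.one_zpow, mul_one]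
      exact map_one ((toPslThree K).comp (glToSlThree.comp glTorus))

end Torus

namespace WreathedTop

open FusionSystem Matrix

variable {P : Type*} [Group P] [Finite P] {a b t : P} {n : ℕ} (D : WreathedTop a b t n)
  {F : FusionSystem P}

include D

theorem isFusionSystemOf_sqSymmThree (hF : F.IsSaturated 2) (hA : F.IsEssential 2 D.base)
    (hα : ∃ α ∈ F.aut D.base, (α ⟨a, D.left_mem⟩ : P) = b ∧
      (α ⟨b, D.right_mem⟩ : P) = (a * b)⁻¹)
    (hB : ¬ Has F a b t n) : F.IsFusionSystemOf 2 (SqSymmThree (2 ^ n)) := by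
  have hne : NeZero (2 ^ n) := ⟨by positivity⟩
  have hconj : ∀ (σ : Equiv.Perm (Fin 3)) (k : Fin 3),
      (SemidirectProduct.inr σ : SqSymmThree (2 ^ n)) *
        SemidirectProduct.inl (Multiplicative.ofAdd (triple (2 ^ n) k)) *
          (SemidirectProduct.inr σ)⁻¹ =
        SemidirectProduct.inl (Multiplicative.ofAdd (triple (2 ^ n) (σ k))) := fun σ k => by
    rw [← map_inv, ← SemidirectProduct.inl_aut]
    exact congrArg (fun v => SemidirectProduct.inl (Multiplicative.ofAdd v)) (tripleLin_triple _ σ k)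
  have : Finite (SqSymmThree (2 ^ n)) := Finite.of_equiv _ SemidirectProduct.equivProd.symm
  refine D.isFusionSystemOf hF (X := SemidirectProduct.inl (Multiplicative.ofAdd (triple (2 ^ n) 0)))
    (Y := SemidirectProduct.inl (Multiplicative.ofAdd (triple (2 ^ n) 1)))
    (T := SemidirectProduct.inr (Equiv.swap 0 1)) ?_ ?_
    (Or.inl ⟨hA, hα, SemidirectProduct.inr (finRotate 3), hconj _ _, ?_⟩)
    (Or.inr ⟨hB, SemidirectProduct.rightHom.ker, MonoidHom.normal_ker _, ?_, ?_⟩)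
  · exact
    { comm := by rw [← map_mul, mul_comm, map_mul]
      conj := hconj _ _
      sq := by rw [← map_mul, Equiv.swap_mul_self, map_one]
      two_le := D.two_le
      indep := fun i j => by
        have hl := map_zpow (SemidirectProduct.inl : _ →* SqSymmThree (2 ^ n))
        rw [← hl, ← hl, ← map_mul, map_eq_one_iff _ SemidirectProduct.inl_injective, ← ofAdd_zsmul,
          ← ofAdd_zsmul, ← ofAdd_add, ofAdd_eq_one, Prod.ext_iff]
        have h := fun i : ℤ => ZMod.intCast_zmod_eq_zero_iff_dvd i (2 ^ n)
        push_cast at h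
        simp [triple, h] }
  · refine not_dvd_of_eq_mul_odd (c := 3) (by decide) ?_
    rw [SemidirectProduct.card, Nat.card_perm, Nat.card_congr Multiplicative.toAdd, Nat.card_prod,
      Nat.card_zmod, Nat.card_fin, show Nat.factorial 3 = 2 * 3 from rfl]
    ring
  · refine (hconj _ _).trans ?_
    rw [← map_mul, ← map_inv, ← ofAdd_add, ← ofAdd_neg]
    simp [triple]
  · rfl
  · intro h
    have h1 : Equiv.swap (0 : Fin 3) 1 = 1 := h
    revert h1
    decide

theorem exists_prime_data : ∃ (p c d : ℕ) (_ : Fact p.Prime) (ζ : (ZMod p)ˣ), Odd c ∧ Odd d ∧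
    p = 2 ^ n * c + 1 ∧ p + 1 = 2 * d ∧ Odd p ∧ Nat.card (ZMod p) % 4 = 1 ∧ (2 : ZMod p) ≠ 0 ∧
    orderOf ζ = 2 ^ n ∧ ζ ^ (2 : ℤ) ^ (n - 1) = -1 := by
  obtain ⟨m, rfl⟩ : ∃ m, n = m + 2 := ⟨n - 2, by have := D.two_le; omega⟩
  obtain ⟨p, c, d, _, hc, hd, hpc, hpd, hp, h2, ζ, hζ⟩ := exists_prime_sub_one (m + 2) (by omega)
  have h4 : 2 ^ (m + 2) * c = 4 * (2 ^ m * c) := by ring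
  refine ⟨p, c, d, inferInstance, ζ, hc, hd, hpc, hpd, hp, ?_, h2, hζ, ?_⟩
  · rw [Nat.card_zmod]
    omega
  · have := pow_eq_neg_one_of_orderOf hζ
    rw [← this, ← zpow_natCast]
    push_cast
    rfl

theorem exists_gl_two (hF : F.IsSaturated 2) (hA : ¬ F.IsEssential 2 D.base)
    (hB : Has F a b t n) : ∃ (K : Type) (_ : Field K) (_ : Finite K), Nat.card K % 4 = 1 ∧
      F.IsFusionSystemOf 2 (GL (Fin 2) K) := by
  obtain ⟨p, c, d, hp, ζ, hc, hd, hpc, hpd, hodd, h4, h2, hζ, hζ'⟩ := D.exists_prime_data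
  have hw : glTorus (ζ, 1) ^ (2 : ℤ) ^ (n - 1) = glTorus (-1, - -1) := by
    rw [← map_zpow, Prod.pow_mk, hζ', neg_neg, _root_.one_zpow]
  have hz : glTorus (ζ, 1) * glTorus (1, ζ) = glTorus (ζ, ζ) := by
    rw [← map_mul, Prod.mk_mul_mk, one_mul, mul_one]
  have hn := D.two_le
  obtain ⟨m, rfl⟩ : ∃ m, n = m + 2 := ⟨n - 2, by omega⟩
  obtain ⟨g, hg1, hg2⟩ := exists_conj_glTorus h2 (e := -1) (j := ζ ^ (2 : ℤ) ^ m) (by simp) (by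
    rw [← _root_.zpow_add, ← mul_two, ← pow_succ]
    exact hζ')
  refine ⟨ZMod p, inferInstance, inferInstance, h4, D.isFusionSystemOf hF
    (wreathed_gl_two hn hζ) ?_ (Or.inr ⟨hA, fun h => ?_⟩)
    (Or.inl ⟨hB, g, 2 ^ m, by ring, ?_, ?_, ?_⟩)⟩
  · refine not_dvd_of_eq_mul_odd (c := c * c * (d * p)) ((hc.mul hc).mul (hd.mul hodd)) ?_
    change Nat.card (GL (Fin 2) (ZMod p)) = _
    rw [card_gl_two, Nat.card_zmod, cardSL, hpd, show p - 1 = 2 ^ (m + 2) * c by omega]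
    ring
  · have h3 := Abelianization.commutator_subset_ker GeneralLinearGroup.det h
    rw [hw, MonoidHom.mem_ker, det_glTorus] at h3
    exact units_neg_one_ne_one h2 (by simpa using h3)
  · rw [hz, mul_inv_eq_iff_eq_mul, glTorus_comm]
  · rw [hw, hg1]
  · rw [hw, hg2, hz, ← map_zpow, Prod.pow_mk]

theorem exists_psl_three (hF : F.IsSaturated 2) (hA : F.IsEssential 2 D.base)
    (hα : ∃ α ∈ F.aut D.base, (α ⟨a, D.left_mem⟩ : P) = b ∧
      (α ⟨b, D.right_mem⟩ : P) = (a * b)⁻¹)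
    (hB : Has F a b t n) : ∃ (K : Type) (_ : Field K) (_ : Finite K), Nat.card K % 4 = 1 ∧
      F.IsFusionSystemOf 2 PSL(3, K) := by
  obtain ⟨p, c, d, hp, ζ, hc, hd, hpc, hpd, hodd, h4, h2, hζ, hζ'⟩ := D.exists_prime_data
  have hn := D.two_le
  obtain ⟨m, rfl⟩ : ∃ m, n = m + 2 := ⟨n - 2, by omega⟩
  have hw : ((ζ ^ (-2 : ℤ), ζ) : (ZMod p)ˣ × (ZMod p)ˣ) ^ (2 : ℤ) ^ (m + 2 - 1) = (1, -1) := by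
    rw [Prod.pow_mk, ← _root_.zpow_mul, mul_comm, _root_.zpow_mul, hζ']
    simp
  have hz' : ((ζ ^ (-2 : ℤ), ζ) * (ζ, ζ ^ (-2 : ℤ)) : (ZMod p)ˣ × (ZMod p)ˣ) = (ζ⁻¹, ζ⁻¹) := by
    rw [Prod.mk_mul_mk, ← _root_.zpow_add_one, ← _root_.zpow_one_add, ← _root_.zpow_neg_one]
    rfl
  have hz : glTorus (ζ ^ (-2 : ℤ), ζ) * glTorus (ζ, ζ ^ (-2 : ℤ)) = glTorus (ζ⁻¹, ζ⁻¹) := by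
    rw [← map_mul, hz']
  obtain ⟨g, hg1, hg2⟩ := exists_conj_glTorus h2 (e := 1) (j := ζ⁻¹ ^ (2 : ℤ) ^ m) (by simp) (by
    rw [← _root_.zpow_add, ← mul_two, ← pow_succ, _root_.inv_zpow,
      show ζ ^ (2 : ℤ) ^ (m + 1) = -1 from hζ']
    simp)
  obtain ⟨r, hr⟩ := exists_conj_glToSlThree (K := ZMod p)
  have E := wreathed_psl_three (K := ZMod p) hn hζ
  refine ⟨ZMod p, inferInstance, inferInstance, h4, D.isFusionSystemOf hF E ?_
    (Or.inl ⟨hA, hα, toPslThree _ r, ?_, ?_⟩)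
    (Or.inl ⟨hB, toPslThree _ (glToSlThree g), 2 ^ m, by ring, ?_, ?_, ?_⟩)⟩
  · intro h3
    refine not_dvd_of_eq_mul_odd (c := c * c * (d * (p ^ 3 * (p * (p + 1) + 1)))) ?_ ?_
      (h3.trans (card_psl_three_dvd (K := ZMod p)))
    · exact (hc.mul hc).mul (hd.mul (hodd.pow.mul (Nat.even_mul_succ_self p).add_one))
    · rw [card_sl_three, Nat.card_zmod, show p - 1 = 2 ^ (m + 2) * c by omega]
      generalize p ^ 3 * (p * (p + 1) + 1) = e
      rw [hpd]
      ring
  · rw [← map_inv, ← map_mul, ← map_mul, hr, show (ζ ^ (-2 : ℤ) * ζ)⁻¹ = ζ by group]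
  · rw [← map_inv, ← map_mul, ← map_mul, hr, ← map_mul, ← map_mul, hz, ← map_inv, ← map_inv,
      ← map_inv, Prod.inv_mk, inv_inv, show (ζ * ζ ^ (-2 : ℤ))⁻¹ = ζ by group]
  · simp only [← map_mul, ← map_inv, hz]
    rw [← glTorus_comm, mul_inv_cancel_right]
  · simp only [← map_mul, ← map_inv, ← map_zpow]
    rw [hw, hg1]
  · simp only [← map_mul, ← map_inv, ← map_zpow]
    rw [hw, hg2, hz', Prod.pow_mk, map_mul glTorus]

theorem classification (hF : F.IsSaturated 2) : F.essentialRank 2 ≤ 2 ∧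
    ((F.essentialRank 2 = 0 ∧ F.IsFusionSystemOf 2 P) ∨
    (F.essentialRank 2 = 1 ∧ F.IsFusionSystemOf 2 (SqSymmThree (2 ^ n))) ∨
    (F.essentialRank 2 = 1 ∧ ∃ (K : Type) (_ : Field K) (_ : Finite K), Nat.card K % 4 = 1 ∧
      F.IsFusionSystemOf 2 (GL (Fin 2) K)) ∨
    (F.essentialRank 2 = 2 ∧ ∃ (K : Type) (_ : Field K) (_ : Finite K), Nat.card K % 4 = 1 ∧
      F.IsFusionSystemOf 2 PSL(3, K))) := by
  by_cases hA : F.IsEssential 2 D.base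
  · obtain ⟨a', b', D', hbase, hα⟩ := D.exists_adapted hA
    rw [← hbase] at hA
    by_cases hB : Has F a' b' t n
    · have h := D'.rank_two hA hB
      exact ⟨h.le, Or.inr (Or.inr (Or.inr ⟨h, D'.exists_psl_three hF hA hα hB⟩))⟩
    · have h := D'.rank_one_left hA hB
      exact ⟨by omega, Or.inr (Or.inl ⟨h, D'.isFusionSystemOf_sqSymmThree hF hA hα hB⟩)⟩
  · by_cases hB : Has F a b t n
    · have h := D.rank_one_right hA hB
      exact ⟨by omega, Or.inr (Or.inr (Or.inl ⟨h, D.exists_gl_two hF hA hB⟩))⟩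
    · have h := D.rank_zero hF hA hB
      exact ⟨by omega, Or.inl h⟩

end WreathedTop

/-- Saturated fusion systems on dihedral, semidihedral, generalized quaternion, wreathed and
homocyclic abelian 2-groups and on the Sylow 2-subgroup of `PSU_3(4)`. -/
theorem theoremt {P : Type*} [Group P] [Finite P] :
    -- dihedral groups of order `2 ^ n`
    (∀ n : ℕ, 3 ≤ n → Nonempty (P ≃* DihedralGroup (2 ^ (n - 1))) →
      ∀ F : FusionSystem P, F.IsSaturated 2 → F.essentialRank 2 ≤ 2 ∧
        ((F.essentialRank 2 = 0 ∧ F.IsFusionSystemOf 2 P) ∨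
        (F.essentialRank 2 = 1 ∧ ∃ (K : Type) (_ : Field K) (_ : Finite K), Odd (Nat.card K) ∧
          F.IsFusionSystemOf 2 (Matrix.ProjGenLinGroup (Fin 2) K)) ∨
        (F.essentialRank 2 = 2 ∧ ∃ (K : Type) (_ : Field K) (_ : Finite K),
          (Nat.card K % 8 = 1 ∨ Nat.card K % 8 = 7) ∧
          F.IsFusionSystemOf 2 (Matrix.ProjectiveSpecialLinearGroup (Fin 2) K)))) ∧
    -- semidihedral groups of order `2 ^ n`
    (∀ n : ℕ, IsSemidihedral n P →
      ∀ F : FusionSystem P, F.IsSaturated 2 → F.essentialRank 2 ≤ 2 ∧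
        ((F.essentialRank 2 = 0 ∧ F.IsFusionSystemOf 2 P) ∨
        (F.essentialRank 2 = 1 ∧ ∃ (K L : Type) (_ : Field K) (_ : Field L) (_ : Algebra K L)
          (_ : Finite L) (hL : Odd (Nat.card L)) (hd : Module.finrank K L = 2),
          F.IsFusionSystemOf 2 (TwistedPSL K L hL hd)) ∨
        (F.essentialRank 2 = 1 ∧ ∃ (K : Type) (_ : Field K) (_ : Finite K), Nat.card K % 4 = 3 ∧
          F.IsFusionSystemOf 2 (Matrix.GeneralLinearGroup (Fin 2) K)) ∨
        (F.essentialRank 2 = 2 ∧ ∃ (K : Type) (_ : Field K) (_ : Finite K), Nat.card K % 4 = 3 ∧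
          F.IsFusionSystemOf 2 (Matrix.ProjectiveSpecialLinearGroup (Fin 3) K)))) ∧
    -- generalized quaternion groups of order `2 ^ n` with `n ≥ 4`
    (∀ n : ℕ, 4 ≤ n → Nonempty (P ≃* QuaternionGroup (2 ^ (n - 2))) →
      ∀ F : FusionSystem P, F.IsSaturated 2 → F.essentialRank 2 ≤ 2 ∧
        ((F.essentialRank 2 = 0 ∧ F.IsFusionSystemOf 2 P) ∨
        (F.essentialRank 2 = 1 ∧ ∃ (K L : Type) (_ : Field K) (_ : Field L) (_ : Algebra K L)
          (_ : Finite L), Odd (Nat.card L) ∧ Module.finrank K L = 2 ∧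
          F.IsFusionSystemOf 2 (slTwoExtension K L)) ∨
        (F.essentialRank 2 = 2 ∧ ∃ (K : Type) (_ : Field K) (_ : Finite K), Odd (Nat.card K) ∧
          F.IsFusionSystemOf 2 (Matrix.SpecialLinearGroup (Fin 2) K)))) ∧
    -- the quaternion group of order 8, where both systems have essential rank 0
    (Nonempty (P ≃* QuaternionGroup 2) →
      ∀ F : FusionSystem P, F.IsSaturated 2 → F.essentialRank 2 = 0 ∧
        (F.IsFusionSystemOf 2 P ∨
        ∃ (K : Type) (_ : Field K) (_ : Finite K), Odd (Nat.card K) ∧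
          F.IsFusionSystemOf 2 (Matrix.SpecialLinearGroup (Fin 2) K))) ∧
    -- wreathed groups
    (∀ n : ℕ, 2 ≤ n → Nonempty (P ≃* RegularWreathProduct (Cyc (2 ^ n)) (Cyc 2)) →
      ∀ F : FusionSystem P, F.IsSaturated 2 → F.essentialRank 2 ≤ 2 ∧
        ((F.essentialRank 2 = 0 ∧ F.IsFusionSystemOf 2 P) ∨
        (F.essentialRank 2 = 1 ∧ F.IsFusionSystemOf 2 (SqSymmThree (2 ^ n))) ∨
        (F.essentialRank 2 = 1 ∧ ∃ (K : Type) (_ : Field K) (_ : Finite K), Nat.card K % 4 = 1 ∧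
          F.IsFusionSystemOf 2 (Matrix.GeneralLinearGroup (Fin 2) K)) ∨
        (F.essentialRank 2 = 2 ∧ ∃ (K : Type) (_ : Field K) (_ : Finite K), Nat.card K % 4 = 1 ∧
          F.IsFusionSystemOf 2 (Matrix.ProjectiveSpecialLinearGroup (Fin 3) K)))) ∧
    -- homocyclic abelian groups of rank two
    (∀ n : ℕ, 1 ≤ n → Nonempty (P ≃* Cyc (2 ^ n) × Cyc (2 ^ n)) →
      (∀ F : FusionSystem P, F.IsSaturated 2 → F.essentialRank 2 = 0 ∧
        (F.IsFusionSystemOf 2 P ∨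
        ∃ φ : Cyc 3 →* MulAut P, Function.Injective φ ∧
          F.IsFusionSystemOf 2 (SemidirectProduct P (Cyc 3) φ))) ∧
      FusionSystem.numSaturated 2 P = 2) ∧
    -- the Sylow 2-subgroup of `PSU_3(4)`
    ((∃ S : Sylow 2 PSUThreeFour, Nonempty (P ≃* S)) →
      (∀ F : FusionSystem P, F.IsSaturated 2 → F.essentialRank 2 = 0 ∧
        (F.IsFusionSystemOf 2 P ∨
        ∃ m ∈ ({3, 5, 15} : Set ℕ), ∃ φ : Cyc m →* MulAut P, Function.Injective φ ∧
          F.IsFusionSystemOf 2 (SemidirectProduct P (Cyc m) φ))) ∧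
      FusionSystem.numSaturated 2 P = 4) := by
  refine ⟨fun n hn ⟨e⟩ F hF => ?_, fun n hP F hF => ?_, fun n hn ⟨e⟩ F hF => ?_, fun ⟨e⟩ F hF => ?_,
    fun n hn ⟨e⟩ F hF => ?_, fun n hn ⟨e⟩ => FusionSystem.classification_homocyclic hn e,
    fun ⟨S, ⟨e⟩⟩ => ?_⟩
  · exact MaxClass.classification_dihedral ((MaxClass.dihedral (k := n - 1) (by omega)).map e.symm) hF
  · obtain ⟨x, y, D⟩ := MaxClass.of_isSemidihedral hP
    exact MaxClass.classification_semidihedral (by have := hP.1; omega) D hF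
  · exact MaxClass.classification_quaternion (k := n - 1) (by omega)
      ((MaxClass.quaternion (k := n - 1) (by omega)).map e.symm) hF
  · exact FusionSystem.classification_quaternion_eight e hF
  · obtain ⟨a, b, t, D⟩ := WreathedTop.exists_of_mulEquiv hn e
    exact D.classification hF
  · obtain ⟨e'⟩ := nonempty_mulEquiv_herm S
    exact FusionSystem.classification_herm (e.trans e')
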